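/- Let $(M,g,J)$ be a closed Kähler spin manifold of complex dimension $d$, with spinor bundle $\Sigma M$, and let $E\to M$ be a Hermitian vector bundle of finite rank with a metric connection $\nabla^E$. Equip $\Sigma M\otimes E$ with the tensor product connection $\nabla$, and let $D_M^E=\sum_{i} e_i\cdot\nabla_{e_i}$ be the twisted Dirac operator, where $(e_i)_{1\le i\le 2d}$ is a local orthonormal frame and Clifford multiplication is normalised by $e_i\cdot e_i\cdot=-1$. Let $\mathrm{Scal}_0$ be the infimum of the scalar curvature of $M$, and let $\kappa_1$ be the smallest eigenvalue (the infimum, over all points of $M$, of the pointwise eigenvalues) of the curvature endomorphism $$R^E\psi=2\sum_{i,j=1}^{2d}\big(e_i\cdot e_j\cdot\otimes R^E_{e_i,e_j}\big)\psi ,\qquad R^E_{X,Y}=[\nabla^E_X,\nabla^E_Y]-\nabla^E_{[X,Y]} .$$ For $0\le r\le d$ let $\Sigma_rM=\mathrm{Ker}\big(\Omega\cdot-\,i(2r-d)\big)\subset\Sigma M$, where $\Omega(X,Y)=g(JX,Y)$ is the Kähler form, acting by $\Omega\cdot=\frac12\sum_{i,j}\Omega(e_i,e_j)\,e_i\cdot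 e_j\cdot$, and let $\Sigma_{d+1}M=0$. An eigenspinor of $D_M^E$ is called of type $(r,r+1)$ if it is a section of $(\Sigma_rM\oplus\Sigma_{r+1}M)\otimes E$. Let $\lambda$ be an eigenvalue of $D_M^E$. 1. If $d$ is odd, then $$\lambda^2\ \ge\ \frac{d+1}{4d}\,(\mathrm{Scal}_0+\kappa_1).$$ 2. If $d$ is even, then $$\lambda^2\ \ge\ \frac{d}{4(d-1)}\,(\mathrm{Scal}_0+\kappa_1),$$ where, if $d\ge4$, it is assumed in addition that the curvature of $\nabla^E$ is of type $(1,1)$ (that is, $R^E_{JX,JY}=R^E_{X,Y}$ for all $X,Y$) or that $D_M^E$ has, for the eigenvalue $\lambda$, an eigenspinor of type $(r,r+1)$ for some $r$. -/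

import Mathlib

open Bundle Set
open scoped Manifold ContDiff

noncomputable section

namespace KaehlerSpin

/-! ### The complex spinor module

The complex spinor module `Δ` of `ℝ²ᵈ` is realised on `ℂ`-valued functions on `Fin d → Bool` (the
Fock space), and the standard basis of `ℝ²ᵈ` is indexed by `Fin d × Fin 2`. -/

/-- Index set of the standard basis of `ℝ²ᵈ`. -/
abbrev VecIdx (d : ℕ) : Type := Fin d × Fin 2

/-- Index set of the standard basis of the `2ᵈ`-dimensional complex spinor module. -/
abbrev SpinorIdx (d : ℕ) : Type := Fin d → Bool

/-- Complex endomorphisms of the spinor module. -/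
abbrev SpinorMatrix (d : ℕ) : Type := Matrix (SpinorIdx d) (SpinorIdx d) ℂ

/-- The sign `(-1)^(number of occupied places before j)`. -/
def orderSign {d : ℕ} (j : Fin d) (s : SpinorIdx d) : ℂ :=
  ∏ i : Fin d, if i < j ∧ s i = true then -1 else 1

/-- Clifford multiplication by the `k`-th standard basis vector of `ℝ²ᵈ`. -/
def gamma {d : ℕ} (k : VecIdx d) : SpinorMatrix d :=
  Matrix.of fun s t =>
    if t = Function.update s k.1 (!s k.1) then
      orderSign k.1 s * (if k.2 = 0 then (if s k.1 then 1 else -1) else Complex.I)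
    else 0

/-- Clifford multiplication by the vector of `ℝ²ᵈ` with coordinates `v`. -/
def cliffordVec {d : ℕ} (v : VecIdx d → ℝ) : SpinorMatrix d :=
  ∑ k, (v k : ℂ) • gamma k

/-- The group `Spin(2d)` in its (faithful) spinor representation: the products of an even number of
unit vectors. -/
def IsSpinElement {d : ℕ} (s : SpinorMatrix d) : Prop :=
  ∃ l : List (EuclideanSpace ℝ (VecIdx d)), (∀ v ∈ l, ‖v‖ = 1) ∧ Even l.length ∧
    s = (l.map fun v => cliffordVec fun k => v k).prod

/-- The endomorphism `A ⊗ Id` of `Δ ⊗ W`, for a complex vector space `W`; elements of `Δ ⊗ W` are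
families of elements of `W` indexed by the basis of `Δ`. -/
def act {d : ℕ} {W : Type*} [AddCommGroup W] [Module ℂ W] (A : SpinorMatrix d)
    (w : SpinorIdx d → W) : SpinorIdx d → W :=
  fun a => ∑ b, A a b • w b

/-! ### Curvature -/

section Curvature

variable {E : Type*} [NormedAddCommGroup E] [NormedSpace ℝ E]
  {H : Type*} [TopologicalSpace H] {I : ModelWithCorners ℝ E H}
  {M : Type*} [TopologicalSpace M] [ChartedSpace H M] [IsManifold I 1 M]
  {F : Type*} [NormedAddCommGroup F] [NormedSpace ℝ F]
  {V : M → Type*} [TopologicalSpace (TotalSpace F V)]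
  [∀ x, AddCommGroup (V x)] [∀ x, Module ℝ (V x)] [∀ x, TopologicalSpace (V x)]
  [∀ x, IsTopologicalAddGroup (V x)] [∀ x, ContinuousSMul ℝ (V x)] [FiberBundle F V]

/-- The curvature `R(u, v) w = ∇_X ∇_Y σ - ∇_Y ∇_X σ - ∇_[X, Y] σ` of a connection at `x`, where
`X`, `Y`, `σ` are extensions of `u`, `v`, `w` that are smooth near `x` (by tensoriality the choice
is immaterial). -/
def curvature (cov : CovariantDerivative I F V) (x : M) (u v : TangentSpace I x) (w : V x) : V x :=
  let X : Π y : M, TangentSpace I y := FiberBundle.extend E u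
  let Y : Π y : M, TangentSpace I y := FiberBundle.extend E v
  let σ : Π y : M, V y := FiberBundle.extend F w
  cov (fun y => cov σ y (Y y)) x u - cov (fun y => cov σ y (X y)) x v
    - cov σ x (VectorField.mlieBracket I X Y x)

end Curvature

section Geometry

variable {d : ℕ} {E : Type*} [NormedAddCommGroup E] [NormedSpace ℝ E] [FiniteDimensional ℝ E]
  {H : Type*} [TopologicalSpace H] {I : ModelWithCorners ℝ E H}
  {M : Type*} [TopologicalSpace M] [ChartedSpace H M] [IsManifold I ∞ M]

/-- A smooth Riemannian metric on `M`. -/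
abbrev Metric (I : ModelWithCorners ℝ E H) (M : Type*) [TopologicalSpace M] [ChartedSpace H M]
    [IsManifold I ∞ M] : Type _ :=
  ContMDiffRiemannianMetric I ∞ E (fun x : M => TangentSpace I x)

/-- A connection on the tangent bundle of `M`. -/
abbrev TangentConnection (I : ModelWithCorners ℝ E H) (M : Type*) [TopologicalSpace M]
    [ChartedSpace H M] [IsManifold I ∞ M] : Type _ :=
  CovariantDerivative I E (fun x : M => TangentSpace I x)

/-- `∇` is the Levi-Civita connection of `g`: the smooth metric connection without torsion. -/
structure IsLeviCivita (g : Metric I M) (cov : TangentConnection I M) : Prop where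
  smooth : cov.ContMDiffCovariantDerivative ∞
  metric : ∀ (Y Z : Π x : M, TangentSpace I x) (x : M), MDiffAt (T% Y) x → MDiffAt (T% Z) x →
    ∀ u, mvfderiv I (fun y => g.inner y (Y y) (Z y)) x u =
      g.inner x (cov Y x u) (Z x) + g.inner x (Y x) (cov Z x u)
  torsion_free : cov.torsion = 0

/-- The vectors `e k` of `T_x M` are orthonormal. When `M` has dimension `2d` they form a basis. -/
def IsOrthonormalFrame (g : Metric I M) (x : M) (e : VecIdx d → TangentSpace I x) : Prop :=
  ∀ k l, g.inner x (e k) (e l) = if k = l then 1 else 0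

/-- The set of all values `∑ g(R(e_k, e_l) e_l, e_k)` of the scalar curvature of a `2d`-dimensional
Riemannian manifold with Levi-Civita connection `∇`; here `e` is an orthonormal basis of `T_x M`, on
which the value does not depend. -/
def scalarCurvatureValues (d : ℕ) (g : Metric I M) (cov : TangentConnection I M) : Set ℝ :=
  {s | ∃ (x : M) (e : VecIdx d → TangentSpace I x), IsOrthonormalFrame g x e ∧
    s = ∑ k, ∑ l, g.inner x (curvature cov x (e k) (e l) (e l)) (e k)}

/-- A field of endomorphisms of the tangent bundle. -/
abbrev TangentEndo (I : ModelWithCorners ℝ E H) (M : Type*) [TopologicalSpace M]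
    [ChartedSpace H M] : Type _ :=
  Π x : M, TangentSpace I x →L[ℝ] TangentSpace I x

/-- `J` makes the Riemannian manifold `(M, g)` with Levi-Civita connection `∇` a Kähler manifold: it
is a smooth orthogonal parallel almost complex structure. -/
structure IsKaehlerStructure (g : Metric I M) (cov : TangentConnection I M)
    (J : TangentEndo I M) : Prop where
  smooth : ContMDiff I (I.prod 𝓘(ℝ, E →L[ℝ] E)) ∞ (fun x => TotalSpace.mk' (E →L[ℝ] E)
    (E := fun x : M => TangentSpace I x →L[ℝ] TangentSpace I x) x (J x))
  sq : ∀ x u, J x (J x u) = -u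
  orthogonal : ∀ x u v, g.inner x (J x u) (J x v) = g.inner x u v
  parallel : ∀ (Y : Π x : M, TangentSpace I x) (x : M), MDiffAt (T% Y) x →
    ∀ u, cov (fun y => J y (Y y)) x u = J x (cov Y x u)

/-! ### Spin structures -/

/-- A spin structure on a Riemannian manifold of dimension `2d`: a cover by open sets `U i` with
smooth orthonormal frames, together with a smooth `Spin(2d)`-valued cocycle `lift i j` that lifts the
cocycle of the changes of frame. -/
structure SpinStructure (d : ℕ) (g : Metric I M) (ι : Type*) where
  U : ι → Set M
  isOpen_U : ∀ i, IsOpen (U i)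
  iUnion_U : ⋃ i, U i = univ
  frame : ι → VecIdx d → Π x : M, TangentSpace I x
  frame_smooth : ∀ i k, ContMDiffOn I I.tangent ∞
    (fun x => (⟨x, frame i k x⟩ : TangentBundle I M)) (U i)
  frame_orthonormal : ∀ i, ∀ x ∈ U i, IsOrthonormalFrame g x (fun k => frame i k x)
  lift : ι → ι → M → SpinorMatrix d
  lift_smooth : ∀ i j a b, ContMDiffOn I 𝓘(ℝ, ℂ) ∞ (fun x => lift i j x a b) (U i ∩ U j)
  lift_spin : ∀ i j, ∀ x ∈ U i ∩ U j, IsSpinElement (lift i j x)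
  lift_frame : ∀ i j, ∀ x ∈ U i ∩ U j, ∀ k, lift i j x * gamma k =
    cliffordVec (fun l => g.inner x (frame i l x) (frame j k x)) * lift i j x
  lift_cocycle : ∀ i j k, ∀ x ∈ U i ∩ U j ∩ U k, lift i j x * lift j k x = lift i k x

/-! ### Hermitian vector bundles with connection -/

variable {F : Type*} [NormedAddCommGroup F] [NormedSpace ℂ F]
  {V : M → Type*} [TopologicalSpace (TotalSpace F V)]
  [∀ x, NormedAddCommGroup (V x)] [∀ x, InnerProductSpace ℂ (V x)] [FiberBundle F V]

/-- The Hermitian metric of the complex vector bundle `V` is smooth. -/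
def IsSmoothHermitian (I : ModelWithCorners ℝ E H) (F : Type*) [NormedAddCommGroup F]
    [NormedSpace ℂ F] (V : M → Type*) [TopologicalSpace (TotalSpace F V)]
    [∀ x, NormedAddCommGroup (V x)] [∀ x, InnerProductSpace ℂ (V x)] [FiberBundle F V] : Prop :=
  ∀ (σ τ : Π x : M, V x) (x : M),
    ContMDiffAt I (I.prod 𝓘(ℝ, F)) ∞ (fun y => (⟨y, σ y⟩ : TotalSpace F V)) x →
    ContMDiffAt I (I.prod 𝓘(ℝ, F)) ∞ (fun y => (⟨y, τ y⟩ : TotalSpace F V)) x →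
    ContMDiffAt I 𝓘(ℝ, ℂ) ∞ (fun y => inner ℂ (σ y) (τ y)) x

/-- `∇^E` is a metric connection on the Hermitian vector bundle `V`: it is smooth, complex linear and
compatible with the Hermitian metric. -/
structure IsMetricConnection [VectorBundle ℝ F V] (covE : CovariantDerivative I F V) : Prop where
  smooth : covE.ContMDiffCovariantDerivative ∞
  complex_linear : ∀ (σ : Π x : M, V x) (x : M),
    MDifferentiableAt I (I.prod 𝓘(ℝ, F)) (fun y => (⟨y, σ y⟩ : TotalSpace F V)) x →
    ∀ u, covE (fun y => Complex.I • σ y) x u = Complex.I • covE σ x u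
  metric : ∀ (σ τ : Π x : M, V x) (x : M),
    MDifferentiableAt I (I.prod 𝓘(ℝ, F)) (fun y => (⟨y, σ y⟩ : TotalSpace F V)) x →
    MDifferentiableAt I (I.prod 𝓘(ℝ, F)) (fun y => (⟨y, τ y⟩ : TotalSpace F V)) x →
    ∀ u, mvfderiv I (fun y => inner ℂ (σ y) (τ y)) x u =
      inner ℂ (covE σ x u) (τ x) + inner ℂ (σ x) (covE τ x u)

/-- The curvature of `∇^E` is of type `(1,1)`. -/
def IsCurvatureOneOne (J : TangentEndo I M) (covE : CovariantDerivative I F V) : Prop :=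
  ∀ (x : M) (u v : TangentSpace I x) (w : V x),
    curvature covE x (J x u) (J x v) w = curvature covE x u v w

/-! ### Twisted spinor fields and the twisted Dirac operator -/

/-- A section of `ΣM ⊗ E`, given by its local representatives: over `U i` the spin frame identifies
`ΣM ⊗ E` with `Δ ⊗ E`. Only the values of the `i`-th representative on `U i` matter. -/
abbrev LocalSpinor (d : ℕ) (ι : Type*) {M : Type*} (V : M → Type*) : Type _ :=
  ι → Π x : M, SpinorIdx d → V x

namespace SpinStructure

variable {ι : Type*} {g : Metric I M} (S : SpinStructure d g ι)

/-- The representatives of `ψ` are smooth and fit together to a section of `ΣM ⊗ E`. -/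
structure IsSmoothSpinor (F : Type*) [NormedAddCommGroup F] [NormedSpace ℂ F]
    {V : M → Type*} [TopologicalSpace (TotalSpace F V)]
    [∀ x, NormedAddCommGroup (V x)] [∀ x, InnerProductSpace ℂ (V x)] [FiberBundle F V]
    (ψ : LocalSpinor d ι V) : Prop where
  smooth : ∀ i a, ContMDiffOn I (I.prod 𝓘(ℝ, F)) ∞
    (fun x => (⟨x, ψ i x a⟩ : TotalSpace F V)) (S.U i)
  compatible : ∀ i j, ∀ x ∈ S.U i ∩ S.U j, ψ i x = act (S.lift i j x) (ψ j x)

/-- The connection of `ΣM ⊗ E` in the spin frame over `U i`: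
`∇_X ψ = ∇^E_X ψ + 1/4 ∑ g(∇_X e_k, e_l) e_k · e_l · ψ`. -/
def spinorCov (cov : TangentConnection I M) (covE : CovariantDerivative I F V)
    (ψ : LocalSpinor d ι V) (i : ι) (x : M) (X : TangentSpace I x) : SpinorIdx d → V x :=
  (fun a => covE (fun y => ψ i y a) x X) +
    act ((1 / 4 : ℂ) • ∑ k, ∑ l,
      ((g.inner x (cov (S.frame i k) x X) (S.frame i l x) : ℝ) : ℂ) • (gamma k * gamma l)) (ψ i x)

/-- The twisted Dirac operator `∑ e_k · ∇_{e_k}`. -/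
def dirac (cov : TangentConnection I M) (covE : CovariantDerivative I F V)
    (ψ : LocalSpinor d ι V) : LocalSpinor d ι V :=
  fun i x => ∑ k, act (gamma k) (S.spinorCov cov covE ψ i x (S.frame i k x))

/-- `ψ` is an eigenspinor of the twisted Dirac operator for the eigenvalue `μ`. -/
structure IsEigenspinor (cov : TangentConnection I M) (covE : CovariantDerivative I F V) (μ : ℝ)
    (ψ : LocalSpinor d ι V) : Prop where
  isSmoothSpinor : S.IsSmoothSpinor F ψ
  ne_zero : ∃ i, ∃ x ∈ S.U i, ψ i x ≠ 0
  eigen : ∀ i, ∀ x ∈ S.U i, S.dirac cov covE ψ i x = (μ : ℂ) • ψ i x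

/-- The curvature endomorphism `R^E = 2 ∑ e_k · e_l · ⊗ R^E(e_k, e_l)` of the fibre of `ΣM ⊗ E` at
`x ∈ U i`. -/
def curvatureEndo (covE : CovariantDerivative I F V) (i : ι) (x : M) (w : SpinorIdx d → V x) :
    SpinorIdx d → V x :=
  (2 : ℂ) • ∑ k, ∑ l, act (gamma k * gamma l)
    (fun b => curvature covE x (S.frame i k x) (S.frame i l x) (w b))

/-- The set of all eigenvalues of the pointwise endomorphisms `R^E`, at all points of `M`. -/
def curvatureEigenvalues (covE : CovariantDerivative I F V) : Set ℝ :=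
  {μ | ∃ i, ∃ x ∈ S.U i, ∃ w : SpinorIdx d → V x, w ≠ 0 ∧
    S.curvatureEndo covE i x w = (μ : ℂ) • w}

/-- Clifford multiplication by the Kähler form `Ω(X, Y) = g(J X, Y)` in the spin frame over
`U i`. -/
def kaehlerClifford (J : TangentEndo I M) (i : ι) (x : M) : SpinorMatrix d :=
  (1 / 2 : ℂ) • ∑ k, ∑ l,
    ((g.inner x (J x (S.frame i k x)) (S.frame i l x) : ℝ) : ℂ) • (gamma k * gamma l)

/-- `φ` takes its values in `Σ_r M ⊗ E`, where `Σ_r M` is the kernel of `Ω · - i (2 r - d)`. -/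
def IsOfDegree (J : TangentEndo I M) (r : ℕ) (φ : LocalSpinor d ι V) : Prop :=
  ∀ i, ∀ x ∈ S.U i,
    act (S.kaehlerClifford J i x) (φ i x) = (Complex.I * (2 * (r : ℂ) - (d : ℂ))) • φ i x

/-- `ψ` is of type `(r, r + 1)`: it is the sum of a section of `Σ_r M ⊗ E` and a section of
`Σ_{r+1} M ⊗ E` (both are smooth when `ψ` is, as its components). -/
def IsOfType (J : TangentEndo I M) (r : ℕ) (ψ : LocalSpinor d ι V) : Prop :=
  ∃ φ₀ φ₁ : LocalSpinor d ι V, S.IsOfDegree J r φ₀ ∧ S.IsOfDegree J (r + 1) φ₁ ∧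
    ∀ i, ∀ x ∈ S.U i, ψ i x = φ₀ i x + φ₁ i x

end SpinStructure

end Geometry

end KaehlerSpin

end

/-!
The estimate compares two expressions for the twisted Dirac operator `D` on a spinor field `χ`. The
integrated Weitzenböck formula `∫ |Dχ|² = ∫ |∇χ|² + ¼ ∫ ⟨(Scal + R^E) χ, χ⟩`
(`SpinStructure.integral_weitzenboeck`) bounds `∫ |Dχ|² - ∫ |∇χ|²` from below by
`¼ (Scal₀ + κ₁) ∫ |χ|²`. On a Kähler manifold the Kähler form is parallel, so that the components
`ψ_k` of a spinor field `ψ` in `Σ_k M ⊗ E` are smooth, `∇` preserves the degree `k`, and `D` maps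
degree `k` to the degrees `k - 1` and `k + 1`. Writing `(Dψ_k)^±` for the two components of `Dψ_k`,
the Kähler twistor inequality (`twistor_inequality`)

  `|∇ψ_k|² ≥ |(Dψ_k)^+|² / (2 (k + 1)) + |(Dψ_k)^-|² / (2 (d - k + 1))`

bounds `|Dχ|² - |∇χ|²` from above for the test spinors `χ = ∑ z_k ψ_k`, where `ψ` is an eigenspinor
and the `z_k` are real. The result is `SpinStructure.integral_estimate`, in which only the numbers
`p_k = ‖(Dψ_{k-1})^+‖²`, `m_k = ‖(Dψ_{k+1})^-‖²`, `c_k = Re ⟪(Dψ_{k-1})^+, (Dψ_{k+1})^-⟫` and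
`‖ψ_k‖²` occur. The eigenvalue equation `λ ψ_k = (Dψ_{k-1})^+ + (Dψ_{k+1})^-` and the symmetry of `D`
give further relations between them, collected in `SpectralData`
(`SpinStructure.spectralData`), and what remains is elementary.

* In odd dimension the signs `z_k = ± 1` can be chosen with any prescribed products
  `z_{k-1} z_{k+1}`, hence against the signs of the `c_k` (`SpectralData.bound_odd`).
* In even dimension, if all `c_k` vanish, testing with the single components `ψ_k` shows that a
  smaller `λ²` would force them to vanish one by one, from both ends to the middle
  (`SpectralData.bound_even`). The `c_k` vanish pointwise for eigenspinors of type `(r, r + 1)`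
  (`SpinStructure.mixed_eq_zero_of_isOfType`). If the curvature of `E` is of type `(1, 1)`, then the
  curvature endomorphism `R^E` preserves the degree, so that every other term of the Weitzenböck
  formula for `ψ_{k-1} + ψ_{k+1}` splits, and `c_k = 0`
  (`SpinStructure.integral_mixed_eq_zero`). In complex dimension `2` only `c_1` can be nonzero, and
  testing with `ψ_0 ± ψ_2` deals with it (`SpectralData.bound_two`).

Spinor fields are given by components in local spin frames. The pointwise Weitzenböck formula
(`SpinStructure.weitzenboeck`) follows from the curvature of the spin connection, a quarter of the
Riemannian curvature acting by Clifford multiplication, and the first Bianchi identity. That `∇`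
and `D` do not depend on the spin frame (`SpinStructure.nabla_lift`) requires that the change of
frame `s`, with values in the spin group, intertwines the connection forms: the defect commutes with
Clifford multiplication up to `s`, and is traceless since `det s` is a root of unity, so it vanishes
by Schur's lemma (`SpinStructure.matrixDeriv_lift`).

Integration enters only as a strictly positive linear functional on continuous functions that
annihilates divergences (`IsIntegral`). It is constructed from charts and a partition of unity
(`exists_isIntegral`), with the help of the divergence formula `√G div Z = ∑ ∂_k (√G Z^k)`
(`volDensity_mul_divergence`).
-/

noncomputable section

namespace KaehlerSpin

/-! ### The Clifford relations -/

section Clifford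

variable {d : ℕ}

/-- The nonzero entry of `gamma k` in the row `s`. -/
def gammaCoeff (k : VecIdx d) (s : SpinorIdx d) : ℂ :=
  orderSign k.1 s * (if k.2 = 0 then (if s k.1 then 1 else -1) else Complex.I)

/-- The basis spinor `s` with the occupation number at the place `j` reversed. -/
def flipAt (j : Fin d) (s : SpinorIdx d) : SpinorIdx d := Function.update s j (!s j)

lemma gamma_apply (k : VecIdx d) (s t : SpinorIdx d) :
    gamma k s t = if t = flipAt k.1 s then gammaCoeff k s else 0 := rfl

lemma flipAt_self (j : Fin d) (s : SpinorIdx d) : flipAt j s j = !s j := by simp [flipAt]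

lemma flipAt_of_ne {i j : Fin d} (h : i ≠ j) (s : SpinorIdx d) : flipAt j s i = s i := by
  simp [flipAt, h]

lemma flipAt_flipAt (j : Fin d) (s : SpinorIdx d) : flipAt j (flipAt j s) = s := by
  simp [flipAt]

lemma flipAt_comm (i j : Fin d) (s : SpinorIdx d) :
    flipAt i (flipAt j s) = flipAt j (flipAt i s) := by
  by_cases h : i = j
  · subst h; rfl
  · simp only [flipAt]
    rw [Function.update_of_ne h, Function.update_of_ne (Ne.symm h), Function.update_comm h]

lemma orderSign_flipAt (i j : Fin d) (s : SpinorIdx d) :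
    orderSign j (flipAt i s) = (if i < j then -1 else 1) * orderSign j s := by
  unfold orderSign
  rw [← Finset.mul_prod_erase _ _ (Finset.mem_univ i),
    ← Finset.mul_prod_erase (Finset.univ) (fun i => if i < j ∧ s i = true then (-1 : ℂ) else 1)
      (Finset.mem_univ i)]
  have : ∀ l ∈ Finset.univ.erase i, (if l < j ∧ flipAt i s l = true then (-1 : ℂ) else 1) =
      if l < j ∧ s l = true then -1 else 1 := by
    intro l hl
    rw [flipAt_of_ne (Finset.ne_of_mem_erase hl)]
  rw [Finset.prod_congr rfl this, ← mul_assoc]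
  congr 1
  rw [flipAt_self]
  by_cases h : i < j <;> cases s i <;> simp [h]

lemma orderSign_mul_self (j : Fin d) (s : SpinorIdx d) : orderSign j s * orderSign j s = 1 := by
  unfold orderSign
  rw [← Finset.prod_mul_distrib]
  apply Finset.prod_eq_one
  intro i _
  split_ifs <;> simp

lemma star_orderSign (j : Fin d) (s : SpinorIdx d) : star (orderSign j s) = orderSign j s := by
  unfold orderSign
  rw [star_prod]
  apply Finset.prod_congr rfl
  intro i _
  split_ifs <;> simp

lemma gamma_mul_gamma_apply (k l : VecIdx d) (s t : SpinorIdx d) :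
    (gamma k * gamma l) s t =
      if t = flipAt l.1 (flipAt k.1 s) then gammaCoeff k s * gammaCoeff l (flipAt k.1 s) else 0 := by
  rw [Matrix.mul_apply, Finset.sum_eq_single (flipAt k.1 s)]
  · simp [gamma_apply]
  · intro u _ hu
    simp [gamma_apply, hu]
  · simp

lemma gammaCoeff_mul_add (k l : VecIdx d) (s : SpinorIdx d) :
    gammaCoeff k s * gammaCoeff l (flipAt k.1 s) + gammaCoeff l s * gammaCoeff k (flipAt l.1 s) =
      if k = l then -2 else 0 := by
  obtain ⟨i, a⟩ := k
  obtain ⟨j, b⟩ := l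
  simp only [gammaCoeff, orderSign_flipAt]
  have hi := orderSign_mul_self i s
  have hI := Complex.I_mul_I
  rcases lt_trichotomy i j with h | h | h
  · have h' : ¬ j < i := not_lt.2 h.le
    have hne : i ≠ j := h.ne
    simp only [h, h', if_true, if_false, flipAt_of_ne hne, flipAt_of_ne hne.symm]
    simp only [Prod.mk.injEq, hne, false_and, if_false]
    ring
  · subst h
    simp only [lt_irrefl, if_false, flipAt_self, Prod.mk.injEq, true_and]
    fin_cases a <;> fin_cases b <;> cases s i <;> simp <;>
      first
      | linear_combination (-2 : ℂ) * hi
      | linear_combination 2 * orderSign i s * orderSign i s * hI - 2 * hi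
      | ring
  · have h' : ¬ i < j := not_lt.2 h.le
    have hne : i ≠ j := h.ne'
    simp only [h, h', if_true, if_false, flipAt_of_ne hne, flipAt_of_ne hne.symm]
    simp only [Prod.mk.injEq, hne, false_and, if_false]
    ring

lemma gamma_mul_add (k l : VecIdx d) :
    gamma k * gamma l + gamma l * gamma k = if k = l then (-2 : ℂ) • (1 : SpinorMatrix d) else 0 := by
  ext s t
  rw [Matrix.add_apply, gamma_mul_gamma_apply, gamma_mul_gamma_apply, flipAt_comm k.1 l.1]
  have h := gammaCoeff_mul_add k l s
  by_cases hkl : k = l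
  · subst hkl
    simp only [if_true, flipAt_flipAt] at h ⊢
    by_cases hst : t = s
    · subst hst; simp [h]
    · simp [hst, Ne.symm hst]
  · simp only [hkl, if_false] at h ⊢
    split_ifs
    · simpa using h
    · simp

lemma gamma_mul_self (k : VecIdx d) : gamma k * gamma k = -(1 : SpinorMatrix d) := by
  have h := gamma_mul_add k k
  rw [if_pos rfl, ← two_smul ℂ] at h
  have := congrArg (fun A => (1 / 2 : ℂ) • A) h
  simpa [smul_smul] using this

lemma conjTranspose_gamma (k : VecIdx d) : (gamma k).conjTranspose = -gamma k := by
  ext s t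
  rw [Matrix.conjTranspose_apply, Matrix.neg_apply, gamma_apply, gamma_apply]
  have hiff : s = flipAt k.1 t ↔ t = flipAt k.1 s :=
    ⟨fun h => by rw [h, flipAt_flipAt], fun h => by rw [h, flipAt_flipAt]⟩
  by_cases h : t = flipAt k.1 s
  · subst h
    rw [if_pos (hiff.2 rfl), if_pos rfl]
    obtain ⟨i, a⟩ := k
    simp only [gammaCoeff, orderSign_flipAt, lt_irrefl, if_false, flipAt_self, star_mul',
      star_orderSign, one_mul]
    fin_cases a <;> cases s i <;> simp
  · rw [if_neg h, if_neg (fun h' => h (hiff.1 h'))]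
    simp

/-- Clifford multiplication `A ↦ A ⊗ Id` as a homomorphism of algebras. -/
def actHom (W : Type*) [AddCommGroup W] [Module ℂ W] :
    SpinorMatrix d →ₐ[ℂ] Module.End ℂ (SpinorIdx d → W) :=
  AlgHom.ofLinearMap
    { toFun := fun A =>
        { toFun := act A
          map_add' := fun v w => by
            funext a; simp [act, Finset.sum_add_distrib]
          map_smul' := fun c v => by
            funext a; simp [act, Finset.smul_sum, smul_smul, mul_comm] }
      map_add' := fun A B => by
        ext v a; simp [act, add_smul, Finset.sum_add_distrib]
      map_smul' := fun c A => by
        ext v a; simp [act, Finset.smul_sum, smul_smul] }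
    (by
      refine LinearMap.ext fun v => funext fun a => ?_
      simp [act, Matrix.one_apply])
    (fun A B => by
      refine LinearMap.ext fun v => funext fun a => ?_
      simp only [act, LinearMap.coe_mk, AddHom.coe_mk, Module.End.mul_apply, Matrix.mul_apply,
        Finset.sum_smul, Finset.smul_sum, smul_smul]
      rw [Finset.sum_comm])

section Act

variable {W : Type*} [AddCommGroup W] [Module ℂ W]

lemma actHom_apply (A : SpinorMatrix d) (w : SpinorIdx d → W) : actHom W A w = act A w := rfl

lemma act_mul (A B : SpinorMatrix d) (w : SpinorIdx d → W) : act (A * B) w = act A (act B w) := by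
  simp only [← actHom_apply, map_mul, Module.End.mul_apply]

lemma act_one (w : SpinorIdx d → W) : act (1 : SpinorMatrix d) w = w := by
  simp only [← actHom_apply, map_one, Module.End.one_apply]

lemma act_add (A : SpinorMatrix d) (v w : SpinorIdx d → W) : act A (v + w) = act A v + act A w := by
  simp only [← actHom_apply, map_add]

lemma act_sub (A : SpinorMatrix d) (v w : SpinorIdx d → W) : act A (v - w) = act A v - act A w := by
  simp only [← actHom_apply, map_sub]

lemma act_neg (A : SpinorMatrix d) (v : SpinorIdx d → W) : act A (-v) = -act A v := by
  simp only [← actHom_apply, map_neg]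

lemma act_zero (A : SpinorMatrix d) : act A (0 : SpinorIdx d → W) = 0 := by
  simp only [← actHom_apply, map_zero]

lemma act_smul (A : SpinorMatrix d) (c : ℂ) (v : SpinorIdx d → W) : act A (c • v) = c • act A v := by
  simp only [← actHom_apply, map_smul]

lemma act_sum {κ : Type*} (A : SpinorMatrix d) (t : Finset κ) (v : κ → SpinorIdx d → W) :
    act A (∑ k ∈ t, v k) = ∑ k ∈ t, act A (v k) := by
  simp only [← actHom_apply, map_sum]

lemma add_act (A B : SpinorMatrix d) (v : SpinorIdx d → W) : act (A + B) v = act A v + act B v := by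
  simp only [← actHom_apply, map_add, LinearMap.add_apply]

lemma sub_act (A B : SpinorMatrix d) (v : SpinorIdx d → W) : act (A - B) v = act A v - act B v := by
  simp only [← actHom_apply, map_sub, LinearMap.sub_apply]

lemma neg_act (A : SpinorMatrix d) (v : SpinorIdx d → W) : act (-A) v = -act A v := by
  simp only [← actHom_apply, map_neg, LinearMap.neg_apply]

lemma zero_act (v : SpinorIdx d → W) : act (0 : SpinorMatrix d) v = 0 := by
  simp only [← actHom_apply, map_zero, LinearMap.zero_apply]

lemma smul_act (c : ℂ) (A : SpinorMatrix d) (v : SpinorIdx d → W) :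
    act (c • A) v = c • act A v := by
  simp only [← actHom_apply, map_smul, LinearMap.smul_apply]

lemma sum_act {κ : Type*} (t : Finset κ) (A : κ → SpinorMatrix d) (v : SpinorIdx d → W) :
    act (∑ k ∈ t, A k) v = ∑ k ∈ t, act (A k) v := by
  simp only [← actHom_apply, map_sum, LinearMap.sum_apply]

end Act

section InnerProduct

variable {W : Type*} [NormedAddCommGroup W] [InnerProductSpace ℂ W]

/-- The Hermitian product of `Δ ⊗ W`, complex linear in the second argument. -/
def ip (v w : SpinorIdx d → W) : ℂ := ∑ a, inner ℂ (v a) (w a)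

lemma ip_add_left (u v w : SpinorIdx d → W) : ip (u + v) w = ip u w + ip v w := by
  simp [ip, Finset.sum_add_distrib]

lemma ip_add_right (u v w : SpinorIdx d → W) : ip u (v + w) = ip u v + ip u w := by
  simp [ip, Finset.sum_add_distrib]

lemma ip_smul_left (c : ℂ) (v w : SpinorIdx d → W) : ip (c • v) w = star c * ip v w := by
  simp [ip, Finset.mul_sum, mul_comm]

lemma ip_smul_right (c : ℂ) (v w : SpinorIdx d → W) : ip v (c • w) = c * ip v w := by
  simp [ip, Finset.mul_sum]

lemma ip_neg_right (v w : SpinorIdx d → W) : ip v (-w) = -ip v w := by simp [ip]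

lemma ip_sub_right (u v w : SpinorIdx d → W) : ip u (v - w) = ip u v - ip u w := by
  simp [ip]

lemma ip_zero_left (w : SpinorIdx d → W) : ip 0 w = 0 := by simp [ip]

lemma ip_zero_right (w : SpinorIdx d → W) : ip w 0 = 0 := by simp [ip]

lemma ip_sum_left {κ : Type*} (t : Finset κ) (v : κ → SpinorIdx d → W) (w : SpinorIdx d → W) :
    ip (∑ k ∈ t, v k) w = ∑ k ∈ t, ip (v k) w := by
  simp only [ip, Finset.sum_apply, sum_inner]
  exact Finset.sum_comm

lemma ip_sum_right {κ : Type*} (t : Finset κ) (v : SpinorIdx d → W) (w : κ → SpinorIdx d → W) :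
    ip v (∑ k ∈ t, w k) = ∑ k ∈ t, ip v (w k) := by
  simp only [ip, Finset.sum_apply, inner_sum]
  exact Finset.sum_comm

lemma star_ip (v w : SpinorIdx d → W) : star (ip v w) = ip w v := by
  simp [ip]

lemma re_ip_comm (v w : SpinorIdx d → W) : (ip v w).re = (ip w v).re := by
  rw [← star_ip w v]; simp

lemma ip_self (v : SpinorIdx d → W) : ip v v = ((∑ a, ‖v a‖ ^ 2 : ℝ) : ℂ) := by
  simp [ip, inner_self_eq_norm_sq_to_K]

lemma re_ip_self_nonneg (v : SpinorIdx d → W) : 0 ≤ (ip v v).re := by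
  rw [ip_self, Complex.ofReal_re]; positivity

lemma eq_zero_of_re_ip_self (v : SpinorIdx d → W) (h : (ip v v).re = 0) : v = 0 := by
  rw [ip_self, Complex.ofReal_re, Finset.sum_eq_zero_iff_of_nonneg (fun _ _ => by positivity)] at h
  funext a
  simpa using h a (Finset.mem_univ a)

lemma ip_act_left (A : SpinorMatrix d) (v w : SpinorIdx d → W) :
    ip (act A v) w = ip v (act A.conjTranspose w) := by
  simp only [ip, act, sum_inner, inner_sum, inner_smul_left, inner_smul_right,
    Matrix.conjTranspose_apply]
  rw [Finset.sum_comm]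
  rfl

lemma ip_act_gamma_left (k : VecIdx d) (v w : SpinorIdx d → W) :
    ip (act (gamma k) v) w = -ip v (act (gamma k) w) := by
  rw [ip_act_left, conjTranspose_gamma, neg_act, ip_neg_right]

end InnerProduct

/-! ### Elements of the spin group -/

lemma conjTranspose_cliffordVec (v : VecIdx d → ℝ) :
    (cliffordVec v).conjTranspose = -cliffordVec v := by
  simp [cliffordVec, Matrix.conjTranspose_sum, Matrix.conjTranspose_smul, conjTranspose_gamma]

lemma cliffordVec_mul_add (v w : VecIdx d → ℝ) :
    cliffordVec v * cliffordVec w + cliffordVec w * cliffordVec v =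
      (-2 * ((∑ k, v k * w k : ℝ) : ℂ)) • (1 : SpinorMatrix d) := by
  have h0 : ∀ v w : VecIdx d → ℝ, cliffordVec v * cliffordVec w =
      ∑ k, ∑ l, ((v k : ℂ) * (w l : ℂ)) • (gamma k * gamma l : SpinorMatrix d) := by
    intro v w
    simp only [cliffordVec, Finset.sum_mul_sum, smul_mul_assoc, mul_smul_comm, smul_smul]
    refine Finset.sum_congr rfl fun k _ => Finset.sum_congr rfl fun l _ => ?_
    first
    | rfl
    | rw [mul_comm]
  have h1 : cliffordVec v * cliffordVec w + cliffordVec w * cliffordVec v =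
      ∑ k, ∑ l, ((v k : ℂ) * (w l : ℂ)) • (gamma k * gamma l + gamma l * gamma k) := by
    rw [h0 v w, h0 w v, Finset.sum_comm (f := fun k l => ((w k : ℂ) * (v l : ℂ)) •
      (gamma k * gamma l : SpinorMatrix d)), ← Finset.sum_add_distrib]
    refine Finset.sum_congr rfl fun k _ => ?_
    rw [← Finset.sum_add_distrib]
    refine Finset.sum_congr rfl fun l _ => ?_
    rw [smul_add, mul_comm (w l : ℂ)]
  rw [h1]
  simp only [gamma_mul_add, smul_ite, smul_zero, Finset.sum_ite_eq, Finset.mem_univ, if_true]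
  rw [← Finset.sum_smul, smul_smul]
  congr 1
  push_cast
  ring

lemma cliffordVec_mul_self (v : VecIdx d → ℝ) :
    cliffordVec v * cliffordVec v = (-((∑ k, v k * v k : ℝ) : ℂ)) • (1 : SpinorMatrix d) := by
  have h := cliffordVec_mul_add v v
  rw [← two_smul ℂ] at h
  have := congrArg (fun A => (1 / 2 : ℂ) • A) h
  simp only [smul_smul] at this
  rw [show (1 / 2 : ℂ) * 2 = 1 by norm_num, one_smul] at this
  rw [this]
  congr 1
  ring

lemma cliffordVec_unit_mul_self (v : EuclideanSpace ℝ (VecIdx d)) (hv : ‖v‖ = 1) :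
    cliffordVec (fun k => v k) * cliffordVec (fun k => v k) = -(1 : SpinorMatrix d) := by
  have h1 : ∑ k, v k * v k = 1 := by
    have := EuclideanSpace.norm_sq_eq v
    rw [hv] at this
    simpa [pow_two] using this.symm
  rw [cliffordVec_mul_self, h1]
  simp

lemma IsSpinElement.conjTranspose_mul_self {s : SpinorMatrix d} (hs : IsSpinElement s) :
    s.conjTranspose * s = 1 := by
  obtain ⟨l, hl, -, rfl⟩ := hs
  induction l with
  | nil => simp
  | cons v l ih =>
    have hv := cliffordVec_unit_mul_self v (hl v (by simp))
    have ih := ih fun w hw => hl w (by simp [hw])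
    simp only [List.map_cons, List.prod_cons, Matrix.conjTranspose_mul]
    rw [Matrix.mul_assoc, ← Matrix.mul_assoc (cliffordVec _).conjTranspose,
      conjTranspose_cliffordVec, Matrix.neg_mul, hv, neg_neg, Matrix.one_mul, ih]

lemma IsSpinElement.mul_conjTranspose_self {s : SpinorMatrix d} (hs : IsSpinElement s) :
    s * s.conjTranspose = 1 :=
  mul_eq_one_comm.1 hs.conjTranspose_mul_self

lemma IsSpinElement.det_pow_four {s : SpinorMatrix d} (hs : IsSpinElement s) : s.det ^ 4 = 1 := by
  obtain ⟨l, hl, -, rfl⟩ := hs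
  induction l with
  | nil => simp
  | cons v l ih =>
    have hv := cliffordVec_unit_mul_self v (hl v (by simp))
    have ih := ih fun w hw => hl w (by simp [hw])
    simp only [List.map_cons, List.prod_cons, Matrix.det_mul, mul_pow, ih, mul_one]
    have := congrArg Matrix.det hv
    rw [Matrix.det_mul, Matrix.det_neg, Matrix.det_one, mul_one] at this
    calc (cliffordVec fun k => v k).det ^ 4
        = ((cliffordVec fun k => v k).det * (cliffordVec fun k => v k).det) ^ 2 := by ring
      _ = 1 := by rw [this, ← pow_mul, mul_comm, pow_mul]; simp

lemma IsSpinElement.ip_act {W : Type*} [NormedAddCommGroup W] [InnerProductSpace ℂ W]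
    {s : SpinorMatrix d} (hs : IsSpinElement s) (v w : SpinorIdx d → W) :
    ip (act s v) (act s w) = ip v w := by
  rw [ip_act_left, ← act_mul, hs.conjTranspose_mul_self, act_one]

lemma trace_gamma_mul_gamma {k l : VecIdx d} (h : k ≠ l) : (gamma k * gamma l).trace = 0 := by
  have h1 := congrArg Matrix.trace (gamma_mul_add k l)
  rw [if_neg h, Matrix.trace_add, Matrix.trace_mul_comm (gamma l), Matrix.trace_zero] at h1
  exact add_self_eq_zero.1 h1

/-- The spinor module is irreducible: an endomorphism that commutes with Clifford multiplication is
a multiple of the identity, hence vanishes when its trace does. -/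
lemma eq_zero_of_commute_gamma {A : SpinorMatrix d} (h : ∀ k, A * gamma k = gamma k * A)
    (htr : A.trace = 0) : A = 0 := by
  have key : ∀ (k : VecIdx d) (s t : SpinorIdx d),
      A s t * gammaCoeff k t = gammaCoeff k s * A (flipAt k.1 s) (flipAt k.1 t) := by
    intro k s t
    have h1 := congrFun (congrFun (h k) s) (flipAt k.1 t)
    rw [Matrix.mul_apply, Matrix.mul_apply, Finset.sum_eq_single t,
      Finset.sum_eq_single (flipAt k.1 s)] at h1
    · simpa [gamma_apply] using h1
    · intro u _ hu
      simp [gamma_apply, hu]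
    · simp
    · intro u _ hu
      rw [gamma_apply, if_neg, mul_zero]
      intro h'
      exact hu (by rw [← flipAt_flipAt k.1 u, ← h', flipAt_flipAt])
    · simp
  have hos : ∀ (j : Fin d) (s : SpinorIdx d), orderSign j s ≠ 0 := fun j s hz => by
    have := orderSign_mul_self j s
    simp [hz] at this
  -- the two gammas at a place where `s` and `t` differ relate `A s t` to the same entry of `A` with
  -- opposite signs
  have hoff : ∀ s t : SpinorIdx d, s ≠ t → A s t = 0 := by
    intro s t hst
    obtain ⟨j, hj⟩ := Function.ne_iff.1 hst
    have h0 := key (j, 0) s t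
    have h1 := key (j, 1) s t
    simp only [gammaCoeff, if_true] at h0
    simp only [gammaCoeff, one_ne_zero, if_false] at h1
    have hI := Complex.I_ne_zero
    have h1' : A s t * orderSign j t = orderSign j s * A (flipAt j s) (flipAt j t) := by
      have : (A s t * orderSign j t) * Complex.I =
        (orderSign j s * A (flipAt j s) (flipAt j t)) * Complex.I := by linear_combination h1
      exact mul_right_cancel₀ hI this
    have h2 : A s t * orderSign j t = 0 := by
      cases hs : s j <;> cases ht : t j <;> simp [hs, ht] at hj h0
      · linear_combination (1 / 2 : ℂ) * h0 + (1 / 2 : ℂ) * h1'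
      · linear_combination (-1 / 2 : ℂ) * h0 + (1 / 2 : ℂ) * h1'
    exact (mul_eq_zero.1 h2).resolve_right (hos j t)
  -- a single gamma flips a place, so the diagonal entries all agree
  have hflip : ∀ (j : Fin d) (s : SpinorIdx d), A (flipAt j s) (flipAt j s) = A s s := by
    intro j s
    have h1 := key (j, 1) s s
    simp only [gammaCoeff, one_ne_zero, if_false] at h1
    have hne : orderSign j s * Complex.I ≠ 0 := mul_ne_zero (hos j s) Complex.I_ne_zero
    exact (mul_left_cancel₀ hne (by linear_combination h1)).symm
  have hupd : ∀ (s t : SpinorIdx d) (T : Finset (Fin d)),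
      A (fun i => if i ∈ T then t i else s i) (fun i => if i ∈ T then t i else s i) = A s s := by
    intro s t T
    induction T using Finset.induction_on with
    | empty => simp
    | insert j T hj ih =>
      rw [← ih]
      set u : SpinorIdx d := fun i => if i ∈ T then t i else s i with hu
      have huj : u j = s j := by simp [hu, hj]
      by_cases hst : t j = s j
      · congr 1 <;> funext i <;> by_cases hi : i = j <;> simp [hu, hi, hj, hst]
      · have : (fun i => if i ∈ insert j T then t i else s i) = flipAt j u := by
          funext i
          by_cases hi : i = j
          · subst hi
            rw [flipAt_self, huj]
            simp only [Finset.mem_insert_self, if_true]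
            revert hst
            cases t i <;> cases s i <;> simp
          · rw [flipAt_of_ne hi]
            simp [hu, hi]
        rw [this, hflip]
  have hconst : ∀ s t : SpinorIdx d, A s s = A t t := by
    intro s t
    have := hupd s t Finset.univ
    simpa using this.symm
  ext s t
  by_cases hst : s = t
  · subst hst
    have : A.trace = (Fintype.card (SpinorIdx d) : ℂ) * A s s := by
      have hd : ∀ t ∈ Finset.univ, Matrix.diag A t = A s s := fun t _ => hconst t s
      rw [Matrix.trace, Finset.sum_congr rfl hd]
      simp
    rw [htr] at this
    have hc : (Fintype.card (SpinorIdx d) : ℂ) ≠ 0 := by simp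
    simpa [hc] using this.symm
  · simpa using hoff s t hst

end Clifford

/-! ### Bivectors in the Clifford algebra -/

section Bivector

variable {d : ℕ}

/-- The element `∑ b k l e_k e_l` of the Clifford algebra, acting on spinors. -/
def bivector (b : VecIdx d → VecIdx d → ℝ) : SpinorMatrix d :=
  ∑ k, ∑ l, ((b k l : ℝ) : ℂ) • (gamma k * gamma l)

lemma gamma_mul_comm (k l : VecIdx d) :
    gamma k * gamma l = -(gamma l * gamma k) + if k = l then (-2 : ℂ) • (1 : SpinorMatrix d) else 0 := by
  rw [← gamma_mul_add]; abel

lemma gamma_mul_gamma_commutator (k l m : VecIdx d) :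
    gamma k * gamma l * gamma m - gamma m * (gamma k * gamma l) =
      (if m = k then (2 : ℂ) • gamma l else 0) - (if m = l then (2 : ℂ) • gamma k else 0) := by
  have h1 := gamma_mul_add m l
  have h2 := gamma_mul_add m k
  have h : gamma k * gamma l * gamma m - gamma m * (gamma k * gamma l) =
      gamma k * (gamma m * gamma l + gamma l * gamma m) -
        (gamma m * gamma k + gamma k * gamma m) * gamma l := by noncomm_ring
  rw [h, h1, h2]
  split_ifs <;> simp
  abel

lemma bivector_commutator_gamma {b : VecIdx d → VecIdx d → ℝ} (hb : ∀ k l, b k l = -b l k)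
    (m : VecIdx d) :
    bivector b * gamma m - gamma m * bivector b = (4 : ℂ) • ∑ c, ((b m c : ℝ) : ℂ) • gamma c := by
  have h1 : bivector b * gamma m - gamma m * bivector b = ∑ k, ∑ l, ((b k l : ℝ) : ℂ) •
      (gamma k * gamma l * gamma m - gamma m * (gamma k * gamma l)) := by
    simp only [bivector, Finset.sum_mul, Finset.mul_sum, smul_mul_assoc, mul_smul_comm, smul_sub,
      Finset.sum_sub_distrib]
  rw [h1]
  simp only [gamma_mul_gamma_commutator, smul_sub, Finset.sum_sub_distrib, smul_ite, smul_zero,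
    Finset.sum_ite_eq, Finset.mem_univ, if_true]
  rw [Finset.sum_comm]
  simp only [Finset.sum_ite_eq, Finset.mem_univ, if_true]
  rw [← Finset.sum_sub_distrib, Finset.smul_sum]
  refine Finset.sum_congr rfl fun c _ => ?_
  rw [hb c m, smul_smul, smul_smul, smul_smul, ← sub_smul]
  congr 1
  push_cast
  ring

lemma bivector_commutator_bivector {a : VecIdx d → VecIdx d → ℝ} (ha : ∀ k l, a k l = -a l k)
    (b : VecIdx d → VecIdx d → ℝ) :
    bivector a * bivector b - bivector b * bivector a =
      (4 : ℂ) • bivector fun k l => ∑ c, (a c k * b c l + a c l * b k c) := by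
  have h1 : bivector a * bivector b - bivector b * bivector a =
      ∑ k, ∑ l, ((b k l : ℝ) : ℂ) • ((bivector a * gamma k - gamma k * bivector a) * gamma l +
        gamma k * (bivector a * gamma l - gamma l * bivector a)) := by
    conv_lhs => rw [show bivector b = ∑ k, ∑ l, ((b k l : ℝ) : ℂ) • (gamma k * gamma l) from rfl]
    simp only [Finset.sum_mul, Finset.mul_sum, smul_mul_assoc, mul_smul_comm]
    rw [← Finset.sum_sub_distrib]
    refine Finset.sum_congr rfl fun k _ => ?_
    rw [← Finset.sum_sub_distrib]
    refine Finset.sum_congr rfl fun l _ => ?_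
    rw [← smul_sub]
    congr 1
    noncomm_ring
  rw [h1]
  simp only [bivector_commutator_gamma ha]
  simp only [smul_mul_assoc, mul_smul_comm, Finset.sum_mul,
    Finset.mul_sum, smul_add, Finset.sum_add_distrib, Finset.smul_sum, bivector, smul_smul]
  have e1 : ∑ k, ∑ l, ∑ c, (((b k l : ℝ) : ℂ) * (4 * ((a k c : ℝ) : ℂ))) •
      (gamma c * gamma l : SpinorMatrix d) =
      ∑ k, ∑ l, ∑ c, ((4 : ℂ) * ((a c k * b c l : ℝ) : ℂ)) • (gamma k * gamma l) := by
    rw [Finset.sum_comm]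
    conv_rhs => rw [Finset.sum_comm]
    refine Finset.sum_congr rfl fun l _ => ?_
    rw [Finset.sum_comm]
    refine Finset.sum_congr rfl fun k _ => Finset.sum_congr rfl fun c _ => ?_
    congr 1
    push_cast
    ring
  have e2 : ∑ k, ∑ l, ∑ c, (((b k l : ℝ) : ℂ) * (4 * ((a l c : ℝ) : ℂ))) •
      (gamma k * gamma c : SpinorMatrix d) =
      ∑ k, ∑ l, ∑ c, ((4 : ℂ) * ((a c l * b k c : ℝ) : ℂ)) • (gamma k * gamma l) := by
    refine Finset.sum_congr rfl fun k _ => ?_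
    rw [Finset.sum_comm]
    refine Finset.sum_congr rfl fun l _ => Finset.sum_congr rfl fun c _ => ?_
    congr 1
    push_cast
    ring
  rw [e1, e2, ← Finset.sum_add_distrib]
  refine Finset.sum_congr rfl fun k _ => ?_
  rw [← Finset.sum_add_distrib]
  refine Finset.sum_congr rfl fun l _ => ?_
  rw [← Finset.sum_add_distrib, ← Finset.sum_add_distrib, Complex.ofReal_sum, Finset.mul_sum,
    Finset.sum_smul]
  refine Finset.sum_congr rfl fun c _ => ?_
  rw [← add_smul]
  congr 1
  push_cast
  ring

lemma trace_bivector {b : VecIdx d → VecIdx d → ℝ} (hb : ∀ k l, b k l = -b l k) :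
    (bivector b).trace = 0 := by
  simp only [bivector, Matrix.trace_sum, Matrix.trace_smul]
  refine Finset.sum_eq_zero fun k _ => Finset.sum_eq_zero fun l _ => ?_
  by_cases hkl : k = l
  · subst hkl
    have : b k k = 0 := by linarith [hb k k]
    simp [this]
  · simp [trace_gamma_mul_gamma hkl]

lemma conjTranspose_bivector {b : VecIdx d → VecIdx d → ℝ} (hb : ∀ k l, b k l = -b l k) :
    (bivector b).conjTranspose = -bivector b := by
  simp only [bivector, Matrix.conjTranspose_sum, Matrix.conjTranspose_smul,
    Matrix.conjTranspose_mul, conjTranspose_gamma, neg_mul_neg]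
  rw [Finset.sum_comm, ← Finset.sum_neg_distrib]
  refine Finset.sum_congr rfl fun k _ => ?_
  rw [← Finset.sum_neg_distrib]
  refine Finset.sum_congr rfl fun l _ => ?_
  rw [hb l k, ← neg_smul]
  congr 1

end Bivector

/-! ### The Kähler form acting on spinors -/

section KaehlerForm

variable {d : ℕ}

/-- `j` is the matrix of an orthogonal complex structure `J` in an orthonormal basis:
`J e_k = ∑ j k l e_l`. -/
structure IsComplexStructure (j : VecIdx d → VecIdx d → ℝ) : Prop where
  skew : ∀ k l, j k l = -j l k
  sq : ∀ k m, ∑ l, j k l * j l m = if k = m then -1 else 0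

/-- Clifford multiplication by `J e_k`. -/
def gammaJ (j : VecIdx d → VecIdx d → ℝ) (k : VecIdx d) : SpinorMatrix d :=
  ∑ l, ((j k l : ℝ) : ℂ) • gamma l

/-- Clifford multiplication by the Kähler form. -/
def kaehlerOp (j : VecIdx d → VecIdx d → ℝ) : SpinorMatrix d := (1 / 2 : ℂ) • bivector j

/-- Clifford multiplication by the component of `e_k` that raises the degree. -/
def raising (j : VecIdx d → VecIdx d → ℝ) (k : VecIdx d) : SpinorMatrix d :=
  (1 / 2 : ℂ) • (gamma k - Complex.I • gammaJ j k)

/-- Clifford multiplication by the component of `e_k` that lowers the degree. -/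
def lowering (j : VecIdx d → VecIdx d → ℝ) (k : VecIdx d) : SpinorMatrix d :=
  (1 / 2 : ℂ) • (gamma k + Complex.I • gammaJ j k)

lemma raising_add_lowering (j : VecIdx d → VecIdx d → ℝ) (k : VecIdx d) :
    raising j k + lowering j k = gamma k := by
  rw [raising, lowering, ← smul_add]
  rw [show gamma k - Complex.I • gammaJ j k + (gamma k + Complex.I • gammaJ j k) =
    (2 : ℂ) • gamma k by rw [two_smul]; abel, smul_smul]
  norm_num

lemma conjTranspose_gammaJ (j : VecIdx d → VecIdx d → ℝ) (k : VecIdx d) :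
    (gammaJ j k).conjTranspose = -gammaJ j k := by
  simp [gammaJ, Matrix.conjTranspose_sum, Matrix.conjTranspose_smul, conjTranspose_gamma]

lemma conjTranspose_raising (j : VecIdx d → VecIdx d → ℝ) (k : VecIdx d) :
    (raising j k).conjTranspose = -lowering j k := by
  rw [raising, lowering, Matrix.conjTranspose_smul, Matrix.conjTranspose_sub,
    Matrix.conjTranspose_smul, conjTranspose_gammaJ, conjTranspose_gamma, ← smul_neg]
  simp
  module

lemma conjTranspose_lowering (j : VecIdx d → VecIdx d → ℝ) (k : VecIdx d) :
    (lowering j k).conjTranspose = -raising j k := by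
  rw [← Matrix.conjTranspose_conjTranspose (raising j k), conjTranspose_raising,
    Matrix.conjTranspose_neg, neg_neg]

variable {j : VecIdx d → VecIdx d → ℝ}

lemma sum_gamma_mul_gammaJ (j : VecIdx d → VecIdx d → ℝ) : ∑ k, gamma k * gammaJ j k = (2 : ℂ) • kaehlerOp j := by
  simp only [kaehlerOp, bivector, smul_smul, gammaJ, Finset.mul_sum, mul_smul_comm]
  norm_num

lemma sum_gammaJ_mul_gamma (hj : IsComplexStructure j) : ∑ k, gammaJ j k * gamma k = -((2 : ℂ) • kaehlerOp j) := by
  simp only [kaehlerOp, bivector, smul_smul, gammaJ, Finset.sum_mul, smul_mul_assoc]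
  rw [Finset.sum_comm]
  norm_num
  simp only [← Finset.sum_neg_distrib]
  refine Finset.sum_congr rfl fun k _ => Finset.sum_congr rfl fun l _ => ?_
  rw [hj.skew l k]
  simp

lemma sum_gammaJ_mul_gammaJ (hj : IsComplexStructure j) : ∑ k, gammaJ j k * gammaJ j k = ∑ k, gamma k * gamma k := by
  have h : ∀ k, gammaJ j k * gammaJ j k =
      ∑ l, ∑ m, ((j k l * j k m : ℝ) : ℂ) • (gamma l * gamma m) := by
    intro k
    simp only [gammaJ, Finset.sum_mul_sum, smul_mul_assoc, mul_smul_comm, smul_smul]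
    refine Finset.sum_congr rfl fun l _ => Finset.sum_congr rfl fun m _ => ?_
    push_cast
    first
    | rfl
    | rw [mul_comm]
  simp only [h]
  rw [Finset.sum_comm]
  refine Finset.sum_congr rfl fun l _ => ?_
  rw [Finset.sum_comm]
  have h2 : ∀ m, ∑ k, ((j k l * j k m : ℝ) : ℂ) • (gamma l * gamma m : SpinorMatrix d) =
      if l = m then gamma l * gamma m else 0 := by
    intro m
    rw [← Finset.sum_smul, ← Complex.ofReal_sum]
    have : ∑ k, j k l * j k m = if l = m then 1 else 0 := by
      have h3 := hj.sq l m
      have h4 : ∑ k, j k l * j k m = -∑ k, j l k * j k m := by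
        rw [← Finset.sum_neg_distrib]
        exact Finset.sum_congr rfl fun k _ => by rw [hj.skew k l]; ring
      rw [h4, h3]
      split_ifs <;> simp
    rw [this]
    split_ifs <;> simp
  rw [Finset.sum_congr rfl fun m _ => h2 m]
  simp

lemma sum_gamma_mul_self : ∑ k : VecIdx d, gamma k * gamma k = (-2 * (d : ℂ)) • (1 : SpinorMatrix d) := by
  simp only [gamma_mul_self, Finset.sum_const, Finset.card_univ, Fintype.card_prod, Fintype.card_fin]
  rw [← Nat.cast_smul_eq_nsmul ℂ, smul_neg, ← neg_smul]
  congr 1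
  push_cast
  ring

lemma sum_raising_mul_lowering (hj : IsComplexStructure j) :
    ∑ k, raising j k * lowering j k = Complex.I • kaehlerOp j - (d : ℂ) • (1 : SpinorMatrix d) := by
  have h : ∀ k, raising j k * lowering j k = (1 / 4 : ℂ) • (gamma k * gamma k +
      gammaJ j k * gammaJ j k + Complex.I • (gamma k * gammaJ j k) -
        Complex.I • (gammaJ j k * gamma k)) := by
    intro k
    rw [raising, lowering, smul_mul_smul_comm, sub_mul, mul_add, mul_add, smul_mul_smul_comm,
      Complex.I_mul_I, mul_smul_comm, smul_mul_assoc]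
    norm_num
    module
  simp only [h, ← Finset.smul_sum, Finset.sum_add_distrib, Finset.sum_sub_distrib,
    sum_gammaJ_mul_gammaJ hj, sum_gamma_mul_gammaJ j, sum_gammaJ_mul_gamma hj, sum_gamma_mul_self]
  module

lemma sum_lowering_mul_raising (hj : IsComplexStructure j) :
    ∑ k, lowering j k * raising j k = -(Complex.I • kaehlerOp j) - (d : ℂ) • (1 : SpinorMatrix d) := by
  have h : ∀ k, lowering j k * raising j k = (1 / 4 : ℂ) • (gamma k * gamma k +
      gammaJ j k * gammaJ j k - Complex.I • (gamma k * gammaJ j k) +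
        Complex.I • (gammaJ j k * gamma k)) := by
    intro k
    rw [raising, lowering, smul_mul_smul_comm, add_mul, mul_sub, mul_sub, smul_mul_smul_comm,
      Complex.I_mul_I, mul_smul_comm, smul_mul_assoc]
    norm_num
    module
  simp only [h, ← Finset.smul_sum, Finset.sum_add_distrib, Finset.sum_sub_distrib,
    sum_gammaJ_mul_gammaJ hj, sum_gamma_mul_gammaJ j, sum_gammaJ_mul_gamma hj, sum_gamma_mul_self]
  module

lemma sum_raising_mul_raising (hj : IsComplexStructure j) : ∑ k, raising j k * raising j k = 0 := by
  have h : ∀ k, raising j k * raising j k = (1 / 4 : ℂ) • (gamma k * gamma k -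
      gammaJ j k * gammaJ j k - Complex.I • (gamma k * gammaJ j k) -
        Complex.I • (gammaJ j k * gamma k)) := by
    intro k
    rw [raising, smul_mul_smul_comm, sub_mul, mul_sub, mul_sub, smul_mul_smul_comm,
      Complex.I_mul_I, mul_smul_comm, smul_mul_assoc]
    norm_num
    module
  simp only [h, ← Finset.smul_sum, Finset.sum_sub_distrib,
    sum_gammaJ_mul_gammaJ hj, sum_gamma_mul_gammaJ j, sum_gammaJ_mul_gamma hj]
  module

lemma kaehlerOp_commutator_gamma (hj : IsComplexStructure j) (k : VecIdx d) :
    kaehlerOp j * gamma k - gamma k * kaehlerOp j = (2 : ℂ) • gammaJ j k := by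
  rw [kaehlerOp, smul_mul_assoc, mul_smul_comm, ← smul_sub, bivector_commutator_gamma hj.skew,
    smul_smul]
  norm_num [gammaJ]

lemma kaehlerOp_commutator_gammaJ (hj : IsComplexStructure j) (k : VecIdx d) :
    kaehlerOp j * gammaJ j k - gammaJ j k * kaehlerOp j = -((2 : ℂ) • gamma k) := by
  have h : kaehlerOp j * gammaJ j k - gammaJ j k * kaehlerOp j =
      ∑ l, ((j k l : ℝ) : ℂ) • (kaehlerOp j * gamma l - gamma l * kaehlerOp j) := by
    rw [show gammaJ j k = ∑ l, ((j k l : ℝ) : ℂ) • gamma l from rfl, Finset.mul_sum,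
      Finset.sum_mul, ← Finset.sum_sub_distrib]
    exact Finset.sum_congr rfl fun l _ => by rw [mul_smul_comm, smul_mul_assoc, smul_sub]
  rw [h]
  simp only [kaehlerOp_commutator_gamma hj, gammaJ, Finset.smul_sum, smul_smul]
  rw [Finset.sum_comm, ← neg_smul]
  have h2 : ∀ m, ∑ l, (((j k l : ℝ) : ℂ) * (2 * ((j l m : ℝ) : ℂ))) • (gamma m : SpinorMatrix d) =
      if k = m then (-2 : ℂ) • gamma m else 0 := by
    intro m
    rw [← Finset.sum_smul]
    have h3 : ∑ l, ((j k l : ℝ) : ℂ) * (2 * ((j l m : ℝ) : ℂ)) =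
        2 * ((∑ l, j k l * j l m : ℝ) : ℂ) := by
      push_cast
      rw [Finset.mul_sum]
      exact Finset.sum_congr rfl fun l _ => by ring
    rw [h3, hj.sq]
    split_ifs <;> simp
  simp [h2]

lemma kaehlerOp_mul_raising (hj : IsComplexStructure j) (k : VecIdx d) :
    kaehlerOp j * raising j k = raising j k * kaehlerOp j + (2 * Complex.I) • raising j k := by
  have h1 := kaehlerOp_commutator_gamma hj k
  have h2 := kaehlerOp_commutator_gammaJ hj k
  rw [← sub_eq_iff_eq_add', raising, mul_smul_comm, smul_mul_assoc, mul_sub, sub_mul, mul_smul_comm,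
    smul_mul_assoc]
  rw [show (1 / 2 : ℂ) • (kaehlerOp j * gamma k - Complex.I • (kaehlerOp j * gammaJ j k)) -
    (1 / 2 : ℂ) • (gamma k * kaehlerOp j - Complex.I • (gammaJ j k * kaehlerOp j)) =
    (1 / 2 : ℂ) • ((kaehlerOp j * gamma k - gamma k * kaehlerOp j) -
      Complex.I • (kaehlerOp j * gammaJ j k - gammaJ j k * kaehlerOp j)) by module, h1, h2]
  simp only [smul_sub, smul_smul, smul_neg]
  rw [show 2 * Complex.I * (1 / 2 * Complex.I) = -1 by linear_combination Complex.I_mul_I]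
  module

lemma kaehlerOp_mul_lowering (hj : IsComplexStructure j) (k : VecIdx d) :
    kaehlerOp j * lowering j k = lowering j k * kaehlerOp j - (2 * Complex.I) • lowering j k := by
  have h1 := kaehlerOp_commutator_gamma hj k
  have h2 := kaehlerOp_commutator_gammaJ hj k
  rw [sub_eq_add_neg, ← sub_eq_iff_eq_add', lowering, mul_smul_comm, smul_mul_assoc, mul_add,
    add_mul, mul_smul_comm, smul_mul_assoc]
  rw [show (1 / 2 : ℂ) • (kaehlerOp j * gamma k + Complex.I • (kaehlerOp j * gammaJ j k)) -
    (1 / 2 : ℂ) • (gamma k * kaehlerOp j + Complex.I • (gammaJ j k * kaehlerOp j)) =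
    (1 / 2 : ℂ) • ((kaehlerOp j * gamma k - gamma k * kaehlerOp j) +
      Complex.I • (kaehlerOp j * gammaJ j k - gammaJ j k * kaehlerOp j)) by module, h1, h2]
  simp only [smul_add, smul_smul, smul_neg]
  rw [show 2 * Complex.I * (1 / 2 * Complex.I) = -1 by linear_combination Complex.I_mul_I]
  module

lemma conjTranspose_kaehlerOp (hj : IsComplexStructure j) : (kaehlerOp j).conjTranspose = -kaehlerOp j := by
  rw [kaehlerOp, Matrix.conjTranspose_smul, conjTranspose_bivector hj.skew]
  simp

end KaehlerForm

/-! ### The decomposition of spinors by degree -/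

section Degree

open Polynomial

variable {d : ℕ} {j : VecIdx d → VecIdx d → ℝ}

/-- `w` belongs to the eigenspace `Σ_μ ⊗ W` of the Kähler form, for the eigenvalue `i (2 μ - d)`. -/
def HasDegree {W : Type*} [AddCommGroup W] [Module ℂ W] (j : VecIdx d → VecIdx d → ℝ) (μ : ℂ)
    (w : SpinorIdx d → W) : Prop :=
  act (kaehlerOp j) w = (Complex.I * (2 * μ - (d : ℂ))) • w

/-- The degree operator: it is `r` on the eigenspace of the Kähler form for `i (2 r - d)`. -/
def degreeOp (j : VecIdx d → VecIdx d → ℝ) : SpinorMatrix d :=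
  (1 / 2 : ℂ) • ((d : ℂ) • (1 : SpinorMatrix d) - Complex.I • kaehlerOp j)

lemma kaehlerOp_eq_degreeOp (j : VecIdx d → VecIdx d → ℝ) :
    kaehlerOp j = Complex.I • ((2 : ℂ) • degreeOp j - (d : ℂ) • (1 : SpinorMatrix d)) := by
  have hI := Complex.I_mul_I
  rw [degreeOp, smul_smul, show (2 : ℂ) * (1 / 2) = 1 by norm_num, one_smul, sub_sub_cancel_left,
    smul_neg, smul_smul, hI, neg_smul, one_smul, neg_neg]

lemma conjTranspose_degreeOp (hj : IsComplexStructure j) :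
    (degreeOp j).conjTranspose = degreeOp j := by
  rw [degreeOp, Matrix.conjTranspose_smul, Matrix.conjTranspose_sub, Matrix.conjTranspose_smul,
    Matrix.conjTranspose_smul, conjTranspose_kaehlerOp hj]
  simp

section Module

variable {W : Type*} [AddCommGroup W] [Module ℂ W]

lemma hasDegree_iff (j : VecIdx d → VecIdx d → ℝ) (μ : ℂ) (w : SpinorIdx d → W) :
    HasDegree j μ w ↔ act (degreeOp j) w = μ • w := by
  have hI := Complex.I_mul_I
  rw [HasDegree, kaehlerOp_eq_degreeOp, smul_act, sub_act, smul_act, smul_act, act_one]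
  constructor
  · intro h
    have h2 := congrArg (fun u => (-(1 / 2) * Complex.I) • u) h
    simp only [smul_smul] at h2
    rw [show -(1 / 2) * Complex.I * Complex.I = (1 / 2 : ℂ) by linear_combination (-(1 / 2) : ℂ) * hI,
      show -(1 / 2) * Complex.I * (Complex.I * (2 * μ - d)) = μ - d / 2 by
        linear_combination (-(1 / 2) : ℂ) * (2 * μ - d) * hI] at h2
    rw [smul_sub, smul_smul, smul_smul, sub_smul] at h2
    norm_num at h2
    have h3 : act (degreeOp j) w = (μ • w - ((d : ℂ) / 2) • w) + ((1 / 2 : ℂ) * (d : ℂ)) • w := by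
      rw [← h2]; norm_num
    rw [h3]
    module
  · intro h
    rw [h]
    module

lemma HasDegree.act_raising (hj : IsComplexStructure j) {μ : ℂ} {w : SpinorIdx d → W}
    (h : HasDegree j μ w) (k : VecIdx d) : HasDegree j (μ + 1) (act (raising j k) w) := by
  rw [HasDegree, ← act_mul, kaehlerOp_mul_raising hj, add_act, act_mul, h, smul_act, act_smul]
  module

lemma HasDegree.act_lowering (hj : IsComplexStructure j) {μ : ℂ} {w : SpinorIdx d → W}
    (h : HasDegree j μ w) (k : VecIdx d) : HasDegree j (μ - 1) (act (lowering j k) w) := by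
  rw [HasDegree, ← act_mul, kaehlerOp_mul_lowering hj, sub_act, act_mul, h, smul_act, act_smul]
  module

lemma HasDegree.smul {μ : ℂ} {v : SpinorIdx d → W} (hv : HasDegree j μ v) (c : ℂ) :
    HasDegree j μ (c • v) := by
  rw [HasDegree, act_smul, hv, smul_comm]

lemma HasDegree.sum {κ : Type*} {μ : ℂ} {v : κ → SpinorIdx d → W} (t : Finset κ)
    (hv : ∀ k, HasDegree j μ (v k)) : HasDegree j μ (∑ k ∈ t, v k) := by
  rw [HasDegree, act_sum, Finset.smul_sum]
  exact Finset.sum_congr rfl fun k _ => hv k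

end Module

section Inner

variable {W : Type*} [NormedAddCommGroup W] [InnerProductSpace ℂ W]

lemma HasDegree.sum_lowering (hj : IsComplexStructure j) {μ : ℂ} {w : SpinorIdx d → W}
    (h : HasDegree j μ w) :
    ∑ k, ip (act (lowering j k) w) (act (lowering j k) w) = 2 * μ * ip w w := by
  simp only [ip_act_left, conjTranspose_lowering, ← act_mul, neg_mul, neg_act, ip_neg_right]
  rw [Finset.sum_neg_distrib, ← ip_sum_right, ← sum_act, sum_raising_mul_lowering hj, sub_act,
    smul_act, smul_act, act_one, h, smul_smul, ip_sub_right, ip_smul_right, ip_smul_right]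
  linear_combination (-(2 * μ - d) * ip w w) * Complex.I_mul_I

lemma HasDegree.sum_raising (hj : IsComplexStructure j) {μ : ℂ} {w : SpinorIdx d → W}
    (h : HasDegree j μ w) :
    ∑ k, ip (act (raising j k) w) (act (raising j k) w) = 2 * (d - μ) * ip w w := by
  simp only [ip_act_left, conjTranspose_raising, ← act_mul, neg_mul, neg_act, ip_neg_right]
  rw [Finset.sum_neg_distrib, ← ip_sum_right, ← sum_act, sum_lowering_mul_raising hj, sub_act,
    neg_act, smul_act, smul_act, act_one, h, smul_smul, ip_sub_right, ip_neg_right, ip_smul_right,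
    ip_smul_right]
  linear_combination ((2 * μ - d) * ip w w) * Complex.I_mul_I

lemma re_ip_self_pos {w : SpinorIdx d → W} (hw : w ≠ 0) : 0 < (ip w w).re :=
  lt_of_le_of_ne (re_ip_self_nonneg w) fun h => hw (eq_zero_of_re_ip_self w h.symm)

lemma re_real_mul_ip_self (μ : ℝ) (w : SpinorIdx d → W) : (2 * (μ : ℂ) * ip w w).re = 2 * μ * (ip w w).re := by
  rw [ip_self]
  norm_cast

lemma HasDegree.nonneg_of_real (hj : IsComplexStructure j) {μ : ℝ} {w : SpinorIdx d → W}
    (h : HasDegree j μ w) (hw : w ≠ 0) : 0 ≤ μ := by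
  have h1 := congrArg Complex.re (h.sum_lowering hj)
  rw [re_real_mul_ip_self, Complex.re_sum] at h1
  have h2 : 0 ≤ ∑ k, (ip (act (lowering j k) w) (act (lowering j k) w)).re :=
    Finset.sum_nonneg fun k _ => re_ip_self_nonneg _
  have := re_ip_self_pos hw
  nlinarith

lemma HasDegree.exists_nat (hj : IsComplexStructure j) (n : ℕ) :
    ∀ {μ : ℝ} {w : SpinorIdx d → W}, HasDegree j μ w → w ≠ 0 → μ < n → ∃ r : ℕ, μ = r := by
  induction n with
  | zero =>
    intro μ w h hw hn
    have := h.nonneg_of_real hj hw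
    simp at hn
    linarith
  | succ n ih =>
    intro μ w h hw hn
    by_cases hz : ∀ k, act (lowering j k) w = 0
    · have h1 := congrArg Complex.re (h.sum_lowering hj)
      rw [re_real_mul_ip_self] at h1
      simp only [hz, ip_zero_left, Finset.sum_const_zero, Complex.zero_re] at h1
      refine ⟨0, ?_⟩
      have := re_ip_self_pos hw
      simp only [Nat.cast_zero]
      nlinarith
    · push Not at hz
      obtain ⟨k, hk⟩ := hz
      have h1 := h.act_lowering hj k
      have h2 : HasDegree j ((μ - 1 : ℝ) : ℂ) (act (lowering j k) w) := by
        push_cast; exact h1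
      obtain ⟨r, hr⟩ := ih h2 hk (by push_cast at hn; linarith)
      exact ⟨r + 1, by push_cast; linarith⟩

/-- The eigenvalues of the Kähler form are the numbers `i (2 r - d)` with `0 ≤ r ≤ d`. -/
lemma HasDegree.exists_nat_le (hj : IsComplexStructure j) {μ : ℝ} {w : SpinorIdx d → W}
    (h : HasDegree j μ w) (hw : w ≠ 0) : ∃ r : ℕ, r ≤ d ∧ μ = r := by
  obtain ⟨n, hn⟩ := exists_nat_gt μ
  obtain ⟨r, hr⟩ := HasDegree.exists_nat hj n h hw hn
  refine ⟨r, ?_, hr⟩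
  have h1 := congrArg Complex.re (h.sum_raising hj)
  rw [show (2 : ℂ) * (d - μ) = 2 * ((d - μ : ℝ) : ℂ) by push_cast; ring, re_real_mul_ip_self,
    Complex.re_sum] at h1
  have h2 : 0 ≤ ∑ k, (ip (act (raising j k) w) (act (raising j k) w)).re :=
    Finset.sum_nonneg fun k _ => re_ip_self_nonneg _
  have := re_ip_self_pos hw
  have h3 : 0 ≤ (d : ℝ) - μ := by nlinarith
  rw [hr] at h3
  exact_mod_cast sub_nonneg.1 h3

lemma HasDegree.ip_eq_zero (hj : IsComplexStructure j) {r s : ℕ} (hrs : r ≠ s)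
    {v w : SpinorIdx d → W} (hv : HasDegree j r v) (hw : HasDegree j s w) : ip v w = 0 := by
  rw [hasDegree_iff] at hv hw
  have h1 : ip (act (degreeOp j) v) w = ip v (act (degreeOp j) w) := by
    rw [ip_act_left, conjTranspose_degreeOp hj]
  rw [hv, hw, ip_smul_left, ip_smul_right] at h1
  have h2 : ((r : ℂ) - s) * ip v w = 0 := by
    simp at h1 ⊢
    rcases h1 with h1 | h1
    · exact Or.inl (by rw [h1]; ring)
    · exact Or.inr h1
  refine (mul_eq_zero.1 h2).resolve_left fun h3 => hrs ?_
  exact_mod_cast sub_eq_zero.1 h3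

end Inner

lemma aeval_act_of_eigen {W : Type*} [AddCommGroup W] [Module ℂ W] (A : SpinorMatrix d) (f : ℂ[X])
    {c : ℂ} {w : SpinorIdx d → W} (h : act A w = c • w) : act (aeval A f) w = (f.eval c) • w := by
  induction f using Polynomial.induction_on' with
  | add p q hp hq => rw [map_add, add_act, hp, hq, eval_add, add_smul]
  | monomial n a =>
    rw [aeval_monomial, eval_monomial, Algebra.algebraMap_eq_smul_one, smul_mul_assoc, one_mul,
      smul_act, mul_smul]
    congr 1
    induction n with
    | zero => simp [act_one]
    | succ n ih => rw [pow_succ, act_mul, h, act_smul, ih, smul_smul, pow_succ, mul_comm]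

lemma aeval_nodal_degreeOp (hj : IsComplexStructure j) :
    aeval (degreeOp j) (Lagrange.nodal (Finset.range (d + 1)) fun n : ℕ => (n : ℂ)) = 0 := by
  have hN : (degreeOp j).IsHermitian := conjTranspose_degreeOp hj
  set M := aeval (degreeOp j) (Lagrange.nodal (Finset.range (d + 1)) fun n : ℕ => (n : ℂ)) with hM
  have key : ∀ i, M.mulVec (hN.eigenvectorBasis i).ofLp = 0 := by
    intro i
    have h1 := hN.mulVec_eigenvectorBasis i
    set v : SpinorIdx d → ℂ := (hN.eigenvectorBasis i).ofLp with hv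
    have hv0 : v ≠ 0 := by
      intro h0
      have : hN.eigenvectorBasis i = 0 := by
        apply (WithLp.ofLp_injective 2)
        exact h0
      exact hN.eigenvectorBasis.orthonormal.ne_zero i this
    have hact : act (degreeOp j) v = ((hN.eigenvalues i : ℝ) : ℂ) • v := h1
    obtain ⟨r, hr, hr'⟩ := ((hasDegree_iff j _ v).2 hact).exists_nat_le hj hv0
    have h2 : act M v = 0 := by
      rw [hM, aeval_act_of_eigen _ _ hact, Lagrange.eval_nodal, hr',
        Finset.prod_eq_zero (Finset.mem_range.2 (Nat.lt_succ_of_le hr)) (by simp), zero_smul]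
    exact h2
  have h2 : Matrix.toEuclideanLin M = 0 := by
    apply hN.eigenvectorBasis.toBasis.ext
    intro i
    rw [OrthonormalBasis.coe_toBasis, LinearMap.zero_apply]
    apply (WithLp.ofLp_injective 2)
    exact key i
  exact (LinearEquiv.map_eq_zero_iff _).1 h2

/-- The polynomial which is `1` at `r` and `0` at the other degrees. -/
def degreePoly (d r : ℕ) : ℂ[X] :=
  if r ≤ d then Lagrange.basis (Finset.range (d + 1)) (fun n : ℕ => (n : ℂ)) r else 0

/-- The projection of the spinors to the eigenspace `Σ_r`, which is `0` for `r > d`. -/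
def degreeProj (j : VecIdx d → VecIdx d → ℝ) (r : ℕ) : SpinorMatrix d :=
  aeval (degreeOp j) (degreePoly d r)

lemma degreeProj_of_lt {r : ℕ} (hr : d < r) : degreeProj j r = 0 := by
  simp [degreeProj, degreePoly, not_le.2 hr]

lemma sum_degreeProj (j : VecIdx d → VecIdx d → ℝ) :
    ∑ r ∈ Finset.range (d + 1), degreeProj j r = 1 := by
  have h : ∑ r ∈ Finset.range (d + 1), degreePoly d r = 1 := by
    rw [← Lagrange.sum_basis (s := Finset.range (d + 1)) (v := fun n : ℕ => (n : ℂ))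
      (fun a _ b _ h => Nat.cast_injective h) ⟨0, by simp⟩]
    refine Finset.sum_congr rfl fun r hr => ?_
    rw [degreePoly, if_pos (Nat.lt_succ_iff.1 (Finset.mem_range.1 hr))]
  simp only [degreeProj, ← map_sum, h, map_one]

lemma degreeOp_mul_degreeProj (hj : IsComplexStructure j) (r : ℕ) :
    degreeOp j * degreeProj j r = (r : ℂ) • degreeProj j r := by
  by_cases hr : r ≤ d
  swap
  · rw [degreeProj_of_lt (not_le.1 hr)]; simp
  have hmem : r ∈ Finset.range (d + 1) := Finset.mem_range.2 (Nat.lt_succ_of_le hr)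
  have h1 : (X - C (r : ℂ)) * degreePoly d r =
      C (Lagrange.nodalWeight (Finset.range (d + 1)) (fun n : ℕ => (n : ℂ)) r) *
        Lagrange.nodal (Finset.range (d + 1)) (fun n : ℕ => (n : ℂ)) := by
    rw [degreePoly, if_pos hr, Lagrange.basis_eq_prod_sub_inv_mul_nodal_div hmem, ← mul_assoc,
      mul_comm (X - C _), mul_assoc, EuclideanDomain.mul_div_cancel']
    · exact X_sub_C_ne_zero _
    · exact Lagrange.X_sub_C_dvd_nodal _ hmem
  have h2 := congrArg (aeval (degreeOp j)) h1
  rw [map_mul, map_mul, aeval_nodal_degreeOp hj, mul_zero, map_sub, aeval_X, aeval_C, sub_mul,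
    Algebra.algebraMap_eq_smul_one, smul_mul_assoc, one_mul, sub_eq_zero] at h2
  exact h2

lemma degreeProj_commute (j : VecIdx d → VecIdx d → ℝ) (r : ℕ) :
    degreeProj j r * degreeOp j = degreeOp j * degreeProj j r := by
  have : (aeval (degreeOp j) (degreePoly d r * X)) = aeval (degreeOp j) (X * degreePoly d r) := by
    rw [mul_comm]
  simpa [map_mul, degreeProj] using this

section Proj

variable {W : Type*} [AddCommGroup W] [Module ℂ W]

lemma hasDegree_degreeProj (hj : IsComplexStructure j) (r : ℕ) (w : SpinorIdx d → W) :
    HasDegree j r (act (degreeProj j r) w) := by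
  rw [hasDegree_iff, ← act_mul, degreeOp_mul_degreeProj hj, smul_act]

lemma sum_act_degreeProj (j : VecIdx d → VecIdx d → ℝ) (w : SpinorIdx d → W) :
    ∑ r ∈ Finset.range (d + 1), act (degreeProj j r) w = w := by
  rw [← sum_act, sum_degreeProj, act_one]

lemma HasDegree.degreeProj_of_ne (hj : IsComplexStructure j) {r : ℕ} {μ : ℂ} (hrs : (r : ℂ) ≠ μ)
    {w : SpinorIdx d → W} (hw : HasDegree j μ w) : act (degreeProj j r) w = 0 := by
  have h1 : act (degreeProj j r * degreeOp j) w = act (degreeOp j * degreeProj j r) w := by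
    rw [degreeProj_commute]
  rw [degreeOp_mul_degreeProj hj, act_mul, (hasDegree_iff _ _ _).1 hw, act_smul, smul_act] at h1
  have h2 : ((r : ℂ) - μ) • act (degreeProj j r) w = 0 := by rw [sub_smul, h1, sub_self]
  exact (smul_eq_zero.1 h2).resolve_left (sub_ne_zero.2 hrs)

lemma HasDegree.eq_zero (hj : IsComplexStructure j) {μ : ℂ} (hμ : ∀ r : ℕ, r ≤ d → (r : ℂ) ≠ μ)
    {w : SpinorIdx d → W} (hw : HasDegree j μ w) : w = 0 := by
  rw [← sum_act_degreeProj j w]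
  exact Finset.sum_eq_zero fun r hr => hw.degreeProj_of_ne hj
    (hμ r (Nat.lt_succ_iff.1 (Finset.mem_range.1 hr)))

lemma HasDegree.eq_zero_of_lt (hj : IsComplexStructure j) {r : ℕ} (hr : d < r)
    {w : SpinorIdx d → W} (hw : HasDegree j r w) : w = 0 :=
  hw.eq_zero hj fun s hs h => by
    have : s = r := by exact_mod_cast h
    omega

lemma HasDegree.degreeProj_self (hj : IsComplexStructure j) {r : ℕ} {w : SpinorIdx d → W}
    (hw : HasDegree j r w) : act (degreeProj j r) w = w := by
  by_cases hr : r ≤ d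
  · conv_rhs => rw [← sum_act_degreeProj j w]
    rw [Finset.sum_eq_single r]
    · intro s _ hs
      exact hw.degreeProj_of_ne hj (by exact_mod_cast hs)
    · intro h
      exact absurd (Finset.mem_range.2 (Nat.lt_succ_of_le hr)) h
  · rw [hw.eq_zero_of_lt hj (not_le.1 hr), act_zero]

end Proj

end Degree

/-! ### The Kähler twistor inequality -/

section Twistor

variable {d : ℕ} {j : VecIdx d → VecIdx d → ℝ}

section Module

variable {W : Type*} [AddCommGroup W] [Module ℂ W]

/-- The symbol `∑ e_k · v_k` of the Dirac operator. -/
def diracSymbol (v : VecIdx d → SpinorIdx d → W) : SpinorIdx d → W := ∑ k, act (gamma k) (v k)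

/-- The part of the symbol of the Dirac operator that raises the degree. -/
def diracUp (j : VecIdx d → VecIdx d → ℝ) (v : VecIdx d → SpinorIdx d → W) : SpinorIdx d → W :=
  ∑ k, act (raising j k) (v k)

/-- The part of the symbol of the Dirac operator that lowers the degree. -/
def diracDown (j : VecIdx d → VecIdx d → ℝ) (v : VecIdx d → SpinorIdx d → W) : SpinorIdx d → W :=
  ∑ k, act (lowering j k) (v k)

lemma diracUp_add_diracDown (j : VecIdx d → VecIdx d → ℝ) (v : VecIdx d → SpinorIdx d → W) :
    diracUp j v + diracDown j v = diracSymbol v := by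
  rw [diracUp, diracDown, diracSymbol, ← Finset.sum_add_distrib]
  exact Finset.sum_congr rfl fun k _ => by rw [← add_act, raising_add_lowering]

variable {v : VecIdx d → SpinorIdx d → W}

lemma hasDegree_diracUp (hj : IsComplexStructure j) {μ : ℂ} (hv : ∀ k, HasDegree j μ (v k)) :
    HasDegree j (μ + 1) (diracUp j v) :=
  HasDegree.sum _ fun k => (hv k).act_raising hj k

lemma hasDegree_diracDown (hj : IsComplexStructure j) {μ : ℂ} (hv : ∀ k, HasDegree j μ (v k)) :
    HasDegree j (μ - 1) (diracDown j v) :=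
  HasDegree.sum _ fun k => (hv k).act_lowering hj k

lemma degreeProj_succ_diracSymbol (hj : IsComplexStructure j) {r : ℕ}
    (hv : ∀ k, HasDegree j r (v k)) :
    act (degreeProj j (r + 1)) (diracSymbol v) = diracUp j v := by
  have h1 : HasDegree j ((r + 1 : ℕ) : ℂ) (diracUp j v) := by
    push_cast; exact hasDegree_diracUp hj hv
  rw [← diracUp_add_diracDown j, act_add, h1.degreeProj_self hj,
    (hasDegree_diracDown hj hv).degreeProj_of_ne hj, add_zero]
  push_cast
  intro h
  have : (2 : ℂ) = 0 := by linear_combination h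
  norm_num at this

lemma degreeProj_diracSymbol_succ (hj : IsComplexStructure j) {r : ℕ}
    (hv : ∀ k, HasDegree j (r + 1 : ℕ) (v k)) :
    act (degreeProj j r) (diracSymbol v) = diracDown j v := by
  have h1 : HasDegree j (r : ℂ) (diracDown j v) := by
    have := hasDegree_diracDown hj hv
    push_cast at this
    rwa [add_sub_cancel_right] at this
  rw [← diracUp_add_diracDown j, act_add, h1.degreeProj_self hj,
    (hasDegree_diracUp hj hv).degreeProj_of_ne hj, zero_add]
  push_cast
  intro h
  have : (2 : ℂ) = 0 := by linear_combination -h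
  norm_num at this

lemma diracDown_of_zero (hj : IsComplexStructure j) (hv : ∀ k, HasDegree j (0 : ℕ) (v k)) :
    diracDown j v = 0 := by
  refine (hasDegree_diracDown hj hv).eq_zero hj fun r _ h => ?_
  have h2 : ((r + 1 : ℕ) : ℂ) = 0 := by push_cast; rw [h]; simp
  have h3 : r + 1 = 0 := by exact_mod_cast h2
  omega

lemma degreeProj_diracSymbol_of_ne (hj : IsComplexStructure j) {r s : ℕ}
    (hv : ∀ k, HasDegree j r (v k)) (h1 : s ≠ r + 1) (h2 : s + 1 ≠ r) :
    act (degreeProj j s) (diracSymbol v) = 0 := by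
  rw [← diracUp_add_diracDown j, act_add, (hasDegree_diracUp hj hv).degreeProj_of_ne hj,
    (hasDegree_diracDown hj hv).degreeProj_of_ne hj, zero_add]
  · intro h
    apply h2
    have : ((s + 1 : ℕ) : ℂ) = r := by push_cast; rw [h]; ring
    exact_mod_cast this
  · exact_mod_cast h1

end Module

variable {W : Type*} [NormedAddCommGroup W] [InnerProductSpace ℂ W]
  {v : VecIdx d → SpinorIdx d → W}

/-- The Kähler twistor inequality: if all `v_k` have degree `r`, then `∑ |v_k|²` is bounded below by
the sizes of the two components of `∑ e_k · v_k`. It is the positivity of the norm of the component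
of `v` in the kernel of both parts of the Dirac symbol. -/
lemma twistor_inequality (hj : IsComplexStructure j) {r : ℕ} (hr : r ≤ d)
    (hv : ∀ k, HasDegree j r (v k)) :
    (ip (diracUp j v) (diracUp j v)).re / (2 * (r + 1)) +
      (ip (diracDown j v) (diracDown j v)).re / (2 * (d - r + 1)) ≤ ∑ k, (ip (v k) (v k)).re := by
  set U := diracUp j v with hU
  set L := diracDown j v with hL
  have hrd : (r : ℝ) ≤ d := by exact_mod_cast hr
  have ha0 : (0 : ℝ) < 2 * (r + 1) := by positivity
  have hb0 : (0 : ℝ) < 2 * (d - r + 1) := by linarith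
  -- the weights make `v_k + a p_k U + b q_k L`, with `p_k` and `q_k` the lowering and raising parts of
  -- `e_k`, the component of `v` on which both parts of the symbol vanish; its norm is expanded below
  set a : ℝ := 1 / (2 * (r + 1)) with ha
  set b : ℝ := 1 / (2 * (d - r + 1)) with hb
  have h1 : ∑ k, ip (v k) (act (lowering j k) U) = -ip U U := by
    have e : ip U U = ∑ k, ip (act (raising j k) (v k)) U := by
      rw [← ip_sum_left]; rfl
    rw [e, ← Finset.sum_neg_distrib]
    exact Finset.sum_congr rfl fun k _ => by
      rw [ip_act_left, conjTranspose_raising, neg_act, ip_neg_right, neg_neg]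
  have h2 : ∑ k, ip (v k) (act (raising j k) L) = -ip L L := by
    have e : ip L L = ∑ k, ip (act (lowering j k) (v k)) L := by
      rw [← ip_sum_left]; rfl
    rw [e, ← Finset.sum_neg_distrib]
    exact Finset.sum_congr rfl fun k _ => by
      rw [ip_act_left, conjTranspose_lowering, neg_act, ip_neg_right, neg_neg]
  -- `∑ |p_k U|²` and `∑ |q_k L|²` are multiples of `|U|²` and `|L|²` by the Kähler form
  have h3 := (hasDegree_diracUp hj hv).sum_lowering hj
  have h4 := (hasDegree_diracDown hj hv).sum_raising hj
  rw [← hU] at h3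
  rw [← hL] at h4
  have h5 : ∑ k, ip (act (lowering j k) U) (act (raising j k) L) = 0 := by
    simp only [ip_act_left, conjTranspose_lowering, ← act_mul, neg_mul, neg_act, ip_neg_right]
    rw [Finset.sum_neg_distrib, ← ip_sum_right, ← sum_act, sum_raising_mul_raising hj, zero_act,
      ip_zero_right, neg_zero]
  have hexp : ∀ k, (ip (v k + ((a : ℂ) • act (lowering j k) U + (b : ℂ) • act (raising j k) L))
      (v k + ((a : ℂ) • act (lowering j k) U + (b : ℂ) • act (raising j k) L))).re =
      (ip (v k) (v k)).re + 2 * a * (ip (v k) (act (lowering j k) U)).re +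
      2 * b * (ip (v k) (act (raising j k) L)).re +
      a ^ 2 * (ip (act (lowering j k) U) (act (lowering j k) U)).re +
      b ^ 2 * (ip (act (raising j k) L) (act (raising j k) L)).re +
      2 * a * b * (ip (act (lowering j k) U) (act (raising j k) L)).re := by
    intro k
    simp only [ip_add_left, ip_add_right, ip_smul_left, ip_smul_right, Complex.star_def,
      Complex.conj_ofReal, Complex.re_ofReal_mul, Complex.add_re]
    rw [re_ip_comm (act (lowering j k) U) (v k), re_ip_comm (act (raising j k) L) (v k),
      re_ip_comm (act (raising j k) L) (act (lowering j k) U)]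
    ring
  have hpos : 0 ≤ ∑ k, (ip (v k + ((a : ℂ) • act (lowering j k) U + (b : ℂ) • act (raising j k) L))
      (v k + ((a : ℂ) • act (lowering j k) U + (b : ℂ) • act (raising j k) L))).re :=
    Finset.sum_nonneg fun k _ => re_ip_self_nonneg _
  simp only [hexp, Finset.sum_add_distrib, ← Finset.mul_sum, ← Complex.re_sum] at hpos
  rw [h1, h2, h3, h4, h5] at hpos
  have e3 : (2 * ((r : ℂ) + 1) * ip U U).re = 2 * (r + 1) * (ip U U).re := by
    rw [ip_self]; norm_cast
  have e4 : (2 * ((d : ℂ) - (r - 1)) * ip L L).re = 2 * (d - r + 1) * (ip L L).re := by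
    rw [ip_self, show (2 * ((d : ℂ) - (r - 1))) = ((2 * ((d : ℝ) - r + 1) : ℝ) : ℂ) by
      push_cast; ring, ← Complex.ofReal_mul, Complex.ofReal_re, Complex.ofReal_re]
  rw [e3, e4, Complex.neg_re, Complex.neg_re, Complex.zero_re] at hpos
  have ea : a * (2 * (r + 1)) = 1 := by rw [ha]; field_simp
  have eb : b * (2 * (d - r + 1)) = 1 := by rw [hb]; exact one_div_mul_cancel hb0.ne'
  rw [← Complex.re_sum]
  have : (ip U U).re / (2 * (r + 1)) = a * (ip U U).re := by rw [ha]; ring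
  rw [this]
  have : (ip L L).re / (2 * (d - r + 1)) = b * (ip L L).re := by rw [hb]; ring
  rw [this]
  have e6 : a ^ 2 * (2 * (r + 1) * (ip U U).re) = a * (ip U U).re := by
    linear_combination a * (ip U U).re * ea
  have e7 : b ^ 2 * (2 * (d - r + 1) * (ip L L).re) = b * (ip L L).re := by
    linear_combination b * (ip L L).re * eb
  rw [e6, e7] at hpos
  linarith

end Twistor

/-! ### The combinatorial part of the estimates -/

section Combinatorics

/-- A sequence of signs with prescribed products `z (k - 1) * z (k + 1)`. -/
lemma exists_signs (ε : ℕ → ℝ) (hε : ∀ k, ε k ^ 2 = 1) :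
    ∃ z : ℕ → ℝ, (∀ k, z k ^ 2 = 1) ∧ ∀ k, 1 ≤ k → z (k - 1) * z (k + 1) = ε k := by
  let f : ℕ → ℝ × ℝ := fun n => Nat.rec (1, 1) (fun k p => (p.2, ε (k + 1) * p.1)) n
  have hf : ∀ n, f (n + 1) = ((f n).2, ε (n + 1) * (f n).1) := fun n => rfl
  have h1 : ∀ n, (f n).1 ^ 2 = 1 ∧ (f n).2 ^ 2 = 1 := by
    intro n
    induction n with
    | zero => simp [f]
    | succ n ih => rw [hf]; exact ⟨ih.2, by rw [mul_pow, hε, ih.1, one_mul]⟩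
  refine ⟨fun n => (f n).1, fun k => (h1 k).1, fun k hk => ?_⟩
  obtain ⟨n, rfl⟩ := Nat.exists_eq_add_of_le hk
  have h2 : f (1 + n + 1) = (ε (n + 1) * (f n).1, ε (n + 2) * (f n).2) := by
    rw [show 1 + n + 1 = (n + 1) + 1 by ring, hf (n + 1), hf n]
  have h3 : (1 + n - 1) = n := by omega
  simp only [h2, h3]
  rw [show 1 + n = n + 1 by ring]
  linear_combination ε (n + 1) * (h1 n).1

/-- The numerical data of an eigenspinor `ψ` for the eigenvalue `λ` (with `L = λ²`) on a Kähler
manifold of complex dimension `d`. With `ψ_k` the component of degree `k`, and `A_k`, `B_k` the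
components of degree `k` of `D ψ_{k-1}` and `D ψ_{k+1}`, one has `p k = ‖A_k‖²`, `m k = ‖B_k‖²`,
`c k = Re ⟪A_k, B_k⟫` and `n k = ‖ψ_k‖²`. -/
structure SpectralData (d : ℕ) (L : ℝ) (p m c n : ℕ → ℝ) : Prop where
  p_nonneg : ∀ k, 0 ≤ p k
  m_nonneg : ∀ k, 0 ≤ m k
  n_nonneg : ∀ k, 0 ≤ n k
  p_zero : p 0 = 0
  c_zero : c 0 = 0
  m_top : m d = 0
  c_top : c d = 0
  balance : ∀ k, p (k + 1) + c (k + 1) = m k + c k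
  norm_eq : ∀ k, L * n k = p k + m k + 2 * c k
  n_pos : 0 < ∑ k ∈ Finset.range (d + 1), n k

/-- The right-hand side of the integrated Weitzenböck formula for `∑ z_k ψ_k`, after the twistor
inequality has been used in each degree. -/
def weitzenboeckBound (d : ℕ) (p m c z : ℕ → ℝ) : ℝ :=
  ∑ k ∈ Finset.range (d + 1), (z (k - 1) ^ 2 * p k * (1 - 1 / (2 * k)) +
    z (k + 1) ^ 2 * m k * (1 - 1 / (2 * (d - k))) + 2 * z (k - 1) * z (k + 1) * c k)

variable {d : ℕ} {L S : ℝ} {p m c n : ℕ → ℝ}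

lemma one_div_add_one_div_ge {a b : ℝ} (ha : 0 < a) (hb : 0 < b) :
    2 / (a + b) ≤ 1 / (2 * a) + 1 / (2 * b) := by
  rw [div_add_div _ _ (by positivity) (by positivity), div_le_div_iff₀ (by positivity)
    (by positivity)]
  nlinarith [sq_nonneg (a - b)]

lemma sum_range_shift (f g : ℕ → ℝ) (d : ℕ) (hf : f 0 = 0) (hg : g d = 0) :
    ∑ k ∈ Finset.range (d + 1), (f k + g k) = ∑ k ∈ Finset.range d, (f (k + 1) + g k) := by
  rw [Finset.sum_add_distrib, Finset.sum_range_succ' f, Finset.sum_range_succ g, hf, hg,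
    Finset.sum_add_distrib, add_zero, add_zero]

/-- The estimate in odd dimension: the signs of the test spinor `∑ ± ψ_k` are chosen against the
signs of the correlations `c k`. -/
lemma SpectralData.bound_odd (h : SpectralData d L p m c n) (hd : 1 ≤ d)
    (hW : ∀ z : ℕ → ℝ, S / 4 * ∑ k ∈ Finset.range (d + 1), z k ^ 2 * n k ≤
      weitzenboeckBound d p m c z) :
    (d + 1) / (4 * d) * S ≤ L := by
  have hd0 : (0 : ℝ) < d := by exact_mod_cast hd
  -- by the balance equation the total mass is `2 ∑ s k`, where `s (k + 1)` is `λ` times the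
  -- correlation of `ψ_k` and `D ψ_{k+1}`
  set s : ℕ → ℝ := fun k => p k + c k with hs
  have hs0 : s 0 = 0 := by simp [hs, h.p_zero, h.c_zero]
  have hs' : ∀ k, s (k + 1) = m k + c k := fun k => h.balance k
  obtain ⟨z, hz1, hz2⟩ := exists_signs (fun k => if c k ≤ 0 then 1 else -1)
    (fun k => by split_ifs <;> simp)
  have hWz := hW z
  simp only [hz1, one_mul] at hWz
  have hterm : ∀ k ∈ Finset.range (d + 1), (z (k - 1) ^ 2 * p k * (1 - 1 / (2 * k)) +
      z (k + 1) ^ 2 * m k * (1 - 1 / (2 * (d - k))) + 2 * z (k - 1) * z (k + 1) * c k) ≤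
      (s k - max (s k) 0 / (2 * k)) + (s (k + 1) - max (s (k + 1)) 0 / (2 * (d - k))) := by
    intro k hk
    have hkd : k ≤ d := Nat.lt_succ_iff.1 (Finset.mem_range.1 hk)
    rw [hz1, hz1, one_mul, one_mul]
    have hp := h.p_nonneg k
    have hm := h.m_nonneg k
    have e1 : s k = p k + c k := rfl
    have e2 := hs' k
    have hg1 : (0 : ℝ) ≤ 1 / (2 * k) := by positivity
    have hkd' : (k : ℝ) ≤ d := by exact_mod_cast hkd
    have hg2 : (0 : ℝ) ≤ 1 / (2 * ((d : ℝ) - k)) := by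
      apply div_nonneg zero_le_one; linarith
    have hg1' : 1 / (2 * (k : ℝ)) ≤ 1 := by
      rcases Nat.eq_zero_or_pos k with rfl | hk
      · simp
      · have : (1 : ℝ) ≤ k := by exact_mod_cast hk
        rw [div_le_one (by positivity)]; linarith
    have hg2' : 1 / (2 * ((d : ℝ) - k)) ≤ 1 := by
      rcases Nat.eq_or_lt_of_le hkd with rfl | hk
      · simp
      · have : (k : ℝ) + 1 ≤ d := by exact_mod_cast hk
        rw [div_le_one (by linarith)]; linarith
    rw [div_eq_mul_one_div (max (s k) 0), div_eq_mul_one_div (max (s (k + 1)) 0)]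
    set g1 := 1 / (2 * (k : ℝ))
    set g2 := 1 / (2 * ((d : ℝ) - k))
    have hcz : 2 * z (k - 1) * z (k + 1) * c k = 2 * (if c k ≤ 0 then 1 else -1) * c k := by
      rcases Nat.eq_zero_or_pos k with rfl | hk
      · rw [h.c_zero]; simp
      · rw [← hz2 k hk]; ring
    rw [hcz]
    -- for `c k ≤ 0` one has `s k ≤ p k` and `s (k + 1) ≤ m k`; for `c k > 0` the negative mixed term
    -- makes up for the multiples of `c k` that are added
    by_cases hc : c k ≤ 0
    · rw [if_pos hc]
      have m1 : max (s k) 0 ≤ p k := max_le (by linarith) hp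
      have m2 : max (s (k + 1)) 0 ≤ m k := max_le (by linarith) hm
      have := mul_le_mul_of_nonneg_right m1 hg1
      have := mul_le_mul_of_nonneg_right m2 hg2
      nlinarith
    · rw [if_neg hc]
      push Not at hc
      rw [max_eq_left (by linarith), max_eq_left (by linarith)]
      nlinarith [mul_le_mul_of_nonneg_left hg1' hc.le, mul_le_mul_of_nonneg_left hg2' hc.le]
  have hbound := Finset.sum_le_sum hterm
  have hsd : s (d + 1) = 0 := by rw [hs', h.m_top, h.c_top, add_zero]
  rw [sum_range_shift (fun k => s k - max (s k) 0 / (2 * (k : ℝ)))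
    (fun k => s (k + 1) - max (s (k + 1)) 0 / (2 * ((d : ℝ) - k))) d (by simp [hs0])
    (by simp [hsd])] at hbound
  -- the harmonic mean of `k + 1` and `d - k` is at most `(d + 1) / 2`
  have hterm2 : ∀ k ∈ Finset.range d, (s (k + 1) - max (s (k + 1)) 0 / (2 * ((k + 1 : ℕ) : ℝ))) +
      (s (k + 1) - max (s (k + 1)) 0 / (2 * ((d : ℝ) - k))) ≤ 2 * (d / (d + 1)) * s (k + 1) := by
    intro k hk
    have hk' : (k : ℝ) + 1 ≤ d := by exact_mod_cast Finset.mem_range.1 hk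
    have h1 := one_div_add_one_div_ge (a := (k : ℝ) + 1) (b := d - k) (by positivity) (by linarith)
    rw [show (k : ℝ) + 1 + (d - k) = d + 1 by ring] at h1
    have h2 : max (s (k + 1)) 0 * (2 / (d + 1)) ≤ max (s (k + 1)) 0 * (1 / (2 * ((k : ℝ) + 1)) +
      1 / (2 * (d - k))) := mul_le_mul_of_nonneg_left h1 (le_max_right _ _)
    have h3 : s (k + 1) * (2 / (d + 1)) ≤ max (s (k + 1)) 0 * (2 / (d + 1)) :=
      mul_le_mul_of_nonneg_right (le_max_left _ _) (by positivity)
    push_cast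
    have h4 : 2 * ((d : ℝ) / (d + 1)) * s (k + 1) = 2 * s (k + 1) - s (k + 1) * (2 / (d + 1)) := by
      field_simp; ring
    rw [h4, div_eq_mul_one_div (max _ _) (2 * ((k : ℝ) + 1)),
      div_eq_mul_one_div (max _ _) (2 * ((d : ℝ) - k))]
    nlinarith
  have hbound2 := Finset.sum_le_sum hterm2
  have hN : L * ∑ k ∈ Finset.range (d + 1), n k = 2 * ∑ k ∈ Finset.range d, s (k + 1) := by
    rw [Finset.mul_sum, Finset.sum_congr rfl fun k _ => (show L * n k = s k + s (k + 1) by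
      rw [h.norm_eq, hs']; simp only [hs]; ring), sum_range_shift s (fun k => s (k + 1)) d hs0 hsd,
      Finset.mul_sum]
    exact Finset.sum_congr rfl fun k _ => by ring
  rw [← Finset.mul_sum] at hbound2
  have hfin : S / 4 * ∑ k ∈ Finset.range (d + 1), n k ≤
      d / (d + 1) * L * ∑ k ∈ Finset.range (d + 1), n k := by
    calc _ ≤ _ := hWz
      _ ≤ _ := hbound
      _ ≤ _ := hbound2
      _ = _ := by rw [mul_assoc (_ / _), hN]; ring
  have hfin2 := le_of_mul_le_mul_right hfin h.n_pos
  have h5 : (d + 1) / (4 * (d : ℝ)) * S = ((d : ℝ) + 1) / d * (S / 4) := by field_simp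
  rw [h5]
  calc ((d : ℝ) + 1) / d * (S / 4) ≤ (d + 1) / d * (d / (d + 1) * L) :=
        mul_le_mul_of_nonneg_left hfin2 (by positivity)
    _ = L := by field_simp

/-- Testing with a single component `ψ_i`. -/
lemma single_bound (hW : ∀ z : ℕ → ℝ, S / 4 * ∑ k ∈ Finset.range (d + 1), z k ^ 2 * n k ≤
      weitzenboeckBound d p m c z) (h : SpectralData d L p m c n) {i : ℕ} (hi : i ≤ d) :
    S / 4 * n i ≤ (if i < d then p (i + 1) * (1 - 1 / (2 * (i + 1))) else 0) +
      (if 1 ≤ i then m (i - 1) * (1 - 1 / (2 * (d - i + 1))) else 0) := by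
  have h1 := hW (fun k => if k = i then 1 else 0)
  have hl : ∑ k ∈ Finset.range (d + 1), (if k = i then (1 : ℝ) else 0) ^ 2 * n k = n i := by
    rw [Finset.sum_eq_single i]
    · simp
    · intro k _ hk; simp [hk]
    · intro hn; exact absurd (Finset.mem_range.2 (Nat.lt_succ_of_le hi)) hn
  rw [hl] at h1
  refine h1.trans (le_of_eq ?_)
  unfold weitzenboeckBound
  have hc : ∀ k, 2 * (if k - 1 = i then (1 : ℝ) else 0) * (if k + 1 = i then 1 else 0) * c k = 0 := by
    intro k
    by_cases h1 : k - 1 = i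
    · rw [if_neg (by omega : ¬ k + 1 = i)]; ring
    · rw [if_neg h1]; ring
  simp only [hc, add_zero]
  rw [Finset.sum_add_distrib]
  congr 1
  · split_ifs with hid
    · rw [Finset.sum_eq_single (i + 1)]
      · simp
      · intro k _ hk
        rcases Nat.eq_zero_or_pos k with rfl | hk0
        · rw [h.p_zero]; simp
        · rw [if_neg (by omega)]; simp
      · intro hn; exact absurd (Finset.mem_range.2 (by omega)) hn
    · apply Finset.sum_eq_zero
      intro k hk
      have := Finset.mem_range.1 hk
      rcases Nat.eq_zero_or_pos k with rfl | hk0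
      · rw [h.p_zero]; simp
      · rw [if_neg (by omega)]; simp
  · split_ifs with hid
    · rw [Finset.sum_eq_single (i - 1)]
      · rw [if_pos (by omega)]
        rw [Nat.cast_sub hid]
        push_cast
        ring_nf
      · intro k _ hk
        rw [if_neg (by omega)]; simp
      · intro hn; exact absurd (Finset.mem_range.2 (by omega)) hn
    · apply Finset.sum_eq_zero
      intro k hk
      rw [if_neg (by omega)]; simp

/-- The estimate in even dimension when the correlations vanish. If it failed, the numbers `p k`
would vanish one after the other, starting from both ends. -/
lemma SpectralData.bound_even (h : SpectralData d L p m c n) (hd : 2 ≤ d) (hde : Even d)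
    (hL : 0 ≤ L) (hc : ∀ k, c k = 0)
    (hW : ∀ z : ℕ → ℝ, S / 4 * ∑ k ∈ Finset.range (d + 1), z k ^ 2 * n k ≤
      weitzenboeckBound d p m c z) :
    d / (4 * (d - 1)) * S ≤ L := by
  have hd0 : (2 : ℝ) ≤ d := by exact_mod_cast hd
  obtain ⟨e, he⟩ := hde
  by_contra hcon
  push Not at hcon
  have hτ : (d - 1) / d * L < S / 4 := by
    have h5 : d / (4 * ((d : ℝ) - 1)) * S = (d : ℝ) / (d - 1) * (S / 4) := by
      field_simp
    rw [h5] at hcon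
    have hq : (0 : ℝ) < (d - 1) / d := div_pos (by linarith) (by linarith)
    calc (d - 1) / d * L < (d - 1) / d * (d / (d - 1) * (S / 4)) :=
          mul_lt_mul_of_pos_left hcon hq
      _ = S / 4 := by
          have : (d : ℝ) - 1 ≠ 0 := by linarith
          field_simp
  have hS : 0 < S / 4 := lt_of_le_of_lt (by
    apply mul_nonneg _ hL; apply div_nonneg <;> linarith) hτ
  -- without correlations the balance equation reads `p (k + 1) = m k`
  have hpm : ∀ k, p (k + 1) = m k := fun k => by simpa [hc] using h.balance k
  have hn : ∀ k, L * n k = p k + p (k + 1) := fun k => by rw [h.norm_eq, hc, hpm]; ring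
  have hptop : p (d + 1) = 0 := by rw [hpm, h.m_top]
  have hτ1 : (d - 1) / (d : ℝ) = 1 - 1 / d := by field_simp
  -- the components vanish one by one, from below
  have hlow : ∀ k, k ≤ e → p k = 0 := by
    intro k
    induction k with
    | zero => intro _; exact h.p_zero
    | succ k ih =>
      intro hk
      have hpk := ih (by omega)
      by_contra hne
      have hpos : 0 < p (k + 1) := lt_of_le_of_ne (h.p_nonneg _) (Ne.symm hne)
      have h1 := single_bound hW h (i := k) (by omega)
      rw [if_pos (by omega : k < d)] at h1
      have h2 : (if 1 ≤ k then m (k - 1) * (1 - 1 / (2 * ((d : ℝ) - k + 1))) else 0) = 0 := by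
        split_ifs with hk1
        · rw [← hpm, Nat.sub_add_cancel hk1, hpk, zero_mul]
        · rfl
      rw [h2, add_zero] at h1
      have h3 := hn k
      rw [hpk, zero_add] at h3
      have hnpos : 0 < n k := by
        rcases (h.n_nonneg k).lt_or_eq with h4 | h4
        · exact h4
        · rw [← h4, mul_zero] at h3; linarith
      have h4 : (d - 1) / d * L * n k < S / 4 * n k := mul_lt_mul_of_pos_right hτ hnpos
      rw [mul_assoc, h3] at h4
      have h5 := lt_of_lt_of_le h4 h1
      rw [mul_comm, hτ1] at h5
      have h6 := lt_of_mul_lt_mul_left h5 hpos.le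
      -- this is where `k < d / 2` enters: the factor `1 - 1 / (2 (k + 1))` is at most `1 - 1 / d`
      have hk2 : 2 * ((k : ℝ) + 1) ≤ d := by
        rw [he]; push_cast
        have : (k : ℝ) + 1 ≤ e := by exact_mod_cast hk
        linarith
      have h7 : 1 / (d : ℝ) ≤ 1 / (2 * ((k : ℝ) + 1)) :=
        one_div_le_one_div_of_le (by positivity) hk2
      linarith
  -- and from above
  have hhigh : ∀ k, k ≤ e → p (d + 1 - k) = 0 := by
    intro k
    induction k with
    | zero => intro _; exact hptop
    | succ k ih =>
      intro hk
      have hpk := ih (by omega)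
      by_contra hne
      set i := d - k with hi
      have hi1 : d + 1 - (k + 1) = i := by omega
      have hi2 : d + 1 - k = i + 1 := by omega
      rw [hi1] at hne
      rw [hi2] at hpk
      have hpos : 0 < p i := lt_of_le_of_ne (h.p_nonneg _) (Ne.symm hne)
      have h1 := single_bound hW h (i := i) (by omega)
      rw [hpk, zero_mul, ite_self, zero_add, if_pos (by omega : 1 ≤ i), ← hpm,
        Nat.sub_add_cancel (by omega : 1 ≤ i)] at h1
      have h3 := hn i
      rw [hpk, add_zero] at h3
      have hnpos : 0 < n i := by
        rcases (h.n_nonneg i).lt_or_eq with h4 | h4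
        · exact h4
        · rw [← h4, mul_zero] at h3; linarith
      have h4 : (d - 1) / d * L * n i < S / 4 * n i := mul_lt_mul_of_pos_right hτ hnpos
      rw [mul_assoc, h3] at h4
      have h5 := lt_of_lt_of_le h4 h1
      rw [mul_comm, hτ1] at h5
      have h6 := lt_of_mul_lt_mul_left h5 hpos.le
      have hik : (i : ℝ) = d - k := by rw [hi, Nat.cast_sub (by omega)]
      have hk2 : 2 * ((d : ℝ) - i + 1) ≤ d := by
        rw [hik, he]; push_cast
        have : (k : ℝ) + 1 ≤ e := by exact_mod_cast hk
        linarith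
      have h7 : 1 / (d : ℝ) ≤ 1 / (2 * ((d : ℝ) - i + 1)) := by
        apply one_div_le_one_div_of_le _ hk2
        rw [hik]; have : (0 : ℝ) ≤ k := by positivity
        linarith
      linarith
  have hall : ∀ k, k ≤ d + 1 → p k = 0 := by
    intro k hk
    by_cases hke : k ≤ e
    · exact hlow k hke
    · have := hhigh (d + 1 - k) (by omega)
      rwa [show d + 1 - (d + 1 - k) = k by omega] at this
  -- then the right-hand side of the estimate is `0` for each component, although `S > 0`
  have hzero : ∀ k ∈ Finset.range (d + 1), n k = 0 := by
    intro k hk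
    have hkd : k ≤ d := Nat.lt_succ_iff.1 (Finset.mem_range.1 hk)
    have h1 := single_bound hW h hkd
    rw [hall (k + 1) (by omega), zero_mul, ite_self, zero_add] at h1
    have h2 : (if 1 ≤ k then m (k - 1) * (1 - 1 / (2 * ((d : ℝ) - k + 1))) else 0) = 0 := by
      split_ifs with hk1
      · rw [← hpm, Nat.sub_add_cancel hk1, hall k (by omega), zero_mul]
      · rfl
    rw [h2] at h1
    have := h.n_nonneg k
    nlinarith
  have := h.n_pos
  rw [Finset.sum_eq_zero hzero] at this
  exact lt_irrefl _ this

/-- The estimate in complex dimension `2`, where the only correlation is between the two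
contributions in the middle degree; it is removed by testing with `ψ_0 ± ψ_2`. -/
lemma SpectralData.bound_two (h : SpectralData 2 L p m c n) (hL : 0 ≤ L)
    (hW : ∀ z : ℕ → ℝ, S / 4 * ∑ k ∈ Finset.range (2 + 1), z k ^ 2 * n k ≤
      weitzenboeckBound 2 p m c z) :
    ((2 : ℕ) : ℝ) / (4 * (((2 : ℕ) : ℝ) - 1)) * S ≤ L := by
  by_contra hcon
  push Not at hcon
  norm_num at hcon
  have hS : 0 < S := by linarith
  have hp0 := h.p_zero
  have hc0 := h.c_zero
  have hm2 := h.m_top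
  have hc2 := h.c_top
  have hb0 := h.balance 0
  have hb1 := h.balance 1
  have n0 := h.norm_eq 0
  have n1 := h.norm_eq 1
  have n2 := h.norm_eq 2
  have q0 := h.n_nonneg 0
  have q1 := h.n_nonneg 1
  have q2 := h.n_nonneg 2
  have hpos := h.n_pos
  have w1 := hW (fun k => if k = 1 then 0 else 1)
  have w2 := hW (fun k => if k = 1 then 0 else if k = 0 then 1 else -1)
  have w3 := single_bound hW h (i := 1) (by norm_num)
  simp [weitzenboeckBound, Finset.sum_range_succ] at w1 w2 w3 hpos
  norm_num at w1 w2 w3 hb0 hb1 n0 n1 n2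
  have k1 := h.p_nonneg 1
  have k2 := h.m_nonneg 1
  simp only [hp0, hc0, hm2, hc2, zero_add, add_zero, mul_zero] at *
  have hn02 : n 0 + n 2 = 0 := by
    by_contra hne
    have hgt : 0 < n 0 + n 2 := lt_of_le_of_ne (by linarith) (Ne.symm hne)
    have h1 : L * (n 0 + n 2) < 1 / 2 * S * (n 0 + n 2) := mul_lt_mul_of_pos_right hcon hgt
    have h2 : L * (n 0 + n 2) = p 1 + m 1 + 2 * c 1 := by linarith
    rcases le_total 0 (c 1) with hc | hc <;> nlinarith
  have z0 : n 0 = 0 := by linarith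
  have z2 : n 2 = 0 := by linarith
  rw [z0, mul_zero] at n0
  rw [z2, mul_zero] at n2
  have : 0 < n 1 := by linarith
  nlinarith

end Combinatorics

/-! ### Derivatives of functions along vector fields -/

section VectorFields

open Filter Topology VectorField

variable {E : Type*} [NormedAddCommGroup E] [NormedSpace ℝ E]
  {H : Type*} [TopologicalSpace H] {I : ModelWithCorners ℝ E H}
  {M : Type*} [TopologicalSpace M] [ChartedSpace H M]
  {G : Type*} [NormedAddCommGroup G] [NormedSpace ℝ G]

theorem mvfderiv_congr {f h : M → G} {x : M} (hfh : f =ᶠ[𝓝 x] h) :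
    mvfderiv I f x = mvfderiv I h x := by
  unfold mvfderiv
  ext v
  have := hfh.mfderiv_eq (I := I) (I' := 𝓘(ℝ, G))
  exact congrArg (fun L : E →L[ℝ] G => L v) this

theorem mvfderiv_comp_clm {G' : Type*} [NormedAddCommGroup G'] [NormedSpace ℝ G']
    (L : G →L[ℝ] G') {f : M → G} {x : M} (hf : MDifferentiableAt I 𝓘(ℝ, G) f x)
    (v : TangentSpace I x) :
    mvfderiv I (fun y => L (f y)) x v = L (mvfderiv I f x v) := by
  have h := mfderiv_comp_apply (I := I) (I' := 𝓘(ℝ, G)) (I'' := 𝓘(ℝ, G')) x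
    (g := L) L.differentiableAt.mdifferentiableAt hf v
  rw [mfderiv_eq_fderiv, L.fderiv] at h
  exact h

variable {f : M → G} {x : M}

theorem contDiffAt_comp_extChartAt_symm [I.Boundaryless] {n : ℕ∞}
    (hf : ContMDiffAt I 𝓘(ℝ, G) n f x) :
    ContDiffAt ℝ n (f ∘ (extChartAt I x).symm) (extChartAt I x x) := by
  have h := (contMDiffAt_iff.1 hf).2
  rw [I.range_eq_univ, contDiffWithinAt_univ] at h
  exact h

variable [IsManifold I 1 M]

theorem mvfderiv_eq_fderiv_extChartAt [I.Boundaryless] {f : M → G} (x : M) {y : M}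
    (hy : y ∈ (extChartAt I x).source) (hf : MDifferentiableAt I 𝓘(ℝ, G) f y)
    (v : TangentSpace I y) :
    mvfderiv I f y v =
      fderiv ℝ (f ∘ (extChartAt I x).symm) (extChartAt I x y)
        (mfderiv I 𝓘(ℝ, E) (extChartAt I x) y v) := by
  have hy' : (extChartAt I x).symm (extChartAt I x y) = y := (extChartAt I x).left_inv hy
  have hsymm : MDifferentiableAt 𝓘(ℝ, E) I (extChartAt I x).symm (extChartAt I x y) :=
    (contMDiffOn_extChartAt_symm (n := 1) x).contMDiffAt
      ((isOpen_extChartAt_target x).mem_nhds ((extChartAt I x).map_source hy))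
      |>.mdifferentiableAt (by simp)
  have hchart : MDifferentiableAt I 𝓘(ℝ, E) (extChartAt I x) y :=
    mdifferentiableAt_extChartAt (by simpa using hy)
  have hg : MDifferentiableAt 𝓘(ℝ, E) 𝓘(ℝ, G) (f ∘ (extChartAt I x).symm) (extChartAt I x y) :=
    MDifferentiableAt.comp (extChartAt I x y) (by rw [hy']; exact hf) hsymm
  have h1 : f =ᶠ[𝓝 y] (f ∘ (extChartAt I x).symm) ∘ extChartAt I x := by
    filter_upwards [(isOpen_extChartAt_source (I := I) x).mem_nhds hy] with z hz
    simp only [Function.comp_apply]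
    rw [(extChartAt I x).left_inv hz]
  rw [mvfderiv_congr h1]
  have h2 := mfderiv_comp_apply y hg hchart v
  rw [mfderiv_eq_fderiv] at h2
  exact h2

/-- The representative of a vector field in the chart at `x`. -/
def chartField (I : ModelWithCorners ℝ E H) (X : Π y : M, TangentSpace I y) (x : M) : E → E :=
  mpullbackWithin 𝓘(ℝ, E) I (extChartAt I x).symm X (range I)

theorem mfderiv_extChartAt_apply_eq_chartField (X : Π y : M, TangentSpace I y) (x : M) {e : E}
    (he : e ∈ (extChartAt I x).target) :
    mfderiv I 𝓘(ℝ, E) (extChartAt I x) ((extChartAt I x).symm e) (X ((extChartAt I x).symm e)) =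
      chartField I X x e := by
  have h1 := mfderiv_extChartAt_comp_mfderivWithin_extChartAt_symm (I := I) he
  have h2 := mfderivWithin_extChartAt_symm_comp_mfderiv_extChartAt (I := I) he
  have h3 := ContinuousLinearMap.inverse_eq h2 h1
  change _ = (mfderivWithin 𝓘(ℝ, E) I (extChartAt I x).symm (range I) e).inverse _
  rw [h3]
  rfl

theorem mfderiv_extChartAt_apply_eq_chartField' (X : Π y : M, TangentSpace I y) (x : M) {y : M}
    (hy : y ∈ (extChartAt I x).source) :
    (mfderiv I 𝓘(ℝ, E) (extChartAt I x) y (X y) : E) = chartField I X x (extChartAt I x y) := by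
  have h := mfderiv_extChartAt_apply_eq_chartField X x ((extChartAt I x).map_source hy)
  have aux : ∀ z, z = y → (mfderiv I 𝓘(ℝ, E) (extChartAt I x) z (X z) : E) =
      mfderiv I 𝓘(ℝ, E) (extChartAt I x) y (X y) := by rintro z rfl; rfl
  rw [← h]
  exact (aux _ ((extChartAt I x).left_inv hy)).symm

variable [I.Boundaryless] {X Y : Π y : M, TangentSpace I y}

theorem mvfderiv_field_eventuallyEq (hf : ContMDiffAt I 𝓘(ℝ, G) 2 f x) :
    (fun y => mvfderiv I f y (Y y)) =ᶠ[𝓝 x] (fun e => fderiv ℝ (f ∘ (extChartAt I x).symm) e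
      (chartField I Y x e)) ∘ extChartAt I x := by
  have h1 : ∀ᶠ y in 𝓝 x, ContMDiffAt I 𝓘(ℝ, G) 1 f y :=
    (contMDiffAt_iff_contMDiffAt_nhds (by simp)).1 (hf.of_le (by norm_num))
  filter_upwards [(isOpen_extChartAt_source (I := I) x).mem_nhds (mem_extChartAt_source x), h1]
    with y hy hfy
  simp only [Function.comp_apply]
  rw [← mfderiv_extChartAt_apply_eq_chartField' Y x hy,
    mvfderiv_eq_fderiv_extChartAt x hy (hfy.mdifferentiableAt (by simp))]

variable [IsManifold I 2 M] [CompleteSpace E]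

theorem differentiableAt_chartField (hY : MDifferentiableAt I I.tangent
    (fun y => (⟨y, Y y⟩ : TangentBundle I M)) x) :
    DifferentiableAt ℝ (chartField I Y x) (extChartAt I x x) := by
  have h := MDifferentiableWithinAt.differentiableWithinAt_mpullbackWithin_vectorField
    (I := I) (V := Y) (s := univ) (x := x) hY.mdifferentiableWithinAt
  change DifferentiableWithinAt ℝ (chartField I Y x) _ _ at h
  rwa [preimage_univ, univ_inter, I.range_eq_univ, differentiableWithinAt_univ] at h

theorem mdifferentiableAt_mvfderiv_field (hf : ContMDiffAt I 𝓘(ℝ, G) 2 f x)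
    (hY : MDifferentiableAt I I.tangent (fun y => (⟨y, Y y⟩ : TangentBundle I M)) x) :
    MDifferentiableAt I 𝓘(ℝ, G) (fun y => mvfderiv I f y (Y y)) x := by
  refine MDifferentiableAt.congr_of_eventuallyEq ?_ (mvfderiv_field_eventuallyEq hf)
  refine MDifferentiableAt.comp x (I' := 𝓘(ℝ, E)) ?_
    (mdifferentiableAt_extChartAt (mem_chart_source H x))
  apply DifferentiableAt.mdifferentiableAt
  have h2 := contDiffAt_comp_extChartAt_symm (n := 2) hf
  exact ((h2.fderiv_right (m := 1) (by norm_num)).differentiableAt (by simp)).clm_apply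
    (differentiableAt_chartField hY)

/-- A vector field is determined by its action on functions, and the Lie bracket acts as the
commutator. -/
theorem mvfderiv_mlieBracket (hf : ContMDiffAt I 𝓘(ℝ, G) 2 f x)
    (hX : MDifferentiableAt I I.tangent (fun y => (⟨y, X y⟩ : TangentBundle I M)) x)
    (hY : MDifferentiableAt I I.tangent (fun y => (⟨y, Y y⟩ : TangentBundle I M)) x) :
    mvfderiv I f x (mlieBracket I X Y x) =
      mvfderiv I (fun y => mvfderiv I f y (Y y)) x (X x) -
        mvfderiv I (fun y => mvfderiv I f y (X y)) x (Y x) := by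
  have hxs := mem_extChartAt_source (I := I) x
  have key : ∀ X Y : Π y : M, TangentSpace I y,
      MDifferentiableAt I I.tangent (fun y => (⟨y, Y y⟩ : TangentBundle I M)) x →
      mvfderiv I (fun y => mvfderiv I f y (Y y)) x (X x) =
        fderiv ℝ (fun e => fderiv ℝ (f ∘ (extChartAt I x).symm) e (chartField I Y x e))
          (extChartAt I x x) (chartField I X x (extChartAt I x x)) := by
    intro X Y hY
    rw [mvfderiv_eq_fderiv_extChartAt x hxs (mdifferentiableAt_mvfderiv_field hf hY),
      mfderiv_extChartAt_apply_eq_chartField' X x hxs]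
    congr 1
    apply Filter.EventuallyEq.fderiv_eq
    have h := (mvfderiv_field_eventuallyEq (Y := Y) hf)
    have hc : Tendsto (extChartAt I x).symm (𝓝 (extChartAt I x x)) (𝓝 x) := by
      have := continuousAt_extChartAt_symm (I := I) x
      unfold ContinuousAt at this
      rwa [(extChartAt I x).left_inv hxs] at this
    filter_upwards [hc.eventually h, (isOpen_extChartAt_target (I := I) x).mem_nhds
      (mem_extChartAt_target x)] with e he het
    simp only [Function.comp_apply] at he ⊢
    rw [he, (extChartAt I x).right_inv het]
  rw [key X Y hY, key Y X hX, mvfderiv_eq_fderiv_extChartAt x hxs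
    (hf.mdifferentiableAt (by simp))]
  have h3 : (mfderiv I 𝓘(ℝ, E) (extChartAt I x) x (mlieBracket I X Y x) : E) =
      lieBracket ℝ (chartField I X x) (chartField I Y x) (extChartAt I x x) := by
    have h4 := isInvertible_mfderiv_extChartAt (I := I) hxs
    have h5 : mlieBracket I X Y x = (mfderiv I 𝓘(ℝ, E) (extChartAt I x) x).inverse
        (lieBracketWithin (E := E) ℝ (chartField I X x) (chartField I Y x)
          ((extChartAt I x).symm ⁻¹' univ ∩ range I) (extChartAt I x x) : E) := rfl
    rw [preimage_univ, univ_inter, I.range_eq_univ, lieBracketWithin_univ] at h5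
    rw [h5]
    exact h4.self_apply_inverse _
  rw [h3]
  exact fderiv_apply_lieBracket (n := 2) (contDiffAt_comp_extChartAt_symm (n := 2) hf) (by simp)
    (differentiableAt_chartField hY) (differentiableAt_chartField hX)

end VectorFields

/-! ### Germs of smooth functions and sections -/

section Germs

open Filter Topology VectorField

variable {E : Type*} [NormedAddCommGroup E] [NormedSpace ℝ E]
  {H : Type*} [TopologicalSpace H] {I : ModelWithCorners ℝ E H}
  {M : Type*} [TopologicalSpace M] [ChartedSpace H M]

/-- `f` is smooth at all points near `x`. -/
def SmoothFunNear {G : Type*} [NormedAddCommGroup G] [NormedSpace ℝ G] (I : ModelWithCorners ℝ E H)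
    (f : M → G) (x : M) : Prop :=
  ∀ᶠ y in 𝓝 x, ContMDiffAt I 𝓘(ℝ, G) ∞ f y

namespace SmoothFunNear

variable {G : Type*} [NormedAddCommGroup G] [NormedSpace ℝ G] {f h : M → G} {x : M}

theorem eventually (hf : SmoothFunNear I f x) : ∀ᶠ y in 𝓝 x, SmoothFunNear I f y :=
  eventually_eventually_nhds.2 hf

theorem contMDiffAt (hf : SmoothFunNear I f x) : ContMDiffAt I 𝓘(ℝ, G) ∞ f x := hf.self_of_nhds

theorem mdifferentiableAt (hf : SmoothFunNear I f x) : MDifferentiableAt I 𝓘(ℝ, G) f x :=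
  hf.contMDiffAt.mdifferentiableAt (by simp)

theorem congr (hf : SmoothFunNear I f x) (hfh : h =ᶠ[𝓝 x] f) : SmoothFunNear I h x := by
  filter_upwards [hf, hfh.eventuallyEq_nhds] with y hy hy' using hy.congr_of_eventuallyEq hy'

theorem of_contMDiffOn {U : Set M} (hU : IsOpen U) (hf : ContMDiffOn I 𝓘(ℝ, G) ∞ f U)
    (hx : x ∈ U) : SmoothFunNear I f x := by
  filter_upwards [hU.mem_nhds hx] with y hy using hf.contMDiffAt (hU.mem_nhds hy)

theorem const (c : G) : SmoothFunNear I (fun _ : M => c) x :=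
  Eventually.of_forall fun _ => contMDiffAt_const

theorem add (hf : SmoothFunNear I f x) (hh : SmoothFunNear I h x) :
    SmoothFunNear I (fun y => f y + h y) x := by
  filter_upwards [hf, hh] with y h1 h2 using h1.add h2

theorem sum {ι : Type*} {s : Finset ι} {f : ι → M → G} (hf : ∀ i ∈ s, SmoothFunNear I (f i) x) :
    SmoothFunNear I (fun y => ∑ i ∈ s, f i y) x := by
  filter_upwards [(Filter.eventually_all_finset s).2 hf] with y hy
  exact contMDiffAt_finsetSum fun i hi => hy i hi

theorem clm_comp {G' : Type*} [NormedAddCommGroup G'] [NormedSpace ℝ G'] (L : G →L[ℝ] G')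
    (hf : SmoothFunNear I f x) : SmoothFunNear I (fun y => L (f y)) x := by
  filter_upwards [hf] with y h1
  exact L.contDiff.contMDiff.contMDiffAt.comp y h1

theorem mul {A : Type*} [NormedRing A] [NormedAlgebra ℝ A] {f h : M → A}
    (hf : SmoothFunNear I f x) (hh : SmoothFunNear I h x) :
    SmoothFunNear I (fun y => f y * h y) x := by
  filter_upwards [hf, hh] with y h1 h2
  exact ((contDiff_mul (𝕜 := ℝ) (𝔸 := A)).contMDiff.contMDiffAt).comp y (h1.prodMk_space h2)

end SmoothFunNear

section Bundle

variable {F : Type*} [NormedAddCommGroup F] [NormedSpace ℝ F]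
  {V : M → Type*} [TopologicalSpace (TotalSpace F V)] [∀ x, TopologicalSpace (V x)]
  [FiberBundle F V]

/-- The section `σ` is smooth at all points near `x`. -/
def SmoothNear (I : ModelWithCorners ℝ E H) (F : Type*) [NormedAddCommGroup F] [NormedSpace ℝ F]
    {V : M → Type*} [TopologicalSpace (TotalSpace F V)] [∀ x, TopologicalSpace (V x)]
    [FiberBundle F V] (σ : Π x : M, V x) (x : M) : Prop :=
  ∀ᶠ y in 𝓝 x, ContMDiffAt I (I.prod 𝓘(ℝ, F)) ∞ (fun y => (⟨y, σ y⟩ : TotalSpace F V)) y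

namespace SmoothNear

variable {σ τ : Π x : M, V x} {x : M}


theorem eventually (hσ : SmoothNear I F σ x) : ∀ᶠ y in 𝓝 x, SmoothNear I F σ y :=
  eventually_eventually_nhds.2 hσ

theorem contMDiffAt (hσ : SmoothNear I F σ x) :
    ContMDiffAt I (I.prod 𝓘(ℝ, F)) ∞ (fun y => (⟨y, σ y⟩ : TotalSpace F V)) x := hσ.self_of_nhds

theorem mdifferentiableAt (hσ : SmoothNear I F σ x) :
    MDifferentiableAt I (I.prod 𝓘(ℝ, F)) (fun y => (⟨y, σ y⟩ : TotalSpace F V)) x :=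
  hσ.contMDiffAt.mdifferentiableAt (by simp)

theorem congr (hσ : SmoothNear I F σ x) (h : ∀ᶠ y in 𝓝 x, τ y = σ y) : SmoothNear I F τ x := by
  filter_upwards [hσ, eventually_eventually_nhds.2 h] with y hy hy'
  refine hy.congr_of_eventuallyEq ?_
  filter_upwards [hy'] with z hz
  rw [hz]

theorem of_contMDiffOn {U : Set M} (hU : IsOpen U)
    (hσ : ContMDiffOn I (I.prod 𝓘(ℝ, F)) ∞ (fun y => (⟨y, σ y⟩ : TotalSpace F V)) U)
    (hx : x ∈ U) : SmoothNear I F σ x := by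
  filter_upwards [hU.mem_nhds hx] with y hy using hσ.contMDiffAt (hU.mem_nhds hy)

theorem contMDiffOn {U : Set M} (hσ : ∀ x ∈ U, SmoothNear I F σ x) :
    ContMDiffOn I (I.prod 𝓘(ℝ, F)) ∞ (fun y => (⟨y, σ y⟩ : TotalSpace F V)) U :=
  fun x hx => (hσ x hx).contMDiffAt.contMDiffWithinAt

variable [∀ x, AddCommGroup (V x)] [∀ x, Module ℝ (V x)] [VectorBundle ℝ F V]

theorem add (hσ : SmoothNear I F σ x) (hτ : SmoothNear I F τ x) :
    SmoothNear I F (fun y => σ y + τ y) x := by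
  filter_upwards [hσ, hτ] with y h1 h2 using h1.add_section h2

theorem sub (hσ : SmoothNear I F σ x) (hτ : SmoothNear I F τ x) :
    SmoothNear I F (fun y => σ y - τ y) x := by
  filter_upwards [hσ, hτ] with y h1 h2 using h1.sub_section h2

theorem neg (hσ : SmoothNear I F σ x) : SmoothNear I F (fun y => -σ y) x := by
  filter_upwards [hσ] with y h1 using h1.neg_section

theorem smul {f : M → ℝ} (hf : SmoothFunNear I f x) (hσ : SmoothNear I F σ x) :
    SmoothNear I F (fun y => f y • σ y) x := by
  filter_upwards [hf, hσ] with y h1 h2 using h1.smul_section h2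

theorem sum {ι : Type*} {s : Finset ι} {σ : ι → Π x : M, V x}
    (hσ : ∀ i ∈ s, SmoothNear I F (σ i) x) : SmoothNear I F (fun y => ∑ i ∈ s, σ i y) x := by
  filter_upwards [(Filter.eventually_all_finset s).2 hσ] with y hy
  exact ContMDiffAt.sum_section fun i hi => hy i hi

theorem zero : SmoothNear I F (fun y => (0 : V y)) x :=
  Eventually.of_forall fun _ => (contMDiff_zeroSection ℝ V).contMDiffAt

variable [ContMDiffVectorBundle ∞ F V I]

theorem extend (v : V x) : SmoothNear I F (FiberBundle.extend F v) x := by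
  obtain ⟨s, hs, h⟩ := FiberBundle.exists_contMDiffOn_extend (k := ∞) I F v
  obtain ⟨t, hts, ht, hxt⟩ := mem_nhds_iff.1 hs
  exact of_contMDiffOn ht (h.mono hts) hxt

end SmoothNear

end Bundle

end Germs

section Connections

open Filter Topology VectorField

variable {E : Type*} [NormedAddCommGroup E] [NormedSpace ℝ E] [FiniteDimensional ℝ E]
  {H : Type*} [TopologicalSpace H] {I : ModelWithCorners ℝ E H} [I.Boundaryless]
  {M : Type*} [TopologicalSpace M] [T2Space M] [ChartedSpace H M] [IsManifold I ∞ M]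

theorem SmoothFunNear.mvfderiv {G : Type*} [NormedAddCommGroup G] [NormedSpace ℝ G]
    {f : M → G} {X : Π y : M, TangentSpace I y} {x : M} (hf : SmoothFunNear I f x)
    (hX : SmoothNear I E X x) : SmoothFunNear I (fun y => mvfderiv I f y (X y)) x := by
  have : CompleteSpace E := FiniteDimensional.complete ℝ E
  filter_upwards [hf, hX] with y hf hX
  refine ContMDiffAt.congr_of_eventuallyEq ?_
    (mvfderiv_field_eventuallyEq (hf.of_le ENat.LEInfty.out))
  refine ContMDiffAt.comp (I' := 𝓘(ℝ, E)) y ?_ contMDiffAt_extChartAt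
  apply ContDiffAt.contMDiffAt
  have h1 : ContDiffAt ℝ ∞ (f ∘ (extChartAt I y).symm) (extChartAt I y y) :=
    contDiffAt_comp_extChartAt_symm (n := ⊤) hf
  refine (h1.fderiv_right (m := ∞) (by simp)).clm_apply ?_
  have h2 := contMDiffWithinAt_mpullbackWithin_extChartAt_symm (n := ∞) (m := ∞) (s := univ)
    (V := X) (x := y) hX.contMDiffWithinAt uniqueMDiffOn_univ (mem_univ _) (by simp)
  have h3 := ((contMDiff_snd_tangentBundle_modelSpace E 𝓘(ℝ, E)).contMDiffAt).comp_contMDiffWithinAt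
    _ h2
  have h4 : ContMDiffWithinAt 𝓘(ℝ, E) 𝓘(ℝ, E) ∞ (chartField I X y) _ _ := h3
  rw [preimage_univ, inter_univ] at h4
  exact (h4.contMDiffAt ((isOpen_extChartAt_target (I := I) y).mem_nhds
    (mem_extChartAt_target y))).contDiffAt

theorem SmoothNear.mlieBracket {X Y : Π y : M, TangentSpace I y} {x : M}
    (hX : SmoothNear I E X x) (hY : SmoothNear I E Y x) :
    SmoothNear I E (fun y => VectorField.mlieBracket I X Y y) x := by
  have : CompleteSpace E := FiniteDimensional.complete ℝ E
  have : IsManifold I (minSmoothness ℝ 2) M := by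
    rw [minSmoothness_of_isRCLikeNormedField]; infer_instance
  have : IsManifold I (minSmoothness ℝ 3) M := by
    rw [minSmoothness_of_isRCLikeNormedField]; exact IsManifold.of_le (n := ∞) (WithTop.coe_le_coe.2 le_top)
  have : IsManifold I (((⊤ : ℕ∞) : ℕ∞ω) + 1) M := ‹IsManifold I ∞ M›
  filter_upwards [hX, hY] with y h1 h2
  exact ContMDiffAt.mlieBracket_vectorField (m := ⊤) (n := ⊤) h1 h2 (by simp)

variable {F : Type*} [NormedAddCommGroup F] [NormedSpace ℝ F]
  {V : M → Type*} [TopologicalSpace (TotalSpace F V)]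
  [∀ x, AddCommGroup (V x)] [∀ x, Module ℝ (V x)] [∀ x, TopologicalSpace (V x)]
  [∀ x, IsTopologicalAddGroup (V x)] [∀ x, ContinuousSMul ℝ (V x)] [FiberBundle F V]

section Connection

variable {cov : CovariantDerivative I F V} {σ τ : Π x : M, V x} {x : M}

theorem cov_congr (h : ∀ᶠ y in 𝓝 x, σ y = τ y) (hσ : SmoothNear I F σ x) :
    cov σ x = cov τ x :=
  cov.isCovariantDerivativeOnUniv.congr_of_eventuallyEq hσ.mdifferentiableAt
    (hσ.congr (h.mono fun _ hy => hy.symm)).mdifferentiableAt univ_mem h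

theorem cov_add (hσ : SmoothNear I F σ x) (hτ : SmoothNear I F τ x) (v : TangentSpace I x) :
    cov (fun y => σ y + τ y) x v = cov σ x v + cov τ x v :=
  congrArg (fun L => L v)
    (cov.isCovariantDerivativeOnUniv.add hσ.mdifferentiableAt hτ.mdifferentiableAt)

theorem cov_smul {f : M → ℝ} (hf : SmoothFunNear I f x) (hσ : SmoothNear I F σ x)
    (v : TangentSpace I x) :
    cov (fun y => f y • σ y) x v = f x • cov σ x v + mvfderiv I f x v • σ x :=
  congrArg (fun L => L v)
    (cov.isCovariantDerivativeOnUniv.leibniz hσ.mdifferentiableAt hf.mdifferentiableAt)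

variable [VectorBundle ℝ F V]

theorem cov_neg (hσ : SmoothNear I F σ x) (v : TangentSpace I x) :
    cov (fun y => -σ y) x v = -cov σ x v := by
  have h := cov_smul (cov := cov) (SmoothFunNear.const (I := I) (x := x) (-1 : ℝ)) hσ v
  simpa [mvfderiv_const] using h

theorem cov_sub (hσ : SmoothNear I F σ x) (hτ : SmoothNear I F τ x) (v : TangentSpace I x) :
    cov (fun y => σ y - τ y) x v = cov σ x v - cov τ x v := by
  simp only [sub_eq_add_neg]
  rw [cov_add hσ hτ.neg, cov_neg hτ]

theorem cov_sum {ι : Type*} {s : Finset ι} {σ : ι → Π x : M, V x}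
    (hσ : ∀ i ∈ s, SmoothNear I F (σ i) x) (v : TangentSpace I x) :
    cov (fun y => ∑ i ∈ s, σ i y) x v = ∑ i ∈ s, cov (σ i) x v := by
  classical
  induction s using Finset.induction_on with
  | empty =>
    have : cov (fun y => (0 : V y)) x = 0 := cov.isCovariantDerivativeOnUniv.zero
    simp [this]
  | insert a s ha ih =>
    simp only [Finset.sum_insert ha]
    rw [cov_add (hσ a (by simp)) (SmoothNear.sum fun i hi => hσ i (by simp [hi])),
      ih fun i hi => hσ i (by simp [hi])]

variable [FiniteDimensional ℝ F] [ContMDiffVectorBundle ∞ F V I]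

theorem contMDiffAt_cov (hcov : cov.ContMDiffCovariantDerivative ∞) (hσ : SmoothNear I F σ x) :
    ContMDiffAt I (I.prod 𝓘(ℝ, E →L[ℝ] F)) ∞ (fun y => TotalSpace.mk' (E →L[ℝ] F)
      (E := fun y : M => TangentSpace I y →L[ℝ] V y) y (cov σ y)) x := by
  obtain ⟨U, hU, hUo, hxU⟩ := eventually_nhds_iff.1 hσ
  obtain ⟨χ, -, hχ⟩ := (SmoothBumpFunction.nhds_basis_tsupport (I := I) x).mem_iff.1
    (hUo.mem_nhds hxU)
  have h1 : ContMDiff I (I.prod 𝓘(ℝ, F)) ∞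
      (fun y => (⟨y, ((χ : M → ℝ) • σ) y⟩ : TotalSpace F V)) :=
    ContMDiffOn.smul_section_of_tsupport χ.contMDiff.contMDiffOn hUo hχ
      fun y hy => (hU y hy).contMDiffWithinAt
  have h2 := hcov.contMDiff.contMDiff (σ := (χ : M → ℝ) • σ) h1.contMDiffOn
  have h3 := (h2 x (mem_univ _)).contMDiffAt univ_mem
  refine h3.congr_of_eventuallyEq ?_
  filter_upwards [hσ.eventually, χ.eventuallyEq_one.eventuallyEq_nhds] with y hy hy'
  congr 1
  apply cov_congr _ hy
  filter_upwards [hy'] with z hz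
  simp [hz]

theorem SmoothNear.covariantDerivative (hcov : cov.ContMDiffCovariantDerivative ∞) (hσ : SmoothNear I F σ x)
    {X : Π y : M, TangentSpace I y} (hX : SmoothNear I E X x) :
    SmoothNear I F (fun y => cov σ y (X y)) x := by
  filter_upwards [hσ.eventually, hX] with y h1 h2
  exact (contMDiffAt_cov hcov h1).clm_bundle_apply h2

theorem mdifferentiableAt_cov (hcov : cov.ContMDiffCovariantDerivative ∞)
    (hσ : SmoothNear I F σ x) {X : Π y : M, TangentSpace I y}
    (hX : MDifferentiableAt I I.tangent (fun y => (⟨y, X y⟩ : TangentBundle I M)) x) :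
    MDifferentiableAt I (I.prod 𝓘(ℝ, F)) (fun y => (⟨y, cov σ y (X y)⟩ : TotalSpace F V)) x :=
  ((contMDiffAt_cov hcov hσ).mdifferentiableAt (by simp)).clm_bundle_apply hX

end Connection

end Connections

/-! ### Curvature -/

section CurvatureTensor

open Filter Topology VectorField

variable {E : Type*} [NormedAddCommGroup E] [NormedSpace ℝ E] [FiniteDimensional ℝ E]
  {H : Type*} [TopologicalSpace H] {I : ModelWithCorners ℝ E H} [I.Boundaryless]
  {M : Type*} [TopologicalSpace M] [T2Space M] [ChartedSpace H M] [IsManifold I ∞ M]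
  {F : Type*} [NormedAddCommGroup F] [NormedSpace ℝ F]
  {V : M → Type*} [TopologicalSpace (TotalSpace F V)]
  [∀ x, AddCommGroup (V x)] [∀ x, Module ℝ (V x)] [∀ x, TopologicalSpace (V x)]
  [∀ x, IsTopologicalAddGroup (V x)] [∀ x, ContinuousSMul ℝ (V x)] [FiberBundle F V]

/-- The curvature `∇_X ∇_Y σ - ∇_Y ∇_X σ - ∇_[X, Y] σ` of a connection on vector fields and a
section. -/
def curvatureField (cov : CovariantDerivative I F V) (X Y : Π y : M, TangentSpace I y)
    (σ : Π y : M, V y) (x : M) : V x :=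
  cov (fun y => cov σ y (Y y)) x (X x) - cov (fun y => cov σ y (X y)) x (Y x) -
    cov σ x (mlieBracket I X Y x)

variable {cov : CovariantDerivative I F V} {σ τ : Π x : M, V x} {x : M}
  {X Y : Π y : M, TangentSpace I y}

theorem curvatureField_swap : curvatureField cov X Y σ x = -curvatureField cov Y X σ x := by
  unfold curvatureField
  rw [mlieBracket_swap_apply, map_neg]
  abel

variable [VectorBundle ℝ F V] [FiniteDimensional ℝ F] [ContMDiffVectorBundle ∞ F V I]

theorem tensorialAt_curvatureField (hcov : cov.ContMDiffCovariantDerivative ∞)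
    (hσ : SmoothNear I F σ x) :
    TensorialAt I E (fun X => curvatureField cov X Y σ x) x := by
  have : CompleteSpace E := FiniteDimensional.complete ℝ E
  constructor
  · intro f X hf hX
    have h1 := congrArg (fun L => L (Y x)) (cov.isCovariantDerivativeOnUniv.leibniz
      (mdifferentiableAt_cov hcov hσ hX) hf)
    have h2 : (fun y => cov σ y ((f • X) y)) = f • fun y => cov σ y (X y) := by
      ext y
      simp
    simp only [curvatureField]
    rw [h2]
    erw [h1]
    rw [mlieBracket_smul_left hf hX]
    simp only [Pi.smul_apply', map_smul, map_add, add_apply,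
      smul_apply, ContinuousLinearMap.smulRight_apply]
    module
  · intro X X' hX hX'
    have h1 := congrArg (fun L => L (Y x)) (cov.isCovariantDerivativeOnUniv.add
      (mdifferentiableAt_cov hcov hσ hX) (mdifferentiableAt_cov hcov hσ hX'))
    have h2 : (fun y => cov σ y ((X + X') y)) =
        (fun y => cov σ y (X y)) + fun y => cov σ y (X' y) := by
      ext y
      simp
    simp only [curvatureField]
    rw [h2]
    erw [h1]
    rw [mlieBracket_add_left hX hX']
    simp only [Pi.add_apply, map_add, add_apply]
    module

theorem curvatureField_congr_fields (hcov : cov.ContMDiffCovariantDerivative ∞)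
    (hσ : SmoothNear I F σ x) {X' Y' : Π y : M, TangentSpace I y}
    (hX : MDifferentiableAt I I.tangent (fun y => (⟨y, X y⟩ : TangentBundle I M)) x)
    (hY : MDifferentiableAt I I.tangent (fun y => (⟨y, Y y⟩ : TangentBundle I M)) x)
    (hX' : MDifferentiableAt I I.tangent (fun y => (⟨y, X' y⟩ : TangentBundle I M)) x)
    (hY' : MDifferentiableAt I I.tangent (fun y => (⟨y, Y' y⟩ : TangentBundle I M)) x)
    (hXX' : X x = X' x) (hYY' : Y x = Y' x) :
    curvatureField cov X Y σ x = curvatureField cov X' Y' σ x := by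
  rw [(tensorialAt_curvatureField hcov hσ).pointwise hX hX' hXX', curvatureField_swap,
    (tensorialAt_curvatureField hcov hσ).pointwise hY hY' hYY', ← curvatureField_swap]

theorem curvatureField_congr (h : ∀ᶠ y in 𝓝 x, σ y = τ y) (hcov : cov.ContMDiffCovariantDerivative ∞)
    (hσ : SmoothNear I F σ x) (hX : SmoothNear I E X x) (hY : SmoothNear I E Y x) :
    curvatureField cov X Y σ x = curvatureField cov X Y τ x := by
  have h1 : ∀ Z : Π y : M, TangentSpace I y, ∀ᶠ y in 𝓝 x, cov σ y (Z y) = cov τ y (Z y) := by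
    intro Z
    filter_upwards [eventually_eventually_nhds.2 h, hσ.eventually] with y hy hy'
    rw [cov_congr hy hy']
  unfold curvatureField
  rw [cov_congr h hσ, cov_congr (h1 Y) (hσ.covariantDerivative hcov hY),
    cov_congr (h1 X) (hσ.covariantDerivative hcov hX)]

theorem curvatureField_add (hcov : cov.ContMDiffCovariantDerivative ∞)
    (hσ : SmoothNear I F σ x) (hτ : SmoothNear I F τ x) (hX : SmoothNear I E X x)
    (hY : SmoothNear I E Y x) :
    curvatureField cov X Y (fun y => σ y + τ y) x =
      curvatureField cov X Y σ x + curvatureField cov X Y τ x := by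
  have h1 : ∀ Z : Π y : M, TangentSpace I y, SmoothNear I E Z x → ∀ v : TangentSpace I x,
      cov (fun y => cov (fun y => σ y + τ y) y (Z y)) x v =
        cov (fun y => cov σ y (Z y)) x v + cov (fun y => cov τ y (Z y)) x v := by
    intro Z hZ v
    rw [← cov_add (hσ.covariantDerivative hcov hZ) (hτ.covariantDerivative hcov hZ)]
    refine congrArg (fun L => L v) (cov_congr ?_ ((hσ.add hτ).covariantDerivative hcov hZ))
    filter_upwards [hσ.eventually, hτ.eventually] with y h1 h2 using cov_add h1 h2 _
  unfold curvatureField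
  rw [h1 Y hY, h1 X hX, cov_add hσ hτ]
  abel

theorem curvatureField_smul (hcov : cov.ContMDiffCovariantDerivative ∞) {f : M → ℝ}
    (hf : SmoothFunNear I f x) (hσ : SmoothNear I F σ x) (hX : SmoothNear I E X x)
    (hY : SmoothNear I E Y x) :
    curvatureField cov X Y (fun y => f y • σ y) x = f x • curvatureField cov X Y σ x := by
  have : CompleteSpace E := FiniteDimensional.complete ℝ E
  have h1 : ∀ Z : Π y : M, TangentSpace I y, SmoothNear I E Z x → ∀ v : TangentSpace I x,
      cov (fun y => cov (fun y => f y • σ y) y (Z y)) x v =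
        f x • cov (fun y => cov σ y (Z y)) x v + mvfderiv I f x v • cov σ x (Z x) +
        (mvfderiv I f x (Z x) • cov σ x v +
          mvfderiv I (fun y => mvfderiv I f y (Z y)) x v • σ x) := by
    intro Z hZ v
    rw [← cov_smul hf (hσ.covariantDerivative hcov hZ), ← cov_smul (hf.mvfderiv hZ) hσ, ← cov_add
      (SmoothNear.smul hf (hσ.covariantDerivative hcov hZ)) (SmoothNear.smul (hf.mvfderiv hZ) hσ)]
    refine congrArg (fun L => L v) (cov_congr ?_ ((SmoothNear.smul hf hσ).covariantDerivative hcov hZ))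
    filter_upwards [hf.eventually, hσ.eventually] with y h1 h2 using cov_smul h1 h2 _
  unfold curvatureField
  rw [h1 Y hY, h1 X hX, cov_smul hf hσ, mvfderiv_mlieBracket (hf.contMDiffAt.of_le ENat.LEInfty.out)
    hX.mdifferentiableAt hY.mdifferentiableAt]
  module

theorem curvatureField_sum (hcov : cov.ContMDiffCovariantDerivative ∞) {ι : Type*} {s : Finset ι}
    {σ : ι → Π y : M, V y} (hσ : ∀ i ∈ s, SmoothNear I F (σ i) x) (hX : SmoothNear I E X x)
    (hY : SmoothNear I E Y x) :
    curvatureField cov X Y (fun y => ∑ i ∈ s, σ i y) x =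
      ∑ i ∈ s, curvatureField cov X Y (σ i) x := by
  classical
  induction s using Finset.induction_on with
  | empty =>
    have h := curvatureField_smul hcov (SmoothFunNear.const (I := I) (x := x) (0 : ℝ))
      (SmoothNear.zero (I := I) (F := F) (V := V) (x := x)) hX hY
    simpa using h
  | insert a s ha ih =>
    simp only [Finset.sum_insert ha]
    rw [curvatureField_add hcov (hσ a (by simp)) (SmoothNear.sum fun i hi => hσ i (by simp [hi]))
      hX hY, ih fun i hi => hσ i (by simp [hi])]

/-- The curvature of a connection depends on a section only through its value at the point. -/
theorem curvatureField_congr_section (hcov : cov.ContMDiffCovariantDerivative ∞)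
    (hσ : SmoothNear I F σ x) (hτ : SmoothNear I F τ x) (hX : SmoothNear I E X x)
    (hY : SmoothNear I E Y x) (hστ : σ x = τ x) :
    curvatureField cov X Y σ x = curvatureField cov X Y τ x := by
  let t := trivializationAt F V x
  have hx : x ∈ t.baseSet := FiberBundle.mem_baseSet_trivializationAt F V x
  let b := Module.Basis.ofVectorSpace ℝ F
  have hs : ∀ i, SmoothNear I F (t.localFrame b i) x := fun i => by
    filter_upwards [t.open_baseSet.mem_nhds hx] with y hy
    exact contMDiffAt_localFrame_of_mem ∞ _ b i hy
  have hc : ∀ {ρ : Π y : M, V y}, SmoothNear I F ρ x → ∀ i,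
      SmoothFunNear I (fun y => t.localFrameCoeff I b i y (ρ y)) x := fun hρ i => by
    filter_upwards [t.open_baseSet.mem_nhds hx, hρ] with y hy h1
    exact contMDiffAt_localFrameCoeff b hy h1 i
  have key : ∀ {ρ : Π y : M, V y}, SmoothNear I F ρ x → curvatureField cov X Y ρ x =
      ∑ i, t.localFrameCoeff I b i x (ρ x) • curvatureField cov X Y (t.localFrame b i) x := by
    intro ρ hρ
    rw [curvatureField_congr (t.eventually_eq_localFrame_sum_coeff_smul (I := I) b hx) hcov hρ hX hY,
      curvatureField_sum hcov (fun i _ => SmoothNear.smul (hc hρ i) (hs i)) hX hY]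
    exact Finset.sum_congr rfl fun i _ => curvatureField_smul hcov (hc hρ i) (hs i) hX hY
  rw [key hσ, key hτ, hστ]

theorem curvature_eq (hcov : cov.ContMDiffCovariantDerivative ∞)
    (hX : SmoothNear I E X x) (hY : SmoothNear I E Y x) (hσ : SmoothNear I F σ x) :
    curvature cov x (X x) (Y x) (σ x) = curvatureField cov X Y σ x := by
  have h : curvature cov x (X x) (Y x) (σ x) = curvatureField cov (FiberBundle.extend E (X x))
      (FiberBundle.extend E (Y x)) (FiberBundle.extend F (σ x)) x := by
    simp [curvature, curvatureField]
  have hXe : SmoothNear I E (FiberBundle.extend E (X x)) x := SmoothNear.extend _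
  have hYe : SmoothNear I E (FiberBundle.extend E (Y x)) x := SmoothNear.extend _
  have hσe : SmoothNear I F (FiberBundle.extend F (σ x)) x := SmoothNear.extend _
  rw [h, curvatureField_congr_section hcov hσe hσ hXe hYe (by simp),
    curvatureField_congr_fields hcov hσ hXe.mdifferentiableAt hYe.mdifferentiableAt
      hX.mdifferentiableAt hY.mdifferentiableAt (by simp) (by simp)]

theorem curvature_swap (hcov : cov.ContMDiffCovariantDerivative ∞) (u v : TangentSpace I x)
    (w : V x) : curvature cov x u v w = -curvature cov x v u w := by
  have hu : SmoothNear I E (FiberBundle.extend E u) x := SmoothNear.extend _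
  have hv : SmoothNear I E (FiberBundle.extend E v) x := SmoothNear.extend _
  have hw : SmoothNear I F (FiberBundle.extend F w) x := SmoothNear.extend _
  have h1 := curvature_eq hcov hu hv hw
  have h2 := curvature_eq hcov hv hu hw
  simp only [FiberBundle.extend_apply_self] at h1 h2
  rw [h1, h2, curvatureField_swap]

theorem curvature_add_left (hcov : cov.ContMDiffCovariantDerivative ∞)
    (u u' v : TangentSpace I x) (w : V x) :
    curvature cov x (u + u') v w = curvature cov x u v w + curvature cov x u' v w := by
  have hu : SmoothNear I E (FiberBundle.extend E u) x := SmoothNear.extend _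
  have hu' : SmoothNear I E (FiberBundle.extend E u') x := SmoothNear.extend _
  have hv : SmoothNear I E (FiberBundle.extend E v) x := SmoothNear.extend _
  have hw : SmoothNear I F (FiberBundle.extend F w) x := SmoothNear.extend _
  have h1 := curvature_eq hcov hu hv hw
  have h2 := curvature_eq hcov hu' hv hw
  have h3 := curvature_eq hcov (hu.add hu') hv hw
  have h4 := (tensorialAt_curvatureField (Y := FiberBundle.extend E v) hcov hw).add
    hu.mdifferentiableAt hu'.mdifferentiableAt
  simp only [FiberBundle.extend_apply_self] at h1 h2 h3
  rw [h1, h2, h3]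
  exact h4

theorem curvature_smul_left (hcov : cov.ContMDiffCovariantDerivative ∞) (c : ℝ)
    (u v : TangentSpace I x) (w : V x) :
    curvature cov x (c • u) v w = c • curvature cov x u v w := by
  have hu : SmoothNear I E (FiberBundle.extend E u) x := SmoothNear.extend _
  have hv : SmoothNear I E (FiberBundle.extend E v) x := SmoothNear.extend _
  have hw : SmoothNear I F (FiberBundle.extend F w) x := SmoothNear.extend _
  have h1 := curvature_eq hcov hu hv hw
  have h3 := curvature_eq hcov (SmoothNear.smul (SmoothFunNear.const c) hu) hv hw
  have h4 := (tensorialAt_curvatureField (Y := FiberBundle.extend E v) hcov hw).smul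
    (f := fun _ => c) mdifferentiableAt_const hu.mdifferentiableAt
  simp only [FiberBundle.extend_apply_self] at h1 h3
  rw [h1, h3]
  exact h4

theorem curvature_add (hcov : cov.ContMDiffCovariantDerivative ∞)
    (u v : TangentSpace I x) (w w' : V x) :
    curvature cov x u v (w + w') = curvature cov x u v w + curvature cov x u v w' := by
  have hu : SmoothNear I E (FiberBundle.extend E u) x := SmoothNear.extend _
  have hv : SmoothNear I E (FiberBundle.extend E v) x := SmoothNear.extend _
  have hw : SmoothNear I F (FiberBundle.extend F w) x := SmoothNear.extend _
  have hw' : SmoothNear I F (FiberBundle.extend F w') x := SmoothNear.extend _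
  have h1 := curvature_eq hcov hu hv hw
  have h2 := curvature_eq hcov hu hv hw'
  have h3 := curvature_eq hcov hu hv (hw.add hw')
  simp only [FiberBundle.extend_apply_self] at h1 h2 h3
  rw [h1, h2, h3, curvatureField_add hcov hw hw' hu hv]

end CurvatureTensor

/-- The first Bianchi identity for a connection without torsion. -/
theorem curvature_bianchi {E : Type*} [NormedAddCommGroup E] [NormedSpace ℝ E]
    [FiniteDimensional ℝ E] {H : Type*} [TopologicalSpace H] {I : ModelWithCorners ℝ E H}
    [I.Boundaryless] {M : Type*} [TopologicalSpace M] [T2Space M] [ChartedSpace H M]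
    [IsManifold I ∞ M] {cov : TangentConnection I M} (hcov : cov.ContMDiffCovariantDerivative ∞)
    (htor : cov.torsion = 0) {x : M} (u v w : TangentSpace I x) :
    curvature cov x u v w + curvature cov x v w u + curvature cov x w u v = 0 := by
  have : CompleteSpace E := FiniteDimensional.complete ℝ E
  have ht : ∀ {X Y : Π y : M, TangentSpace I y} {y : M},
      MDifferentiableAt I I.tangent (fun y => (⟨y, X y⟩ : TangentBundle I M)) y →
      MDifferentiableAt I I.tangent (fun y => (⟨y, Y y⟩ : TangentBundle I M)) y →
      cov Y y (X y) - cov X y (Y y) = VectorField.mlieBracket I X Y y :=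
    fun hX hY => cov.torsion_eq_zero_iff.1 htor hX hY
  have key : ∀ {X Y Z : Π y : M, TangentSpace I y}, SmoothNear I E X x → SmoothNear I E Y x →
      SmoothNear I E Z x →
      curvatureField cov X Y Z x + curvatureField cov Y Z X x + curvatureField cov Z X Y x = 0 := by
    intro X Y Z hX hY hZ
    have hb : ∀ {A B C : Π y : M, TangentSpace I y}, SmoothNear I E A x → SmoothNear I E B x →
        SmoothNear I E C x → cov (fun y => cov B y (A y)) x (C x) -
          cov (fun y => cov A y (B y)) x (C x) =
        cov (fun y => VectorField.mlieBracket I A B y) x (C x) := by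
      intro A B C hA hB hC
      rw [← cov_sub (hB.covariantDerivative hcov hA) (hA.covariantDerivative hcov hB)]
      refine congrArg (fun L => L (C x)) (cov_congr ?_ ((hB.covariantDerivative hcov hA).sub
        (hA.covariantDerivative hcov hB)))
      filter_upwards [hA, hB] with y h1 h2
      exact ht (h1.mdifferentiableAt (by simp)) (h2.mdifferentiableAt (by simp))
    have h1 := hb hX hY hZ
    have h2 := hb hY hZ hX
    have h3 := hb hX hZ hY
    have t1 := ht (hX.mlieBracket hY).mdifferentiableAt hZ.mdifferentiableAt
    have t2 := ht (hY.mlieBracket hZ).mdifferentiableAt hX.mdifferentiableAt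
    have t3 := ht (hX.mlieBracket hZ).mdifferentiableAt hY.mdifferentiableAt
    have : IsManifold I (minSmoothness ℝ 3) M := by
      rw [minSmoothness_of_isRCLikeNormedField]
      exact IsManifold.of_le (n := ∞) (WithTop.coe_le_coe.2 le_top)
    have hm : minSmoothness ℝ 2 ≤ ∞ := by
      rw [minSmoothness_of_isRCLikeNormedField]; exact ENat.LEInfty.out
    have hj := VectorField.leibniz_identity_mlieBracket_apply (hX.contMDiffAt.of_le hm)
      (hY.contMDiffAt.of_le hm) (hZ.contMDiffAt.of_le hm)
    rw [VectorField.mlieBracket_swap_apply (V := X) (W := VectorField.mlieBracket I Y Z),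
      VectorField.mlieBracket_swap_apply (V := Y) (W := VectorField.mlieBracket I X Z)] at hj
    unfold curvatureField
    rw [VectorField.mlieBracket_swap_apply (V := Z) (W := X), map_neg]
    linear_combination (norm := module) h1 + h2 - h3 - t1 - t2 + t3 + hj
  have hu : SmoothNear I E (FiberBundle.extend E u) x := SmoothNear.extend _
  have hv : SmoothNear I E (FiberBundle.extend E v) x := SmoothNear.extend _
  have hw : SmoothNear I E (FiberBundle.extend E w) x := SmoothNear.extend _
  have h1 := curvature_eq hcov hu hv hw
  have h2 := curvature_eq hcov hv hw hu
  have h3 := curvature_eq hcov hw hu hv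
  simp only [FiberBundle.extend_apply_self] at h1 h2 h3
  rw [h1, h2, h3]
  exact key hu hv hw

/-! ### Hermitian bundles -/

section Hermitian

open Filter Topology VectorField

variable {E : Type*} [NormedAddCommGroup E] [NormedSpace ℝ E] [FiniteDimensional ℝ E]
  {H : Type*} [TopologicalSpace H] {I : ModelWithCorners ℝ E H} [I.Boundaryless]
  {M : Type*} [TopologicalSpace M] [T2Space M] [ChartedSpace H M] [IsManifold I ∞ M]
  {F : Type*} [NormedAddCommGroup F] [NormedSpace ℂ F] [FiniteDimensional ℂ F]
  {V : M → Type*} [TopologicalSpace (TotalSpace F V)]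
  [∀ x, NormedAddCommGroup (V x)] [∀ x, InnerProductSpace ℂ (V x)]
  [FiberBundle F V] [VectorBundle ℂ F V] [VectorBundle ℝ F V]
  [ContMDiffVectorBundle ∞ F V I]
  {covE : CovariantDerivative I F V} {σ τ : Π x : M, V x} {x : M}

theorem SmoothNear.I_smul (hσ : SmoothNear I F σ x) :
    SmoothNear I F (fun y => Complex.I • σ y) x := by
  filter_upwards [hσ] with y hy
  rw [contMDiffAt_section] at hy ⊢
  have h1 : ContMDiffAt I 𝓘(ℝ, F) ∞
      (fun z => Complex.I • (trivializationAt F V y ⟨z, σ z⟩).2) y := by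
    have h2 := (((Complex.I • ContinuousLinearMap.id ℂ F).restrictScalars ℝ).contDiff
      (n := ∞)).contMDiff.contMDiffAt.comp y hy
    exact h2
  refine h1.congr_of_eventuallyEq ?_
  filter_upwards [(trivializationAt F V y).open_baseSet.mem_nhds
    (FiberBundle.mem_baseSet_trivializationAt F V y)] with z hz
  exact ((trivializationAt F V y).linear ℂ hz).map_smul Complex.I (σ z)

theorem SmoothNear.complex_smul {f : M → ℂ} (hf : SmoothFunNear I f x)
    (hσ : SmoothNear I F σ x) : SmoothNear I F (fun y => f y • σ y) x := by
  refine (SmoothNear.add (SmoothNear.smul (hf.clm_comp Complex.reCLM) hσ)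
    (SmoothNear.smul (hf.clm_comp Complex.imCLM) hσ.I_smul)).congr (Eventually.of_forall ?_)
  intro y
  simp only [Complex.reCLM_apply, Complex.imCLM_apply]
  conv_lhs => rw [← Complex.re_add_im (f y), add_smul, mul_smul]
  simp only [Complex.coe_smul]

theorem cov_complex_smul (hcovE : IsMetricConnection covE) {f : M → ℂ}
    (hf : SmoothFunNear I f x) (hσ : SmoothNear I F σ x) (v : TangentSpace I x) :
    covE (fun y => f y • σ y) x v = f x • covE σ x v + mvfderiv I f x v • σ x := by
  have h1 : (fun y => f y • σ y) = fun y => (f y).re • σ y + (f y).im • Complex.I • σ y := by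
    ext y
    conv_lhs => rw [← Complex.re_add_im (f y), add_smul, mul_smul]
    simp only [Complex.coe_smul]
  have hre : SmoothFunNear I (fun y => (f y).re) x := hf.clm_comp Complex.reCLM
  have him : SmoothFunNear I (fun y => (f y).im) x := hf.clm_comp Complex.imCLM
  have h2 : mvfderiv I (fun y => (f y).re) x v = (mvfderiv I f x v).re :=
    mvfderiv_comp_clm Complex.reCLM hf.mdifferentiableAt v
  have h3 : mvfderiv I (fun y => (f y).im) x v = (mvfderiv I f x v).im :=
    mvfderiv_comp_clm Complex.imCLM hf.mdifferentiableAt v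
  rw [h1, cov_add (SmoothNear.smul hre hσ) (SmoothNear.smul him hσ.I_smul), cov_smul hre hσ,
    cov_smul him hσ.I_smul, hcovE.complex_linear σ x hσ.mdifferentiableAt, h2, h3]
  conv_rhs => rw [← Complex.re_add_im (f x), ← Complex.re_add_im (mvfderiv I f x v)]
  simp only [add_smul, mul_smul, Complex.coe_smul]
  abel

theorem cov_complex_const_smul (hcovE : IsMetricConnection covE) (c : ℂ)
    (hσ : SmoothNear I F σ x) (v : TangentSpace I x) :
    covE (fun y => c • σ y) x v = c • covE σ x v := by
  rw [cov_complex_smul hcovE (SmoothFunNear.const c) hσ, mvfderiv_const]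
  simp

theorem curvature_complex_smul (hcovE : IsMetricConnection covE) (c : ℂ)
    (u v : TangentSpace I x) (w : V x) :
    curvature covE x u v (c • w) = c • curvature covE x u v w := by
  have hu : SmoothNear I E (FiberBundle.extend E u) x := SmoothNear.extend _
  have hv : SmoothNear I E (FiberBundle.extend E v) x := SmoothNear.extend _
  have hw : SmoothNear I F (FiberBundle.extend F w) x := SmoothNear.extend _
  have h1 := curvature_eq hcovE.smooth hu hv hw
  have h3 := curvature_eq hcovE.smooth hu hv
    (SmoothNear.complex_smul (SmoothFunNear.const c) hw)
  simp only [FiberBundle.extend_apply_self] at h1 h3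
  have h4 : ∀ {Z : Π y : M, TangentSpace I y}, SmoothNear I E Z x → ∀ v : TangentSpace I x,
      covE (fun y => covE (fun y => c • FiberBundle.extend F w y) y (Z y)) x v =
        c • covE (fun y => covE (FiberBundle.extend F w) y (Z y)) x v := by
    intro Z hZ v
    rw [← cov_complex_const_smul hcovE c (hw.covariantDerivative hcovE.smooth hZ)]
    refine congrArg (fun L => L v) (cov_congr ?_
      ((SmoothNear.complex_smul (SmoothFunNear.const c) hw).covariantDerivative hcovE.smooth hZ))
    filter_upwards [hw.eventually] with y hy using cov_complex_const_smul hcovE c hy _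
  rw [h1, h3]
  unfold curvatureField
  rw [h4 hv, h4 hu, cov_complex_const_smul hcovE c hw]
  module

theorem smoothFunNear_inner (hV : IsSmoothHermitian I F V) (hσ : SmoothNear I F σ x)
    (hτ : SmoothNear I F τ x) : SmoothFunNear I (fun y => inner ℂ (σ y) (τ y)) x := by
  filter_upwards [hσ, hτ] with y h1 h2 using hV σ τ y h1 h2

/-- The curvature of a metric connection is skew-Hermitian. -/
theorem inner_curvature (hV : IsSmoothHermitian I F V) (hcovE : IsMetricConnection covE)
    (u v : TangentSpace I x) (w w' : V x) :
    inner ℂ (curvature covE x u v w) w' = -inner ℂ w (curvature covE x u v w') := by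
  have : CompleteSpace E := FiniteDimensional.complete ℝ E
  have key : ∀ {X Y : Π y : M, TangentSpace I y} {σ τ : Π y : M, V y}, SmoothNear I E X x →
      SmoothNear I E Y x →
      SmoothNear I F σ x → SmoothNear I F τ x →
      inner ℂ (curvatureField covE X Y σ x) (τ x) = -inner ℂ (σ x) (curvatureField covE X Y τ x) := by
    intro X Y σ τ hX hY hσ hτ
    have hd : ∀ {Z : Π y : M, TangentSpace I y}, SmoothNear I E Z x → ∀ v : TangentSpace I x,
        mvfderiv I (fun y => mvfderiv I (fun y => inner ℂ (σ y) (τ y)) y (Z y)) x v =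
          inner ℂ (covE (fun y => covE σ y (Z y)) x v) (τ x) + inner ℂ (covE σ x (Z x)) (covE τ x v)
          + (inner ℂ (covE σ x v) (covE τ x (Z x)) +
            inner ℂ (σ x) (covE (fun y => covE τ y (Z y)) x v)) := by
      intro Z hZ v
      have h1 := hσ.covariantDerivative hcovE.smooth hZ
      have h2 := hτ.covariantDerivative hcovE.smooth hZ
      have h3 : (fun y => mvfderiv I (fun y => inner ℂ (σ y) (τ y)) y (Z y)) =ᶠ[𝓝 x]
          fun y => inner ℂ (covE σ y (Z y)) (τ y) + inner ℂ (σ y) (covE τ y (Z y)) := by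
        filter_upwards [hσ.eventually, hτ.eventually] with y hy hy'
        exact hcovE.metric σ τ y hy.mdifferentiableAt hy'.mdifferentiableAt _
      rw [mvfderiv_congr h3]
      have h4 := mvfderiv_add (smoothFunNear_inner hV h1 hτ).mdifferentiableAt
        (smoothFunNear_inner hV hσ h2).mdifferentiableAt
      have h5 := congrArg (fun L => L v) h4
      refine h5.trans ?_
      rw [add_apply, hcovE.metric _ _ x h1.mdifferentiableAt hτ.mdifferentiableAt,
        hcovE.metric _ _ x hσ.mdifferentiableAt h2.mdifferentiableAt]
    have hb := mvfderiv_mlieBracket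
      ((smoothFunNear_inner hV hσ hτ).contMDiffAt.of_le ENat.LEInfty.out)
      hX.mdifferentiableAt hY.mdifferentiableAt
    rw [hd hX, hd hY, hcovE.metric σ τ x hσ.mdifferentiableAt hτ.mdifferentiableAt] at hb
    unfold curvatureField
    simp only [inner_sub_left, inner_sub_right]
    linear_combination -hb
  have hu : SmoothNear I E (FiberBundle.extend E u) x := SmoothNear.extend _
  have hv : SmoothNear I E (FiberBundle.extend E v) x := SmoothNear.extend _
  have hw : SmoothNear I F (FiberBundle.extend F w) x := SmoothNear.extend _
  have hw' : SmoothNear I F (FiberBundle.extend F w') x := SmoothNear.extend _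
  have h1 := curvature_eq hcovE.smooth hu hv hw
  have h2 := curvature_eq hcovE.smooth hu hv hw'
  simp only [FiberBundle.extend_apply_self] at h1 h2
  rw [h1, h2]
  simpa using key hu hv hw hw'

end Hermitian

/-! ### Orthonormal frames -/

section Frames

open Filter Topology

variable {d : ℕ} {E : Type*} [NormedAddCommGroup E] [NormedSpace ℝ E] [FiniteDimensional ℝ E]
  {H : Type*} [TopologicalSpace H] {I : ModelWithCorners ℝ E H} [I.Boundaryless]
  {M : Type*} [TopologicalSpace M] [T2Space M] [ChartedSpace H M] [IsManifold I ∞ M]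
  {g : Metric I M} {x : M}

theorem IsOrthonormalFrame.linearIndependent {e : VecIdx d → TangentSpace I x}
    (he : IsOrthonormalFrame g x e) : LinearIndependent ℝ e := by
  rw [Fintype.linearIndependent_iff]
  intro c hc k
  have h := congrArg (fun v => g.inner x v (e k)) hc
  simpa [he _ _] using h

theorem IsOrthonormalFrame.span_eq_top {e : VecIdx d → TangentSpace I x}
    (he : IsOrthonormalFrame g x e) (hdim : Module.finrank ℝ E = 2 * d) :
    Submodule.span ℝ (range e) = ⊤ := by
  have : FiniteDimensional ℝ (TangentSpace I x) := inferInstanceAs (FiniteDimensional ℝ E)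
  refine he.linearIndependent.span_eq_top_of_card_eq_finrank' ?_
  change _ = Module.finrank ℝ E
  rw [hdim]
  simp [mul_comm]

/-- The orthonormal basis of the tangent space given by an orthonormal frame. -/
def IsOrthonormalFrame.basis {e : VecIdx d → TangentSpace I x}
    (he : IsOrthonormalFrame g x e) (hdim : Module.finrank ℝ E = 2 * d) :
    Module.Basis (VecIdx d) ℝ (TangentSpace I x) :=
  Module.Basis.mk he.linearIndependent (he.span_eq_top hdim).ge

theorem IsOrthonormalFrame.basis_apply {e : VecIdx d → TangentSpace I x}
    (he : IsOrthonormalFrame g x e) (hdim : Module.finrank ℝ E = 2 * d) (k : VecIdx d) :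
    he.basis hdim k = e k := by simp [basis]

theorem IsOrthonormalFrame.basis_repr {e : VecIdx d → TangentSpace I x}
    (he : IsOrthonormalFrame g x e) (hdim : Module.finrank ℝ E = 2 * d) (v : TangentSpace I x)
    (k : VecIdx d) : (he.basis hdim).repr v k = g.inner x v (e k) := by
  conv_rhs => rw [← (he.basis hdim).sum_repr v]
  simp [he.basis_apply hdim, he _ _]

theorem IsOrthonormalFrame.expand {e : VecIdx d → TangentSpace I x}
    (he : IsOrthonormalFrame g x e) (hdim : Module.finrank ℝ E = 2 * d) (v : TangentSpace I x) :
    v = ∑ k, g.inner x v (e k) • e k := by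
  conv_lhs => rw [← (he.basis hdim).sum_repr v]
  simp only [he.basis_repr, he.basis_apply]

theorem IsOrthonormalFrame.inner_eq_sum {e : VecIdx d → TangentSpace I x}
    (he : IsOrthonormalFrame g x e) (hdim : Module.finrank ℝ E = 2 * d)
    (v w : TangentSpace I x) :
    g.inner x v w = ∑ k, g.inner x v (e k) * g.inner x w (e k) := by
  conv_lhs => rw [he.expand hdim w]
  simp [mul_comm]

theorem IsOrthonormalFrame.trace_eq_sum {e : VecIdx d → TangentSpace I x}
    (he : IsOrthonormalFrame g x e) (hdim : Module.finrank ℝ E = 2 * d)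
    (L : TangentSpace I x →ₗ[ℝ] TangentSpace I x) :
    LinearMap.trace ℝ _ L = ∑ k, g.inner x (L (e k)) (e k) := by
  rw [LinearMap.trace_eq_matrix_trace ℝ (he.basis hdim), Matrix.trace]
  refine Finset.sum_congr rfl fun k _ => ?_
  rw [Matrix.diag_apply, LinearMap.toMatrix_apply, he.basis_repr, he.basis_apply]

theorem smoothFunNear_metric {X Y : Π y : M, TangentSpace I y} (hX : SmoothNear I E X x)
    (hY : SmoothNear I E Y x) : SmoothFunNear I (fun y => g.inner y (X y) (Y y)) x := by
  filter_upwards [hX, hY] with y h1 h2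
  have h3 := ContMDiffAt.clm_bundle_apply₂ (F₃ := ℝ) (E₃ := Bundle.Trivial M ℝ) (b := id)
    (ψ := fun y => g.inner y) (v := X) (w := Y) g.contMDiff.contMDiffAt h1 h2
  exact (contMDiffAt_section y).1 h3

end Frames

section SpinConnection

open Filter Topology

variable {d : ℕ} {E : Type*} [NormedAddCommGroup E] [NormedSpace ℝ E] [FiniteDimensional ℝ E]
  {H : Type*} [TopologicalSpace H] {I : ModelWithCorners ℝ E H} [I.Boundaryless]
  {M : Type*} [TopologicalSpace M] [T2Space M] [ChartedSpace H M] [IsManifold I ∞ M]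
  {g : Metric I M} {ι : Type*} (S : SpinStructure d g ι) (cov : TangentConnection I M)
  {x : M} {i : ι}

namespace SpinStructure

theorem smoothNear_frame (hx : x ∈ S.U i) (k : VecIdx d) : SmoothNear I E (S.frame i k) x :=
  SmoothNear.of_contMDiffOn (S.isOpen_U i) (S.frame_smooth i k) hx

theorem eventually_mem (hx : x ∈ S.U i) : ∀ᶠ y in 𝓝 x, y ∈ S.U i := (S.isOpen_U i).mem_nhds hx

/-- The connection coefficients `g(∇_X e_k, e_l)` of the Levi-Civita connection. -/
def connCoeff (i : ι) (x : M) (X : TangentSpace I x) (k l : VecIdx d) : ℝ :=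
  g.inner x (cov (S.frame i k) x X) (S.frame i l x)

/-- The connection form of the spinor bundle. -/
def connMatrix (i : ι) (x : M) (X : TangentSpace I x) : SpinorMatrix d :=
  (1 / 4 : ℂ) • bivector (S.connCoeff cov i x X)

variable {cov}

theorem connCoeff_skew (hcov : IsLeviCivita g cov) (hx : x ∈ S.U i) (X : TangentSpace I x)
    (k l : VecIdx d) : S.connCoeff cov i x X k l = -S.connCoeff cov i x X l k := by
  have h := hcov.metric _ _ x (S.smoothNear_frame hx k).mdifferentiableAt
    (S.smoothNear_frame hx l).mdifferentiableAt X
  have h1 : (fun y => g.inner y (S.frame i k y) (S.frame i l y)) =ᶠ[𝓝 x]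
      fun _ => if k = l then 1 else 0 := by
    filter_upwards [S.eventually_mem hx] with y hy using S.frame_orthonormal i y hy k l
  rw [mvfderiv_congr h1, mvfderiv_const] at h
  unfold connCoeff
  rw [g.symm x (S.frame i k x)] at h
  simp only [zero_apply] at h
  linarith

theorem connCoeff_add (X Y : TangentSpace I x) (k l : VecIdx d) :
    S.connCoeff cov i x (X + Y) k l = S.connCoeff cov i x X k l + S.connCoeff cov i x Y k l := by
  simp [connCoeff]

theorem connCoeff_smul (c : ℝ) (X : TangentSpace I x) (k l : VecIdx d) :
    S.connCoeff cov i x (c • X) k l = c * S.connCoeff cov i x X k l := by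
  simp [connCoeff]

theorem smoothFunNear_connCoeff (hcov : IsLeviCivita g cov) (hx : x ∈ S.U i)
    {X : Π y : M, TangentSpace I y} (hX : SmoothNear I E X x) (k l : VecIdx d) :
    SmoothFunNear I (fun y => S.connCoeff cov i y (X y) k l) x :=
  smoothFunNear_metric ((S.smoothNear_frame hx k).covariantDerivative hcov.smooth hX)
    (S.smoothNear_frame hx l)

theorem cov_frame (hdim : Module.finrank ℝ E = 2 * d) (hx : x ∈ S.U i) (X : TangentSpace I x)
    (k : VecIdx d) :
    cov (S.frame i k) x X = ∑ l, S.connCoeff cov i x X k l • S.frame i l x :=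
  (S.frame_orthonormal i x hx).expand hdim _

theorem connMatrix_add (X Y : TangentSpace I x) :
    S.connMatrix cov i x (X + Y) = S.connMatrix cov i x X + S.connMatrix cov i x Y := by
  simp only [connMatrix, bivector, connCoeff_add, ← smul_add, ← Finset.sum_add_distrib]
  push_cast
  simp only [add_smul]

theorem connMatrix_smul (c : ℝ) (X : TangentSpace I x) :
    S.connMatrix cov i x (c • X) = (c : ℂ) • S.connMatrix cov i x X := by
  simp only [connMatrix, bivector, connCoeff_smul]
  rw [smul_comm, Finset.smul_sum]
  simp only [Finset.smul_sum, smul_smul]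
  push_cast
  rfl

theorem connMatrix_commutator_gamma (hcov : IsLeviCivita g cov) (hx : x ∈ S.U i)
    (X : TangentSpace I x) (m : VecIdx d) :
    S.connMatrix cov i x X * gamma m - gamma m * S.connMatrix cov i x X =
      ∑ c, ((S.connCoeff cov i x X m c : ℝ) : ℂ) • gamma c := by
  rw [connMatrix, smul_mul_assoc, mul_smul_comm, ← smul_sub,
    bivector_commutator_gamma (S.connCoeff_skew hcov hx X), smul_smul]
  norm_num

theorem conjTranspose_connMatrix (hcov : IsLeviCivita g cov) (hx : x ∈ S.U i)
    (X : TangentSpace I x) :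
    (S.connMatrix cov i x X).conjTranspose = -S.connMatrix cov i x X := by
  rw [connMatrix, Matrix.conjTranspose_smul, conjTranspose_bivector (S.connCoeff_skew hcov hx X)]
  simp

theorem trace_connMatrix (hcov : IsLeviCivita g cov) (hx : x ∈ S.U i) (X : TangentSpace I x) :
    (S.connMatrix cov i x X).trace = 0 := by
  rw [connMatrix, Matrix.trace_smul, trace_bivector (S.connCoeff_skew hcov hx X), smul_zero]

end SpinStructure

/-! ### The connection of the twisted spinor bundle -/

/-- The entries of the matrix-valued function `B` are smooth near `x`. -/
def SmoothMatrixNear (I : ModelWithCorners ℝ E H) (B : M → SpinorMatrix d) (x : M) : Prop :=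
  ∀ a b, SmoothFunNear I (fun y => B y a b) x

/-- The derivative of a matrix-valued function along a tangent vector. -/
def matrixDeriv (I : ModelWithCorners ℝ E H) (B : M → SpinorMatrix d) (x : M)
    (X : TangentSpace I x) : SpinorMatrix d :=
  Matrix.of fun a b => mvfderiv I (fun y => B y a b) x X

section Matrix

variable {B C : M → SpinorMatrix d}

theorem SmoothMatrixNear.const (A : SpinorMatrix d) : SmoothMatrixNear I (fun _ : M => A) x :=
  fun _ _ => SmoothFunNear.const _

theorem SmoothMatrixNear.add (hB : SmoothMatrixNear I B x) (hC : SmoothMatrixNear I C x) :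
    SmoothMatrixNear I (fun y => B y + C y) x := fun a b => (hB a b).add (hC a b)

theorem SmoothMatrixNear.mul (hB : SmoothMatrixNear I B x) (hC : SmoothMatrixNear I C x) :
    SmoothMatrixNear I (fun y => B y * C y) x := fun a b => by
  simp only [Matrix.mul_apply]
  exact SmoothFunNear.sum fun c _ => (hB a c).mul (hC c b)

theorem SmoothMatrixNear.smul {f : M → ℂ} (hf : SmoothFunNear I f x)
    (hB : SmoothMatrixNear I B x) : SmoothMatrixNear I (fun y => f y • B y) x := fun a b => by
  simp only [Matrix.smul_apply, smul_eq_mul]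
  exact hf.mul (hB a b)

theorem SmoothMatrixNear.sum {κ : Type*} {t : Finset κ} {B : κ → M → SpinorMatrix d}
    (hB : ∀ k ∈ t, SmoothMatrixNear I (B k) x) :
    SmoothMatrixNear I (fun y => ∑ k ∈ t, B k y) x := fun a b => by
  simp only [Matrix.sum_apply]
  exact SmoothFunNear.sum fun c hc => hB c hc a b

theorem mvfderiv_fun_mul {f h : M → ℂ} (hf : SmoothFunNear I f x) (hh : SmoothFunNear I h x)
    (X : TangentSpace I x) : mvfderiv I (fun y => f y * h y) x X =
      f x * mvfderiv I h x X + mvfderiv I f x X * h x := by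
  have h1 := HasMFDerivAt.mul' (hf.mdifferentiableAt.hasMFDerivAt)
    (hh.mdifferentiableAt.hasMFDerivAt)
  have h2 := congrArg (fun L => L X) h1.mfderiv
  exact h2

theorem mvfderiv_fun_sum {G : Type*} [NormedAddCommGroup G] [NormedSpace ℝ G] {κ : Type*}
    {t : Finset κ} {f : κ → M → G}
    (hf : ∀ k ∈ t, SmoothFunNear I (f k) x) (X : TangentSpace I x) :
    mvfderiv I (fun y => ∑ k ∈ t, f k y) x X = ∑ k ∈ t, mvfderiv I (f k) x X := by
  classical
  induction t using Finset.induction_on with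
  | empty =>
    simp only [Finset.sum_empty]
    rw [mvfderiv_const]
    rfl
  | insert a s ha ih =>
    simp only [Finset.sum_insert ha]
    rw [← ih fun k hk => hf k (by simp [hk])]
    exact congrArg (fun L => L X) (mvfderiv_add (hf a (by simp)).mdifferentiableAt
      (SmoothFunNear.sum (s := s) fun k hk => hf k (Finset.mem_insert_of_mem hk)).mdifferentiableAt)

theorem matrixDeriv_const (A : SpinorMatrix d) (X : TangentSpace I x) :
    matrixDeriv I (fun _ : M => A) x X = 0 := by
  ext a b
  simp [matrixDeriv, mvfderiv_const]

theorem matrixDeriv_congr (h : B =ᶠ[𝓝 x] C) (X : TangentSpace I x) :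
    matrixDeriv I B x X = matrixDeriv I C x X := by
  ext a b
  simp only [matrixDeriv, Matrix.of_apply]
  rw [mvfderiv_congr]
  filter_upwards [h] with y hy
  rw [hy]

theorem matrixDeriv_mul (hB : SmoothMatrixNear I B x) (hC : SmoothMatrixNear I C x)
    (X : TangentSpace I x) : matrixDeriv I (fun y => B y * C y) x X =
      B x * matrixDeriv I C x X + matrixDeriv I B x X * C x := by
  ext a b
  simp only [matrixDeriv, Matrix.of_apply, Matrix.mul_apply, Matrix.add_apply]
  rw [mvfderiv_fun_sum fun c _ => (hB a c).mul (hC c b), ← Finset.sum_add_distrib]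
  exact Finset.sum_congr rfl fun c _ => mvfderiv_fun_mul (hB a c) (hC c b) X

theorem matrixDeriv_smul_const {f : M → ℝ} (hf : SmoothFunNear I f x) (A : SpinorMatrix d)
    (X : TangentSpace I x) :
    matrixDeriv I (fun y => ((f y : ℝ) : ℂ) • A) x X = ((mvfderiv I f x X : ℝ) : ℂ) • A := by
  ext a b
  simp only [matrixDeriv, Matrix.of_apply, Matrix.smul_apply, smul_eq_mul]
  have h1 : SmoothFunNear I (fun y => ((f y : ℝ) : ℂ)) x := hf.clm_comp Complex.ofRealCLM
  rw [mvfderiv_fun_mul h1 (SmoothFunNear.const _), mvfderiv_const]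
  have h2 : mvfderiv I (fun y => ((f y : ℝ) : ℂ)) x X = ((mvfderiv I f x X : ℝ) : ℂ) :=
    mvfderiv_comp_clm Complex.ofRealCLM hf.mdifferentiableAt X
  rw [h2]
  simp

theorem matrixDeriv_sum {κ : Type*} {t : Finset κ} {B : κ → M → SpinorMatrix d}
    (hB : ∀ k ∈ t, SmoothMatrixNear I (B k) x) (X : TangentSpace I x) :
    matrixDeriv I (fun y => ∑ k ∈ t, B k y) x X = ∑ k ∈ t, matrixDeriv I (B k) x X := by
  ext a b
  simp only [matrixDeriv, Matrix.of_apply, Matrix.sum_apply]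
  exact mvfderiv_fun_sum (fun k hk => hB k hk a b) X

end Matrix

end SpinConnection

section TwistedConnection

open Filter Topology

variable {d : ℕ} {E : Type*} [NormedAddCommGroup E] [NormedSpace ℝ E] [FiniteDimensional ℝ E]
  {H : Type*} [TopologicalSpace H] {I : ModelWithCorners ℝ E H} [I.Boundaryless]
  {M : Type*} [TopologicalSpace M] [T2Space M] [ChartedSpace H M] [IsManifold I ∞ M]
  {g : Metric I M} {ι : Type*} (S : SpinStructure d g ι) {cov : TangentConnection I M}
  {F : Type*} [NormedAddCommGroup F] [NormedSpace ℂ F] [FiniteDimensional ℂ F]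
  {V : M → Type*} [TopologicalSpace (TotalSpace F V)]
  [∀ x, NormedAddCommGroup (V x)] [∀ x, InnerProductSpace ℂ (V x)]
  [FiberBundle F V] [VectorBundle ℂ F V] [VectorBundle ℝ F V]
  [ContMDiffVectorBundle ∞ F V I]
  {covE : CovariantDerivative I F V} {x : M} {i : ι}

/-- The components of the local spinor field `φ` are smooth near `x`. -/
def SmoothSpinorNear (I : ModelWithCorners ℝ E H) (F : Type*) [NormedAddCommGroup F]
    [NormedSpace ℂ F] {V : M → Type*} [TopologicalSpace (TotalSpace F V)]
    [∀ x, NormedAddCommGroup (V x)] [∀ x, InnerProductSpace ℂ (V x)] [FiberBundle F V]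
    (φ : Π y : M, SpinorIdx d → V y) (x : M) : Prop :=
  ∀ a, SmoothNear I F (fun y => φ y a) x

variable {φ χ : Π y : M, SpinorIdx d → V y} {B : M → SpinorMatrix d}

namespace SmoothSpinorNear

theorem add (hφ : SmoothSpinorNear I F φ x) (hχ : SmoothSpinorNear I F χ x) :
    SmoothSpinorNear I F (fun y => φ y + χ y) x := fun a => (hφ a).add (hχ a)

theorem sum {κ : Type*} {t : Finset κ} {φ : κ → Π y : M, SpinorIdx d → V y}
    (hφ : ∀ k ∈ t, SmoothSpinorNear I F (φ k) x) :
    SmoothSpinorNear I F (fun y => ∑ k ∈ t, φ k y) x := fun a => by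
  simp only [Finset.sum_apply]
  exact SmoothNear.sum fun k hk => hφ k hk a

theorem smul {f : M → ℂ} (hf : SmoothFunNear I f x) (hφ : SmoothSpinorNear I F φ x) :
    SmoothSpinorNear I F (fun y => f y • φ y) x := fun a => SmoothNear.complex_smul hf (hφ a)

theorem act (hB : SmoothMatrixNear I B x) (hφ : SmoothSpinorNear I F φ x) :
    SmoothSpinorNear I F (fun y => KaehlerSpin.act (B y) (φ y)) x := fun a =>
  SmoothNear.sum fun b _ => SmoothNear.complex_smul (hB a b) (hφ b)

theorem act_const (A : SpinorMatrix d) (hφ : SmoothSpinorNear I F φ x) :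
    SmoothSpinorNear I F (fun y => KaehlerSpin.act A (φ y)) x :=
  act (SmoothMatrixNear.const A) hφ

theorem congr (hφ : SmoothSpinorNear I F φ x) (h : ∀ᶠ y in 𝓝 x, χ y = φ y) :
    SmoothSpinorNear I F χ x := fun a => (hφ a).congr (h.mono fun y hy => by rw [hy])

theorem ip (hV : IsSmoothHermitian I F V) (hφ : SmoothSpinorNear I F φ x)
    (hχ : SmoothSpinorNear I F χ x) : SmoothFunNear I (fun y => KaehlerSpin.ip (φ y) (χ y)) x :=
  SmoothFunNear.sum fun a _ => smoothFunNear_inner hV (hφ a) (hχ a)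

end SmoothSpinorNear

namespace SpinStructure

variable (cov covE)

/-- The connection of `ΣM ⊗ E` on local spinor fields, in the spin frame over `U i`. -/
def nabla (i : ι) (φ : Π y : M, SpinorIdx d → V y) (x : M) (X : TangentSpace I x) :
    SpinorIdx d → V x :=
  (fun a => covE (fun y => φ y a) x X) + act (S.connMatrix cov i x X) (φ x)

/-- The twisted Dirac operator on local spinor fields, in the spin frame over `U i`. -/
def localDirac (i : ι) (φ : Π y : M, SpinorIdx d → V y) (x : M) : SpinorIdx d → V x :=
  ∑ k, act (gamma k) (S.nabla cov covE i φ x (S.frame i k x))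

theorem dirac_eq_localDirac (ψ : LocalSpinor d ι V) (i : ι) :
    S.dirac cov covE ψ i = S.localDirac cov covE i (ψ i) := rfl

variable {cov covE}

theorem nabla_congr (hφ : SmoothSpinorNear I F φ x) (h : ∀ᶠ y in 𝓝 x, φ y = χ y)
    (X : TangentSpace I x) : S.nabla cov covE i φ x X = S.nabla cov covE i χ x X := by
  unfold nabla
  rw [h.self_of_nhds]
  congr 1
  funext a
  rw [cov_congr (h.mono fun y hy => by rw [hy]) (hφ a)]

theorem nabla_add_vector (X Y : TangentSpace I x) :
    S.nabla cov covE i φ x (X + Y) = S.nabla cov covE i φ x X + S.nabla cov covE i φ x Y := by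
  unfold nabla
  rw [connMatrix_add, add_act]
  ext a
  simp only [Pi.add_apply, map_add]
  abel

theorem nabla_smul_vector (c : ℝ) (X : TangentSpace I x) :
    S.nabla cov covE i φ x (c • X) = (c : ℂ) • S.nabla cov covE i φ x X := by
  unfold nabla
  rw [connMatrix_smul, smul_act, smul_add]
  congr 1
  ext a
  simp only [Pi.smul_apply, map_smul, Complex.coe_smul]

/-- `∇φ` as a linear map on tangent vectors. -/
def nablaHom (i : ι) (φ : Π y : M, SpinorIdx d → V y) (x : M) :
    TangentSpace I x →ₗ[ℝ] (SpinorIdx d → V x) where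
  toFun := S.nabla cov covE i φ x
  map_add' := S.nabla_add_vector
  map_smul' c X := by
    rw [nabla_smul_vector]
    ext a
    simp only [Pi.smul_apply, Complex.coe_smul, RingHom.id_apply]

theorem nabla_sum_vector {κ : Type*} (t : Finset κ) (X : κ → TangentSpace I x) :
    S.nabla cov covE i φ x (∑ k ∈ t, X k) = ∑ k ∈ t, S.nabla cov covE i φ x (X k) :=
  map_sum (S.nablaHom (cov := cov) (covE := covE) i φ x) X t

theorem nabla_sub_vector (X Y : TangentSpace I x) :
    S.nabla cov covE i φ x (X - Y) = S.nabla cov covE i φ x X - S.nabla cov covE i φ x Y :=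
  map_sub (S.nablaHom (cov := cov) (covE := covE) i φ x) X Y

theorem smoothMatrixNear_connMatrix (hcov : IsLeviCivita g cov) (hx : x ∈ S.U i)
    {X : Π y : M, TangentSpace I y} (hX : SmoothNear I E X x) :
    SmoothMatrixNear I (fun y => S.connMatrix cov i y (X y)) x := by
  refine SmoothMatrixNear.smul (SmoothFunNear.const _) ?_
  refine SmoothMatrixNear.sum fun k _ => SmoothMatrixNear.sum fun l _ => ?_
  exact SmoothMatrixNear.smul ((S.smoothFunNear_connCoeff hcov hx hX k l).clm_comp
    Complex.ofRealCLM) (SmoothMatrixNear.const _)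

theorem smoothSpinorNear_nabla (hcov : IsLeviCivita g cov) (hcovE : IsMetricConnection covE)
    (hx : x ∈ S.U i) (hφ : SmoothSpinorNear I F φ x)
    {X : Π y : M, TangentSpace I y} (hX : SmoothNear I E X x) :
    SmoothSpinorNear I F (fun y => S.nabla cov covE i φ y (X y)) x :=
  SmoothSpinorNear.add (fun a => (hφ a).covariantDerivative hcovE.smooth hX)
    (SmoothSpinorNear.act (S.smoothMatrixNear_connMatrix hcov hx hX) hφ)

theorem smoothSpinorNear_localDirac (hcov : IsLeviCivita g cov) (hcovE : IsMetricConnection covE)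
    (hx : x ∈ S.U i) (hφ : SmoothSpinorNear I F φ x) :
    SmoothSpinorNear I F (S.localDirac cov covE i φ) x :=
  SmoothSpinorNear.sum fun k _ => SmoothSpinorNear.act_const _
    (S.smoothSpinorNear_nabla hcov hcovE hx hφ (S.smoothNear_frame hx k))

theorem nabla_add (hφ : SmoothSpinorNear I F φ x) (hχ : SmoothSpinorNear I F χ x)
    (X : TangentSpace I x) : S.nabla cov covE i (fun y => φ y + χ y) x X =
      S.nabla cov covE i φ x X + S.nabla cov covE i χ x X := by
  unfold nabla
  rw [act_add]
  ext a
  simp only [Pi.add_apply]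
  rw [cov_add (hφ a) (hχ a)]
  abel

theorem nabla_act (hcovE : IsMetricConnection covE) (hB : SmoothMatrixNear I B x)
    (hφ : SmoothSpinorNear I F φ x) (X : TangentSpace I x) :
    S.nabla cov covE i (fun y => act (B y) (φ y)) x X =
      act (matrixDeriv I B x X + (S.connMatrix cov i x X * B x - B x * S.connMatrix cov i x X))
        (φ x) + act (B x) (S.nabla cov covE i φ x X) := by
  have h1 : (fun a => covE (fun y => act (B y) (φ y) a) x X) =
      act (matrixDeriv I B x X) (φ x) + act (B x) (fun a => covE (fun y => φ y a) x X) := by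
    ext a
    simp only [act, Pi.add_apply]
    rw [cov_sum fun b _ => SmoothNear.complex_smul (hB a b) (hφ b), ← Finset.sum_add_distrib]
    refine Finset.sum_congr rfl fun b _ => ?_
    rw [cov_complex_smul hcovE (hB a b) (hφ b), add_comm]
    rfl
  unfold nabla
  rw [h1, add_act, sub_act, act_add, act_mul, act_mul]
  abel

theorem nabla_act_const (hcovE : IsMetricConnection covE) (A : SpinorMatrix d)
    (hφ : SmoothSpinorNear I F φ x) (X : TangentSpace I x) :
    S.nabla cov covE i (fun y => act A (φ y)) x X =
      act (S.connMatrix cov i x X * A - A * S.connMatrix cov i x X) (φ x) +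
        act A (S.nabla cov covE i φ x X) := by
  rw [S.nabla_act hcovE (SmoothMatrixNear.const A) hφ, matrixDeriv_const, zero_add]

theorem nabla_const_smul (hcovE : IsMetricConnection covE) (c : ℂ)
    (hφ : SmoothSpinorNear I F φ x) (X : TangentSpace I x) :
    S.nabla cov covE i (fun y => c • φ y) x X = c • S.nabla cov covE i φ x X := by
  have h := S.nabla_act_const (cov := cov) (i := i) hcovE (c • (1 : SpinorMatrix d)) hφ X
  simpa only [smul_act, act_one, mul_smul_comm, smul_mul_assoc, mul_one, one_mul, sub_self,
    zero_act, zero_add] using h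

theorem nabla_zero (hcovE : IsMetricConnection covE) (X : TangentSpace I x) :
    S.nabla cov covE i (fun y => (0 : SpinorIdx d → V y)) x X = 0 := by
  have h := S.nabla_const_smul (cov := cov) (i := i) hcovE 0
    (φ := fun y => (0 : SpinorIdx d → V y)) (x := x) (fun a => SmoothNear.zero) X
  simpa using h

theorem nabla_sum (hcovE : IsMetricConnection covE) {κ : Type*} (t : Finset κ)
    {φ : κ → Π y : M, SpinorIdx d → V y} (hφ : ∀ k ∈ t, SmoothSpinorNear I F (φ k) x)
    (X : TangentSpace I x) : S.nabla cov covE i (fun y => ∑ k ∈ t, φ k y) x X =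
      ∑ k ∈ t, S.nabla cov covE i (φ k) x X := by
  classical
  induction t using Finset.induction_on with
  | empty => simpa using S.nabla_zero (cov := cov) hcovE X
  | insert a s ha ih =>
    simp only [Finset.sum_insert ha]
    rw [S.nabla_add (hφ a (by simp)) (SmoothSpinorNear.sum fun k hk =>
      hφ k (Finset.mem_insert_of_mem hk)), ih fun k hk => hφ k (Finset.mem_insert_of_mem hk)]

/-- The covariant derivative of Clifford multiplication by a frame vector. -/
theorem nabla_gamma (hcov : IsLeviCivita g cov) (hcovE : IsMetricConnection covE) (hx : x ∈ S.U i)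
    (m : VecIdx d) (hφ : SmoothSpinorNear I F φ x) (X : TangentSpace I x) :
    S.nabla cov covE i (fun y => act (gamma m) (φ y)) x X =
      ∑ c, ((S.connCoeff cov i x X m c : ℝ) : ℂ) • act (gamma c) (φ x) +
        act (gamma m) (S.nabla cov covE i φ x X) := by
  rw [S.nabla_act_const hcovE _ hφ, S.connMatrix_commutator_gamma hcov hx, sum_act]
  simp only [smul_act]

/-- The connection of the twisted spinor bundle is metric. -/
theorem mvfderiv_ip (hV : IsSmoothHermitian I F V) (hcov : IsLeviCivita g cov)
    (hcovE : IsMetricConnection covE) (hx : x ∈ S.U i) (hφ : SmoothSpinorNear I F φ x)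
    (hχ : SmoothSpinorNear I F χ x) (X : TangentSpace I x) :
    mvfderiv I (fun y => ip (φ y) (χ y)) x X =
      ip (S.nabla cov covE i φ x X) (χ x) + ip (φ x) (S.nabla cov covE i χ x X) := by
  have h1 : mvfderiv I (fun y => ip (φ y) (χ y)) x X =
      ip (fun a => covE (fun y => φ y a) x X) (χ x) +
        ip (φ x) (fun a => covE (fun y => χ y a) x X) := by
    unfold ip
    rw [mvfderiv_fun_sum fun a _ => smoothFunNear_inner hV (hφ a) (hχ a),
      ← Finset.sum_add_distrib]
    exact Finset.sum_congr rfl fun a _ => hcovE.metric _ _ x (hφ a).mdifferentiableAt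
      (hχ a).mdifferentiableAt X
  unfold nabla
  rw [h1, ip_add_left, ip_add_right, ip_act_left, S.conjTranspose_connMatrix hcov hx, neg_act,
    ip_neg_right]
  ring

end SpinStructure

end TwistedConnection

/-! ### The curvature of the twisted spinor bundle -/

section TwistedCurvature

open Filter Topology

variable {d : ℕ} {E : Type*} [NormedAddCommGroup E] [NormedSpace ℝ E] [FiniteDimensional ℝ E]
  {H : Type*} [TopologicalSpace H] {I : ModelWithCorners ℝ E H} [I.Boundaryless]
  {M : Type*} [TopologicalSpace M] [T2Space M] [ChartedSpace H M] [IsManifold I ∞ M]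
  {g : Metric I M} {ι : Type*} (S : SpinStructure d g ι) {cov : TangentConnection I M}
  {F : Type*} [NormedAddCommGroup F] [NormedSpace ℂ F] [FiniteDimensional ℂ F]
  {V : M → Type*} [TopologicalSpace (TotalSpace F V)]
  [∀ x, NormedAddCommGroup (V x)] [∀ x, InnerProductSpace ℂ (V x)]
  [FiberBundle F V] [VectorBundle ℂ F V] [VectorBundle ℝ F V]
  [ContMDiffVectorBundle ∞ F V I]
  {covE : CovariantDerivative I F V} {x : M} {i : ι}
  {φ χ : Π y : M, SpinorIdx d → V y} {X Y : Π y : M, TangentSpace I y}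

theorem bivector_add (a b : VecIdx d → VecIdx d → ℝ) :
    bivector (fun k l => a k l + b k l) = bivector a + bivector b := by
  simp only [bivector, Complex.ofReal_add, add_smul, Finset.sum_add_distrib]

theorem bivector_sub (a b : VecIdx d → VecIdx d → ℝ) :
    bivector (fun k l => a k l - b k l) = bivector a - bivector b := by
  simp only [bivector, Complex.ofReal_sub, sub_smul, Finset.sum_sub_distrib]

theorem matrixDeriv_bivector {b : M → VecIdx d → VecIdx d → ℝ}
    (hb : ∀ k l, SmoothFunNear I (fun y => b y k l) x) (v : TangentSpace I x) :
    matrixDeriv I (fun y => bivector (b y)) x v =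
      bivector fun k l => mvfderiv I (fun y => b y k l) x v := by
  have h : ∀ k l, SmoothMatrixNear I (fun y => ((b y k l : ℝ) : ℂ) • (gamma k * gamma l)) x :=
    fun k l => SmoothMatrixNear.smul ((hb k l).clm_comp Complex.ofRealCLM)
      (SmoothMatrixNear.const _)
  unfold bivector
  rw [matrixDeriv_sum fun k _ => SmoothMatrixNear.sum fun l _ => h k l]
  refine Finset.sum_congr rfl fun k _ => ?_
  rw [matrixDeriv_sum fun l _ => h k l]
  exact Finset.sum_congr rfl fun l _ => matrixDeriv_smul_const (hb k l) _ v

theorem matrixDeriv_const_smul (c : ℂ) {B : M → SpinorMatrix d} (hB : SmoothMatrixNear I B x)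
    (v : TangentSpace I x) :
    matrixDeriv I (fun y => c • B y) x v = c • matrixDeriv I B x v := by
  have h := matrixDeriv_mul (SmoothMatrixNear.const (c • (1 : SpinorMatrix d))) hB v
  simpa only [smul_mul_assoc, one_mul, matrixDeriv_const, zero_mul, add_zero] using h

namespace SpinStructure

/-- The components `g(R(X, Y) e_a, e_b)` of the Riemannian curvature in the frame. -/
def riemann (cov : TangentConnection I M) (i : ι) (x : M) (u v : TangentSpace I x)
    (a b : VecIdx d) : ℝ :=
  g.inner x (curvature cov x u v (S.frame i a x)) (S.frame i b x)

theorem inner_cov_cov_frame (hdim : Module.finrank ℝ E = 2 * d) (hcov : IsLeviCivita g cov)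
    (hx : x ∈ S.U i) (hY : SmoothNear I E Y x) (v : TangentSpace I x) (a b : VecIdx d) :
    g.inner x (cov (fun y => cov (S.frame i a) y (Y y)) x v) (S.frame i b x) =
      mvfderiv I (fun y => S.connCoeff cov i y (Y y) a b) x v -
        ∑ c, S.connCoeff cov i x (Y x) a c * S.connCoeff cov i x v b c := by
  have h := hcov.metric _ _ x ((S.smoothNear_frame hx a).covariantDerivative hcov.smooth hY
    ).mdifferentiableAt (S.smoothNear_frame hx b).mdifferentiableAt v
  have h2 := (S.frame_orthonormal i x hx).inner_eq_sum hdim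
    (cov (S.frame i a) x (Y x)) (cov (S.frame i b) x v)
  unfold connCoeff
  rw [h, h2]
  ring

/-- The curvature form of the spin connection is a quarter of the Riemannian curvature, acting by
Clifford multiplication. -/
theorem curvature_connMatrix (hdim : Module.finrank ℝ E = 2 * d) (hcov : IsLeviCivita g cov)
    (hx : x ∈ S.U i) (hX : SmoothNear I E X x) (hY : SmoothNear I E Y x) :
    matrixDeriv I (fun y => S.connMatrix cov i y (Y y)) x (X x) -
      matrixDeriv I (fun y => S.connMatrix cov i y (X y)) x (Y x) +
      (S.connMatrix cov i x (X x) * S.connMatrix cov i x (Y x) -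
        S.connMatrix cov i x (Y x) * S.connMatrix cov i x (X x)) -
      S.connMatrix cov i x (VectorField.mlieBracket I X Y x) =
    (1 / 4 : ℂ) • bivector (S.riemann cov i x (X x) (Y x)) := by
  have hR : S.riemann cov i x (X x) (Y x) = fun a b =>
      mvfderiv I (fun y => S.connCoeff cov i y (Y y) a b) x (X x) -
        mvfderiv I (fun y => S.connCoeff cov i y (X y) a b) x (Y x) +
        (∑ c, (S.connCoeff cov i x (X x) c a * S.connCoeff cov i x (Y x) c b +
          S.connCoeff cov i x (X x) c b * S.connCoeff cov i x (Y x) a c)) -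
        S.connCoeff cov i x (VectorField.mlieBracket I X Y x) a b := by
    funext a b
    unfold riemann
    rw [curvature_eq hcov.smooth hX hY (S.smoothNear_frame hx a)]
    unfold curvatureField
    rw [map_sub, map_sub, sub_apply, sub_apply,
      S.inner_cov_cov_frame hdim hcov hx hY, S.inner_cov_cov_frame hdim hcov hx hX]
    have h1 : ∀ c, S.connCoeff cov i x (X x) c a * S.connCoeff cov i x (Y x) c b +
          S.connCoeff cov i x (X x) c b * S.connCoeff cov i x (Y x) a c =
        S.connCoeff cov i x (X x) a c * S.connCoeff cov i x (Y x) b c -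
          S.connCoeff cov i x (Y x) a c * S.connCoeff cov i x (X x) b c := fun c => by
      rw [S.connCoeff_skew hcov hx _ c a, S.connCoeff_skew hcov hx _ c b,
        S.connCoeff_skew hcov hx _ c b]
      ring
    simp only [h1, Finset.sum_sub_distrib]
    unfold connCoeff
    ring
  have hd : ∀ {Z : Π y : M, TangentSpace I y}, SmoothNear I E Z x → ∀ v,
      matrixDeriv I (fun y => S.connMatrix cov i y (Z y)) x v = (1 / 4 : ℂ) •
        bivector fun a b => mvfderiv I (fun y => S.connCoeff cov i y (Z y) a b) x v := by
    intro Z hZ v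
    have hs := S.smoothFunNear_connCoeff hcov hx hZ
    rw [← matrixDeriv_bivector hs]
    refine matrixDeriv_const_smul _ ?_ v
    exact SmoothMatrixNear.sum fun k _ => SmoothMatrixNear.sum fun l _ =>
      SmoothMatrixNear.smul ((hs k l).clm_comp Complex.ofRealCLM) (SmoothMatrixNear.const _)
  have hb := bivector_commutator_bivector (S.connCoeff_skew hcov hx (X x))
    (S.connCoeff cov i x (Y x))
  have hc : S.connMatrix cov i x (X x) * S.connMatrix cov i x (Y x) -
      S.connMatrix cov i x (Y x) * S.connMatrix cov i x (X x) = (1 / 4 : ℂ) •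
      bivector fun k l => ∑ c, (S.connCoeff cov i x (X x) c k * S.connCoeff cov i x (Y x) c l +
          S.connCoeff cov i x (X x) c l * S.connCoeff cov i x (Y x) k c) := by
    simp only [connMatrix, smul_mul_assoc, mul_smul_comm]
    rw [← smul_sub, ← smul_sub, hb, smul_smul, smul_smul]
    norm_num
  rw [hd hX, hd hY, hc, connMatrix, hR, bivector_sub, bivector_add, bivector_sub, smul_sub,
    smul_add, smul_sub]

theorem nabla_nabla (hcov : IsLeviCivita g cov) (hcovE : IsMetricConnection covE)
    (hx : x ∈ S.U i) (hφ : SmoothSpinorNear I F φ x) (hY : SmoothNear I E Y x)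
    (v : TangentSpace I x) :
    S.nabla cov covE i (fun y => S.nabla cov covE i φ y (Y y)) x v =
      (fun a => covE (fun y => covE (fun z => φ z a) y (Y y)) x v) +
      act (S.connMatrix cov i x v) (fun a => covE (fun y => φ y a) x (Y x)) +
      act (S.connMatrix cov i x (Y x)) (fun a => covE (fun y => φ y a) x v) +
      act (matrixDeriv I (fun y => S.connMatrix cov i y (Y y)) x v +
        S.connMatrix cov i x v * S.connMatrix cov i x (Y x)) (φ x) := by
  have h1 : SmoothSpinorNear I F (fun y a => covE (fun z => φ z a) y (Y y)) x :=
    fun a => (hφ a).covariantDerivative hcovE.smooth hY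
  have hB := S.smoothMatrixNear_connMatrix hcov hx hY
  have h2 := S.nabla_add (cov := cov) (covE := covE) (i := i) h1 (SmoothSpinorNear.act hB hφ) v
  rw [S.nabla_act hcovE hB hφ] at h2
  unfold nabla at h2 ⊢
  rw [h2]
  simp only [add_act, sub_act, act_add, act_mul]
  abel

/-- The curvature of `ΣM ⊗ E`. -/
theorem nabla_commutator (hdim : Module.finrank ℝ E = 2 * d) (hcov : IsLeviCivita g cov)
    (hcovE : IsMetricConnection covE) (hx : x ∈ S.U i) (hφ : SmoothSpinorNear I F φ x)
    (hX : SmoothNear I E X x) (hY : SmoothNear I E Y x) :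
    S.nabla cov covE i (fun y => S.nabla cov covE i φ y (Y y)) x (X x) -
      S.nabla cov covE i (fun y => S.nabla cov covE i φ y (X y)) x (Y x) -
      S.nabla cov covE i φ x (VectorField.mlieBracket I X Y x) =
    (fun a => curvature covE x (X x) (Y x) (φ x a)) +
      act ((1 / 4 : ℂ) • bivector (S.riemann cov i x (X x) (Y x))) (φ x) := by
  rw [S.nabla_nabla hcov hcovE hx hφ hY, S.nabla_nabla hcov hcovE hx hφ hX,
    ← S.curvature_connMatrix hdim hcov hx hX hY]
  have h1 : (fun a => curvature covE x (X x) (Y x) (φ x a)) =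
      fun a => curvatureField covE X Y (fun y => φ y a) x := by
    funext a
    exact curvature_eq (σ := fun y => φ y a) hcovE.smooth hX hY (hφ a)
  rw [h1]
  have h2 : (fun a => curvatureField covE X Y (fun y => φ y a) x) =
    (fun a => covE (fun y => covE (fun z => φ z a) y (Y y)) x (X x)) -
    (fun a => covE (fun y => covE (fun z => φ z a) y (X y)) x (Y x)) -
    (fun a => covE (fun y => φ y a) x (VectorField.mlieBracket I X Y x)) := rfl
  rw [h2]
  unfold nabla
  simp only [add_act, sub_act]
  abel

end SpinStructure

end TwistedCurvature

/-! ### The scalar curvature term -/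

section RiemannAlgebra

variable {d : ℕ}

/-- The first Bianchi identity reduces the Clifford contraction of the curvature tensor to the Ricci
tensor. -/
theorem sum_gamma_curvature {r : VecIdx d → VecIdx d → VecIdx d → ℝ}
    (hskew : ∀ k l a, r k l a = -r l k a)
    (hbianchi : ∀ k l a, r k l a + r l a k + r a k l = 0) :
    ∑ k, ∑ l, ∑ a, ((r k l a : ℝ) : ℂ) • (gamma k * gamma l * gamma a : SpinorMatrix d) =
      (-2 : ℂ) • ∑ k, ((∑ l, r k l l : ℝ) : ℂ) • gamma k := by
  set Q := ∑ k, ∑ l, ∑ a, ((r k l a : ℝ) : ℂ) • (gamma k * gamma l * gamma a : SpinorMatrix d)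
    with hQ
  set R := ∑ k, ((∑ l, r k l l : ℝ) : ℂ) • (gamma k : SpinorMatrix d) with hR
  have hdiag : ∀ k a, r k k a = 0 := fun k a => by linarith [hskew k k a]
  have hR' : R = ∑ k, ∑ l, ((r k l l : ℝ) : ℂ) • (gamma k : SpinorMatrix d) := by
    rw [hR]
    refine Finset.sum_congr rfl fun k _ => ?_
    rw [Complex.ofReal_sum, Finset.sum_smul]
  -- cyclic permutations of a product of three gammas
  have e1 : ∀ k l a : VecIdx d, gamma k * gamma l * gamma a = gamma l * gamma a * gamma k -
      (if k = l then (2 : ℂ) • gamma a else 0) +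
      (if a = k then (2 : ℂ) • gamma l else 0 : SpinorMatrix d) := fun k l a => by
    rw [mul_assoc (gamma l), gamma_mul_comm a k, gamma_mul_comm k l]
    split_ifs <;> simp only [mul_add, add_mul, mul_neg, neg_mul, smul_mul_assoc, mul_smul_comm,
      one_mul, mul_one, mul_assoc, mul_zero, zero_mul] <;> module
  have e2 : ∀ k l a : VecIdx d, gamma k * gamma l * gamma a = gamma a * gamma k * gamma l -
      (if a = l then (2 : ℂ) • gamma k else 0) +
      (if a = k then (2 : ℂ) • gamma l else 0 : SpinorMatrix d) := fun k l a => by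
    rw [gamma_mul_comm a k, add_mul, neg_mul, mul_assoc (gamma k) (gamma a), gamma_mul_comm a l]
    split_ifs <;> simp only [mul_add, mul_neg, smul_mul_assoc, mul_smul_comm,
      one_mul, mul_one, mul_assoc, mul_zero, zero_mul] <;> module
  have h2 : ∑ k, ∑ l, ∑ a, ((r l a k : ℝ) : ℂ) • (gamma k * gamma l * gamma a : SpinorMatrix d) =
      Q + (4 : ℂ) • R := by
    have c1 : ∀ k l a, ((r l a k : ℝ) : ℂ) • (gamma k * gamma l * gamma a : SpinorMatrix d) =
        ((r l a k : ℝ) : ℂ) • (gamma l * gamma a * gamma k) +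
        (if k = l then (2 : ℂ) • ((r a k k : ℝ) : ℂ) • gamma a else 0) +
        (if a = k then (2 : ℂ) • ((r l k k : ℝ) : ℂ) • gamma l else 0) := fun k l a => by
      rw [e1 k l a]
      split_ifs with h1 h2 h2
      · subst h1; subst h2; rw [hdiag]; simp
      · subst h1; rw [hskew k a k]; push_cast; module
      · subst h2; module
      · module
    simp only [c1, Finset.sum_add_distrib, Finset.sum_ite_eq', Finset.mem_univ, if_true]
    have c2 : ∑ k, ∑ l, ∑ a, ((r l a k : ℝ) : ℂ) • (gamma l * gamma a * gamma k : SpinorMatrix d) =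
        Q := by
      rw [Finset.sum_comm]
      exact Finset.sum_congr rfl fun _ _ => Finset.sum_comm
    have c3 : ∑ k, ∑ l, ∑ a, (if k = l then (2 : ℂ) • ((r a k k : ℝ) : ℂ) • gamma a else 0) =
        (2 : ℂ) • R := by
      have : ∀ k : VecIdx d, ∑ l, ∑ a, (if k = l then (2 : ℂ) • ((r a k k : ℝ) : ℂ) • gamma a
          else (0 : SpinorMatrix d)) = ∑ a, (2 : ℂ) • ((r a k k : ℝ) : ℂ) • gamma a := fun k => by
        rw [Finset.sum_comm]
        simp
      simp only [this]
      rw [Finset.sum_comm, hR']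
      simp only [Finset.smul_sum]
    have c4 : ∑ k, ∑ l, (2 : ℂ) • ((r l k k : ℝ) : ℂ) • (gamma l : SpinorMatrix d) =
        (2 : ℂ) • R := by
      rw [Finset.sum_comm, hR']
      simp only [Finset.smul_sum]
    rw [c2, c3, c4]
    module
  have h3 : ∑ k, ∑ l, ∑ a, ((r a k l : ℝ) : ℂ) • (gamma k * gamma l * gamma a : SpinorMatrix d) =
      Q + (2 : ℂ) • R := by
    have c1 : ∀ k l a, ((r a k l : ℝ) : ℂ) • (gamma k * gamma l * gamma a : SpinorMatrix d) =
        ((r a k l : ℝ) : ℂ) • (gamma a * gamma k * gamma l) +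
        (if a = l then (2 : ℂ) • ((r k l l : ℝ) : ℂ) • gamma k else 0) := fun k l a => by
      rw [e2 k l a]
      split_ifs with h1 h2 h2
      · subst h1; subst h2; rw [hdiag]; simp
      · subst h1; rw [hskew a k a]; push_cast; module
      · subst h2; rw [hdiag]; simp
      · module
    simp only [c1, Finset.sum_add_distrib, Finset.sum_ite_eq', Finset.mem_univ, if_true]
    have c2 : ∑ k, ∑ l, ∑ a, ((r a k l : ℝ) : ℂ) • (gamma a * gamma k * gamma l : SpinorMatrix d) =
        Q := by
      rw [hQ, Finset.sum_congr rfl fun _ _ => Finset.sum_comm, Finset.sum_comm]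
    rw [c2, hR']
    simp only [Finset.smul_sum]
  -- the cyclic sum of the coefficients vanishes
  have h4 : Q + (Q + (4 : ℂ) • R) + (Q + (2 : ℂ) • R) = 0 := by
    rw [← h2, ← h3, hQ]
    simp only [← Finset.sum_add_distrib, ← add_smul, ← Complex.ofReal_add, hbianchi]
    simp
  linear_combination (norm := module) (1 / 3 : ℂ) • h4

end RiemannAlgebra

/-! ### The Weitzenböck formula -/

section Weitzenboeck

open Filter Topology

variable {d : ℕ} {E : Type*} [NormedAddCommGroup E] [NormedSpace ℝ E] [FiniteDimensional ℝ E]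
  {H : Type*} [TopologicalSpace H] {I : ModelWithCorners ℝ E H} [I.Boundaryless]
  {M : Type*} [TopologicalSpace M] [T2Space M] [ChartedSpace H M] [IsManifold I ∞ M]
  {g : Metric I M} {ι : Type*} (S : SpinStructure d g ι) {cov : TangentConnection I M}
  {F : Type*} [NormedAddCommGroup F] [NormedSpace ℂ F] [FiniteDimensional ℂ F]
  {V : M → Type*} [TopologicalSpace (TotalSpace F V)]
  [∀ x, NormedAddCommGroup (V x)] [∀ x, InnerProductSpace ℂ (V x)]
  [FiberBundle F V] [VectorBundle ℂ F V] [VectorBundle ℝ F V]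
  [ContMDiffVectorBundle ∞ F V I]
  {covE : CovariantDerivative I F V} {x : M} {i : ι}
  {φ χ : Π y : M, SpinorIdx d → V y}

/-- The divergence of a vector field. -/
def divergence (cov : TangentConnection I M) (Z : Π y : M, TangentSpace I y) (x : M) : ℝ :=
  LinearMap.trace ℝ (TangentSpace I x) (cov Z x : TangentSpace I x →ₗ[ℝ] TangentSpace I x)

theorem re_ip_gamma_mul_gamma {W : Type*} [NormedAddCommGroup W] [InnerProductSpace ℂ W]
    (k l : VecIdx d) (w : SpinorIdx d → W) :
    (ip w (act (gamma k * gamma l) w)).re = if k = l then -(ip w w).re else 0 := by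
  have h1 : (ip w (act (gamma k * gamma l) w)).re = (ip w (act (gamma l * gamma k) w)).re := by
    rw [re_ip_comm, act_mul, act_mul, ip_act_gamma_left, ip_act_gamma_left, neg_neg]
  have h2 := congrArg (fun A => (ip w (act A w)).re) (gamma_mul_add k l)
  simp only [add_act, ip_add_right, Complex.add_re] at h2
  rw [← h1] at h2
  split_ifs with h
  · rw [if_pos h, smul_act, act_one, ip_smul_right] at h2
    simp at h2
    linarith
  · rw [if_neg h, zero_act, ip_zero_right, Complex.zero_re] at h2
    linarith

namespace SpinStructure

theorem divergence_eq (hdim : Module.finrank ℝ E = 2 * d) (hx : x ∈ S.U i) {f : VecIdx d → M → ℝ} (hf : ∀ l, SmoothFunNear I (f l) x)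
    {Z : Π y : M, TangentSpace I y} (hZ : ∀ᶠ y in 𝓝 x, Z y = ∑ l, f l y • S.frame i l y) :
    divergence cov Z x = ∑ k, (mvfderiv I (f k) x (S.frame i k x) +
      ∑ l, f l x * S.connCoeff cov i x (S.frame i k x) l k) := by
  have hs : ∀ l ∈ Finset.univ, SmoothNear I E (fun y => f l y • S.frame i l y) x :=
    fun l _ => SmoothNear.smul (hf l) (S.smoothNear_frame hx l)
  have hsum := SmoothNear.sum hs
  have hZ' : cov Z x = cov (fun y => ∑ l, f l y • S.frame i l y) x :=
    cov_congr hZ (hsum.congr hZ)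
  unfold divergence
  rw [(S.frame_orthonormal i x hx).trace_eq_sum hdim, hZ']
  refine Finset.sum_congr rfl fun k _ => ?_
  rw [ContinuousLinearMap.coe_coe, cov_sum hs]
  have h1 : ∀ l, cov (fun y => f l y • S.frame i l y) x (S.frame i k x) =
      f l x • cov (S.frame i l) x (S.frame i k x) +
        mvfderiv I (f l) x (S.frame i k x) • S.frame i l x :=
    fun l => cov_smul (hf l) (S.smoothNear_frame hx l) _
  simp only [h1, map_sum, map_add, map_smul, sum_apply, add_apply,
    smul_apply, smul_eq_mul, Finset.sum_add_distrib]
  rw [add_comm]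
  congr 1
  simp [S.frame_orthonormal i x hx _ _]

variable (cov covE)

/-- The second covariant derivative `∇²φ(e_l, e_k) = ∇_{e_l} ∇_{e_k} φ - ∇_{∇_{e_l} e_k} φ`. -/
def hessian (i : ι) (φ : Π y : M, SpinorIdx d → V y) (x : M) (l k : VecIdx d) :
    SpinorIdx d → V x :=
  S.nabla cov covE i (fun y => S.nabla cov covE i φ y (S.frame i k y)) x (S.frame i l x) +
    ∑ c, ((S.connCoeff cov i x (S.frame i l x) c k : ℝ) : ℂ) •
      S.nabla cov covE i φ x (S.frame i c x)

/-- The scalar curvature computed in the frame over `U i`. -/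
def scalar (i : ι) (x : M) : ℝ :=
  ∑ k, ∑ l, g.inner x (curvature cov x (S.frame i k x) (S.frame i l x) (S.frame i l x))
    (S.frame i k x)

variable {cov covE}

theorem hessian_sub (hdim : Module.finrank ℝ E = 2 * d) (hcov : IsLeviCivita g cov)
    (hcovE : IsMetricConnection covE) (hx : x ∈ S.U i) (hφ : SmoothSpinorNear I F φ x)
    (l k : VecIdx d) :
    S.hessian cov covE i φ x l k - S.hessian cov covE i φ x k l =
      (fun a => curvature covE x (S.frame i l x) (S.frame i k x) (φ x a)) +
      act ((1 / 4 : ℂ) • bivector (S.riemann cov i x (S.frame i l x) (S.frame i k x))) (φ x) := by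
  have hl := S.smoothNear_frame hx l
  have hk := S.smoothNear_frame hx k
  have ht : cov (S.frame i k) x (S.frame i l x) - cov (S.frame i l) x (S.frame i k x) =
      VectorField.mlieBracket I (S.frame i l) (S.frame i k) x :=
    have : CompleteSpace E := FiniteDimensional.complete ℝ E
    cov.torsion_eq_zero_iff.1 hcov.torsion_free hl.mdifferentiableAt hk.mdifferentiableAt
  have hn : ∀ a b : VecIdx d, S.nabla cov covE i φ x (cov (S.frame i b) x (S.frame i a x)) =
      -∑ c, ((S.connCoeff cov i x (S.frame i a x) c b : ℝ) : ℂ) •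
        S.nabla cov covE i φ x (S.frame i c x) := by
    intro a b
    rw [S.cov_frame hdim hx, nabla_sum_vector, ← Finset.sum_neg_distrib]
    refine Finset.sum_congr rfl fun c _ => ?_
    rw [nabla_smul_vector, S.connCoeff_skew hcov hx _ b c, Complex.ofReal_neg, neg_smul]
  rw [← S.nabla_commutator hdim hcov hcovE hx hφ hl hk, ← ht, nabla_sub_vector, hn, hn]
  unfold hessian
  abel

theorem localDirac_localDirac (hcov : IsLeviCivita g cov)
    (hcovE : IsMetricConnection covE) (hx : x ∈ S.U i) (hφ : SmoothSpinorNear I F φ x) :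
    S.localDirac cov covE i (S.localDirac cov covE i φ) x =
      ∑ l, ∑ k, act (gamma l * gamma k) (S.hessian cov covE i φ x l k) := by
  have hk : ∀ k ∈ Finset.univ, SmoothSpinorNear I F
      (fun y => S.nabla cov covE i φ y (S.frame i k y)) x := fun k _ =>
    S.smoothSpinorNear_nabla hcov hcovE hx hφ (S.smoothNear_frame hx k)
  conv_lhs => unfold localDirac
  refine Finset.sum_congr rfl fun l _ => ?_
  rw [S.nabla_sum hcovE _ fun k hk' => SmoothSpinorNear.act_const _ (hk k hk')]
  have h1 : ∀ k, S.nabla cov covE i (fun y => act (gamma k)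
      (S.nabla cov covE i φ y (S.frame i k y))) x (S.frame i l x) = _ := fun k =>
    S.nabla_gamma hcov hcovE hx k (hk k (Finset.mem_univ _)) _
  simp only [h1, hessian, act_mul, act_add, Finset.sum_add_distrib, act_sum, act_smul]
  rw [add_comm]
  congr 1
  exact Finset.sum_comm

/-- The Riemannian curvature contributes the scalar curvature to the square of the Dirac operator. Only
real parts are compared, so the symmetry of the Ricci tensor is not needed. -/
theorem curvature_term (hcov : IsLeviCivita g cov) (w : SpinorIdx d → V x) :
    (ip w (∑ l, ∑ k, act (gamma l * gamma k)
      (act (bivector (S.riemann cov i x (S.frame i l x) (S.frame i k x))) w))).re =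
    2 * (S.scalar cov i x * (ip w w).re) := by
  let r : VecIdx d → VecIdx d → VecIdx d → VecIdx d → ℝ := fun b l k a =>
    S.riemann cov i x (S.frame i l x) (S.frame i k x) a b
  have h1 : ∑ l, ∑ k, gamma l * gamma k *
      bivector (S.riemann cov i x (S.frame i l x) (S.frame i k x)) =
      ∑ b, (∑ l, ∑ k, ∑ a, ((r b l k a : ℝ) : ℂ) • (gamma l * gamma k * gamma a)) * gamma b := by
    simp only [bivector, Finset.mul_sum, Finset.sum_mul, mul_smul_comm, smul_mul_assoc, mul_assoc]
    conv_rhs => rw [Finset.sum_comm]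
    refine Finset.sum_congr rfl fun l _ => ?_
    conv_rhs => rw [Finset.sum_comm]
    refine Finset.sum_congr rfl fun k _ => ?_
    conv_rhs => rw [Finset.sum_comm]
  have h2 : ∀ b, ∑ l, ∑ k, ∑ a, ((r b l k a : ℝ) : ℂ) •
      (gamma l * gamma k * gamma a : SpinorMatrix d) =
      (-2 : ℂ) • ∑ k, ((∑ l, r b k l l : ℝ) : ℂ) • gamma k := fun b => by
    refine sum_gamma_curvature (fun k l a => ?_) fun k l a => ?_
    · simp only [r, riemann]
      rw [curvature_swap hcov.smooth, map_neg, neg_apply]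
    · have h := curvature_bianchi hcov.smooth hcov.torsion_free (S.frame i k x) (S.frame i l x)
        (S.frame i a x)
      have h' := congrArg (fun v => g.inner x v (S.frame i b x)) h
      simp only [map_add, add_apply, map_zero, zero_apply] at h'
      exact h'
  have h3 : ∑ l, ∑ k, act (gamma l * gamma k)
      (act (bivector (S.riemann cov i x (S.frame i l x) (S.frame i k x))) w) =
      ∑ b, ∑ k, (-2 : ℂ) • ((∑ l, r b k l l : ℝ) : ℂ) • act (gamma k * gamma b) w := by
    simp only [← act_mul, ← sum_act, h1, h2, smul_mul_assoc, Finset.sum_mul, Finset.smul_sum]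
    simp only [sum_act, smul_act]
  have h4 : ∀ (c : ℝ) (z : ℂ), (-2 * ((c : ℂ) * z)).re = -2 * (c * z.re) := fun c z => by simp
  rw [h3]
  simp only [ip_sum_right, ip_smul_right, Complex.re_sum, h4, re_ip_gamma_mul_gamma, mul_ite,
    mul_zero, Finset.sum_ite_eq', Finset.mem_univ, if_true]
  rw [← Finset.mul_sum]
  simp only [mul_neg, Finset.sum_neg_distrib, ← Finset.sum_mul]
  have h5 : ∑ b, ∑ l, r b b l l = S.scalar cov i x := rfl
  rw [h5]
  ring

theorem weitzenboeck (hdim : Module.finrank ℝ E = 2 * d) (hcov : IsLeviCivita g cov)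
    (hcovE : IsMetricConnection covE) (hx : x ∈ S.U i) (hφ : SmoothSpinorNear I F φ x) :
    (ip (φ x) (S.localDirac cov covE i (S.localDirac cov covE i φ) x)).re =
      -(ip (φ x) (∑ k, S.hessian cov covE i φ x k k)).re +
        1 / 4 * (S.scalar cov i x * (ip (φ x) (φ x)).re +
          (ip (φ x) (S.curvatureEndo covE i x (φ x))).re) := by
  have h1 : (2 : ℂ) • S.localDirac cov covE i (S.localDirac cov covE i φ) x =
      (-2 : ℂ) • ∑ k, S.hessian cov covE i φ x k k +
      ∑ l, ∑ k, act (gamma l * gamma k)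
        (S.hessian cov covE i φ x l k - S.hessian cov covE i φ x k l) := by
    rw [S.localDirac_localDirac hcov hcovE hx hφ]
    -- the symmetric part of the Hessian contributes its trace, the antisymmetric part the curvature
    have h2 : ∑ l, ∑ k, act (gamma l * gamma k) (S.hessian cov covE i φ x k l) =
      ∑ l, ∑ k, act (gamma k * gamma l) (S.hessian cov covE i φ x l k) := Finset.sum_comm
    have h3 : ∑ l, ∑ k, (act (gamma l * gamma k) (S.hessian cov covE i φ x l k) +
        act (gamma k * gamma l) (S.hessian cov covE i φ x l k)) =
        (-2 : ℂ) • ∑ k, S.hessian cov covE i φ x k k := by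
      have h4 : ∀ l k, act (gamma l * gamma k) (S.hessian cov covE i φ x l k) +
          act (gamma k * gamma l) (S.hessian cov covE i φ x l k) =
          if l = k then (-2 : ℂ) • S.hessian cov covE i φ x l k else 0 := fun l k => by
        rw [← add_act, gamma_mul_add]
        split_ifs
        · rw [smul_act, act_one]
        · rw [zero_act]
      simp only [h4, Finset.sum_ite_eq, Finset.mem_univ, if_true, Finset.smul_sum]
    rw [← h3]
    simp only [act_sub, Finset.sum_sub_distrib, Finset.sum_add_distrib, h2, two_smul]
    abel
  simp only [S.hessian_sub hdim hcov hcovE hx hφ, act_add, Finset.sum_add_distrib, smul_act,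
    act_smul, ← Finset.smul_sum] at h1
  have h4 := congrArg (fun w => (ip (φ x) w).re) h1
  simp only [ip_add_right, ip_smul_right, Complex.add_re] at h4
  have h5 := S.curvature_term (i := i) hcov (φ x)
  have h6 : (ip (φ x) (S.curvatureEndo covE i x (φ x))).re = 2 * (ip (φ x) (∑ k, ∑ l,
      act (gamma k * gamma l)
    (fun b => curvature covE x (S.frame i k x) (S.frame i l x) (φ x b)))).re := by
    unfold curvatureEndo
    rw [ip_smul_right]
    simp
  have h7 : ∀ z : ℂ, (2 * z).re = 2 * z.re := fun z => by simp
  have h8 : ∀ z : ℂ, (-2 * z).re = -2 * z.re := fun z => by simp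
  have h9 : ∀ z : ℂ, (1 / 4 * z).re = 1 / 4 * z.re := fun z => by simp
  rw [h7, h8, h9, h5] at h4
  rw [h6]
  linarith

theorem sum_mvfderiv_ip_gamma (hV : IsSmoothHermitian I F V)
    (hcov : IsLeviCivita g cov) (hcovE : IsMetricConnection covE) (hx : x ∈ S.U i)
    (hφ : SmoothSpinorNear I F φ x) (hχ : SmoothSpinorNear I F χ x) :
    ∑ k, (mvfderiv I (fun y => (ip (φ y) (act (gamma k) (χ y))).re) x (S.frame i k x) +
      ∑ l, (ip (φ x) (act (gamma l) (χ x))).re * S.connCoeff cov i x (S.frame i k x) l k) =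
    (ip (φ x) (S.localDirac cov covE i χ x)).re - (ip (S.localDirac cov covE i φ x) (χ x)).re := by
  have h1 : ∀ k, mvfderiv I (fun y => (ip (φ y) (act (gamma k) (χ y))).re) x (S.frame i k x) +
      ∑ l, (ip (φ x) (act (gamma l) (χ x))).re * S.connCoeff cov i x (S.frame i k x) l k =
      -(ip (act (gamma k) (S.nabla cov covE i φ x (S.frame i k x))) (χ x)).re +
        (ip (φ x) (act (gamma k) (S.nabla cov covE i χ x (S.frame i k x)))).re := by
    intro k
    have hχ' := SmoothSpinorNear.act_const (gamma k) hχ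
    have e1 : mvfderiv I (fun y => (ip (φ y) (act (gamma k) (χ y))).re) x (S.frame i k x) =
        (mvfderiv I (fun y => ip (φ y) (act (gamma k) (χ y))) x (S.frame i k x)).re :=
      mvfderiv_comp_clm Complex.reCLM (hφ.ip hV hχ').mdifferentiableAt _
    rw [e1, S.mvfderiv_ip hV hcov hcovE hx hφ hχ', S.nabla_gamma hcov hcovE hx k hχ,
      ip_act_gamma_left, ip_add_right, ip_sum_right]
    simp only [ip_smul_right, Complex.add_re, Complex.re_sum, Complex.re_ofReal_mul, Complex.neg_re]
    have e2 : ∀ l, (ip (φ x) (act (gamma l) (χ x))).re *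
        S.connCoeff cov i x (S.frame i k x) l k = -(S.connCoeff cov i x (S.frame i k x) k l *
          (ip (φ x) (act (gamma l) (χ x))).re) := fun l => by
      rw [S.connCoeff_skew hcov hx _ l k]
      ring
    simp only [e2, Finset.sum_neg_distrib]
    ring
  simp only [h1, Finset.sum_add_distrib, Finset.sum_neg_distrib, localDirac, ip_sum_left,
    ip_sum_right, Complex.re_sum]
  ring

theorem sum_mvfderiv_ip_nabla (hV : IsSmoothHermitian I F V)
    (hcov : IsLeviCivita g cov) (hcovE : IsMetricConnection covE) (hx : x ∈ S.U i)
    (hφ : SmoothSpinorNear I F φ x) :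
    ∑ k, (mvfderiv I (fun y => (ip (φ y) (S.nabla cov covE i φ y (S.frame i k y))).re) x
        (S.frame i k x) + ∑ l, (ip (φ x) (S.nabla cov covE i φ x (S.frame i l x))).re *
          S.connCoeff cov i x (S.frame i k x) l k) =
    ∑ k, (ip (S.nabla cov covE i φ x (S.frame i k x))
      (S.nabla cov covE i φ x (S.frame i k x))).re +
    (ip (φ x) (∑ k, S.hessian cov covE i φ x k k)).re := by
  have h1 : ∀ k, mvfderiv I (fun y => (ip (φ y) (S.nabla cov covE i φ y (S.frame i k y))).re) x
        (S.frame i k x) + ∑ l, (ip (φ x) (S.nabla cov covE i φ x (S.frame i l x))).re *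
          S.connCoeff cov i x (S.frame i k x) l k =
      (ip (S.nabla cov covE i φ x (S.frame i k x)) (S.nabla cov covE i φ x (S.frame i k x))).re +
        (ip (φ x) (S.hessian cov covE i φ x k k)).re := by
    intro k
    have hk := S.smoothSpinorNear_nabla hcov hcovE hx hφ (S.smoothNear_frame hx k)
    have e1 : mvfderiv I (fun y => (ip (φ y) (S.nabla cov covE i φ y (S.frame i k y))).re) x
        (S.frame i k x) = (mvfderiv I (fun y => ip (φ y) (S.nabla cov covE i φ y (S.frame i k y))) x
        (S.frame i k x)).re :=
      mvfderiv_comp_clm Complex.reCLM (hφ.ip hV hk).mdifferentiableAt _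
    rw [e1, S.mvfderiv_ip hV hcov hcovE hx hφ hk, hessian, ip_add_right, ip_sum_right]
    simp only [ip_smul_right, Complex.add_re, Complex.re_sum, Complex.re_ofReal_mul]
    rw [add_assoc]
    congr 2
    exact Finset.sum_congr rfl fun l _ => mul_comm _ _
  simp only [h1, Finset.sum_add_distrib, ip_sum_right, Complex.re_sum]

end SpinStructure

end Weitzenboeck

/-! ### The derivative of the determinant -/

section Jacobi

variable {n : Type*} [Fintype n] [DecidableEq n] {K : Type*} [RCLike K]

/-- The determinant as a continuous real multilinear function of the rows. -/
def detMultilinear (n : Type*) [Fintype n] [DecidableEq n] (K : Type*) [RCLike K] :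
    ContinuousMultilinearMap ℝ (fun _ : n => n → K) K :=
  ContinuousMultilinearMap.restrictScalars ℝ
    { toMultilinearMap := (Matrix.detRowAlternating (n := n) (R := K)).toMultilinearMap
      cont := Continuous.matrix_det continuous_id }

/-- Jacobi's formula for the derivative of the determinant. -/
theorem detMultilinear_linearDeriv (B A : n → n → K) :
    (detMultilinear n K).linearDeriv B A = ((Matrix.of B).adjugate * Matrix.of A).trace := by
  rw [ContinuousMultilinearMap.linearDeriv_apply]
  have h : ∀ i, detMultilinear n K (Function.update B i (A i)) =
      ∑ j, (Matrix.of B).adjugate j i * A i j := by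
    intro i
    have h1 := Matrix.cramer_transpose_apply (Matrix.of B) (A i) i
    rw [Matrix.cramer_eq_adjugate_mulVec, ← Matrix.adjugate_transpose] at h1
    exact h1.symm
  rw [Finset.sum_congr rfl fun i _ => h i, Finset.sum_comm]
  rfl

theorem hasFDerivAt_det (B : n → n → K) :
    HasFDerivAt (𝕜 := ℝ) (fun A : n → n → K => (Matrix.of A).det)
      ((detMultilinear n K).linearDeriv B) B :=
  (detMultilinear n K).hasFDerivAt B

variable {E : Type*} [NormedAddCommGroup E] [NormedSpace ℝ E]
  {H : Type*} [TopologicalSpace H] {I : ModelWithCorners ℝ E H}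
  {M : Type*} [TopologicalSpace M] [ChartedSpace H M]

theorem contMDiffAt_det {B : M → Matrix n n K} {x : M}
    (hB : ∀ a b, ContMDiffAt I 𝓘(ℝ, K) ∞ (fun y => B y a b) x) :
    ContMDiffAt I 𝓘(ℝ, K) ∞ (fun y => (B y).det) x := by
  let b : M → n → n → K := fun y => B y
  have hb : ContMDiffAt I 𝓘(ℝ, n → n → K) ∞ b x :=
    contMDiffAt_pi_space.2 fun a => contMDiffAt_pi_space.2 fun c => hB a c
  exact (detMultilinear n K).contDiff.contMDiff.contMDiffAt.comp x hb

theorem mvfderiv_det {B : M → Matrix n n K} {x : M}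
    (hB : ∀ a b, ContMDiffAt I 𝓘(ℝ, K) ∞ (fun y => B y a b) x) (v : TangentSpace I x) :
    mvfderiv I (fun y => (B y).det) x v =
      ((B x).adjugate * Matrix.of fun a b => mvfderiv I (fun y => B y a b) x v).trace := by
  let b : M → n → n → K := fun y => B y
  have hb : ContMDiffAt I 𝓘(ℝ, n → n → K) ∞ b x :=
    contMDiffAt_pi_space.2 fun a => contMDiffAt_pi_space.2 fun c => hB a c
  have hb' := hb.mdifferentiableAt (by simp)
  have h1 := ((hasFDerivAt_det (b x)).hasMFDerivAt.comp x hb'.hasMFDerivAt).mfderiv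
  have h2 : mvfderiv I (fun y => (B y).det) x v =
      (detMultilinear n K).linearDeriv (B x) (mvfderiv I b x v) := congrArg (fun L => L v) h1
  have h3 : (mvfderiv I b x v : n → n → K) = fun a c => mvfderiv I (fun y => B y a c) x v := by
    funext a c
    exact (mvfderiv_comp_clm ((ContinuousLinearMap.proj (R := ℝ) (φ := fun _ : n => K) c).comp
      (ContinuousLinearMap.proj (R := ℝ) (φ := fun _ : n => n → K) a)) hb' v).symm
  rw [h2, h3]
  exact detMultilinear_linearDeriv (B x) (fun a b => mvfderiv I (fun y => B y a b) x v)

end Jacobi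

/-! ### Change of the spin frame -/

section ChangeOfFrame

open Filter Topology

variable {d : ℕ} {E : Type*} [NormedAddCommGroup E] [NormedSpace ℝ E] [FiniteDimensional ℝ E]
  {H : Type*} [TopologicalSpace H] {I : ModelWithCorners ℝ E H} [I.Boundaryless]
  {M : Type*} [TopologicalSpace M] [T2Space M] [ChartedSpace H M] [IsManifold I ∞ M]
  {g : Metric I M} {ι : Type*} (S : SpinStructure d g ι) {cov : TangentConnection I M}
  {F : Type*} [NormedAddCommGroup F] [NormedSpace ℂ F] [FiniteDimensional ℂ F]
  {V : M → Type*} [TopologicalSpace (TotalSpace F V)]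
  [∀ x, NormedAddCommGroup (V x)] [∀ x, InnerProductSpace ℂ (V x)]
  [FiberBundle F V] [VectorBundle ℂ F V] [VectorBundle ℝ F V]
  [ContMDiffVectorBundle ∞ F V I]
  {covE : CovariantDerivative I F V} {x : M} {i j : ι}

namespace SpinStructure

theorem smoothMatrixNear_lift (hi : x ∈ S.U i) (hj : x ∈ S.U j) :
    SmoothMatrixNear I (S.lift i j) x := fun a b =>
  SmoothFunNear.of_contMDiffOn ((S.isOpen_U i).inter (S.isOpen_U j)) (S.lift_smooth i j a b)
    ⟨hi, hj⟩

/-- The matrix of the change of frame. -/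
def transition (i j : ι) (x : M) (l k : VecIdx d) : ℝ :=
  g.inner x (S.frame i l x) (S.frame j k x)

theorem smoothFunNear_transition (hi : x ∈ S.U i) (hj : x ∈ S.U j) (l k : VecIdx d) :
    SmoothFunNear I (fun y => S.transition i j y l k) x :=
  smoothFunNear_metric (S.smoothNear_frame hi l) (S.smoothNear_frame hj k)

theorem mvfderiv_transition (hdim : Module.finrank ℝ E = 2 * d) (hcov : IsLeviCivita g cov)
    (hi : x ∈ S.U i) (hj : x ∈ S.U j) (v : TangentSpace I x) (l k : VecIdx d) :
    mvfderiv I (fun y => S.transition i j y l k) x v =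
      ∑ p, S.connCoeff cov i x v l p * S.transition i j x p k +
        ∑ m, S.connCoeff cov j x v k m * S.transition i j x l m := by
  unfold transition
  rw [hcov.metric _ _ x (S.smoothNear_frame hi l).mdifferentiableAt
    (S.smoothNear_frame hj k).mdifferentiableAt v, S.cov_frame hdim hi, S.cov_frame hdim hj]
  simp

/-- The failure of `lift i j` to intertwine the connection forms. It commutes with Clifford
multiplication and is traceless, since the determinant of an element of the spin group is a root of
unity; by Schur's lemma it vanishes. -/
theorem matrixDeriv_lift (hdim : Module.finrank ℝ E = 2 * d) (hcov : IsLeviCivita g cov)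
    (hi : x ∈ S.U i) (hj : x ∈ S.U j) (v : TangentSpace I x) :
    matrixDeriv I (S.lift i j) x v + S.connMatrix cov i x v * S.lift i j x -
      S.lift i j x * S.connMatrix cov j x v = 0 := by
  set s := S.lift i j x with hs
  set D := matrixDeriv I (S.lift i j) x v with hD
  set K := D + S.connMatrix cov i x v * s - s * S.connMatrix cov j x v with hK
  have hsp : IsSpinElement s := S.lift_spin i j x ⟨hi, hj⟩
  have hsm := S.smoothMatrixNear_lift hi hj
  let c : M → VecIdx d → SpinorMatrix d := fun y k => cliffordVec fun l => S.transition i j y l k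
  have hc : ∀ k, s * gamma k = c x k * s := fun k => S.lift_frame i j x ⟨hi, hj⟩ k
  have hcs : ∀ k, SmoothMatrixNear I (fun y => c y k) x := fun k =>
    SmoothMatrixNear.sum fun l _ => SmoothMatrixNear.smul
      ((S.smoothFunNear_transition hi hj l k).clm_comp Complex.ofRealCLM) (SmoothMatrixNear.const _)
  have hdc : ∀ k, matrixDeriv I (fun y => c y k) x v =
      ∑ l, ((mvfderiv I (fun y => S.transition i j y l k) x v : ℝ) : ℂ) • gamma l := fun k => by
    have h := matrixDeriv_sum (I := I) (x := x) (t := Finset.univ)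
      (B := fun l y => ((S.transition i j y l k : ℝ) : ℂ) • (gamma l : SpinorMatrix d))
      (fun l _ => SmoothMatrixNear.smul
      ((S.smoothFunNear_transition hi hj l k).clm_comp Complex.ofRealCLM)
      (SmoothMatrixNear.const _)) v
    exact h.trans (Finset.sum_congr rfl fun l _ =>
      matrixDeriv_smul_const (S.smoothFunNear_transition hi hj l k) _ v)
  -- derivative of the relation `lift * gamma k = c k * lift`
  have h1 : ∀ k, D * gamma k = c x k * D + matrixDeriv I (fun y => c y k) x v * s := by
    intro k
    have e1 := matrixDeriv_mul hsm (SmoothMatrixNear.const (gamma k)) v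
    have e2 := matrixDeriv_mul (hcs k) hsm v
    have e3 : matrixDeriv I (fun y => S.lift i j y * gamma k) x v =
        matrixDeriv I (fun y => c y k * S.lift i j y) x v := by
      refine matrixDeriv_congr ?_ v
      filter_upwards [S.eventually_mem hi, S.eventually_mem hj] with y h1 h2
      exact S.lift_frame i j y ⟨h1, h2⟩ k
    rw [e1, e2, matrixDeriv_const, mul_zero, zero_add] at e3
    exact e3
  have h2 : ∀ k, K * gamma k = c x k * K := by
    intro k
    have e1 := S.connMatrix_commutator_gamma hcov hj v k
    have e2 : S.connMatrix cov i x v * c x k - c x k * S.connMatrix cov i x v =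
        ∑ p, ((S.transition i j x p k : ℝ) : ℂ) •
          ∑ l, ((S.connCoeff cov i x v p l : ℝ) : ℂ) • gamma l := by
      simp only [c, cliffordVec, Finset.mul_sum, Finset.sum_mul, mul_smul_comm, smul_mul_assoc,
        ← Finset.sum_sub_distrib, ← smul_sub, S.connMatrix_commutator_gamma hcov hi]
    have e3 : s * ∑ m, ((S.connCoeff cov j x v k m : ℝ) : ℂ) • gamma m =
        (∑ m, ((S.connCoeff cov j x v k m : ℝ) : ℂ) • c x m) * s := by
      simp only [Finset.mul_sum, Finset.sum_mul, mul_smul_comm, smul_mul_assoc, hc]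
    have e4 : matrixDeriv I (fun y => c y k) x v +
        (S.connMatrix cov i x v * c x k - c x k * S.connMatrix cov i x v) -
        ∑ m, ((S.connCoeff cov j x v k m : ℝ) : ℂ) • c x m = 0 := by
      rw [hdc, e2]
      simp only [c, cliffordVec, Finset.smul_sum, S.mvfderiv_transition hdim hcov hi hj, smul_smul]
      rw [Finset.sum_comm (γ := VecIdx d), ← Finset.sum_add_distrib]
      rw [Finset.sum_comm (γ := VecIdx d) (f := fun m l => _ • gamma l), ← Finset.sum_sub_distrib]
      refine Finset.sum_eq_zero fun l _ => ?_
      rw [← Finset.sum_smul, ← Finset.sum_smul, ← add_smul, ← sub_smul]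
      refine smul_eq_zero_of_left ?_ _
      push_cast
      have : ∀ p, ((S.connCoeff cov i x v l p : ℝ) : ℂ) = -((S.connCoeff cov i x v p l : ℝ) : ℂ) :=
        fun p => by rw [S.connCoeff_skew hcov hi v l p, Complex.ofReal_neg]
      simp only [this, neg_mul, Finset.sum_neg_distrib, mul_comm]
      ring
    calc K * gamma k = D * gamma k + S.connMatrix cov i x v * (s * gamma k) -
          s * (S.connMatrix cov j x v * gamma k - gamma k * S.connMatrix cov j x v) -
          (s * gamma k) * S.connMatrix cov j x v := by rw [hK]; noncomm_ring
      _ = c x k * K + (matrixDeriv I (fun y => c y k) x v +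
        (S.connMatrix cov i x v * c x k - c x k * S.connMatrix cov i x v) -
        ∑ m, ((S.connCoeff cov j x v k m : ℝ) : ℂ) • c x m) * s := by
          rw [h1, e1, e3, hc, hK]
          noncomm_ring
      _ = c x k * K := by rw [e4, zero_mul, add_zero]
  -- `s⁻¹ K` commutes with Clifford multiplication
  have h3 : ∀ k, s.conjTranspose * K * gamma k = gamma k * (s.conjTranspose * K) := by
    intro k
    have e1 : s.conjTranspose * c x k = gamma k * s.conjTranspose := by
      calc s.conjTranspose * c x k = s.conjTranspose * (c x k * s) * s.conjTranspose := by
            rw [mul_assoc, mul_assoc, hsp.mul_conjTranspose_self, mul_one]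
        _ = gamma k * s.conjTranspose := by
            rw [← hc, ← mul_assoc, hsp.conjTranspose_mul_self, one_mul]
    rw [mul_assoc, h2, ← mul_assoc, e1, mul_assoc]
  -- `tr (s⁻¹ D)` is the logarithmic derivative of `det (lift)`, a fourth root of unity
  have h4 : (s.conjTranspose * D).trace = 0 := by
    have hdet : mvfderiv I (fun y => (S.lift i j y).det) x v = 0 := by
      have hsd : SmoothFunNear I (fun y => (S.lift i j y).det) x := by
        filter_upwards [eventually_all.2 fun a => eventually_all.2 fun b => hsm a b] with y hy
        exact contMDiffAt_det hy
      have e1 : mvfderiv I (fun y => (S.lift i j y).det ^ 4) x v = 0 := by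
        rw [mvfderiv_congr (h := fun _ => (1 : ℂ)), mvfderiv_const]
        · rfl
        filter_upwards [S.eventually_mem hi, S.eventually_mem hj] with y h1 h2
        exact (S.lift_spin i j y ⟨h1, h2⟩).det_pow_four
      have e2 : ∀ z : ℂ, z ^ 4 = z * (z * (z * z)) := fun z => by ring
      simp only [e2] at e1
      rw [mvfderiv_fun_mul hsd (hsd.mul (hsd.mul hsd)), mvfderiv_fun_mul hsd (hsd.mul hsd),
        mvfderiv_fun_mul hsd hsd] at e1
      have e3 : 4 * s.det ^ 3 * mvfderiv I (fun y => (S.lift i j y).det) x v = 0 := by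
        rw [← e1]
        ring
      have e4 : s.det ≠ 0 := fun h0 => by
        have := hsp.det_pow_four
        rw [h0] at this
        norm_num at this
      simpa [e4] using e3
    rw [mvfderiv_det fun a b => (hsm a b).contMDiffAt] at hdet
    have e5 : s.adjugate = s.det • s.conjTranspose := by
      calc s.adjugate = s.adjugate * (s * s.conjTranspose) := by
            rw [hsp.mul_conjTranspose_self, mul_one]
        _ = s.det • s.conjTranspose := by
            rw [← mul_assoc, Matrix.adjugate_mul, smul_mul_assoc, one_mul]
    have e6 : (s.adjugate * D).trace = 0 := hdet
    rw [e5, smul_mul_assoc, Matrix.trace_smul, smul_eq_zero] at e6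
    refine e6.resolve_left fun h0 => ?_
    have := hsp.det_pow_four
    rw [h0] at this
    norm_num at this
  have h5 : (s.conjTranspose * K).trace = 0 := by
    have e1 : s.conjTranspose * K = s.conjTranspose * D +
        s.conjTranspose * (S.connMatrix cov i x v * s) - S.connMatrix cov j x v := by
      rw [hK, mul_sub, mul_add, ← mul_assoc _ s, hsp.conjTranspose_mul_self, one_mul]
    rw [e1, Matrix.trace_sub, Matrix.trace_add, h4, Matrix.trace_mul_comm, mul_assoc,
      hsp.mul_conjTranspose_self, mul_one, S.trace_connMatrix hcov hi, S.trace_connMatrix hcov hj]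
    simp
  have h6 := eq_zero_of_commute_gamma h3 h5
  calc K = s * (s.conjTranspose * K) := by rw [← mul_assoc, hsp.mul_conjTranspose_self, one_mul]
    _ = 0 := by rw [h6, mul_zero]

theorem nabla_lift (hdim : Module.finrank ℝ E = 2 * d) (hcov : IsLeviCivita g cov)
    (hcovE : IsMetricConnection covE) (hi : x ∈ S.U i) (hj : x ∈ S.U j)
    {φ χ : Π y : M, SpinorIdx d → V y} (hχ : SmoothSpinorNear I F χ x)
    (h : ∀ᶠ y in 𝓝 x, φ y = act (S.lift i j y) (χ y)) (v : TangentSpace I x) :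
    S.nabla cov covE i φ x v = act (S.lift i j x) (S.nabla cov covE j χ x v) := by
  have hsm := S.smoothMatrixNear_lift hi hj
  have hs := SmoothSpinorNear.act hsm hχ
  rw [S.nabla_congr (hs.congr h) h, S.nabla_act hcovE hsm hχ]
  have h1 : S.nabla cov covE i χ x v = S.nabla cov covE j χ x v +
      act (S.connMatrix cov i x v - S.connMatrix cov j x v) (χ x) := by
    unfold nabla
    rw [sub_act]
    abel
  have h2 := congrArg (fun A => act A (χ x)) (S.matrixDeriv_lift hdim hcov hi hj v)
  simp only [zero_act] at h2
  rw [h1, act_add, ← act_mul, add_left_comm, ← add_act, mul_sub]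
  have h3 : matrixDeriv I (S.lift i j) x v + (S.connMatrix cov i x v * S.lift i j x -
      S.lift i j x * S.connMatrix cov i x v) + (S.lift i j x * S.connMatrix cov i x v -
      S.lift i j x * S.connMatrix cov j x v) = matrixDeriv I (S.lift i j) x v +
      S.connMatrix cov i x v * S.lift i j x - S.lift i j x * S.connMatrix cov j x v := by abel
  rw [h3, h2, add_zero]

/-- The twisted Dirac operator does not depend on the spin frame. -/
theorem localDirac_lift (hdim : Module.finrank ℝ E = 2 * d) (hcov : IsLeviCivita g cov)
    (hcovE : IsMetricConnection covE) (hi : x ∈ S.U i) (hj : x ∈ S.U j)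
    {φ χ : Π y : M, SpinorIdx d → V y} (hχ : SmoothSpinorNear I F χ x)
    (h : ∀ᶠ y in 𝓝 x, φ y = act (S.lift i j y) (χ y)) :
    S.localDirac cov covE i φ x = act (S.lift i j x) (S.localDirac cov covE j χ x) := by
  have h1 : ∀ k, S.nabla cov covE j χ x (S.frame j k x) = ∑ l, ((S.transition i j x l k : ℝ) : ℂ) •
      S.nabla cov covE j χ x (S.frame i l x) := fun k => by
    conv_lhs => rw [(S.frame_orthonormal i x hi).expand hdim (S.frame j k x), nabla_sum_vector]
    refine Finset.sum_congr rfl fun l _ => ?_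
    rw [nabla_smul_vector, g.symm]
    rfl
  have h2 : ∀ l m, ∑ k, S.transition i j x l k * S.transition i j x m k = if l = m then 1 else 0 :=
    fun l m => by
      rw [← S.frame_orthonormal i x hi l m, (S.frame_orthonormal j x hj).inner_eq_sum hdim]
      rfl
  have h3 : ∀ k, S.lift i j x * gamma k =
      ∑ m, ((S.transition i j x m k : ℝ) : ℂ) • (gamma m * S.lift i j x) := fun k => by
    rw [S.lift_frame i j x ⟨hi, hj⟩ k, cliffordVec, Finset.sum_mul]
    simp only [smul_mul_assoc]
    rfl
  unfold localDirac
  simp only [S.nabla_lift hdim hcov hcovE hi hj hχ h, act_sum, ← act_mul, h3, sum_act, smul_act]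
  simp only [h1, act_sum, act_smul, Finset.smul_sum, smul_smul]
  rw [Finset.sum_comm]
  refine Finset.sum_congr rfl fun m _ => ?_
  rw [Finset.sum_comm]
  simp only [← Finset.sum_smul, ← Complex.ofReal_mul, ← Complex.ofReal_sum, h2]
  simp

end SpinStructure

end ChangeOfFrame

/-! ### The Kähler form and the degree of spinor fields -/

section KaehlerSpinors

open Filter Topology

variable {d : ℕ} {E : Type*} [NormedAddCommGroup E] [NormedSpace ℝ E] [FiniteDimensional ℝ E]
  {H : Type*} [TopologicalSpace H] {I : ModelWithCorners ℝ E H} [I.Boundaryless]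
  {M : Type*} [TopologicalSpace M] [T2Space M] [ChartedSpace H M] [IsManifold I ∞ M]
  {g : Metric I M} {ι : Type*} (S : SpinStructure d g ι) {cov : TangentConnection I M}
  {J : TangentEndo I M}
  {F : Type*} [NormedAddCommGroup F] [NormedSpace ℂ F] [FiniteDimensional ℂ F]
  {V : M → Type*} [TopologicalSpace (TotalSpace F V)]
  [∀ x, NormedAddCommGroup (V x)] [∀ x, InnerProductSpace ℂ (V x)]
  [FiberBundle F V] [VectorBundle ℂ F V] [VectorBundle ℝ F V]
  [ContMDiffVectorBundle ∞ F V I]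
  {covE : CovariantDerivative I F V} {x : M} {i j : ι}
  {φ χ : Π y : M, SpinorIdx d → V y} {B C : M → SpinorMatrix d}

theorem IsKaehlerStructure.smoothNear (hJ : IsKaehlerStructure g cov J)
    {X : Π y : M, TangentSpace I y} (hX : SmoothNear I E X x) :
    SmoothNear I E (fun y => J y (X y)) x := by
  filter_upwards [hX] with y h1
  exact ContMDiffAt.clm_bundle_apply (b := id) (ϕ := J) (v := X) hJ.smooth.contMDiffAt h1

theorem IsKaehlerStructure.inner_left (hJ : IsKaehlerStructure g cov J) (u v : TangentSpace I x) :
    g.inner x (J x u) v = -g.inner x u (J x v) := by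
  have h := hJ.orthogonal x u (J x v)
  rw [hJ.sq, map_neg] at h
  linarith

theorem aeval_intertwine {A B s : SpinorMatrix d} (h : A * s = s * B) (f : Polynomial ℂ) :
    Polynomial.aeval A f * s = s * Polynomial.aeval B f := by
  have hp : ∀ n : ℕ, A ^ n * s = s * B ^ n := fun n => by
    induction n with
    | zero => simp
    | succ n ih => rw [pow_succ, mul_assoc, h, ← mul_assoc, ih, mul_assoc, ← pow_succ]
  induction f using Polynomial.induction_on' with
  | add p q hp hq => rw [map_add, map_add, add_mul, mul_add, hp, hq]
  | monomial n a =>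
    simp only [Polynomial.aeval_monomial, Algebra.algebraMap_eq_smul_one, smul_mul_assoc, one_mul,
      mul_smul_comm, hp]

namespace SpinStructure

/-- The matrix-valued function `B` represents an endomorphism field of the spinor bundle whose
covariant derivative vanishes at `x`. -/
structure ParallelAt (cov : TangentConnection I M) (i : ι) (B : M → SpinorMatrix d) (x : M) :
    Prop where
  smooth : SmoothMatrixNear I B x
  deriv : ∀ v, matrixDeriv I B x v + (S.connMatrix cov i x v * B x - B x * S.connMatrix cov i x v) = 0

variable {S}

theorem ParallelAt.const_smul_one (c : ℂ) :
    S.ParallelAt cov i (fun _ => c • (1 : SpinorMatrix d)) x where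
  smooth := SmoothMatrixNear.const _
  deriv v := by simp [matrixDeriv_const]

theorem ParallelAt.mul (hB : S.ParallelAt cov i B x) (hC : S.ParallelAt cov i C x) :
    S.ParallelAt cov i (fun y => B y * C y) x where
  smooth := hB.smooth.mul hC.smooth
  deriv v := by
    rw [matrixDeriv_mul hB.smooth hC.smooth]
    calc _ = B x * (matrixDeriv I C x v + (S.connMatrix cov i x v * C x -
          C x * S.connMatrix cov i x v)) + (matrixDeriv I B x v + (S.connMatrix cov i x v * B x -
          B x * S.connMatrix cov i x v)) * C x := by noncomm_ring
      _ = 0 := by rw [hB.deriv, hC.deriv]; simp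

theorem ParallelAt.add (hB : S.ParallelAt cov i B x) (hC : S.ParallelAt cov i C x) :
    S.ParallelAt cov i (fun y => B y + C y) x where
  smooth := hB.smooth.add hC.smooth
  deriv v := by
    have h1 : matrixDeriv I (fun y => B y + C y) x v =
        matrixDeriv I B x v + matrixDeriv I C x v := by
      have h := matrixDeriv_sum (t := Finset.univ) (B := fun (b : Bool) y => cond b (B y) (C y))
        (fun b _ => by cases b; exacts [hC.smooth, hB.smooth]) v
      simpa using h
    rw [h1]
    calc _ = (matrixDeriv I C x v + (S.connMatrix cov i x v * C x -
          C x * S.connMatrix cov i x v)) + (matrixDeriv I B x v + (S.connMatrix cov i x v * B x -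
          B x * S.connMatrix cov i x v)) := by noncomm_ring
      _ = 0 := by rw [hB.deriv, hC.deriv]; simp

theorem ParallelAt.aeval (hB : S.ParallelAt cov i B x) (f : Polynomial ℂ) :
    S.ParallelAt cov i (fun y => Polynomial.aeval (B y) f) x := by
  have hp : ∀ n : ℕ, S.ParallelAt cov i (fun y => B y ^ n) x := fun n => by
    induction n with
    | zero => simpa using ParallelAt.const_smul_one (S := S) (cov := cov) (i := i) (x := x) 1
    | succ n ih => simpa only [pow_succ] using ih.mul hB
  induction f using Polynomial.induction_on' with
  | add p q hp hq => simpa only [map_add] using hp.add hq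
  | monomial n a =>
    simpa only [Polynomial.aeval_monomial, Algebra.algebraMap_eq_smul_one] using
      (ParallelAt.const_smul_one (S := S) (cov := cov) (i := i) (x := x) a).mul (hp n)

theorem nabla_parallel (hcovE : IsMetricConnection covE) (hB : S.ParallelAt cov i B x)
    (hφ : SmoothSpinorNear I F φ x) (v : TangentSpace I x) :
    S.nabla cov covE i (fun y => act (B y) (φ y)) x v = act (B x) (S.nabla cov covE i φ x v) := by
  rw [S.nabla_act hcovE hB.smooth hφ, hB.deriv, zero_act, zero_add]

variable (S)

/-- The components of the complex structure in the frame over `U i`. -/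
def kaehlerCoeff (J : TangentEndo I M) (i : ι) (x : M) (k l : VecIdx d) : ℝ :=
  g.inner x (J x (S.frame i k x)) (S.frame i l x)

theorem J_frame (hdim : Module.finrank ℝ E = 2 * d) (hx : x ∈ S.U i) (k : VecIdx d) :
    J x (S.frame i k x) = ∑ l, S.kaehlerCoeff J i x k l • S.frame i l x :=
  (S.frame_orthonormal i x hx).expand hdim _

theorem isComplexStructure (hdim : Module.finrank ℝ E = 2 * d) (hJ : IsKaehlerStructure g cov J)
    (hx : x ∈ S.U i) : IsComplexStructure (S.kaehlerCoeff J i x) where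
  skew k l := by
    unfold kaehlerCoeff
    rw [hJ.inner_left, g.symm]
  sq k m := by
    have h1 : ∑ l, S.kaehlerCoeff J i x k l * S.kaehlerCoeff J i x l m =
        g.inner x (J x (J x (S.frame i k x))) (S.frame i m x) := by
      conv_rhs => rw [S.J_frame hdim hx k]
      simp [kaehlerCoeff]
    rw [h1, hJ.sq, map_neg, neg_apply, S.frame_orthonormal i x hx]
    split_ifs <;> simp

theorem parallelAt_kaehlerOp (hdim : Module.finrank ℝ E = 2 * d) (hcov : IsLeviCivita g cov)
    (hJ : IsKaehlerStructure g cov J) (hx : x ∈ S.U i) :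
    S.ParallelAt cov i (fun y => kaehlerOp (S.kaehlerCoeff J i y)) x := by
  have hs : ∀ k l, SmoothFunNear I (fun y => S.kaehlerCoeff J i y k l) x := fun k l =>
    smoothFunNear_metric (hJ.smoothNear (S.smoothNear_frame hx k)) (S.smoothNear_frame hx l)
  have hb : SmoothMatrixNear I (fun y => bivector (S.kaehlerCoeff J i y)) x :=
    SmoothMatrixNear.sum fun k _ => SmoothMatrixNear.sum fun l _ =>
      SmoothMatrixNear.smul ((hs k l).clm_comp Complex.ofRealCLM) (SmoothMatrixNear.const _)
  refine ⟨SmoothMatrixNear.smul (SmoothFunNear.const _) hb, fun v => ?_⟩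
  have h1 : ∀ k l, mvfderiv I (fun y => S.kaehlerCoeff J i y k l) x v =
      -∑ c, (S.connCoeff cov i x v c k * S.kaehlerCoeff J i x c l +
        S.connCoeff cov i x v c l * S.kaehlerCoeff J i x k c) := by
    intro k l
    have e1 := hcov.metric _ _ x (hJ.smoothNear (S.smoothNear_frame hx k)).mdifferentiableAt
      (S.smoothNear_frame hx l).mdifferentiableAt v
    rw [hJ.parallel _ x (S.smoothNear_frame hx k).mdifferentiableAt, S.cov_frame hdim hx,
      S.cov_frame hdim hx] at e1
    refine e1.trans ?_
    simp only [map_sum, map_smul, sum_apply, smul_apply, smul_eq_mul, Finset.sum_add_distrib,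
      neg_add, ← Finset.sum_neg_distrib]
    congr 1 <;> refine Finset.sum_congr rfl fun c _ => ?_
    · rw [S.connCoeff_skew hcov hx v k c, neg_mul]
      rfl
    · rw [S.connCoeff_skew hcov hx v l c, neg_mul]
      rfl
  have h2 := bivector_commutator_bivector (S.connCoeff_skew hcov hx v) (S.kaehlerCoeff J i x)
  unfold kaehlerOp connMatrix
  rw [matrixDeriv_const_smul _ hb, matrixDeriv_bivector hs]
  simp only [smul_mul_assoc, mul_smul_comm]
  rw [smul_comm (1 / 4 : ℂ), ← smul_sub, ← smul_sub, h2, ← smul_add]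
  simp only [h1]
  have h3 : ∀ b : VecIdx d → VecIdx d → ℝ, bivector (fun k l => -b k l) = -bivector b := fun b => by
    simp only [bivector, Complex.ofReal_neg, neg_smul, Finset.sum_neg_distrib]
  rw [h3, smul_smul]
  norm_num

theorem parallelAt_degreeProj (hdim : Module.finrank ℝ E = 2 * d) (hcov : IsLeviCivita g cov)
    (hJ : IsKaehlerStructure g cov J) (hx : x ∈ S.U i) (r : ℕ) :
    S.ParallelAt cov i (fun y => degreeProj (S.kaehlerCoeff J i y) r) x := by
  refine ParallelAt.aeval ?_ (degreePoly d r)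
  have h := (ParallelAt.const_smul_one (S := S) (cov := cov) (i := i) (x := x) (d / 2 : ℂ)).add
    ((ParallelAt.const_smul_one (S := S) (cov := cov) (i := i) (x := x) (-(1 / 2) * Complex.I)).mul
      (S.parallelAt_kaehlerOp hdim hcov hJ hx))
  have e : (fun y => degreeOp (S.kaehlerCoeff J i y)) = fun y => (d / 2 : ℂ) • (1 : SpinorMatrix d) +
      ((-(1 / 2) * Complex.I) • (1 : SpinorMatrix d)) * kaehlerOp (S.kaehlerCoeff J i y) := by
    funext y
    rw [degreeOp, smul_mul_assoc, one_mul]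
    module
  rw [e]
  exact h

theorem kaehlerOp_lift (hdim : Module.finrank ℝ E = 2 * d)
    (hi : x ∈ S.U i) (hj : x ∈ S.U j) :
    kaehlerOp (S.kaehlerCoeff J i x) * S.lift i j x =
      S.lift i j x * kaehlerOp (S.kaehlerCoeff J j x) := by
  have h3 : ∀ k, S.lift i j x * gamma k =
      (∑ m, ((S.transition i j x m k : ℝ) : ℂ) • gamma m) * S.lift i j x := fun k =>
    S.lift_frame i j x ⟨hi, hj⟩ k
  have h1 : ∀ k l, S.lift i j x * (gamma k * gamma l) = (∑ p, ∑ q, ((S.transition i j x p k : ℝ) : ℂ) •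
      ((S.transition i j x q l : ℝ) : ℂ) • (gamma p * gamma q)) * S.lift i j x := fun k l => by
    rw [← mul_assoc, h3, mul_assoc, h3, ← mul_assoc]
    congr 1
    simp only [Finset.sum_mul, Finset.mul_sum, smul_mul_assoc, mul_smul_comm, Finset.smul_sum]
    rw [Finset.sum_comm]
    exact Finset.sum_congr rfl fun p _ => Finset.sum_congr rfl fun q _ => smul_comm _ _ _
  have h2 : ∀ p q, S.kaehlerCoeff J i x p q = ∑ k, ∑ l, S.kaehlerCoeff J j x k l *
      (S.transition i j x p k * S.transition i j x q l) := fun p q => by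
    have e1 := (S.frame_orthonormal j x hj).expand hdim (S.frame i p x)
    have e2 := (S.frame_orthonormal j x hj).expand hdim (S.frame i q x)
    conv_lhs => rw [kaehlerCoeff, e1, e2]
    simp only [map_sum, map_smul, sum_apply, smul_apply, smul_eq_mul, Finset.mul_sum]
    refine Finset.sum_comm.trans ?_
    refine Finset.sum_congr rfl fun k _ => Finset.sum_congr rfl fun l _ => ?_
    unfold transition kaehlerCoeff
    ring
  unfold kaehlerOp bivector
  simp only [smul_mul_assoc, mul_smul_comm, Finset.mul_sum, h1, Finset.sum_mul, h2]
  congr 1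
  push_cast
  simp only [Finset.sum_smul, Finset.smul_sum, smul_smul]
  have h4 : ∀ f : VecIdx d → VecIdx d → VecIdx d → VecIdx d → SpinorMatrix d,
      ∑ p, ∑ q, ∑ k, ∑ l, f p q k l = ∑ k, ∑ l, ∑ p, ∑ q, f p q k l := fun f => by
    calc _ = ∑ p, ∑ k, ∑ q, ∑ l, f p q k l := Finset.sum_congr rfl fun p _ => Finset.sum_comm
      _ = ∑ k, ∑ p, ∑ q, ∑ l, f p q k l := Finset.sum_comm
      _ = ∑ k, ∑ p, ∑ l, ∑ q, f p q k l := Finset.sum_congr rfl fun k _ =>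
        Finset.sum_congr rfl fun p _ => Finset.sum_comm
      _ = _ := Finset.sum_congr rfl fun k _ => Finset.sum_comm
  rw [h4]

theorem degreeProj_lift (hdim : Module.finrank ℝ E = 2 * d)
    (hi : x ∈ S.U i) (hj : x ∈ S.U j) (r : ℕ) :
    degreeProj (S.kaehlerCoeff J i x) r * S.lift i j x =
      S.lift i j x * degreeProj (S.kaehlerCoeff J j x) r := by
  refine aeval_intertwine ?_ _
  rw [degreeOp, degreeOp, smul_mul_assoc, mul_smul_comm, sub_mul, mul_sub, smul_mul_assoc,
    smul_mul_assoc, mul_smul_comm, mul_smul_comm, S.kaehlerOp_lift hdim hi hj, one_mul, mul_one]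

/-! ### Global spinor fields -/

section Global

variable {S} {ψ η : LocalSpinor d ι V}

theorem IsSmoothSpinor.smoothSpinorNear (hψ : S.IsSmoothSpinor F ψ) (hx : x ∈ S.U i) :
    SmoothSpinorNear I F (ψ i) x := fun a =>
  SmoothNear.of_contMDiffOn (S.isOpen_U i) (hψ.smooth i a) hx

theorem IsSmoothSpinor.eventually_lift (hψ : S.IsSmoothSpinor F ψ) (hi : x ∈ S.U i)
    (hj : x ∈ S.U j) : ∀ᶠ y in 𝓝 x, ψ i y = act (S.lift i j y) (ψ j y) := by
  filter_upwards [S.eventually_mem hi, S.eventually_mem hj] with y h1 h2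
  exact hψ.compatible i j y ⟨h1, h2⟩

theorem isSmoothSpinor_of (h1 : ∀ i, ∀ x ∈ S.U i, SmoothSpinorNear I F (ψ i) x)
    (h2 : ∀ i j, ∀ x, x ∈ S.U i → x ∈ S.U j → ψ i x = act (S.lift i j x) (ψ j x)) :
    S.IsSmoothSpinor F ψ where
  smooth i a := SmoothNear.contMDiffOn fun x hx => h1 i x hx a
  compatible i j x hx := h2 i j x hx.1 hx.2

theorem IsSmoothSpinor.dirac (hdim : Module.finrank ℝ E = 2 * d) (hcov : IsLeviCivita g cov)
    (hcovE : IsMetricConnection covE) (hψ : S.IsSmoothSpinor F ψ) :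
    S.IsSmoothSpinor F (S.dirac cov covE ψ) :=
  isSmoothSpinor_of (fun _ _ hx => S.smoothSpinorNear_localDirac hcov hcovE hx (hψ.smoothSpinorNear hx))
    fun _ _ _ hi hj => S.localDirac_lift hdim hcov hcovE hi hj (hψ.smoothSpinorNear hj)
      (hψ.eventually_lift hi hj)

theorem IsSmoothSpinor.sum {κ : Type*} {t : Finset κ} {ψ : κ → LocalSpinor d ι V}
    (hψ : ∀ k, S.IsSmoothSpinor F (ψ k)) (z : κ → ℂ) :
    S.IsSmoothSpinor F (fun i x => ∑ k ∈ t, z k • ψ k i x) :=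
  isSmoothSpinor_of (fun _ _ hx => SmoothSpinorNear.sum fun k _ =>
      (SmoothSpinorNear.smul (SmoothFunNear.const (z k)) ((hψ k).smoothSpinorNear hx)))
    fun i j x hi hj => by
      rw [act_sum]
      exact Finset.sum_congr rfl fun k _ => by rw [(hψ k).compatible i j x ⟨hi, hj⟩, act_smul]

variable (S)

/-- The component of the spinor field `ψ` in `Σ_r M ⊗ E`. -/
def component (J : TangentEndo I M) (r : ℕ) (ψ : LocalSpinor d ι V) : LocalSpinor d ι V :=
  fun i x => act (degreeProj (S.kaehlerCoeff J i x) r) (ψ i x)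

variable {S}

theorem IsSmoothSpinor.component (hdim : Module.finrank ℝ E = 2 * d) (hcov : IsLeviCivita g cov)
    (hJ : IsKaehlerStructure g cov J) (hψ : S.IsSmoothSpinor F ψ) (r : ℕ) :
    S.IsSmoothSpinor F (S.component J r ψ) :=
  isSmoothSpinor_of (fun _ _ hx => SmoothSpinorNear.act
      (S.parallelAt_degreeProj hdim hcov hJ hx r).smooth (hψ.smoothSpinorNear hx))
    fun i j x hi hj => by
      unfold SpinStructure.component
      rw [hψ.compatible i j x ⟨hi, hj⟩, ← act_mul, ← act_mul, S.degreeProj_lift hdim hi hj]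

theorem nabla_component (hdim : Module.finrank ℝ E = 2 * d) (hcov : IsLeviCivita g cov)
    (hcovE : IsMetricConnection covE) (hJ : IsKaehlerStructure g cov J)
    (hψ : S.IsSmoothSpinor F ψ) (hx : x ∈ S.U i) (r : ℕ) (v : TangentSpace I x) :
    S.nabla cov covE i (S.component J r ψ i) x v =
      act (degreeProj (S.kaehlerCoeff J i x) r) (S.nabla cov covE i (ψ i) x v) :=
  nabla_parallel hcovE (S.parallelAt_degreeProj hdim hcov hJ hx r) (hψ.smoothSpinorNear hx) v

end Global

end SpinStructure

end KaehlerSpinors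

/-! ### The integrated Weitzenböck formula -/

section Integrated

open Filter Topology

variable {d : ℕ} {E : Type*} [NormedAddCommGroup E] [NormedSpace ℝ E] [FiniteDimensional ℝ E]
  {H : Type*} [TopologicalSpace H] {I : ModelWithCorners ℝ E H} [I.Boundaryless]
  {M : Type*} [TopologicalSpace M] [T2Space M] [ChartedSpace H M] [IsManifold I ∞ M]
  {g : Metric I M} {ι : Type*} {S : SpinStructure d g ι} {cov : TangentConnection I M}
  {J : TangentEndo I M}
  {F : Type*} [NormedAddCommGroup F] [NormedSpace ℂ F] [FiniteDimensional ℂ F]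
  {V : M → Type*} [TopologicalSpace (TotalSpace F V)]
  [∀ x, NormedAddCommGroup (V x)] [∀ x, InnerProductSpace ℂ (V x)]
  [FiberBundle F V] [VectorBundle ℂ F V] [VectorBundle ℝ F V]
  [ContMDiffVectorBundle ∞ F V I]
  {covE : CovariantDerivative I F V} {x : M} {i j : ι}
  {ψ η : LocalSpinor d ι V}

/-- A linear functional `Λ` on functions that behaves like integration over the closed manifold `M`
against a smooth positive density which is parallel for the connection: it is strictly positive and
annihilates divergences. -/
structure IsIntegral (cov : TangentConnection I M) (Λ : (M → ℝ) → ℝ) : Prop where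
  add : ∀ f h : M → ℝ, Continuous f → Continuous h → Λ (fun x => f x + h x) = Λ f + Λ h
  smul : ∀ (c : ℝ) (f : M → ℝ), Continuous f → Λ (fun x => c * f x) = c * Λ f
  pos : ∀ f : M → ℝ, Continuous f → (∀ x, 0 ≤ f x) → (∃ x, f x ≠ 0) → 0 < Λ f
  divergence : ∀ Z : Π x : M, TangentSpace I x, (∀ x, SmoothNear I E Z x) →
    Λ (divergence cov Z) = 0

namespace IsIntegral

variable {Λ : (M → ℝ) → ℝ} {f h : M → ℝ}

theorem sub (hΛ : IsIntegral cov Λ) (hf : Continuous f) (hh : Continuous h) :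
    Λ (fun x => f x - h x) = Λ f - Λ h := by
  have h1 := hΛ.add f (fun x => -1 * h x) hf (continuous_const.mul hh)
  rw [hΛ.smul _ _ hh] at h1
  have h2 : (fun x => f x - h x) = fun x => f x + -1 * h x := by funext x; ring
  rw [h2, h1]
  ring

theorem zero (hΛ : IsIntegral cov Λ) : Λ (fun _ => 0) = 0 := by
  have h := hΛ.smul 0 (fun _ => 0) continuous_const
  simpa using h

theorem nonneg (hΛ : IsIntegral cov Λ) (hf : Continuous f) (h0 : ∀ x, 0 ≤ f x) : 0 ≤ Λ f := by
  by_cases h : ∃ x, f x ≠ 0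
  · exact (hΛ.pos f hf h0 h).le
  · push Not at h
    have : f = fun _ => 0 := funext h
    rw [this, hΛ.zero]

theorem mono (hΛ : IsIntegral cov Λ) (hf : Continuous f) (hh : Continuous h)
    (hle : ∀ x, f x ≤ h x) : Λ f ≤ Λ h := by
  have h1 : 0 ≤ Λ (fun x => h x - f x) := hΛ.nonneg (hh.sub hf) fun x => sub_nonneg.2 (hle x)
  rw [hΛ.sub hh hf] at h1
  linarith

theorem sum (hΛ : IsIntegral cov Λ) {κ : Type*} (t : Finset κ) {f : κ → M → ℝ}
    (hf : ∀ k, Continuous (f k)) : Λ (fun x => ∑ k ∈ t, f k x) = ∑ k ∈ t, Λ (f k) := by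
  classical
  induction t using Finset.induction_on with
  | empty => simpa using hΛ.zero
  | insert a s ha ih =>
    simp only [Finset.sum_insert ha]
    rw [hΛ.add _ _ (hf a) (continuous_finsetSum _ fun k _ => hf k), ih]

end IsIntegral

theorem SmoothFunNear.continuous {f : M → ℝ} (hf : ∀ x, SmoothFunNear I f x) : Continuous f :=
  continuous_iff_continuousAt.2 fun x => (hf x).contMDiffAt.continuousAt

theorem IsOrthonormalFrame.sharp_eq (hdim : Module.finrank ℝ E = 2 * d)
    {e e' : VecIdx d → TangentSpace I x} (he : IsOrthonormalFrame g x e)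
    (he' : IsOrthonormalFrame g x e') (α : TangentSpace I x →ₗ[ℝ] ℝ) :
    ∑ l, α (e l) • e l = ∑ l, α (e' l) • e' l := by
  have h1 : ∀ l, α (e l) = ∑ k, g.inner x (e l) (e' k) * α (e' k) := fun l => by
    conv_lhs => rw [he'.expand hdim (e l)]
    simp
  have h2 : ∀ k, e' k = ∑ l, g.inner x (e l) (e' k) • e l := fun k => by
    conv_lhs => rw [he.expand hdim (e' k)]
    exact Finset.sum_congr rfl fun l _ => by rw [g.symm]
  simp only [h1, Finset.sum_smul]
  rw [Finset.sum_comm]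
  refine Finset.sum_congr rfl fun k _ => ?_
  rw [show α (e' k) • e' k = α (e' k) • ∑ l, g.inner x (e l) (e' k) • e l from
    congrArg (fun v => α (e' k) • v) (h2 k), Finset.smul_sum]
  exact Finset.sum_congr rfl fun l _ => by rw [smul_smul, mul_comm]

namespace SpinStructure

variable (S)

/-- The index of a set of the cover that contains `x`. -/
def index (x : M) : ι := (mem_iUnion.1 (S.iUnion_U.ge (mem_univ x))).choose

theorem mem_index (x : M) : x ∈ S.U (S.index x) :=
  (mem_iUnion.1 (S.iUnion_U.ge (mem_univ x))).choose_spec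

/-- The divergence of the metric dual of a smooth 1-form, given by local representatives `α i` that
agree on overlaps. -/
theorem exists_divergence_eq (hdim : Module.finrank ℝ E = 2 * d)
    (α : ι → Π x : M, TangentSpace I x →ₗ[ℝ] ℝ)
    (hα : ∀ i j x, x ∈ S.U i → x ∈ S.U j → ∀ v, α i x v = α j x v)
    (hs : ∀ i, ∀ x ∈ S.U i, ∀ l, SmoothFunNear I (fun y => α i y (S.frame i l y)) x) :
    ∃ Z : Π x : M, TangentSpace I x, (∀ x, SmoothNear I E Z x) ∧ ∀ x, divergence cov Z x =
      ∑ k, (mvfderiv I (fun y => α (S.index x) y (S.frame (S.index x) k y)) x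
        (S.frame (S.index x) k x) +
        ∑ l, α (S.index x) x (S.frame (S.index x) l x) *
          S.connCoeff cov (S.index x) x (S.frame (S.index x) k x) l k) := by
  let Z : Π x : M, TangentSpace I x := fun x =>
    ∑ l, α (S.index x) x (S.frame (S.index x) l x) • S.frame (S.index x) l x
  have hZ : ∀ i, ∀ x ∈ S.U i, ∀ᶠ y in 𝓝 x, Z y = ∑ l, α i y (S.frame i l y) • S.frame i l y := by
    intro i x hx
    filter_upwards [S.eventually_mem hx] with y hy
    have h1 := (S.frame_orthonormal _ y (S.mem_index y)).sharp_eq hdim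
      (S.frame_orthonormal i y hy) (α (S.index y) y)
    refine h1.trans (Finset.sum_congr rfl fun l _ => ?_)
    rw [hα _ i y (S.mem_index y) hy]
  refine ⟨Z, fun x => ?_, fun x => ?_⟩
  · exact (SmoothNear.sum fun l _ => SmoothNear.smul (hs _ x (S.mem_index x) l)
      (S.smoothNear_frame (S.mem_index x) l)).congr (hZ _ x (S.mem_index x))
  · exact S.divergence_eq hdim (S.mem_index x) (hs _ x (S.mem_index x)) (hZ _ x (S.mem_index x))

theorem continuous_divergence (S : SpinStructure d g ι) (hdim : Module.finrank ℝ E = 2 * d) (hcov : IsLeviCivita g cov)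
    {Z : Π x : M, TangentSpace I x} (hZ : ∀ x, SmoothNear I E Z x) :
    Continuous (divergence cov Z) := by
  refine SmoothFunNear.continuous (I := I) fun x => ?_
  have hx := S.mem_index x
  set i := S.index x
  have hf : ∀ y ∈ S.U i, ∀ l, SmoothFunNear I (fun y => g.inner y (Z y) (S.frame i l y)) y :=
    fun y hy l => smoothFunNear_metric (hZ y) (S.smoothNear_frame hy l)
  have h1 : SmoothFunNear I (fun y => ∑ k, (mvfderiv I
      (fun y => g.inner y (Z y) (S.frame i k y)) y (S.frame i k y) +
      ∑ l, g.inner y (Z y) (S.frame i l y) * S.connCoeff cov i y (S.frame i k y) l k)) x :=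
    SmoothFunNear.sum fun k _ => ((hf x hx k).mvfderiv (S.smoothNear_frame hx k)).add
      (SmoothFunNear.sum fun l _ => (hf x hx l).mul
        (S.smoothFunNear_connCoeff hcov hx (S.smoothNear_frame hx k) l k))
  refine h1.congr ?_
  filter_upwards [S.eventually_mem hx] with y hy
  refine S.divergence_eq hdim hy (hf y hy) ?_
  filter_upwards [S.eventually_mem hy] with z hz
  exact (S.frame_orthonormal i z hz).expand hdim (Z z)

/-- The pointwise real inner product of spinor fields. -/
def pairing (ψ η : LocalSpinor d ι V) (x : M) : ℝ := (ip (ψ (S.index x) x) (η (S.index x) x)).re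

variable (cov covE) in
/-- The pointwise square of the norm of `∇ψ`. -/
def gradSq (ψ : LocalSpinor d ι V) (x : M) : ℝ :=
  ∑ k, (ip (S.nabla cov covE (S.index x) (ψ (S.index x)) x (S.frame (S.index x) k x))
    (S.nabla cov covE (S.index x) (ψ (S.index x)) x (S.frame (S.index x) k x))).re

variable (cov covE) in
/-- The zeroth order term of the Weitzenböck formula, as a quadratic form. -/
def curvatureForm (ψ : LocalSpinor d ι V) (x : M) : ℝ :=
  1 / 4 * (S.scalar cov (S.index x) x * S.pairing ψ ψ x +
    (ip (ψ (S.index x) x) (S.curvatureEndo covE (S.index x) x (ψ (S.index x) x))).re)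

variable {S}

theorem pairing_eq (hψ : S.IsSmoothSpinor F ψ) (hη : S.IsSmoothSpinor F η) (hx : x ∈ S.U i) :
    S.pairing ψ η x = (ip (ψ i x) (η i x)).re := by
  unfold pairing
  have h : x ∈ S.U (S.index x) ∩ S.U i := ⟨S.mem_index x, hx⟩
  rw [hψ.compatible _ i x h, hη.compatible _ i x h, (S.lift_spin _ _ x h).ip_act]

theorem continuous_pairing (hV : IsSmoothHermitian I F V) (hψ : S.IsSmoothSpinor F ψ)
    (hη : S.IsSmoothSpinor F η) : Continuous (S.pairing ψ η) := by
  refine SmoothFunNear.continuous (I := I) fun x => ?_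
  have hx := S.mem_index x
  refine (((hψ.smoothSpinorNear hx).ip hV (hη.smoothSpinorNear hx)).clm_comp
    Complex.reCLM).congr ?_
  filter_upwards [S.eventually_mem hx] with y hy
  exact pairing_eq hψ hη hy

theorem gradSq_eq (hdim : Module.finrank ℝ E = 2 * d) (hcov : IsLeviCivita g cov)
    (hcovE : IsMetricConnection covE) (hψ : S.IsSmoothSpinor F ψ) (hx : x ∈ S.U i) :
    S.gradSq cov covE ψ x = ∑ k, (ip (S.nabla cov covE i (ψ i) x (S.frame i k x))
      (S.nabla cov covE i (ψ i) x (S.frame i k x))).re := by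
  have hj := S.mem_index x
  unfold gradSq
  set j := S.index x
  have h1 : ∀ v, S.nabla cov covE j (ψ j) x v =
      act (S.lift j i x) (S.nabla cov covE i (ψ i) x v) := fun v =>
    S.nabla_lift hdim hcov hcovE hj hx (hψ.smoothSpinorNear hx) (hψ.eventually_lift hj hx) v
  simp only [h1, (S.lift_spin j i x ⟨hj, hx⟩).ip_act]
  have h2 : ∀ k, S.nabla cov covE i (ψ i) x (S.frame j k x) =
      ∑ l, ((S.transition i j x l k : ℝ) : ℂ) • S.nabla cov covE i (ψ i) x (S.frame i l x) :=
    fun k => by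
      conv_lhs => rw [(S.frame_orthonormal i x hx).expand hdim (S.frame j k x), nabla_sum_vector]
      refine Finset.sum_congr rfl fun l _ => ?_
      rw [nabla_smul_vector, g.symm]
      rfl
  have h3 : ∀ l m, ∑ k, S.transition i j x l k * S.transition i j x m k = if l = m then 1 else 0 :=
    fun l m => by
      rw [← S.frame_orthonormal i x hx l m, (S.frame_orthonormal j x hj).inner_eq_sum hdim]
      rfl
  simp only [h2, ip_sum_left, ip_sum_right, ip_smul_left, ip_smul_right, Finset.mul_sum,
    Complex.re_sum]
  have h4 : ∀ (a b : ℝ) (z : ℂ), ((b : ℂ) * (star (a : ℂ) * z)).re = b * a * z.re := fun a b z => by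
    simp
    ring
  simp only [h4]
  rw [Finset.sum_comm]
  conv_lhs => enter [2, m]; rw [Finset.sum_comm]
  simp only [← Finset.sum_mul, h3]
  simp

theorem continuous_gradSq (hdim : Module.finrank ℝ E = 2 * d) (hV : IsSmoothHermitian I F V)
    (hcov : IsLeviCivita g cov) (hcovE : IsMetricConnection covE) (hψ : S.IsSmoothSpinor F ψ) :
    Continuous (S.gradSq cov covE ψ) := by
  refine SmoothFunNear.continuous (I := I) fun x => ?_
  have hx := S.mem_index x
  have h : ∀ k, SmoothSpinorNear I F (fun y => S.nabla cov covE (S.index x) (ψ (S.index x)) y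
      (S.frame (S.index x) k y)) x := fun k =>
    S.smoothSpinorNear_nabla hcov hcovE hx (hψ.smoothSpinorNear hx) (S.smoothNear_frame hx k)
  refine (SmoothFunNear.sum (s := Finset.univ) fun k _ =>
    ((h k).ip hV (h k)).clm_comp Complex.reCLM).congr ?_
  filter_upwards [S.eventually_mem hx] with y hy
  exact gradSq_eq hdim hcov hcovE hψ hy

/-- The divergence of the vector field dual to `v ↦ Re ⟨ψ, v · η⟩` measures the failure of the
Dirac operator to be symmetric pointwise. -/
theorem exists_divergence_current (hdim : Module.finrank ℝ E = 2 * d)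
    (hV : IsSmoothHermitian I F V) (hcov : IsLeviCivita g cov) (hcovE : IsMetricConnection covE)
    (hψ : S.IsSmoothSpinor F ψ) (hη : S.IsSmoothSpinor F η) :
    ∃ Z : Π x : M, TangentSpace I x, (∀ x, SmoothNear I E Z x) ∧ ∀ x, divergence cov Z x =
      S.pairing ψ (S.dirac cov covE η) x - S.pairing (S.dirac cov covE ψ) η x := by
  let α : ι → Π x : M, TangentSpace I x →ₗ[ℝ] ℝ := fun i x =>
    ∑ l, (ip (ψ i x) (act (gamma l) (η i x))).re • ((g.inner x (S.frame i l x)).toLinearMap)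
  have hα0 : ∀ i x v, α i x v =
      (ip (ψ i x) (act (cliffordVec fun l => g.inner x (S.frame i l x) v) (η i x))).re := by
    intro i x v
    simp only [α, LinearMap.sum_apply, LinearMap.smul_apply, cliffordVec, sum_act, smul_act,
      ip_sum_right, ip_smul_right, Complex.re_sum, Complex.re_ofReal_mul, smul_eq_mul]
    exact Finset.sum_congr rfl fun l _ => mul_comm _ _
  have hα1 : ∀ i, ∀ x ∈ S.U i, ∀ l, α i x (S.frame i l x) =
      (ip (ψ i x) (act (gamma l) (η i x))).re := by
    intro i x hx l
    rw [hα0]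
    have : cliffordVec (fun k => g.inner x (S.frame i k x) (S.frame i l x)) = gamma l := by
      simp [cliffordVec, S.frame_orthonormal i x hx _ _]
    rw [this]
  suffices hsuff : (∀ i j x, x ∈ S.U i → x ∈ S.U j → ∀ v, α i x v = α j x v) ∧
      ∀ i, ∀ x ∈ S.U i, ∀ l, SmoothFunNear I (fun y => α i y (S.frame i l y)) x by
    obtain ⟨Z, hZ, hdiv⟩ := S.exists_divergence_eq (cov := cov) hdim α hsuff.1 hsuff.2
    refine ⟨Z, hZ, fun x => ?_⟩
    have hx := S.mem_index x
    rw [hdiv]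
    unfold pairing
    rw [dirac_eq_localDirac, dirac_eq_localDirac, ← S.sum_mvfderiv_ip_gamma hV hcov hcovE hx
      (hψ.smoothSpinorNear hx) (hη.smoothSpinorNear hx)]
    refine Finset.sum_congr rfl fun k _ => ?_
    congr 1
    · rw [mvfderiv_congr]
      filter_upwards [S.eventually_mem hx] with y hy
      exact hα1 _ y hy k
    · exact Finset.sum_congr rfl fun l _ => by rw [hα1 _ x hx]
  refine ⟨?_, ?_⟩
  · intro i j x hi hj v
    rw [hα0, hα0, hψ.compatible i j x ⟨hi, hj⟩, hη.compatible i j x ⟨hi, hj⟩, ← act_mul]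
    have h1 : cliffordVec (fun l => g.inner x (S.frame i l x) v) * S.lift i j x =
        S.lift i j x * cliffordVec (fun l => g.inner x (S.frame j l x) v) := by
      have h2 : ∀ k, S.lift i j x * gamma k =
          (∑ m, ((S.transition i j x m k : ℝ) : ℂ) • gamma m) * S.lift i j x := fun k =>
        S.lift_frame i j x ⟨hi, hj⟩ k
      have h3 : ∀ m, g.inner x (S.frame i m x) v =
          ∑ k, S.transition i j x m k * g.inner x (S.frame j k x) v := fun m => by
        rw [(S.frame_orthonormal j x hj).inner_eq_sum hdim]
        exact Finset.sum_congr rfl fun k _ => by rw [g.symm x v]; rfl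
      simp only [cliffordVec, Finset.mul_sum, mul_smul_comm, h2, h3, Finset.sum_mul,
        smul_mul_assoc, Complex.ofReal_sum, Finset.sum_smul, Finset.smul_sum, smul_smul]
      rw [Finset.sum_comm]
      refine Finset.sum_congr rfl fun k _ => Finset.sum_congr rfl fun m _ => ?_
      rw [Complex.ofReal_mul, mul_comm]
    rw [h1, act_mul, (S.lift_spin i j x ⟨hi, hj⟩).ip_act]
  · intro i x hx l
    refine (((hψ.smoothSpinorNear hx).ip hV (SmoothSpinorNear.act_const (gamma l)
      (hη.smoothSpinorNear hx))).clm_comp Complex.reCLM).congr ?_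
    filter_upwards [S.eventually_mem hx] with y hy
    exact hα1 i y hy l

/-- The Weitzenböck formula, up to the divergence of half the gradient of `|ψ|²`. -/
theorem exists_divergence_weitzenboeck (hdim : Module.finrank ℝ E = 2 * d)
    (hV : IsSmoothHermitian I F V) (hcov : IsLeviCivita g cov) (hcovE : IsMetricConnection covE)
    (hψ : S.IsSmoothSpinor F ψ) :
    ∃ Z : Π x : M, TangentSpace I x, (∀ x, SmoothNear I E Z x) ∧ ∀ x,
      S.gradSq cov covE ψ x + S.curvatureForm cov covE ψ x =
        S.pairing ψ (S.dirac cov covE (S.dirac cov covE ψ)) x + divergence cov Z x := by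
  let α : ι → Π x : M, TangentSpace I x →ₗ[ℝ] ℝ := fun i x =>
    { toFun := fun v => (ip (ψ i x) (S.nabla cov covE i (ψ i) x v)).re
      map_add' := fun v w => by rw [nabla_add_vector, ip_add_right, Complex.add_re]
      map_smul' := fun c v => by
        rw [nabla_smul_vector, ip_smul_right, Complex.re_ofReal_mul]; rfl }
  suffices hsuff : (∀ i j x, x ∈ S.U i → x ∈ S.U j → ∀ v, α i x v = α j x v) ∧
      ∀ i, ∀ x ∈ S.U i, ∀ l, SmoothFunNear I (fun y => α i y (S.frame i l y)) x by
    obtain ⟨Z, hZ, hdiv⟩ := S.exists_divergence_eq (cov := cov) hdim α hsuff.1 hsuff.2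
    refine ⟨Z, hZ, fun x => ?_⟩
    have hx := S.mem_index x
    have h1 := S.sum_mvfderiv_ip_nabla hV hcov hcovE hx (hψ.smoothSpinorNear hx)
    have h2 := S.weitzenboeck hdim hcov hcovE hx (hψ.smoothSpinorNear hx)
    have h3 : divergence cov Z x = S.gradSq cov covE ψ x +
      (ip (ψ (S.index x) x) (∑ k, S.hessian cov covE (S.index x) (ψ (S.index x)) x k k)).re :=
      (hdiv x).trans h1
    have h4 : S.pairing ψ (S.dirac cov covE (S.dirac cov covE ψ)) x = _ := h2
    rw [h3, h4, curvatureForm]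
    unfold pairing
    ring
  refine ⟨?_, ?_⟩
  · intro i j x hi hj v
    change (ip _ _).re = (ip _ _).re
    rw [hψ.compatible i j x ⟨hi, hj⟩, S.nabla_lift hdim hcov hcovE hi hj (hψ.smoothSpinorNear hj)
      (hψ.eventually_lift hi hj), (S.lift_spin i j x ⟨hi, hj⟩).ip_act]
  · intro i x hx l
    exact ((hψ.smoothSpinorNear hx).ip hV (S.smoothSpinorNear_nabla hcov hcovE hx
      (hψ.smoothSpinorNear hx) (S.smoothNear_frame hx l))).clm_comp Complex.reCLM

variable {Λ : (M → ℝ) → ℝ}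

/-- The twisted Dirac operator is symmetric. -/
theorem integral_dirac_symm (hΛ : IsIntegral cov Λ) (hdim : Module.finrank ℝ E = 2 * d)
    (hV : IsSmoothHermitian I F V) (hcov : IsLeviCivita g cov) (hcovE : IsMetricConnection covE)
    (hψ : S.IsSmoothSpinor F ψ) (hη : S.IsSmoothSpinor F η) :
    Λ (S.pairing ψ (S.dirac cov covE η)) = Λ (S.pairing (S.dirac cov covE ψ) η) := by
  obtain ⟨Z, hZ, hdiv⟩ := exists_divergence_current hdim hV hcov hcovE hψ hη
  have h1 := hΛ.divergence Z hZ
  rw [funext hdiv, hΛ.sub (continuous_pairing hV hψ (hη.dirac hdim hcov hcovE))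
    (continuous_pairing hV (hψ.dirac hdim hcov hcovE) hη)] at h1
  linarith

theorem continuous_curvatureForm (hdim : Module.finrank ℝ E = 2 * d)
    (hV : IsSmoothHermitian I F V) (hcov : IsLeviCivita g cov) (hcovE : IsMetricConnection covE)
    (hψ : S.IsSmoothSpinor F ψ) : Continuous (S.curvatureForm cov covE ψ) := by
  obtain ⟨Z, hZ, hdiv⟩ := exists_divergence_weitzenboeck hdim hV hcov hcovE hψ
  have h1 : S.curvatureForm cov covE ψ = fun x =>
      S.pairing ψ (S.dirac cov covE (S.dirac cov covE ψ)) x + divergence cov Z x -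
        S.gradSq cov covE ψ x := by
    funext x
    rw [← hdiv]
    ring
  rw [h1]
  exact ((continuous_pairing hV hψ ((hψ.dirac hdim hcov hcovE).dirac hdim hcov hcovE)).add
    (S.continuous_divergence hdim hcov hZ)).sub (continuous_gradSq hdim hV hcov hcovE hψ)

theorem integral_weitzenboeck (hΛ : IsIntegral cov Λ) (hdim : Module.finrank ℝ E = 2 * d)
    (hV : IsSmoothHermitian I F V) (hcov : IsLeviCivita g cov) (hcovE : IsMetricConnection covE)
    (hψ : S.IsSmoothSpinor F ψ) :
    Λ (S.gradSq cov covE ψ) + Λ (S.curvatureForm cov covE ψ) =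
      Λ (S.pairing (S.dirac cov covE ψ) (S.dirac cov covE ψ)) := by
  obtain ⟨Z, hZ, hdiv⟩ := exists_divergence_weitzenboeck hdim hV hcov hcovE hψ
  have hD := hψ.dirac hdim hcov hcovE
  rw [← integral_dirac_symm hΛ hdim hV hcov hcovE hψ hD,
    ← hΛ.add _ _ (continuous_gradSq hdim hV hcov hcovE hψ)
      (continuous_curvatureForm hdim hV hcov hcovE hψ), funext hdiv,
    hΛ.add _ _ (continuous_pairing hV hψ (hD.dirac hdim hcov hcovE))
      (S.continuous_divergence hdim hcov hZ), hΛ.divergence Z hZ, add_zero]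

end SpinStructure

end Integrated

/-! ### The divergence in coordinates -/

section Coordinates

open Filter Topology

variable {E : Type*} [NormedAddCommGroup E] [NormedSpace ℝ E] [FiniteDimensional ℝ E]
  {H : Type*} [TopologicalSpace H] {I : ModelWithCorners ℝ E H} [I.Boundaryless]
  {M : Type*} [TopologicalSpace M] [T2Space M] [ChartedSpace H M] [IsManifold I ∞ M]
  {g : Metric I M} {cov : TangentConnection I M}
  {κ : Type*} [Fintype κ] [DecidableEq κ] {b : Module.Basis κ ℝ E} {c x : M} {k l : κ}

/-- The coordinate vector fields of the chart at `c`, for the basis `b` of the model space. They are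
only meaningful on the source of the chart. -/
def coordField (I : ModelWithCorners ℝ E H) [IsManifold I ∞ M] (b : Module.Basis κ ℝ E) (c : M)
    (k : κ) (x : M) : TangentSpace I x :=
  (trivializationAt E (fun x : M => TangentSpace I x) c).localFrame b k x

/-- The coordinates of a tangent vector in the chart at `c`. -/
def coordCoeff (I : ModelWithCorners ℝ E H) [IsManifold I ∞ M] (b : Module.Basis κ ℝ E) (c : M)
    (k : κ) (x : M) : TangentSpace I x →ₗ[ℝ] ℝ :=
  (trivializationAt E (fun x : M => TangentSpace I x) c).localFrameCoeff I b k x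

theorem mem_baseSet_iff :
    x ∈ (trivializationAt E (fun x : M => TangentSpace I x) c).baseSet ↔
      x ∈ (extChartAt I c).source := by
  rw [extChartAt_source]
  rfl

theorem mvfderiv_mul_real {f h : M → ℝ} (hf : SmoothFunNear I f x) (hh : SmoothFunNear I h x)
    (X : TangentSpace I x) : mvfderiv I (fun y => f y * h y) x X =
      f x * mvfderiv I h x X + mvfderiv I f x X * h x :=
  congrArg (fun L => L X) (HasMFDerivAt.mul' hf.mdifferentiableAt.hasMFDerivAt
    hh.mdifferentiableAt.hasMFDerivAt).mfderiv

theorem smoothNear_coordField (hx : x ∈ (extChartAt I c).source) (k : κ) :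
    SmoothNear I E (coordField I b c k) x := by
  filter_upwards [(isOpen_extChartAt_source (I := I) c).mem_nhds hx] with y hy
  exact contMDiffAt_localFrame_of_mem ∞ _ b k (mem_baseSet_iff.2 hy)

theorem smoothFunNear_coordCoeff (hx : x ∈ (extChartAt I c).source)
    {Z : Π y : M, TangentSpace I y} (hZ : SmoothNear I E Z x) (k : κ) :
    SmoothFunNear I (fun y => coordCoeff I b c k y (Z y)) x := by
  filter_upwards [(isOpen_extChartAt_source (I := I) c).mem_nhds hx, hZ] with y hy h1
  exact contMDiffAt_localFrameCoeff b (mem_baseSet_iff.2 hy) h1 k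

theorem eq_sum_coordField (hx : x ∈ (extChartAt I c).source) (v : TangentSpace I x) :
    v = ∑ k, coordCoeff I b c k x v • coordField I b c k x := by
  have h := (trivializationAt E (fun x : M => TangentSpace I x) c).eq_sum_localFrameCoeff_smul
    (I := I) (b := b) (s := FiberBundle.extend E v) (mem_baseSet_iff.2 hx)
  simp only [FiberBundle.extend_apply_self] at h
  exact h

theorem mvfderiv_extChartAt_coordField (hx : x ∈ (extChartAt I c).source) (k : κ) :
    mvfderiv I (extChartAt I c) x (coordField I b c k x) = b k := by
  have hx' := mem_baseSet_iff.2 hx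
  rw [extChartAt_source] at hx
  change mfderiv I 𝓘(ℝ, E) (extChartAt I c) x (coordField I b c k x) = b k
  rw [← TangentBundle.continuousLinearMapAt_trivializationAt hx, coordField,
    Bundle.Trivialization.localFrame_apply_of_mem_baseSet _ _ hx']
  simp only [Bundle.Trivialization.basisAt, Module.Basis.map_apply]
  have h := Bundle.Trivialization.continuousLinearMapAt_symmL (R := ℝ)
    (trivializationAt E (fun x : M => TangentSpace I x) c) hx' (b k)
  rw [Bundle.Trivialization.symmL_apply _ hx'] at h
  exact h

theorem coordCoeff_eq (hx : x ∈ (extChartAt I c).source) (k : κ) (v : TangentSpace I x) :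
    coordCoeff I b c k x v = b.repr (mvfderiv I (extChartAt I c) x v) k := by
  conv_rhs => rw [eq_sum_coordField (b := b) hx v]
  simp only [map_sum, map_smul, mvfderiv_extChartAt_coordField hx, Module.Basis.repr_self,
    Finsupp.coe_finsetSum, Finset.sum_apply, Finsupp.smul_apply, Finsupp.single_apply,
    smul_eq_mul, mul_ite, mul_one, mul_zero, Finset.sum_ite_eq', Finset.mem_univ, if_true]

theorem mvfderiv_coordField {G : Type*} [NormedAddCommGroup G] [NormedSpace ℝ G] {f : M → G}
    (hx : x ∈ (extChartAt I c).source)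
    (hf : SmoothFunNear I f x) (k : κ) :
    mvfderiv I f x (coordField I b c k x) =
      fderiv ℝ (f ∘ (extChartAt I c).symm) (extChartAt I c x) (b k) := by
  rw [mvfderiv_eq_fderiv_extChartAt c hx hf.mdifferentiableAt]
  exact congrArg _ (mvfderiv_extChartAt_coordField hx k)

theorem mlieBracket_coordField (hx : x ∈ (extChartAt I c).source) (k l : κ) :
    VectorField.mlieBracket I (coordField I b c k) (coordField I b c l) x = 0 := by
  have : CompleteSpace E := FiniteDimensional.complete ℝ E
  have hs : SmoothFunNear I (extChartAt I c) x := by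
    filter_upwards [(isOpen_extChartAt_source (I := I) c).mem_nhds hx] with y hy
    rw [extChartAt_source] at hy
    exact contMDiffAt_extChartAt' hy
  have h1 := mvfderiv_mlieBracket (hs.contMDiffAt.of_le ENat.LEInfty.out)
    (smoothNear_coordField (b := b) hx k).mdifferentiableAt
    (smoothNear_coordField (b := b) hx l).mdifferentiableAt
  have h2 : ∀ m, (fun y => mvfderiv I (extChartAt I c) y (coordField I b c m y)) =ᶠ[𝓝 x]
      fun _ => b m := fun m => by
    filter_upwards [(isOpen_extChartAt_source (I := I) c).mem_nhds hx] with y hy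
    exact mvfderiv_extChartAt_coordField hy m
  rw [mvfderiv_congr (h2 l), mvfderiv_congr (h2 k), mvfderiv_const, mvfderiv_const] at h1
  simp only [zero_apply, sub_self] at h1
  have h3 := isInvertible_mfderiv_extChartAt (I := I) hx
  obtain ⟨e, he⟩ := h3
  have h4 : mfderiv I 𝓘(ℝ, E) (extChartAt I c) x (VectorField.mlieBracket I (coordField I b c k)
    (coordField I b c l) x) = 0 := h1
  rw [← he] at h4
  exact (map_eq_zero_iff e e.injective).1 h4

/-- The Gram matrix of the metric in the chart at `c`. -/
def gramMatrix (g : Metric I M) (b : Module.Basis κ ℝ E) (c x : M) : Matrix κ κ ℝ :=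
  Matrix.of fun p q => g.inner x (coordField I b c p x) (coordField I b c q x)

/-- The density of the Riemannian volume in the chart at `c`. -/
def volDensity (g : Metric I M) (b : Module.Basis κ ℝ E) (c x : M) : ℝ :=
  √(gramMatrix g b c x).det

theorem det_gramMatrix_pos (hx : x ∈ (extChartAt I c).source) :
    0 < (gramMatrix g b c x).det := by
  refine Matrix.PosDef.det_pos (Matrix.PosDef.of_dotProduct_mulVec_pos ?_ fun v hv => ?_)
  · ext p q
    simp only [gramMatrix, Matrix.conjTranspose_apply, Matrix.of_apply, star_trivial]
    exact g.symm _ _ _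
  · have h1 : dotProduct (star v) ((gramMatrix g b c x).mulVec v) = g.inner x
        (∑ p, v p • coordField I b c p x) (∑ p, v p • coordField I b c p x) := by
      simp only [gramMatrix, dotProduct, Matrix.mulVec, map_sum, map_smul, sum_apply, smul_apply,
        smul_eq_mul, Matrix.of_apply, star_trivial, Finset.mul_sum]
      rw [Finset.sum_comm]
      exact Finset.sum_congr rfl fun p _ => Finset.sum_congr rfl fun q _ => by ring
    rw [h1]
    refine g.pos x _ fun h0 => hv ?_
    have h2 := congrArg (mvfderiv I (extChartAt I c) x) h0
    simp only [map_sum, map_smul, map_zero, mvfderiv_extChartAt_coordField hx] at h2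
    exact funext fun p => Fintype.linearIndependent_iff.1 b.linearIndependent v h2 p

theorem volDensity_pos (hx : x ∈ (extChartAt I c).source) : 0 < volDensity g b c x :=
  Real.sqrt_pos.2 (det_gramMatrix_pos hx)

theorem smoothFunNear_gramMatrix (hx : x ∈ (extChartAt I c).source) (p q : κ) :
    SmoothFunNear I (fun y => gramMatrix g b c y p q) x :=
  smoothFunNear_metric (smoothNear_coordField hx p) (smoothNear_coordField hx q)

theorem smoothFunNear_volDensity (hx : x ∈ (extChartAt I c).source) :
    SmoothFunNear I (volDensity g b c) x := by
  filter_upwards [(isOpen_extChartAt_source (I := I) c).mem_nhds hx] with y hy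
  have h1 : ContMDiffAt I 𝓘(ℝ, ℝ) ∞ (fun y => (gramMatrix g b c y).det) y :=
    contMDiffAt_det fun p q => (smoothFunNear_gramMatrix hy p q).contMDiffAt
  exact (Real.contDiffAt_sqrt (det_gramMatrix_pos hy).ne').contMDiffAt.comp y h1

/-- The logarithmic derivative of the volume density is the divergence of the coordinate fields. -/
theorem mvfderiv_volDensity (hcov : IsLeviCivita g cov) (hx : x ∈ (extChartAt I c).source) (l : κ) :
    mvfderiv I (volDensity g b c) x (coordField I b c l x) = volDensity g b c x *
      ∑ k, coordCoeff I b c k x (cov (coordField I b c l) x (coordField I b c k x)) := by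
  let Γ : Matrix κ κ ℝ := Matrix.of fun p m =>
    coordCoeff I b c m x (cov (coordField I b c p) x (coordField I b c l x))
  set G := gramMatrix g b c x with hG
  have hsym : G.transpose = G := by
    ext p q
    exact g.symm _ _ _
  -- the connection is metric
  have h1 : (Matrix.of fun p q => mvfderiv I (fun y => gramMatrix g b c y p q) x
      (coordField I b c l x)) = Γ * G + G * Γ.transpose := by
    ext p q
    rw [Matrix.of_apply, Matrix.add_apply, Matrix.mul_apply, Matrix.mul_apply]
    have e1 := hcov.metric _ _ x (smoothNear_coordField (b := b) hx p).mdifferentiableAt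
      (smoothNear_coordField (b := b) hx q).mdifferentiableAt (coordField I b c l x)
    refine e1.trans ?_
    have e2 := eq_sum_coordField (b := b) hx (cov (coordField I b c p) x (coordField I b c l x))
    have e3 := eq_sum_coordField (b := b) hx (cov (coordField I b c q) x (coordField I b c l x))
    rw [e2, e3]
    simp only [map_sum, map_smul, sum_apply, smul_apply, smul_eq_mul]
    congr 1
    exact Finset.sum_congr rfl fun m _ => mul_comm _ _
  have h2 : mvfderiv I (fun y => (gramMatrix g b c y).det) x (coordField I b c l x) =
      2 * G.det * Γ.trace := by
    rw [mvfderiv_det fun p q => (smoothFunNear_gramMatrix hx p q).contMDiffAt, h1]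
    change (G.adjugate * (Γ * G + G * Γ.transpose)).trace = _
    rw [mul_add, Matrix.trace_add, ← mul_assoc, ← mul_assoc, Matrix.adjugate_mul,
      Matrix.trace_mul_comm, ← mul_assoc, Matrix.mul_adjugate]
    simp only [smul_mul_assoc, one_mul, Matrix.trace_smul, Matrix.trace_transpose, smul_eq_mul]
    ring
  have hpos := det_gramMatrix_pos (g := g) (b := b) hx
  have hw := smoothFunNear_volDensity (g := g) (b := b) hx
  have h3 : 2 * volDensity g b c x * mvfderiv I (volDensity g b c) x (coordField I b c l x) =
      mvfderiv I (fun y => (gramMatrix g b c y).det) x (coordField I b c l x) := by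
    have e1 : (fun y => volDensity g b c y * volDensity g b c y) =ᶠ[𝓝 x]
        fun y => (gramMatrix g b c y).det := by
      filter_upwards [(isOpen_extChartAt_source (I := I) c).mem_nhds hx] with y hy
      exact Real.mul_self_sqrt (det_gramMatrix_pos hy).le
    rw [← mvfderiv_congr e1, mvfderiv_mul_real hw hw]
    ring
  -- it has no torsion, and coordinate fields commute
  have h4 : Γ.trace = ∑ k, coordCoeff I b c k x (cov (coordField I b c l) x
      (coordField I b c k x)) := by
    rw [Matrix.trace]
    refine Finset.sum_congr rfl fun k _ => ?_
    have ht := cov.torsion_eq_zero_iff.1 hcov.torsion_free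
      (smoothNear_coordField (b := b) hx k).mdifferentiableAt
      (smoothNear_coordField (b := b) hx l).mdifferentiableAt
    rw [mlieBracket_coordField hx, sub_eq_zero] at ht
    rw [ht]
    rfl
  have h5 : volDensity g b c x * volDensity g b c x = G.det := Real.mul_self_sqrt hpos.le
  have h6 : volDensity g b c x ≠ 0 := (volDensity_pos hx).ne'
  rw [← h4]
  rw [h2, ← h5] at h3
  exact mul_left_cancel₀ (mul_ne_zero two_ne_zero h6) (by rw [h3]; ring)

/-- The divergence formula `√G div Z = ∑ ∂_k (√G Z^k)`. -/
theorem volDensity_mul_divergence (hcov : IsLeviCivita g cov) (hx : x ∈ (extChartAt I c).source)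
    {Z : Π y : M, TangentSpace I y} (hZ : SmoothNear I E Z x) :
    divergence cov Z x * volDensity g b c x = ∑ k, mvfderiv I
      (fun y => coordCoeff I b c k y (Z y) * volDensity g b c y) x (coordField I b c k x) := by
  let f : κ → M → ℝ := fun k y => coordCoeff I b c k y (Z y)
  have hf : ∀ k, SmoothFunNear I (f k) x := smoothFunNear_coordCoeff hx hZ
  have hw := smoothFunNear_volDensity (g := g) (b := b) hx
  have hs : ∀ l ∈ Finset.univ, SmoothNear I E (fun y => f l y • coordField I b c l y) x :=
    fun l _ => SmoothNear.smul (hf l) (smoothNear_coordField hx l)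
  have hZ' : cov Z x = cov (fun y => ∑ l, f l y • coordField I b c l y) x := by
    refine cov_congr ?_ hZ
    filter_upwards [(isOpen_extChartAt_source (I := I) c).mem_nhds hx] with y hy
    exact eq_sum_coordField hy (Z y)
  -- the trace in the coordinate frame
  have h1 : divergence cov Z x = ∑ k, coordCoeff I b c k x (cov Z x (coordField I b c k x)) := by
    have hx' := mem_baseSet_iff.2 hx
    let B := (trivializationAt E (fun x : M => TangentSpace I x) c).basisAt b hx'
    unfold divergence
    rw [LinearMap.trace_eq_matrix_trace ℝ B, Matrix.trace]
    refine Finset.sum_congr rfl fun k _ => ?_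
    rw [Matrix.diag_apply, LinearMap.toMatrix_apply]
    have e1 := (trivializationAt E (fun x : M => TangentSpace I x) c).localFrameCoeff_apply_of_mem_baseSet
      (I := I) b hx' (FiberBundle.extend E (cov Z x (coordField I b c k x))) k
    simp only [FiberBundle.extend_apply_self] at e1
    refine Eq.trans ?_ e1.symm
    rw [coordField, Bundle.Trivialization.localFrame_apply_of_mem_baseSet _ _ hx']
    rfl
  have h2 : ∀ k, coordCoeff I b c k x (cov Z x (coordField I b c k x)) =
      mvfderiv I (f k) x (coordField I b c k x) + ∑ l, f l x *
        coordCoeff I b c k x (cov (coordField I b c l) x (coordField I b c k x)) := by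
    intro k
    have e1 : cov Z x (coordField I b c k x) = ∑ l, (f l x • cov (coordField I b c l) x
        (coordField I b c k x) + mvfderiv I (f l) x (coordField I b c k x) •
          coordField I b c l x) := by
      rw [hZ', cov_sum hs]
      exact Finset.sum_congr rfl fun l _ => cov_smul (hf l) (smoothNear_coordField hx l) _
    have e2 : ∀ l, coordCoeff I b c k x (coordField I b c l x) = if l = k then 1 else 0 :=
      fun l => by
        rw [coordCoeff_eq hx, mvfderiv_extChartAt_coordField hx, Module.Basis.repr_self,
          Finsupp.single_apply]
    rw [e1]
    simp only [map_sum, map_add, map_smul, smul_eq_mul, Finset.sum_add_distrib, e2, mul_ite,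
      mul_one, mul_zero, Finset.sum_ite_eq', Finset.mem_univ, if_true]
    exact add_comm _ _
  have h3 : ∀ k, mvfderiv I (fun y => f k y * volDensity g b c y) x (coordField I b c k x) =
      f k x * mvfderiv I (volDensity g b c) x (coordField I b c k x) +
        mvfderiv I (f k) x (coordField I b c k x) * volDensity g b c x :=
    fun k => mvfderiv_mul_real (hf k) hw _
  rw [h1]
  simp only [h2]
  refine Eq.trans ?_ (Finset.sum_congr rfl fun k _ => (h3 k).symm)
  simp only [mvfderiv_volDensity hcov hx, Finset.sum_add_distrib, add_mul, ← Finset.sum_mul]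
  rw [add_comm]
  congr 1
  simp only [Finset.sum_mul, Finset.mul_sum]
  rw [Finset.sum_comm]
  exact Finset.sum_congr rfl fun k _ => Finset.sum_congr rfl fun l _ => by ring

end Coordinates

/-! ### Integration over a closed Riemannian manifold -/

section Integration

open Filter Topology MeasureTheory

variable {E : Type*} [NormedAddCommGroup E] [NormedSpace ℝ E] [FiniteDimensional ℝ E]
  {H : Type*} [TopologicalSpace H] {I : ModelWithCorners ℝ E H} [I.Boundaryless]
  {M : Type*} [TopologicalSpace M] [T2Space M] [CompactSpace M] [ChartedSpace H M]
  [IsManifold I ∞ M]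
  {g : Metric I M} {cov : TangentConnection I M}
  {κ : Type*} [Fintype κ] [DecidableEq κ] {b : Module.Basis κ ℝ E} {c c' x : M} {k l : κ}
  {u v : M → ℝ} {y : E}

/-- The function `u` read in the chart at `c`, extended by zero. -/
def chartExtend (I : ModelWithCorners ℝ E H) (c : M) (u : M → ℝ) : E → ℝ :=
  (extChartAt I c).target.indicator (u ∘ (extChartAt I c).symm)

theorem chartExtend_of_mem (hy : y ∈ (extChartAt I c).target) :
    chartExtend I c u y = u ((extChartAt I c).symm y) :=
  indicator_of_mem hy _

theorem chartExtend_of_notMem_target (hy : y ∉ (extChartAt I c).target) :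
    chartExtend I c u y = 0 :=
  indicator_of_notMem hy _

theorem chartExtend_eventuallyEq (hy : y ∈ (extChartAt I c).target) :
    chartExtend I c u =ᶠ[𝓝 y] u ∘ (extChartAt I c).symm := by
  filter_upwards [(isOpen_extChartAt_target (I := I) c).mem_nhds hy] with z hz
  exact chartExtend_of_mem hz

theorem isCompact_image_tsupport (hu : tsupport u ⊆ (extChartAt I c).source) :
    IsCompact (extChartAt I c '' tsupport u) :=
  (isClosed_tsupport u).isCompact.image_of_continuousOn ((continuousOn_extChartAt c).mono hu)

theorem chartExtend_of_notMem (hy : y ∉ extChartAt I c '' tsupport u) :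
    chartExtend I c u y = 0 := by
  by_cases h : y ∈ (extChartAt I c).target
  · rw [chartExtend_of_mem h]
    by_contra h0
    exact hy ⟨_, subset_tsupport u h0, (extChartAt I c).right_inv h⟩
  · exact chartExtend_of_notMem_target h

theorem hasCompactSupport_chartExtend (hu : tsupport u ⊆ (extChartAt I c).source) :
    HasCompactSupport (chartExtend I c u) :=
  HasCompactSupport.intro (isCompact_image_tsupport hu) fun _ => chartExtend_of_notMem

theorem chartExtend_eventuallyEq_zero (hu : tsupport u ⊆ (extChartAt I c).source)
    (hy : y ∉ (extChartAt I c).target) : chartExtend I c u =ᶠ[𝓝 y] fun _ => 0 := by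
  have h : y ∉ extChartAt I c '' tsupport u := by
    rintro ⟨z, hz, rfl⟩
    exact hy ((extChartAt I c).map_source (hu hz))
  filter_upwards [(isCompact_image_tsupport hu).isClosed.isOpen_compl.mem_nhds h] with z hz
  exact chartExtend_of_notMem hz

theorem continuous_chartExtend (hu : tsupport u ⊆ (extChartAt I c).source)
    (hc : ContinuousOn u (extChartAt I c).source) : Continuous (chartExtend I c u) := by
  refine continuous_iff_continuousAt.2 fun y => ?_
  by_cases hy : y ∈ (extChartAt I c).target
  · refine ContinuousAt.congr ?_ (chartExtend_eventuallyEq hy).symm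
    exact ContinuousAt.comp (hc.continuousAt ((isOpen_extChartAt_source (I := I) c).mem_nhds
      ((extChartAt I c).map_target hy))) (continuousAt_extChartAt_symm'' hy)
  · exact continuousAt_const.congr (chartExtend_eventuallyEq_zero hu hy).symm

theorem contDiff_chartExtend (hu : tsupport u ⊆ (extChartAt I c).source)
    (hs : ∀ x ∈ (extChartAt I c).source, SmoothFunNear I u x) :
    ContDiff ℝ ∞ (chartExtend I c u) := by
  refine contDiff_iff_contDiffAt.2 fun y => ?_
  by_cases hy : y ∈ (extChartAt I c).target
  · refine ContDiffAt.congr_of_eventuallyEq ?_ (chartExtend_eventuallyEq hy)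
    exact (ContMDiffAt.comp y (hs _ ((extChartAt I c).map_target hy)).contMDiffAt
      ((contMDiffOn_extChartAt_symm (I := I) (n := ∞) c).contMDiffAt
        ((isOpen_extChartAt_target (I := I) c).mem_nhds hy))).contDiffAt
  · exact contDiffAt_const.congr_of_eventuallyEq (chartExtend_eventuallyEq_zero hu hy)

variable [MeasurableSpace E] [BorelSpace E] {μ : Measure E} [μ.IsAddHaarMeasure]

theorem integrable_chartExtend (hu : tsupport u ⊆ (extChartAt I c).source)
    (hc : ContinuousOn u (extChartAt I c).source) : Integrable (chartExtend I c u) μ :=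
  (continuous_chartExtend hu hc).integrable_of_hasCompactSupport (hasCompactSupport_chartExtend hu)

theorem integrable_fderiv_chartExtend (hu : tsupport u ⊆ (extChartAt I c).source)
    (hs : ∀ x ∈ (extChartAt I c).source, SmoothFunNear I u x) (e : E) :
    Integrable (fun y => fderiv ℝ (chartExtend I c u) y e) μ := by
  have h1 := ((contDiff_chartExtend hu hs).continuous_fderiv (by simp)).clm_apply
    (continuous_const (y := e))
  refine h1.integrable_of_hasCompactSupport ?_
  refine ((hasCompactSupport_chartExtend hu).fderiv ℝ).mono' ?_
  refine Subset.trans (fun y hy => ?_) (subset_tsupport _)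
  exact fun h => hy (by simp only [h, zero_apply])

theorem integral_fderiv_chartExtend (hu : tsupport u ⊆ (extChartAt I c).source)
    (hs : ∀ x ∈ (extChartAt I c).source, SmoothFunNear I u x) (e : E) :
    ∫ y, fderiv ℝ (chartExtend I c u) y e ∂μ = 0 := by
  have h := integral_mul_fderiv_eq_neg_fderiv_mul_of_integrable (μ := μ) (f := fun _ : E => (1 : ℝ))
    (g := chartExtend I c u) (v := e) (by simp)
    (by simpa using integrable_fderiv_chartExtend hu hs e)
    (by
      have hc : ContinuousOn u (extChartAt I c).source := fun x hx =>
        (hs x hx).contMDiffAt.continuousAt.continuousWithinAt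
      simpa using integrable_chartExtend (μ := μ) hu hc)
    (fun _ _ => differentiableAt_const _)
    (fun y _ => (contDiff_chartExtend hu hs).differentiable (by simp) y)
  simpa using h

/-- The integral over the source of the chart at `c` against the Riemannian volume. -/
def chartIntegral (μ : Measure E) (g : Metric I M) (b : Module.Basis κ ℝ E) (c : M) (u : M → ℝ) :
    ℝ :=
  ∫ y, chartExtend I c (fun x => u x * volDensity g b c x) y ∂μ

theorem continuousOn_volDensity : ContinuousOn (volDensity g b c) (extChartAt I c).source :=
  fun _ hx => (smoothFunNear_volDensity hx).contMDiffAt.continuousAt.continuousWithinAt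

theorem tsupport_mul_volDensity (hu : tsupport u ⊆ (extChartAt I c).source) :
    tsupport (fun x => u x * volDensity g b c x) ⊆ (extChartAt I c).source :=
  (tsupport_mul_subset_left).trans hu

theorem chartIntegral_add (hu : tsupport u ⊆ (extChartAt I c).source) (hcu : Continuous u)
    (hv : tsupport v ⊆ (extChartAt I c).source) (hcv : Continuous v) :
    chartIntegral μ g b c (fun x => u x + v x) =
      chartIntegral μ g b c u + chartIntegral μ g b c v := by
  unfold chartIntegral
  rw [← integral_add (integrable_chartExtend (tsupport_mul_volDensity hu)
    (hcu.continuousOn.mul continuousOn_volDensity)) (integrable_chartExtend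
    (tsupport_mul_volDensity hv) (hcv.continuousOn.mul continuousOn_volDensity))]
  refine integral_congr_ae (ae_of_all _ fun y => ?_)
  by_cases hy : y ∈ (extChartAt I c).target
  · simp only [chartExtend_of_mem hy, add_mul]
  · simp [chartExtend_of_notMem_target hy]

theorem chartIntegral_const_mul (r : ℝ) :
    chartIntegral μ g b c (fun x => r * u x) = r * chartIntegral μ g b c u := by
  unfold chartIntegral
  rw [← integral_const_mul]
  refine integral_congr_ae (ae_of_all _ fun y => ?_)
  by_cases hy : y ∈ (extChartAt I c).target
  · simp only [chartExtend_of_mem hy, mul_assoc]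
  · simp [chartExtend_of_notMem_target hy]

theorem chartIntegral_zero : chartIntegral μ g b c (fun _ => 0) = 0 := by
  simpa using chartIntegral_const_mul (μ := μ) (g := g) (b := b) (c := c) (u := fun _ => 0) 0

theorem tsupport_sum_subset {α : Type*} {t : Finset α} {f : α → M → ℝ} {s : Set M}
    (h : ∀ a ∈ t, tsupport (f a) ⊆ s) : tsupport (fun x => ∑ a ∈ t, f a x) ⊆ s := by
  classical
  have h1 : IsClosed (⋃ a ∈ t, tsupport (f a)) :=
    t.finite_toSet.isClosed_biUnion fun a _ => isClosed_tsupport _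
  refine (closure_minimal (fun x hx => ?_) h1).trans (iUnion₂_subset h)
  obtain ⟨a, ha, h2⟩ := Finset.exists_ne_zero_of_sum_ne_zero hx
  exact mem_biUnion ha (subset_tsupport _ h2)

theorem chartIntegral_sum {α : Type*} {t : Finset α} {f : α → M → ℝ}
    (h : ∀ a ∈ t, tsupport (f a) ⊆ (extChartAt I c).source) (hc : ∀ a ∈ t, Continuous (f a)) :
    chartIntegral μ g b c (fun x => ∑ a ∈ t, f a x) = ∑ a ∈ t, chartIntegral μ g b c (f a) := by
  classical
  induction t using Finset.induction_on with
  | empty => simpa using chartIntegral_zero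
  | insert a s ha ih =>
    simp only [Finset.sum_insert ha]
    rw [← ih (fun k hk => h k (Finset.mem_insert_of_mem hk))
      (fun k hk => hc k (Finset.mem_insert_of_mem hk))]
    exact chartIntegral_add (h a (by simp)) (hc a (by simp))
      (tsupport_sum_subset fun k hk => h k (Finset.mem_insert_of_mem hk))
      (continuous_finsetSum _ fun k hk => hc k (Finset.mem_insert_of_mem hk))

theorem chartIntegral_nonneg (h : ∀ x, 0 ≤ u x) : 0 ≤ chartIntegral μ g b c u :=
  integral_nonneg fun y => by
    by_cases hy : y ∈ (extChartAt I c).target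
    · rw [chartExtend_of_mem hy]
      exact mul_nonneg (h _) (Real.sqrt_nonneg _)
    · simp [chartExtend_of_notMem_target hy]

theorem chartIntegral_pos (hu : tsupport u ⊆ (extChartAt I c).source) (hc : Continuous u)
    (h : ∀ x, 0 ≤ u x) (h0 : u x ≠ 0) : 0 < chartIntegral μ g b c u := by
  have hx : x ∈ (extChartAt I c).source := hu (subset_tsupport _ h0)
  refine (continuous_chartExtend (tsupport_mul_volDensity hu)
    (hc.continuousOn.mul continuousOn_volDensity)).integral_pos_of_hasCompactSupport_nonneg_nonzero
    (x := extChartAt I c x) (hasCompactSupport_chartExtend (tsupport_mul_volDensity hu))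
    (fun y => ?_) ?_
  · by_cases hy : y ∈ (extChartAt I c).target
    · rw [chartExtend_of_mem hy]
      exact mul_nonneg (h _) (Real.sqrt_nonneg _)
    · simp [chartExtend_of_notMem_target hy]
  · rw [chartExtend_of_mem ((extChartAt I c).map_source hx), (extChartAt I c).left_inv hx]
    exact mul_ne_zero h0 (volDensity_pos hx).ne'

/-- The divergence theorem for fields supported in one chart. -/
theorem chartIntegral_divergence (hcov : IsLeviCivita g cov) {Z : Π x : M, TangentSpace I x}
    (hZ : ∀ x, SmoothNear I E Z x) {K : Set M} (hK : IsClosed K)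
    (hKc : K ⊆ (extChartAt I c).source) (hZK : ∀ x ∉ K, Z x = 0) :
    chartIntegral μ g b c (divergence cov Z) = 0 := by
  let f : κ → M → ℝ := fun k x => coordCoeff I b c k x (Z x) * volDensity g b c x
  have hf : ∀ k, tsupport (f k) ⊆ (extChartAt I c).source := fun k => by
    refine (closure_minimal (fun x hx => ?_) hK).trans hKc
    by_contra h
    exact hx (by simp [f, hZK x h])
  have hs : ∀ k, ∀ x ∈ (extChartAt I c).source, SmoothFunNear I (f k) x := fun k x hx =>
    (smoothFunNear_coordCoeff hx (hZ x) k).mul (smoothFunNear_volDensity hx)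
  have h : ∀ y, chartExtend I c (fun x => divergence cov Z x * volDensity g b c x) y =
      ∑ k, fderiv ℝ (chartExtend I c (f k)) y (b k) := fun y => by
    by_cases hy : y ∈ (extChartAt I c).target
    · have hx := (extChartAt I c).map_target hy
      rw [chartExtend_of_mem hy, volDensity_mul_divergence (b := b) hcov hx (hZ _)]
      refine Finset.sum_congr rfl fun k _ => ?_
      rw [mvfderiv_coordField hx (hs k _ hx), (extChartAt I c).right_inv hy,
        (chartExtend_eventuallyEq hy).fderiv_eq]
    · rw [chartExtend_of_notMem_target hy]
      refine (Finset.sum_eq_zero fun k _ => ?_).symm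
      rw [(chartExtend_eventuallyEq_zero (hf k) hy).fderiv_eq]
      simp
  unfold chartIntegral
  simp only [h]
  rw [integral_finsetSum _ fun k _ => integrable_fderiv_chartExtend (hf k) (hs k) (b k)]
  exact Finset.sum_eq_zero fun k _ => integral_fderiv_chartExtend (hf k) (hs k) (b k)

end Integration

/-! ### Change of charts and existence of the integral -/

section ChartChange

open Filter Topology MeasureTheory

variable {E : Type*} [NormedAddCommGroup E] [NormedSpace ℝ E] [FiniteDimensional ℝ E]
  {H : Type*} [TopologicalSpace H] {I : ModelWithCorners ℝ E H} [I.Boundaryless]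
  {M : Type*} [TopologicalSpace M] [T2Space M] [CompactSpace M] [ChartedSpace H M]
  [IsManifold I ∞ M]
  {g : Metric I M} {cov : TangentConnection I M}
  {κ : Type*} [Fintype κ] [DecidableEq κ] {b : Module.Basis κ ℝ E} {c c' x : M} {k l : κ}
  {u v : M → ℝ} {y : E}

theorem smoothFunNear_extChartAt (hx : x ∈ (extChartAt I c).source) :
    SmoothFunNear I (extChartAt I c) x := by
  filter_upwards [(isOpen_extChartAt_source (I := I) c).mem_nhds hx] with y hy
  rw [extChartAt_source] at hy
  exact contMDiffAt_extChartAt' hy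

theorem volDensity_eq (hx : x ∈ (extChartAt I c).source) (hx' : x ∈ (extChartAt I c').source) :
    volDensity g b c x = |(fderiv ℝ (extChartAt I c' ∘ (extChartAt I c).symm)
      (extChartAt I c x)).det| * volDensity g b c' x := by
  set L := fderiv ℝ (extChartAt I c' ∘ (extChartAt I c).symm) (extChartAt I c x) with hL
  let A := LinearMap.toMatrix b b (L : E →ₗ[ℝ] E)
  have hA : ∀ k l, A k l = coordCoeff I b c' k x (coordField I b c l x) := fun k l => by
    rw [coordCoeff_eq hx', mvfderiv_coordField hx (smoothFunNear_extChartAt hx')]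
    exact LinearMap.toMatrix_apply b b _ k l
  have h1 : gramMatrix g b c x = A.transpose * gramMatrix g b c' x * A := by
    ext p q
    simp only [Matrix.mul_apply, Matrix.transpose_apply, gramMatrix, Matrix.of_apply, hA]
    conv_lhs => rw [eq_sum_coordField (b := b) hx' (coordField I b c p x),
      eq_sum_coordField (b := b) hx' (coordField I b c q x)]
    simp only [map_sum, map_smul, sum_apply, smul_apply, smul_eq_mul, Finset.sum_mul,
      Finset.mul_sum]
    exact Finset.sum_congr rfl fun k _ => Finset.sum_congr rfl fun l _ => by ring
  have h2 : A.det = L.det := LinearMap.det_toMatrix b _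
  unfold volDensity
  rw [h1, Matrix.det_mul, Matrix.det_mul, Matrix.det_transpose, h2,
    show L.det * (gramMatrix g b c' x).det * L.det = L.det ^ 2 * (gramMatrix g b c' x).det by ring,
    Real.sqrt_mul (sq_nonneg _), Real.sqrt_sq_eq_abs]

variable [MeasurableSpace E] [BorelSpace E] {μ : Measure E} [μ.IsAddHaarMeasure]

theorem chartIntegral_eq_setIntegral (h : ∀ x ∉ (extChartAt I c').source, u x = 0) :
    chartIntegral μ g b c u = ∫ y in (extChartAt I c).target ∩
      (extChartAt I c).symm ⁻¹' (extChartAt I c').source,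
        u ((extChartAt I c).symm y) * volDensity g b c ((extChartAt I c).symm y) ∂μ := by
  have hm : MeasurableSet (extChartAt I c).target :=
    (isOpen_extChartAt_target (I := I) c).measurableSet
  unfold chartIntegral chartExtend
  rw [integral_indicator hm]
  refine setIntegral_eq_of_subset_of_forall_sdiff_eq_zero hm inter_subset_left fun y hy => ?_
  have h1 := h ((extChartAt I c).symm y) fun h2 => hy.2 ⟨hy.1, h2⟩
  simp only [Function.comp_apply, h1, zero_mul]

/-- The integral against the Riemannian volume does not depend on the chart. -/
theorem chartIntegral_eq_of_support (h : ∀ x ∉ (extChartAt I c).source, u x = 0)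
    (h' : ∀ x ∉ (extChartAt I c').source, u x = 0) :
    chartIntegral μ g b c u = chartIntegral μ g b c' u := by
  rw [chartIntegral_eq_setIntegral h', chartIntegral_eq_setIntegral h]
  set φ := extChartAt I c with hφ
  set φ' := extChartAt I c' with hφ'
  set T := φ.target ∩ φ.symm ⁻¹' φ'.source with hT
  have hopen : IsOpen T := (continuousOn_extChartAt_symm c).isOpen_inter_preimage
    (isOpen_extChartAt_target c) (isOpen_extChartAt_source c')
  have himage : φ'.target ∩ φ'.symm ⁻¹' φ.source = (φ' ∘ φ.symm) '' T := by
    ext y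
    constructor
    · rintro ⟨h1, h2⟩
      refine ⟨φ (φ'.symm y), ⟨φ.map_source h2, ?_⟩, ?_⟩
      · rw [mem_preimage, φ.left_inv h2]
        exact φ'.map_target h1
      · rw [Function.comp_apply, φ.left_inv h2, φ'.right_inv h1]
    · rintro ⟨z, ⟨h1, h2⟩, rfl⟩
      refine ⟨φ'.map_source h2, ?_⟩
      rw [mem_preimage, Function.comp_apply, φ'.left_inv h2]
      exact φ.map_target h1
  have hderiv : ∀ y ∈ T, HasFDerivWithinAt (φ' ∘ φ.symm) (fderiv ℝ (φ' ∘ φ.symm) y) T y := by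
    intro y hy
    have h1 : ContMDiffAt 𝓘(ℝ, E) 𝓘(ℝ, E) ∞ (φ' ∘ φ.symm) y :=
      ContMDiffAt.comp y (smoothFunNear_extChartAt hy.2).contMDiffAt
        ((contMDiffOn_extChartAt_symm (I := I) (n := ∞) c).contMDiffAt
          ((isOpen_extChartAt_target (I := I) c).mem_nhds hy.1))
    exact (h1.contDiffAt.differentiableAt (by simp)).hasFDerivAt.hasFDerivWithinAt
  have hinj : InjOn (φ' ∘ φ.symm) T := by
    intro y hy z hz h1
    have h2 := φ'.injOn hy.2 hz.2 h1
    rw [← φ.right_inv hy.1, h2, φ.right_inv hz.1]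
  rw [himage, integral_image_eq_integral_abs_det_fderiv_smul μ hopen.measurableSet hderiv hinj]
  refine setIntegral_congr_fun hopen.measurableSet fun y hy => ?_
  have h1 := volDensity_eq (g := g) (b := b) (φ.map_target hy.1) hy.2
  rw [← hφ, ← hφ', φ.right_inv hy.1] at h1
  simp only [Function.comp_apply, φ'.left_inv hy.2, smul_eq_mul]
  rw [h1]
  ring

theorem divergence_congr_zero {Z : Π x : M, TangentSpace I x} {K : Set M} (hK : IsClosed K)
    (hZK : ∀ x ∉ K, Z x = 0) (hx : x ∉ K) : divergence cov Z x = 0 := by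
  have h1 : ∀ᶠ y in 𝓝 x, (fun y => (0 : TangentSpace I y)) y = Z y := by
    filter_upwards [hK.isOpen_compl.mem_nhds hx] with y hy
    exact (hZK y hy).symm
  have h0 : SmoothNear I E (fun y => (0 : TangentSpace I y)) x := SmoothNear.zero
  have h2 : cov (fun y => (0 : TangentSpace I y)) x = 0 := cov.isCovariantDerivativeOnUniv.zero
  unfold divergence
  rw [← cov_congr h1 h0, h2]
  exact map_zero _

theorem divergence_sum {α : Type*} {t : Finset α} {Z : α → Π x : M, TangentSpace I x}
    (hZ : ∀ a ∈ t, SmoothNear I E (Z a) x) :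
    divergence cov (fun y => ∑ a ∈ t, Z a y) x = ∑ a ∈ t, divergence cov (Z a) x := by
  have h1 : cov (fun y => ∑ a ∈ t, Z a y) x = ∑ a ∈ t, cov (Z a) x := by
    ext v
    rw [cov_sum hZ, sum_apply]
  unfold divergence
  rw [h1]
  simp only [ContinuousLinearMap.toLinearMap_sum, map_sum]

/-- Integration over a closed Riemannian manifold, by a partition of unity: the divergence theorem
holds for it. -/
theorem exists_isIntegral (μ : Measure E) [μ.IsAddHaarMeasure] (hcov : IsLeviCivita g cov)
    (hdiv : ∀ Z : Π x : M, TangentSpace I x, (∀ x, SmoothNear I E Z x) →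
      Continuous (divergence cov Z)) :
    ∃ Λ, IsIntegral cov Λ := by
  classical
  let b := Module.finBasis ℝ E
  obtain ⟨ρ, hρ⟩ := SmoothPartitionOfUnity.exists_isSubordinate_chartAt_source I M
  have hfin := ρ.locallyFinite.finite_nonempty_of_compact
  let t := hfin.toFinset
  have hsum : ∀ x, ∑ c ∈ t, ρ c x = 1 := fun x => by
    refine ρ.sum_finsupport' x (mem_univ x) fun c hc => ?_
    exact hfin.mem_toFinset.2 ⟨x, (ρ.mem_finsupport x).1 hc⟩
  have hsrc : ∀ c, tsupport (ρ c) ⊆ (extChartAt I c).source := fun c => by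
    rw [extChartAt_source]
    exact hρ c
  have hcont : ∀ c, Continuous (ρ c) := fun c => (ρ c).contMDiff.continuous
  have hsub : ∀ c (f : M → ℝ), tsupport (fun x => ρ c x * f x) ⊆ (extChartAt I c).source :=
    fun c f => tsupport_mul_subset_left.trans (hsrc c)
  refine ⟨fun f => ∑ c ∈ t, chartIntegral μ g b c fun x => ρ c x * f x, ⟨?_, ?_, ?_, ?_⟩⟩
  · intro f h hf hh
    rw [← Finset.sum_add_distrib]
    refine Finset.sum_congr rfl fun c _ => ?_
    rw [← chartIntegral_add (hsub c f) ((hcont c).mul hf) (hsub c h) ((hcont c).mul hh)]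
    simp only [mul_add]
  · intro r f _
    rw [Finset.mul_sum]
    refine Finset.sum_congr rfl fun c _ => ?_
    rw [← chartIntegral_const_mul]
    exact congrArg _ (funext fun x => by ring)
  · rintro f hf h0 ⟨x, hx⟩
    obtain ⟨c, hc⟩ := ρ.exists_pos_of_mem (mem_univ x)
    have hct : c ∈ t := hfin.mem_toFinset.2 ⟨x, hc.ne'⟩
    exact Finset.sum_pos' (fun c _ => chartIntegral_nonneg fun x => mul_nonneg (ρ.nonneg c x) (h0 x))
      ⟨c, hct, chartIntegral_pos (hsub c f) ((hcont c).mul hf)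
        (fun x => mul_nonneg (ρ.nonneg c x) (h0 x)) (mul_ne_zero hc.ne' hx)⟩
  -- `Z = ∑ ρ_c Z`, and the divergence of each summand is integrated in its own chart
  · intro Z hZ
    have hZc : ∀ c x, SmoothNear I E (fun x => ρ c x • Z x) x := fun c x =>
      SmoothNear.smul (Eventually.of_forall fun y => (ρ c).contMDiff y) (hZ x)
    have hzero : ∀ c, ∀ x ∉ tsupport (ρ c), ρ c x • Z x = 0 := fun c x hx => by
      rw [image_eq_zero_of_notMem_tsupport hx, zero_smul]
    have hZsum : ∀ x, divergence cov Z x =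
        ∑ c ∈ t, divergence cov (fun x => ρ c x • Z x) x := fun x => by
      rw [← divergence_sum fun c _ => hZc c x]
      congr 1
      funext y
      rw [← Finset.sum_smul, hsum, one_smul]
    have h0 : ∀ c x, x ∉ (extChartAt I c).source → divergence cov (fun x => ρ c x • Z x) x = 0 :=
      fun c x hx => divergence_congr_zero (isClosed_tsupport _) (hzero c) fun h => hx (hsrc c h)
    have h1 : ∀ c, chartIntegral μ g b c (fun x => ρ c x * divergence cov Z x) =
        ∑ c' ∈ t, chartIntegral μ g b c' fun x => ρ c x *
          divergence cov (fun x => ρ c' x • Z x) x := fun c => by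
      simp only [hZsum, Finset.mul_sum]
      rw [chartIntegral_sum (fun c' _ => hsub c _) fun c' _ => (hcont c).mul (hdiv _ (hZc c'))]
      refine Finset.sum_congr rfl fun c' _ => chartIntegral_eq_of_support (fun x hx => ?_)
        fun x hx => ?_
      · rw [image_eq_zero_of_notMem_tsupport fun h => hx (hsrc c h), zero_mul]
      · rw [h0 c' x hx, mul_zero]
    simp only [h1]
    rw [Finset.sum_comm]
    refine Finset.sum_eq_zero fun c' _ => ?_
    have h2 : ∀ c, tsupport (fun x => ρ c x * divergence cov (fun x => ρ c' x • Z x) x) ⊆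
        (extChartAt I c').source := fun c => by
      refine (closure_minimal (fun x hx => ?_) (isClosed_tsupport (ρ c'))).trans (hsrc c')
      by_contra h
      exact hx (by simp only [divergence_congr_zero (isClosed_tsupport _) (hzero c') h, mul_zero])
    rw [← chartIntegral_sum (fun c _ => h2 c) fun c _ => (hcont c).mul (hdiv _ (hZc c'))]
    simp only [← Finset.sum_mul, hsum, one_mul]
    exact chartIntegral_divergence hcov (hZc c') (isClosed_tsupport _) (hsrc c') (hzero c')

end ChartChange

/-! ### The curvature endomorphism -/

section CurvatureAlgebra

variable {d : ℕ} {W : Type*} [NormedAddCommGroup W] [InnerProductSpace ℂ W]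
  {R : VecIdx d → VecIdx d → W →ₗ[ℂ] W} {j : VecIdx d → VecIdx d → ℝ}

theorem act_map (L : W →ₗ[ℂ] W) (B : SpinorMatrix d) (w : SpinorIdx d → W) :
    act B (fun b => L (w b)) = fun b => L (act B w b) := by
  funext a
  simp only [act, map_sum, map_smul]

/-- The endomorphism `2 ∑ e_k · e_l · ⊗ R(e_k, e_l)` of `Δ ⊗ W` for a two-form `R` with values in
the endomorphisms of `W`. -/
def cliffordCurvature (R : VecIdx d → VecIdx d → W →ₗ[ℂ] W) :
    (SpinorIdx d → W) →ₗ[ℂ] (SpinorIdx d → W) where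
  toFun w := (2 : ℂ) • ∑ k, ∑ l, act (gamma k * gamma l) (fun b => R k l (w b))
  map_add' v w := by
    have h : ∀ k l, (fun b => R k l ((v + w) b)) = (fun b => R k l (v b)) + fun b => R k l (w b) :=
      fun k l => by funext b; simp
    simp only [h, act_add, Finset.sum_add_distrib, smul_add]
  map_smul' c w := by
    have h : ∀ k l, (fun b => R k l ((c • w) b)) = c • fun b => R k l (w b) :=
      fun k l => by funext b; simp
    simp only [h, act_smul, ← Finset.smul_sum, RingHom.id_apply]
    rw [smul_comm]

theorem cliffordCurvature_apply (w : SpinorIdx d → W) : cliffordCurvature R w =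
    (2 : ℂ) • ∑ k, ∑ l, act (gamma k * gamma l) (fun b => R k l (w b)) := rfl

theorem ip_cliffordCurvature (hskew : ∀ k l w, R k l w = -R l k w)
    (hadj : ∀ k l w w', inner ℂ (R k l w) w' = -inner ℂ w (R k l w'))
    (v w : SpinorIdx d → W) : ip (cliffordCurvature R v) w = ip v (cliffordCurvature R w) := by
  have h1 : ∀ k l, ip (act (gamma k * gamma l) (fun b => R k l (v b))) w =
      ip v (act (gamma l * gamma k) (fun b => R l k (w b))) := fun k l => by
    rw [act_mul, ip_act_gamma_left, ip_act_gamma_left, neg_neg, ← act_mul]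
    have h2 : (fun b => R l k (w b)) = -fun b => R k l (w b) := by
      funext b
      exact hskew l k (w b)
    rw [h2, act_neg, act_map, ip_neg_right]
    simp only [ip, hadj, Finset.sum_neg_distrib]
  rw [cliffordCurvature_apply, cliffordCurvature_apply, ip_smul_left, ip_smul_right, ip_sum_left,
    ip_sum_right]
  simp only [ip_sum_left, ip_sum_right, h1]
  rw [Finset.sum_comm]
  simp

/-- If `R` is invariant under the complex structure, its Clifford endomorphism commutes with the
Kähler form. -/
theorem cliffordCurvature_kaehlerOp (hj : IsComplexStructure j)
    (hR : ∀ k l w, ∑ m, (j k m : ℂ) • R m l w + ∑ m, (j l m : ℂ) • R k m w = 0)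
    (w : SpinorIdx d → W) :
    cliffordCurvature R (act (kaehlerOp j) w) = act (kaehlerOp j) (cliffordCurvature R w) := by
  have h1 : ∀ k l, kaehlerOp j * (gamma k * gamma l) = gamma k * gamma l * kaehlerOp j +
      (2 : ℂ) • (∑ m, (j k m : ℂ) • (gamma m * gamma l) +
        ∑ m, (j l m : ℂ) • (gamma k * gamma m)) := fun k l => by
    have e1 := sub_eq_iff_eq_add.1 (kaehlerOp_commutator_gamma hj k)
    have e2 := sub_eq_iff_eq_add.1 (kaehlerOp_commutator_gamma hj l)
    rw [← mul_assoc, e1, add_mul, mul_assoc (gamma k), e2]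
    simp only [gammaJ, smul_mul_assoc, mul_smul_comm, mul_add, Finset.sum_mul, Finset.mul_sum,
      smul_add, mul_assoc]
    abel
  have h2 : ∑ k, ∑ l, act (∑ m, (j k m : ℂ) • (gamma m * gamma l) +
      ∑ m, (j l m : ℂ) • (gamma k * gamma m)) (fun b => R k l (w b)) = 0 := by
    simp only [add_act, sum_act, smul_act, Finset.sum_add_distrib]
    have e1 : ∑ k, ∑ l, ∑ m, (j k m : ℂ) • act (gamma m * gamma l) (fun b => R k l (w b)) =
        -∑ k, ∑ l, act (gamma k * gamma l) (fun b => ∑ m, (j k m : ℂ) • R m l (w b)) := by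
      have e : ∀ k l, (fun b => ∑ m, (j k m : ℂ) • R m l (w b)) =
          ∑ m, (j k m : ℂ) • fun b => R m l (w b) := fun k l => by
        funext b
        simp
      simp only [e, act_sum, act_smul]
      rw [← Finset.sum_neg_distrib]
      simp only [← Finset.sum_neg_distrib, ← neg_smul]
      calc _ = ∑ l, ∑ k, ∑ m, (j k m : ℂ) • act (gamma m * gamma l) (fun b => R k l (w b)) :=
            Finset.sum_comm
        _ = ∑ l, ∑ m, ∑ k, (j k m : ℂ) • act (gamma m * gamma l) (fun b => R k l (w b)) :=
            Finset.sum_congr rfl fun l _ => Finset.sum_comm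
        _ = ∑ m, ∑ l, ∑ k, (j k m : ℂ) • act (gamma m * gamma l) (fun b => R k l (w b)) :=
            Finset.sum_comm
        _ = _ := Finset.sum_congr rfl fun m _ => Finset.sum_congr rfl fun l _ =>
            Finset.sum_congr rfl fun k _ => by rw [hj.skew k m]; push_cast; rfl
    have e2 : ∑ k, ∑ l, ∑ m, (j l m : ℂ) • act (gamma k * gamma m) (fun b => R k l (w b)) =
        -∑ k, ∑ l, act (gamma k * gamma l) (fun b => ∑ m, (j l m : ℂ) • R k m (w b)) := by
      have e : ∀ k l, (fun b => ∑ m, (j l m : ℂ) • R k m (w b)) =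
          ∑ m, (j l m : ℂ) • fun b => R k m (w b) := fun k l => by
        funext b
        simp
      simp only [e, act_sum, act_smul]
      simp only [← Finset.sum_neg_distrib, ← neg_smul]
      refine Finset.sum_congr rfl fun k _ => ?_
      rw [Finset.sum_comm]
      exact Finset.sum_congr rfl fun l _ => Finset.sum_congr rfl fun m _ => by
        rw [hj.skew m l]; push_cast; rfl
    rw [e1, e2, ← neg_add, neg_eq_zero, ← Finset.sum_add_distrib]
    refine Finset.sum_eq_zero fun k _ => ?_
    rw [← Finset.sum_add_distrib]
    refine Finset.sum_eq_zero fun l _ => ?_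
    rw [← act_add]
    have e : ((fun b => ∑ m, (j k m : ℂ) • R m l (w b)) +
        fun b => ∑ m, (j l m : ℂ) • R k m (w b)) = 0 := funext fun b => hR k l (w b)
    rw [e, act_zero]
  have h3 : ∀ k l, (fun b => R k l (act (kaehlerOp j) w b)) =
      act (kaehlerOp j) (fun b => R k l (w b)) := fun k l => (act_map (R k l) _ w).symm
  rw [cliffordCurvature_apply, cliffordCurvature_apply, act_smul]
  simp only [act_sum, h3, ← act_mul, h1, add_act, Finset.sum_add_distrib]
  simp only [smul_act, ← Finset.smul_sum, h2, smul_zero, add_zero]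

/-- A symmetric endomorphism all of whose eigenvalues are at least `κ` is at least `κ`. -/
theorem le_re_ip_of_eigenvalues [FiniteDimensional ℂ W]
    {T : (SpinorIdx d → W) →ₗ[ℂ] (SpinorIdx d → W)} (hT : ∀ v w, ip (T v) w = ip v (T w)) {κ : ℝ}
    (hκ : ∀ μ : ℝ, (∃ w, w ≠ 0 ∧ T w = (μ : ℂ) • w) → κ ≤ μ) (w : SpinorIdx d → W) :
    κ * (ip w w).re ≤ (ip w (T w)).re := by
  let e := WithLp.linearEquiv 2 ℂ (SpinorIdx d → W)
  let T' : PiLp 2 (fun _ : SpinorIdx d => W) →ₗ[ℂ] PiLp 2 (fun _ : SpinorIdx d => W) :=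
    e.symm.toLinearMap ∘ₗ T ∘ₗ e.toLinearMap
  have hinner : ∀ v w : PiLp 2 (fun _ : SpinorIdx d => W), inner ℂ v w = ip (e v) (e w) :=
    fun v w => PiLp.inner_apply v w
  have hsymm : T'.IsSymmetric := fun v w => by
    rw [hinner, hinner]
    exact hT (e v) (e w)
  let b := hsymm.eigenvectorBasis rfl
  have hb : ∀ i, T' (b i) = ((hsymm.eigenvalues rfl i : ℝ) : ℂ) • b i :=
    fun i => hsymm.apply_eigenvectorBasis rfl i
  have hle : ∀ i, κ ≤ hsymm.eigenvalues rfl i := fun i => by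
    refine hκ _ ⟨e (b i), fun h => b.orthonormal.ne_zero i (e.map_eq_zero_iff.1 h), ?_⟩
    have := congrArg e (hb i)
    rwa [map_smul] at this
  let v := e.symm w
  have h1 : (ip w (T w)) = inner ℂ v (T' v) := by
    rw [hinner]
    rfl
  have h2 : (ip w w) = inner ℂ v v := by
    rw [hinner]
    rfl
  rw [h1, h2, ← b.sum_inner_mul_inner v (T' v), ← b.sum_inner_mul_inner v v, Complex.re_sum,
    Complex.re_sum, Finset.mul_sum]
  refine Finset.sum_le_sum fun i _ => ?_
  rw [← hsymm (b i) v, hb, inner_smul_left, Complex.conj_ofReal, mul_left_comm,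
    Complex.re_ofReal_mul]
  refine mul_le_mul_of_nonneg_right (hle i) ?_
  rw [← inner_conj_symm, RCLike.conj_mul]
  norm_cast
  exact sq_nonneg _

end CurvatureAlgebra

section CurvatureBound

variable {d : ℕ} {E : Type*} [NormedAddCommGroup E] [NormedSpace ℝ E] [FiniteDimensional ℝ E]
  {H : Type*} [TopologicalSpace H] {I : ModelWithCorners ℝ E H} [I.Boundaryless]
  {M : Type*} [TopologicalSpace M] [T2Space M] [ChartedSpace H M] [IsManifold I ∞ M]
  {g : Metric I M} {ι : Type*} {S : SpinStructure d g ι} {cov : TangentConnection I M}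
  {J : TangentEndo I M}
  {F : Type*} [NormedAddCommGroup F] [NormedSpace ℂ F] [FiniteDimensional ℂ F]
  {V : M → Type*} [TopologicalSpace (TotalSpace F V)]
  [∀ x, NormedAddCommGroup (V x)] [∀ x, InnerProductSpace ℂ (V x)]
  [FiberBundle F V] [VectorBundle ℂ F V] [VectorBundle ℝ F V]
  [ContMDiffVectorBundle ∞ F V I]
  {covE : CovariantDerivative I F V} {x : M} {i j : ι}
  {ψ η : LocalSpinor d ι V}

namespace SpinStructure

/-- The curvature of `∇^E` in the frame over `U i`. -/
def frameCurvature (S : SpinStructure d g ι) (hcovE : IsMetricConnection covE) (i : ι) (x : M)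
    (k l : VecIdx d) : V x →ₗ[ℂ] V x :=
  have : FiniteDimensional ℝ F := FiniteDimensional.complexToReal F
  { toFun := curvature covE x (S.frame i k x) (S.frame i l x)
    map_add' := curvature_add hcovE.smooth _ _
    map_smul' := fun c w => curvature_complex_smul hcovE c _ _ w }

theorem curvatureEndo_eq (hcovE : IsMetricConnection covE) (w : SpinorIdx d → V x) :
    S.curvatureEndo covE i x w = cliffordCurvature (S.frameCurvature hcovE i x) w := rfl

theorem ip_curvatureEndo (hV : IsSmoothHermitian I F V) (hcovE : IsMetricConnection covE)
    (v w : SpinorIdx d → V x) :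
    ip (S.curvatureEndo covE i x v) w = ip v (S.curvatureEndo covE i x w) := by
  have : FiniteDimensional ℝ F := FiniteDimensional.complexToReal F
  exact ip_cliffordCurvature (R := S.frameCurvature hcovE i x)
    (fun k l w => curvature_swap hcovE.smooth _ _ w)
    (fun k l w w' => inner_curvature hV hcovE _ _ w w') v w

theorem le_curvatureForm (hV : IsSmoothHermitian I F V) (hcovE : IsMetricConnection covE)
    {scal₀ κ₁ : ℝ} (hscal : IsGLB (scalarCurvatureValues d g cov) scal₀)
    (hκ : IsGLB (S.curvatureEigenvalues covE) κ₁) (ψ : LocalSpinor d ι V) (x : M) :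
    (scal₀ + κ₁) / 4 * S.pairing ψ ψ x ≤ S.curvatureForm cov covE ψ x := by
  have hx := S.mem_index x
  have : FiniteDimensional ℂ (V x) := LinearEquiv.finiteDimensional
    ((trivializationAt F V x).linearEquivAt ℂ x
      (FiberBundle.mem_baseSet_trivializationAt F V x)).symm
  have h1 : scal₀ ≤ S.scalar cov (S.index x) x :=
    hscal.1 ⟨x, fun k => S.frame (S.index x) k x, S.frame_orthonormal _ x hx, rfl⟩
  have h2 : κ₁ * S.pairing ψ ψ x ≤
      (ip (ψ (S.index x) x) (S.curvatureEndo covE (S.index x) x (ψ (S.index x) x))).re :=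
    le_re_ip_of_eigenvalues (T := cliffordCurvature (S.frameCurvature hcovE (S.index x) x))
      (fun v w => ip_curvatureEndo hV hcovE v w)
      (fun μ hμ => hκ.1 ⟨S.index x, x, hx, hμ⟩) _
  have h3 : 0 ≤ S.pairing ψ ψ x := re_ip_self_nonneg _
  have h4 := mul_le_mul_of_nonneg_right h1 h3
  unfold curvatureForm
  linarith

/-- For a curvature of type `(1, 1)` the curvature endomorphism preserves the degree. -/
theorem hasDegree_curvatureEndo (hdim : Module.finrank ℝ E = 2 * d) (hJ : IsKaehlerStructure g cov J)
    (hcovE : IsMetricConnection covE) (hone : IsCurvatureOneOne J covE) (hx : x ∈ S.U i) {μ : ℂ}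
    {w : SpinorIdx d → V x} (hw : HasDegree (S.kaehlerCoeff J i x) μ w) :
    HasDegree (S.kaehlerCoeff J i x) μ (S.curvatureEndo covE i x w) := by
  have : FiniteDimensional ℝ F := FiniteDimensional.complexToReal F
  have hsumL : ∀ (t : Finset (VecIdx d)) (a : VecIdx d → ℝ) (u : VecIdx d → TangentSpace I x)
      (v : TangentSpace I x) (w : V x), curvature covE x (∑ m ∈ t, a m • u m) v w =
        ∑ m ∈ t, (a m : ℂ) • curvature covE x (u m) v w := fun t a u v w => by
    let L : TangentSpace I x →ₗ[ℝ] V x :=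
      { toFun := fun u => curvature covE x u v w
        map_add' := fun u u' => curvature_add_left hcovE.smooth u u' v w
        map_smul' := fun c u => curvature_smul_left hcovE.smooth c u v w }
    have h := map_sum L (fun m => a m • u m) t
    simp only [map_smul] at h
    simp only [Complex.coe_smul]
    exact h
  have hR : ∀ k l (w : V x), ∑ m, (S.kaehlerCoeff J i x k m : ℂ) • S.frameCurvature hcovE i x m l w +
      ∑ m, (S.kaehlerCoeff J i x l m : ℂ) • S.frameCurvature hcovE i x k m w = 0 := by
    intro k l w
    have e1 : ∑ m, (S.kaehlerCoeff J i x k m : ℂ) • S.frameCurvature hcovE i x m l w =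
        curvature covE x (J x (S.frame i k x)) (S.frame i l x) w := by
      rw [S.J_frame hdim hx k]
      exact (hsumL _ _ _ _ _).symm
    have e2 : ∑ m, (S.kaehlerCoeff J i x l m : ℂ) • S.frameCurvature hcovE i x k m w =
        curvature covE x (S.frame i k x) (J x (S.frame i l x)) w := by
      rw [curvature_swap hcovE.smooth, S.J_frame hdim hx l, hsumL, ← Finset.sum_neg_distrib]
      refine Finset.sum_congr rfl fun m _ => ?_
      rw [← smul_neg, ← curvature_swap hcovE.smooth]
      rfl
    have e3 := hone x (S.frame i k x) (J x (S.frame i l x)) w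
    rw [hJ.sq, ← neg_one_smul ℝ (S.frame i l x), curvature_swap hcovE.smooth,
      curvature_smul_left hcovE.smooth, neg_one_smul, neg_neg] at e3
    rw [e1, e2, ← e3, curvature_swap hcovE.smooth (J x _), neg_add_cancel]
  rw [HasDegree, curvatureEndo_eq hcovE, ← cliffordCurvature_kaehlerOp
    (S.isComplexStructure hdim hJ hx) hR, hw, map_smul]

end SpinStructure

end CurvatureBound

/-! ### The pointwise estimate -/

section Pointwise

variable {d : ℕ} {W : Type*} [NormedAddCommGroup W] [InnerProductSpace ℂ W]
  {j : VecIdx d → VecIdx d → ℝ} {u : VecIdx d → SpinorIdx d → W}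

/-- The components of degree `r` of a covector with values in the spinors. -/
def covectorComponent (j : VecIdx d → VecIdx d → ℝ) (u : VecIdx d → SpinorIdx d → W) (r : ℕ)
    (k : VecIdx d) : SpinorIdx d → W :=
  act (degreeProj j r) (u k)

/-- The component of degree `k` of the Dirac symbol of the component of degree `k - 1`; it vanishes
for `k = 0`. -/
def symbolFromBelow (j : VecIdx d → VecIdx d → ℝ) (u : VecIdx d → SpinorIdx d → W) :
    ℕ → SpinorIdx d → W
  | 0 => 0
  | k + 1 => act (degreeProj j (k + 1)) (diracSymbol (covectorComponent j u k))

/-- The component of degree `k` of the Dirac symbol of the component of degree `k + 1`. -/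
def symbolFromAbove (j : VecIdx d → VecIdx d → ℝ) (u : VecIdx d → SpinorIdx d → W) (k : ℕ) :
    SpinorIdx d → W :=
  act (degreeProj j k) (diracSymbol (covectorComponent j u (k + 1)))

theorem hasDegree_covectorComponent (hj : IsComplexStructure j) (r : ℕ) (k : VecIdx d) :
    HasDegree j r (covectorComponent j u r k) :=
  hasDegree_degreeProj hj r _

theorem covectorComponent_of_lt {r : ℕ} (hr : d < r) : covectorComponent j u r = 0 := by
  funext k
  simp only [covectorComponent, degreeProj_of_lt hr, zero_act, Pi.zero_apply]

theorem diracSymbol_zero : diracSymbol (0 : VecIdx d → SpinorIdx d → W) = 0 := by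
  simp only [diracSymbol, Pi.zero_apply, act_zero, Finset.sum_const_zero]

theorem symbolFromAbove_of_le {k : ℕ} (hk : d ≤ k) : symbolFromAbove j u k = 0 := by
  rw [symbolFromAbove, covectorComponent_of_lt (Nat.lt_succ_of_le hk), diracSymbol_zero, act_zero]

theorem diracSymbol_sum {α : Type*} (t : Finset α) (z : α → ℂ) (v : α → VecIdx d → SpinorIdx d → W) :
    diracSymbol (fun k => ∑ r ∈ t, z r • v r k) = ∑ r ∈ t, z r • diracSymbol (v r) := by
  simp only [diracSymbol, act_sum, act_smul, Finset.smul_sum]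
  exact Finset.sum_comm

/-- Only the neighbouring degrees contribute to a component of the Dirac symbol. -/
theorem degreeProj_diracSymbol_sum (hj : IsComplexStructure j) (z : ℕ → ℂ) {k : ℕ} (hk : k ≤ d) :
    act (degreeProj j k) (diracSymbol fun l => ∑ r ∈ Finset.range (d + 1),
      z r • covectorComponent j u r l) =
      z (k - 1) • symbolFromBelow j u k + z (k + 1) • symbolFromAbove j u k := by
  have h1 : ∀ r, act (degreeProj j k) (z r • diracSymbol (covectorComponent j u r)) =
      (if r + 1 = k then z (k - 1) • symbolFromBelow j u k else 0) +
        if r = k + 1 then z (k + 1) • symbolFromAbove j u k else 0 := fun r => by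
    rw [act_smul]
    by_cases h1 : r + 1 = k
    · subst h1
      rw [if_pos rfl, if_neg (by omega), add_zero]
      rfl
    by_cases h2 : r = k + 1
    · subst h2
      rw [if_neg h1, if_pos rfl, zero_add]
      rfl
    · rw [if_neg h1, if_neg h2, degreeProj_diracSymbol_of_ne hj
        (hasDegree_covectorComponent hj r) (fun h => h1 h.symm) (fun h => h2 h.symm), smul_zero,
        add_zero]
  rw [diracSymbol_sum, act_sum, Finset.sum_congr rfl fun r _ => h1 r, Finset.sum_add_distrib,
    Finset.sum_ite_eq']
  congr 1
  · cases k with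
    | zero => simp [symbolFromBelow]
    | succ k =>
      simp only [Nat.add_right_cancel_iff]
      rw [Finset.sum_ite_eq', if_pos (Finset.mem_range.2 (by omega))]
  · split_ifs with h
    · rfl
    · rw [symbolFromAbove_of_le (by rw [Finset.mem_range] at h; omega), smul_zero]

theorem degreeProj_diracSymbol (hj : IsComplexStructure j) (k : ℕ) :
    act (degreeProj j k) (diracSymbol u) = symbolFromBelow j u k + symbolFromAbove j u k := by
  by_cases hk : k ≤ d
  · have h := degreeProj_diracSymbol_sum (u := u) hj (fun _ => 1) hk
    simp only [one_smul, covectorComponent, sum_act_degreeProj] at h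
    exact h
  · rw [not_le] at hk
    rw [symbolFromAbove_of_le hk.le, degreeProj_of_lt hk, zero_act, add_zero]
    cases k with
    | zero => rfl
    | succ k => rw [symbolFromBelow, degreeProj_of_lt hk, zero_act]

theorem re_ip_sum_of_degree (hj : IsComplexStructure j) (t : Finset ℕ) {v : ℕ → SpinorIdx d → W}
    (hv : ∀ r : ℕ, HasDegree j r (v r)) :
    (ip (∑ r ∈ t, v r) (∑ r ∈ t, v r)).re = ∑ r ∈ t, (ip (v r) (v r)).re := by
  rw [ip_sum_left, Complex.re_sum]
  refine Finset.sum_congr rfl fun r hr => ?_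
  rw [ip_sum_right, Finset.sum_eq_single r
    (fun s _ hs => HasDegree.ip_eq_zero hj hs.symm (hv r) (hv s)) fun h => absurd hr h]

theorem re_ip_real_smul (a : ℝ) (w : SpinorIdx d → W) :
    (ip ((a : ℂ) • w) ((a : ℂ) • w)).re = a ^ 2 * (ip w w).re := by
  rw [ip_smul_left, ip_smul_right, Complex.star_def, Complex.conj_ofReal, Complex.re_ofReal_mul,
    Complex.re_ofReal_mul]
  ring

theorem re_ip_add_self (v w : SpinorIdx d → W) :
    (ip (v + w) (v + w)).re = (ip v v).re + (ip w w).re + 2 * (ip v w).re := by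
  rw [ip_add_left, ip_add_right, ip_add_right, Complex.add_re, Complex.add_re, Complex.add_re,
    re_ip_comm v w]
  ring

theorem norm_sq_diracSymbol_sum (hj : IsComplexStructure j) (z : ℕ → ℝ) :
    (ip (diracSymbol fun l => ∑ r ∈ Finset.range (d + 1), (z r : ℂ) • covectorComponent j u r l)
      (diracSymbol fun l => ∑ r ∈ Finset.range (d + 1),
        (z r : ℂ) • covectorComponent j u r l)).re =
      ∑ k ∈ Finset.range (d + 1),
        (z (k - 1) ^ 2 * (ip (symbolFromBelow j u k) (symbolFromBelow j u k)).re +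
        z (k + 1) ^ 2 * (ip (symbolFromAbove j u k) (symbolFromAbove j u k)).re +
        2 * z (k - 1) * z (k + 1) * (ip (symbolFromBelow j u k) (symbolFromAbove j u k)).re) := by
  set D := diracSymbol fun l => ∑ r ∈ Finset.range (d + 1), (z r : ℂ) • covectorComponent j u r l
    with hD
  rw [← sum_act_degreeProj j D, re_ip_sum_of_degree hj _ fun r => hasDegree_degreeProj hj r D]
  refine Finset.sum_congr rfl fun k hk => ?_
  rw [hD, degreeProj_diracSymbol_sum hj (fun r => (z r : ℂ)) (Nat.lt_succ_iff.1 (Finset.mem_range.1 hk)),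
    re_ip_add_self, re_ip_real_smul, re_ip_real_smul, ip_smul_left, ip_smul_right,
    Complex.star_def, Complex.conj_ofReal, Complex.re_ofReal_mul, Complex.re_ofReal_mul]
  ring

theorem norm_sq_sum_covectorComponent (hj : IsComplexStructure j) (z : ℕ → ℝ) (l : VecIdx d) :
    (ip (∑ r ∈ Finset.range (d + 1), (z r : ℂ) • covectorComponent j u r l)
      (∑ r ∈ Finset.range (d + 1), (z r : ℂ) • covectorComponent j u r l)).re =
      ∑ r ∈ Finset.range (d + 1),
        z r ^ 2 * (ip (covectorComponent j u r l) (covectorComponent j u r l)).re := by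
  rw [re_ip_sum_of_degree hj _ fun r => (hasDegree_covectorComponent hj r l).smul (z r : ℂ)]
  exact Finset.sum_congr rfl fun r _ => re_ip_real_smul _ _

/-- The twistor inequality in every degree, summed with the weights `z_r ^ 2`. -/
theorem norm_sq_diracSymbol_sum_sub_le (hj : IsComplexStructure j) (z : ℕ → ℝ) :
    (ip (diracSymbol fun l => ∑ r ∈ Finset.range (d + 1), (z r : ℂ) • covectorComponent j u r l)
      (diracSymbol fun l => ∑ r ∈ Finset.range (d + 1),
        (z r : ℂ) • covectorComponent j u r l)).re -
      ∑ l, (ip (∑ r ∈ Finset.range (d + 1), (z r : ℂ) • covectorComponent j u r l)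
        (∑ r ∈ Finset.range (d + 1), (z r : ℂ) • covectorComponent j u r l)).re ≤
      weitzenboeckBound d
        (fun k => (ip (symbolFromBelow j u k) (symbolFromBelow j u k)).re)
        (fun k => (ip (symbolFromAbove j u k) (symbolFromAbove j u k)).re)
        (fun k => (ip (symbolFromBelow j u k) (symbolFromAbove j u k)).re) z := by
  set p : ℕ → ℝ := fun k => (ip (symbolFromBelow j u k) (symbolFromBelow j u k)).re with hp
  set m : ℕ → ℝ := fun k => (ip (symbolFromAbove j u k) (symbolFromAbove j u k)).re with hm
  have hp0 : p 0 = 0 := by simp only [hp, symbolFromBelow, ip_zero_left, Complex.zero_re]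
  have hmd : m d = 0 := by
    simp only [hm, symbolFromAbove_of_le le_rfl, ip_zero_left, Complex.zero_re]
  have h1 : ∀ r ∈ Finset.range (d + 1), z r ^ 2 * (p (r + 1) / (2 * (r + 1)) +
      (if 1 ≤ r then m (r - 1) / (2 * (d - r + 1)) else 0)) ≤
      ∑ l, z r ^ 2 * (ip (covectorComponent j u r l) (covectorComponent j u r l)).re := by
    intro r hr
    rw [← Finset.mul_sum]
    refine mul_le_mul_of_nonneg_left ?_ (sq_nonneg _)
    have hrd := Nat.lt_succ_iff.1 (Finset.mem_range.1 hr)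
    have h2 := twistor_inequality hj hrd (hasDegree_covectorComponent (u := u) hj r)
    have h3 : p (r + 1) = (ip (diracUp j (covectorComponent j u r))
        (diracUp j (covectorComponent j u r))).re := by
      simp only [hp, symbolFromBelow]
      rw [degreeProj_succ_diracSymbol hj (hasDegree_covectorComponent hj r)]
    have h4 : (if 1 ≤ r then m (r - 1) / (2 * ((d : ℝ) - r + 1)) else 0) =
        (ip (diracDown j (covectorComponent j u r))
          (diracDown j (covectorComponent j u r))).re / (2 * (d - r + 1)) := by
      cases r with
      | zero =>
        rw [if_neg (by omega), diracDown_of_zero hj (hasDegree_covectorComponent hj 0), ip_zero_left,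
          Complex.zero_re, zero_div]
      | succ r =>
        rw [if_pos (by omega)]
        simp only [hm, symbolFromAbove, Nat.add_sub_cancel]
        rw [degreeProj_diracSymbol_succ hj (hasDegree_covectorComponent hj (r + 1))]
    rw [h3, h4]
    exact h2
  have h5 := Finset.sum_le_sum h1
  simp only [norm_sq_sum_covectorComponent hj, norm_sq_diracSymbol_sum hj]
  rw [Finset.sum_comm]
  -- the sums are indexed by the degree of `D ψ_r` instead of `r`; the boundary terms vanish
  have h6 : ∑ r ∈ Finset.range (d + 1), z r ^ 2 * (p (r + 1) / (2 * (r + 1)) +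
      (if 1 ≤ r then m (r - 1) / (2 * ((d : ℝ) - r + 1)) else 0)) =
      ∑ k ∈ Finset.range (d + 1), (z (k - 1) ^ 2 * p k * (1 / (2 * k)) +
        z (k + 1) ^ 2 * m k * (1 / (2 * (d - k)))) := by
    simp only [mul_add, Finset.sum_add_distrib]
    congr 1
    · rw [Finset.sum_range_succ, Finset.sum_range_succ' (n := d)]
      have hpd : p (d + 1) = 0 := by
        simp only [hp, symbolFromBelow, degreeProj_of_lt (Nat.lt_succ_self d), zero_act,
          ip_zero_left, Complex.zero_re]
      rw [hpd, hp0]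
      simp only [zero_div, mul_zero, zero_mul, add_zero, Nat.add_sub_cancel]
      refine Finset.sum_congr rfl fun r _ => ?_
      push_cast
      ring
    · rw [Finset.sum_range_succ', Finset.sum_range_succ (n := d), hmd]
      simp only [mul_zero, zero_mul, add_zero, Nat.add_sub_cancel]
      rw [if_neg (by omega), mul_zero, add_zero]
      refine Finset.sum_congr rfl fun r _ => ?_
      rw [if_pos (by omega)]
      push_cast
      rw [show 2 * ((d : ℝ) - (r + 1)) + 2 * 1 = 2 * (d - r) by ring]
      ring
  rw [h6] at h5
  refine (sub_le_sub_left h5 _).trans (le_of_eq ?_)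
  rw [weitzenboeckBound, ← Finset.sum_sub_distrib]
  refine Finset.sum_congr rfl fun k _ => ?_
  simp only [hp, hm]
  ring

end Pointwise

/-! ### The integrated estimate -/

section Spectral

open Filter Topology

variable {d : ℕ} {W : Type*} [NormedAddCommGroup W] [InnerProductSpace ℂ W]
  {j : VecIdx d → VecIdx d → ℝ} {u : VecIdx d → SpinorIdx d → W}

theorem ip_eq_sum_degreeProj (hj : IsComplexStructure j) (v w : SpinorIdx d → W) :
    ip v w = ∑ r ∈ Finset.range (d + 1), ip (act (degreeProj j r) v) (act (degreeProj j r) w) := by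
  conv_lhs => rw [← sum_act_degreeProj j v, ← sum_act_degreeProj j w]
  rw [ip_sum_left]
  refine Finset.sum_congr rfl fun r hr => ?_
  rw [ip_sum_right, Finset.sum_eq_single r (fun s _ hs => HasDegree.ip_eq_zero hj hs.symm
    (hasDegree_degreeProj hj r v) (hasDegree_degreeProj hj s w)) fun h => absurd hr h]

theorem ip_degreeProj_left (hj : IsComplexStructure j) {r : ℕ} (v : SpinorIdx d → W)
    {w : SpinorIdx d → W} (hw : HasDegree j r w) : ip (act (degreeProj j r) v) w = ip v w := by
  by_cases hr : r ≤ d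
  · rw [ip_eq_sum_degreeProj hj v w, Finset.sum_eq_single r, hw.degreeProj_self hj]
    · intro s _ hs
      rw [hw.degreeProj_of_ne hj (by exact_mod_cast hs), ip_zero_right]
    · exact fun h => absurd (Finset.mem_range.2 (Nat.lt_succ_of_le hr)) h
  · rw [hw.eq_zero_of_lt hj (not_le.1 hr), ip_zero_right, ip_zero_right]

/-- The Dirac symbols of components whose degrees differ by two only meet in the degree between. -/
theorem ip_diracSymbol_diracSymbol (hj : IsComplexStructure j) (k : ℕ) :
    ip (diracSymbol (covectorComponent j u k)) (diracSymbol (covectorComponent j u (k + 2))) =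
      ip (symbolFromBelow j u (k + 1)) (symbolFromAbove j u (k + 1)) := by
  rw [ip_eq_sum_degreeProj hj, Finset.sum_eq_single (k + 1)]
  · rfl
  · intro r _ hr
    by_cases h : r + 1 = k
    · rw [degreeProj_diracSymbol_of_ne hj (hasDegree_covectorComponent hj (k + 2)) (by omega)
        (by omega), ip_zero_right]
    · rw [degreeProj_diracSymbol_of_ne hj (hasDegree_covectorComponent hj k) hr h, ip_zero_left]
  · intro h
    rw [degreeProj_of_lt (by rw [Finset.mem_range] at h; omega), zero_act, ip_zero_left]

end Spectral

section Global

open Filter Topology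

variable {d : ℕ} {E : Type*} [NormedAddCommGroup E] [NormedSpace ℝ E] [FiniteDimensional ℝ E]
  {H : Type*} [TopologicalSpace H] {I : ModelWithCorners ℝ E H} [I.Boundaryless]
  {M : Type*} [TopologicalSpace M] [T2Space M] [ChartedSpace H M] [IsManifold I ∞ M]
  {g : Metric I M} {ι : Type*} {S : SpinStructure d g ι} {cov : TangentConnection I M}
  {J : TangentEndo I M}
  {F : Type*} [NormedAddCommGroup F] [NormedSpace ℂ F] [FiniteDimensional ℂ F]
  {V : M → Type*} [TopologicalSpace (TotalSpace F V)]
  [∀ x, NormedAddCommGroup (V x)] [∀ x, InnerProductSpace ℂ (V x)]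
  [FiberBundle F V] [VectorBundle ℂ F V] [VectorBundle ℝ F V]
  [ContMDiffVectorBundle ∞ F V I]
  {covE : CovariantDerivative I F V} {x : M} {i : ι}
  {ψ η : LocalSpinor d ι V} {Λ : (M → ℝ) → ℝ} {lam : ℝ}

theorem continuous_weitzenboeckBound {p m c : ℕ → M → ℝ} (hp : ∀ k, Continuous (p k))
    (hm : ∀ k, Continuous (m k)) (hc : ∀ k, Continuous (c k)) (z : ℕ → ℝ) :
    Continuous fun x => weitzenboeckBound d (fun k => p k x) (fun k => m k x) (fun k => c k x) z := by
  unfold weitzenboeckBound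
  fun_prop

theorem IsIntegral.weitzenboeckBound (hΛ : IsIntegral cov Λ) {p m c : ℕ → M → ℝ}
    (hp : ∀ k, Continuous (p k)) (hm : ∀ k, Continuous (m k)) (hc : ∀ k, Continuous (c k))
    (z : ℕ → ℝ) :
    Λ (fun x => weitzenboeckBound d (fun k => p k x) (fun k => m k x) (fun k => c k x) z) =
      KaehlerSpin.weitzenboeckBound d (fun k => Λ (p k)) (fun k => Λ (m k)) (fun k => Λ (c k)) z := by
  have h : ∀ k x, z (k - 1) ^ 2 * p k x * (1 - 1 / (2 * k)) +
      z (k + 1) ^ 2 * m k x * (1 - 1 / (2 * (d - k))) + 2 * z (k - 1) * z (k + 1) * c k x =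
      (z (k - 1) ^ 2 * (1 - 1 / (2 * k))) * p k x +
        (z (k + 1) ^ 2 * (1 - 1 / (2 * (d - k)))) * m k x + 2 * z (k - 1) * z (k + 1) * c k x :=
    fun k x => by ring
  unfold KaehlerSpin.weitzenboeckBound
  simp only [h]
  rw [hΛ.sum _ fun k => by fun_prop]
  refine Finset.sum_congr rfl fun k _ => ?_
  rw [hΛ.add _ _ (by fun_prop) (by fun_prop), hΛ.add _ _ (by fun_prop) (by fun_prop),
    hΛ.smul _ _ (hp k), hΛ.smul _ _ (hm k), hΛ.smul _ _ (hc k)]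
  ring

namespace SpinStructure

variable (S cov covE) in
/-- The covariant derivative of `ψ` at `x`, in the frame over `U i`. -/
def gradient (ψ : LocalSpinor d ι V) (i : ι) (x : M) (k : VecIdx d) : SpinorIdx d → V x :=
  S.nabla cov covE i (ψ i) x (S.frame i k x)

variable (S cov covE J) in
/-- The component of degree `k` of `D ψ_{k-1}`, which vanishes for `k = 0`. -/
def diracFromBelow (ψ : LocalSpinor d ι V) : ℕ → LocalSpinor d ι V
  | 0 => fun _ _ => 0
  | k + 1 => S.component J (k + 1) (S.dirac cov covE (S.component J k ψ))

variable (S cov covE J) in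
/-- The component of degree `k` of `D ψ_{k+1}`. -/
def diracFromAbove (ψ : LocalSpinor d ι V) (k : ℕ) : LocalSpinor d ι V :=
  S.component J k (S.dirac cov covE (S.component J (k + 1) ψ))

theorem dirac_eq_diracSymbol (ψ : LocalSpinor d ι V) (i : ι) (x : M) :
    S.dirac cov covE ψ i x = diracSymbol (S.gradient cov covE ψ i x) := rfl

theorem isSmoothSpinor_zero : S.IsSmoothSpinor F (fun _ _ => 0 : LocalSpinor d ι V) :=
  isSmoothSpinor_of (fun _ _ _ _ => SmoothNear.zero) fun _ _ _ _ _ => (act_zero _).symm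

theorem gradSq_eq_gradient (ψ : LocalSpinor d ι V) (x : M) : S.gradSq cov covE ψ x =
    ∑ k, (ip (S.gradient cov covE ψ (S.index x) x k)
      (S.gradient cov covE ψ (S.index x) x k)).re := rfl

theorem gradient_component (hdim : Module.finrank ℝ E = 2 * d) (hcov : IsLeviCivita g cov)
    (hcovE : IsMetricConnection covE) (hJ : IsKaehlerStructure g cov J)
    (hψ : S.IsSmoothSpinor F ψ) (hx : x ∈ S.U i) (r : ℕ) :
    S.gradient cov covE (S.component J r ψ) i x =
      covectorComponent (S.kaehlerCoeff J i x) (S.gradient cov covE ψ i x) r :=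
  funext fun k => nabla_component hdim hcov hcovE hJ hψ hx r (S.frame i k x)

theorem diracFromBelow_eq (hdim : Module.finrank ℝ E = 2 * d) (hcov : IsLeviCivita g cov)
    (hcovE : IsMetricConnection covE) (hJ : IsKaehlerStructure g cov J)
    (hψ : S.IsSmoothSpinor F ψ) (hx : x ∈ S.U i) (k : ℕ) :
    S.diracFromBelow cov J covE ψ k i x =
      symbolFromBelow (S.kaehlerCoeff J i x) (S.gradient cov covE ψ i x) k := by
  cases k with
  | zero => rfl
  | succ k =>
    rw [symbolFromBelow, ← gradient_component hdim hcov hcovE hJ hψ hx]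
    rfl

theorem diracFromAbove_eq (hdim : Module.finrank ℝ E = 2 * d) (hcov : IsLeviCivita g cov)
    (hcovE : IsMetricConnection covE) (hJ : IsKaehlerStructure g cov J)
    (hψ : S.IsSmoothSpinor F ψ) (hx : x ∈ S.U i) (k : ℕ) :
    S.diracFromAbove cov J covE ψ k i x =
      symbolFromAbove (S.kaehlerCoeff J i x) (S.gradient cov covE ψ i x) k := by
  rw [symbolFromAbove, ← gradient_component hdim hcov hcovE hJ hψ hx]
  rfl

theorem IsSmoothSpinor.diracFromBelow (hdim : Module.finrank ℝ E = 2 * d)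
    (hcov : IsLeviCivita g cov) (hcovE : IsMetricConnection covE)
    (hJ : IsKaehlerStructure g cov J) (hψ : S.IsSmoothSpinor F ψ) (k : ℕ) :
    S.IsSmoothSpinor F (S.diracFromBelow cov J covE ψ k) := by
  cases k with
  | zero => exact isSmoothSpinor_zero
  | succ k => exact ((hψ.component hdim hcov hJ k).dirac hdim hcov hcovE).component hdim hcov hJ _

theorem IsSmoothSpinor.diracFromAbove (hdim : Module.finrank ℝ E = 2 * d)
    (hcov : IsLeviCivita g cov) (hcovE : IsMetricConnection covE)
    (hJ : IsKaehlerStructure g cov J) (hψ : S.IsSmoothSpinor F ψ) (k : ℕ) :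
    S.IsSmoothSpinor F (S.diracFromAbove cov J covE ψ k) :=
  ((hψ.component hdim hcov hJ _).dirac hdim hcov hcovE).component hdim hcov hJ _

theorem hasDegree_component (hdim : Module.finrank ℝ E = 2 * d) (hJ : IsKaehlerStructure g cov J)
    (hx : x ∈ S.U i) (r : ℕ) (ψ : LocalSpinor d ι V) :
    HasDegree (S.kaehlerCoeff J i x) r (S.component J r ψ i x) :=
  hasDegree_degreeProj (S.isComplexStructure hdim hJ hx) r _

theorem diracFromBelow_add_diracFromAbove (hdim : Module.finrank ℝ E = 2 * d)
    (hcov : IsLeviCivita g cov) (hcovE : IsMetricConnection covE)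
    (hJ : IsKaehlerStructure g cov J) (hψ : S.IsEigenspinor cov covE lam ψ) (hx : x ∈ S.U i)
    (k : ℕ) :
    S.diracFromBelow cov J covE ψ k i x + S.diracFromAbove cov J covE ψ k i x =
      (lam : ℂ) • S.component J k ψ i x := by
  rw [diracFromBelow_eq hdim hcov hcovE hJ hψ.isSmoothSpinor hx,
    diracFromAbove_eq hdim hcov hcovE hJ hψ.isSmoothSpinor hx,
    ← degreeProj_diracSymbol (S.isComplexStructure hdim hJ hx), ← dirac_eq_diracSymbol,
    hψ.eigen i x hx, act_smul]
  rfl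

theorem gradient_sum (hdim : Module.finrank ℝ E = 2 * d) (hcov : IsLeviCivita g cov)
    (hcovE : IsMetricConnection covE) (hJ : IsKaehlerStructure g cov J)
    (hψ : S.IsSmoothSpinor F ψ) (hx : x ∈ S.U i) (t : Finset ℕ) (z : ℕ → ℂ) :
    S.gradient cov covE (fun i x => ∑ r ∈ t, z r • S.component J r ψ i x) i x =
      fun l => ∑ r ∈ t, z r • covectorComponent (S.kaehlerCoeff J i x)
        (S.gradient cov covE ψ i x) r l := by
  funext l
  have hs : ∀ r, SmoothSpinorNear I F (S.component J r ψ i) x := fun r =>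
    (hψ.component hdim hcov hJ r).smoothSpinorNear hx
  have h1 := S.nabla_sum (cov := cov) (i := i) (x := x) hcovE t
    (φ := fun r y => z r • S.component J r ψ i y)
    (fun r _ => SmoothSpinorNear.smul (SmoothFunNear.const (z r)) (hs r)) (S.frame i l x)
  refine Eq.trans h1 (Finset.sum_congr rfl fun r _ => ?_)
  rw [S.nabla_const_smul hcovE (z r) (hs r), ← gradient_component hdim hcov hcovE hJ hψ hx]
  rfl

theorem pairing_sum_component (hdim : Module.finrank ℝ E = 2 * d) (hJ : IsKaehlerStructure g cov J)
    (ψ : LocalSpinor d ι V) (t : Finset ℕ) (z : ℕ → ℝ) (x : M) :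
    S.pairing (fun i x => ∑ r ∈ t, (z r : ℂ) • S.component J r ψ i x)
      (fun i x => ∑ r ∈ t, (z r : ℂ) • S.component J r ψ i x) x =
      ∑ r ∈ t, z r ^ 2 * S.pairing (S.component J r ψ) (S.component J r ψ) x := by
  have hx := S.mem_index x
  unfold pairing
  rw [re_ip_sum_of_degree (S.isComplexStructure hdim hJ hx) t fun r =>
    (hasDegree_component hdim hJ hx r ψ).smul (z r : ℂ)]
  exact Finset.sum_congr rfl fun r _ => re_ip_real_smul _ _

/-- The estimate that results from the Weitzenböck formula for `∑ z_k ψ_k` and the twistor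
inequality. -/
theorem integral_estimate (hΛ : IsIntegral cov Λ) (hdim : Module.finrank ℝ E = 2 * d)
    (hV : IsSmoothHermitian I F V) (hcov : IsLeviCivita g cov) (hcovE : IsMetricConnection covE)
    (hJ : IsKaehlerStructure g cov J) (hψ : S.IsSmoothSpinor F ψ) {scal₀ κ₁ : ℝ}
    (hscal : IsGLB (scalarCurvatureValues d g cov) scal₀)
    (hκ : IsGLB (S.curvatureEigenvalues covE) κ₁) (z : ℕ → ℝ) :
    (scal₀ + κ₁) / 4 * ∑ k ∈ Finset.range (d + 1),
      z k ^ 2 * Λ (S.pairing (S.component J k ψ) (S.component J k ψ)) ≤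
    weitzenboeckBound d
      (fun k => Λ (S.pairing (S.diracFromBelow cov J covE ψ k) (S.diracFromBelow cov J covE ψ k)))
      (fun k => Λ (S.pairing (S.diracFromAbove cov J covE ψ k) (S.diracFromAbove cov J covE ψ k)))
      (fun k => Λ (S.pairing (S.diracFromBelow cov J covE ψ k) (S.diracFromAbove cov J covE ψ k)))
      z := by
  let χ : LocalSpinor d ι V := fun i x =>
    ∑ r ∈ Finset.range (d + 1), (z r : ℂ) • S.component J r ψ i x
  have hχ : S.IsSmoothSpinor F χ :=
    IsSmoothSpinor.sum (fun r => hψ.component hdim hcov hJ r) fun r => (z r : ℂ)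
  have hA := hψ.diracFromBelow hdim hcov hcovE hJ
  have hB := hψ.diracFromAbove hdim hcov hcovE hJ
  have hD := hχ.dirac hdim hcov hcovE
  have hcB : ∀ x, S.pairing (S.dirac cov covE χ) (S.dirac cov covE χ) x -
      S.gradSq cov covE χ x ≤ weitzenboeckBound d
      (fun k => S.pairing (S.diracFromBelow cov J covE ψ k) (S.diracFromBelow cov J covE ψ k) x)
      (fun k => S.pairing (S.diracFromAbove cov J covE ψ k) (S.diracFromAbove cov J covE ψ k) x)
      (fun k => S.pairing (S.diracFromBelow cov J covE ψ k) (S.diracFromAbove cov J covE ψ k) x)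
      z := fun x => by
    have hx := S.mem_index x
    have h := norm_sq_diracSymbol_sum_sub_le (u := S.gradient cov covE ψ (S.index x) x)
      (S.isComplexStructure hdim hJ hx) z
    unfold pairing
    simp only [diracFromBelow_eq hdim hcov hcovE hJ hψ hx,
      diracFromAbove_eq hdim hcov hcovE hJ hψ hx]
    rw [gradSq_eq_gradient, dirac_eq_diracSymbol, gradient_sum hdim hcov hcovE hJ hψ hx]
    exact h
  have hp : ∀ k, Continuous (S.pairing (S.diracFromBelow cov J covE ψ k)
      (S.diracFromBelow cov J covE ψ k)) := fun k => continuous_pairing hV (hA k) (hA k)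
  have hm : ∀ k, Continuous (S.pairing (S.diracFromAbove cov J covE ψ k)
      (S.diracFromAbove cov J covE ψ k)) := fun k => continuous_pairing hV (hB k) (hB k)
  have hc : ∀ k, Continuous (S.pairing (S.diracFromBelow cov J covE ψ k)
      (S.diracFromAbove cov J covE ψ k)) := fun k => continuous_pairing hV (hA k) (hB k)
  have hn : ∀ k, Continuous (S.pairing (S.component J k ψ) (S.component J k ψ)) := fun k =>
    continuous_pairing hV (hψ.component hdim hcov hJ k) (hψ.component hdim hcov hJ k)
  have h1 := integral_weitzenboeck hΛ hdim hV hcov hcovE hχ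
  have h2 := hΛ.mono (f := fun x => S.pairing (S.dirac cov covE χ) (S.dirac cov covE χ) x -
    S.gradSq cov covE χ x) ((continuous_pairing hV hD hD).sub
    (continuous_gradSq hdim hV hcov hcovE hχ)) (continuous_weitzenboeckBound hp hm hc z) hcB
  rw [hΛ.weitzenboeckBound hp hm hc,
    hΛ.sub (continuous_pairing hV hD hD) (continuous_gradSq hdim hV hcov hcovE hχ)] at h2
  have h3 := hΛ.mono (f := fun x => (scal₀ + κ₁) / 4 * S.pairing χ χ x) (continuous_const.mul (continuous_pairing hV hχ hχ))
    (continuous_curvatureForm hdim hV hcov hcovE hχ) (le_curvatureForm hV hcovE hscal hκ χ)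
  rw [hΛ.smul _ _ (continuous_pairing hV hχ hχ),
    funext (pairing_sum_component hdim hJ ψ (Finset.range (d + 1)) z),
    hΛ.sum (f := fun k x => z k ^ 2 * S.pairing (S.component J k ψ) (S.component J k ψ) x) _
      fun k => continuous_const.mul (hn k)] at h3
  simp only [hΛ.smul _ _ (hn _)] at h3
  linarith

end SpinStructure

end Global

/-! ### Eigenspinors of the twisted Dirac operator -/

section Eigenspinor

open Filter Topology

variable {d : ℕ} {E : Type*} [NormedAddCommGroup E] [NormedSpace ℝ E] [FiniteDimensional ℝ E]
  {H : Type*} [TopologicalSpace H] {I : ModelWithCorners ℝ E H} [I.Boundaryless]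
  {M : Type*} [TopologicalSpace M] [T2Space M] [ChartedSpace H M] [IsManifold I ∞ M]
  {g : Metric I M} {ι : Type*} {S : SpinStructure d g ι} {cov : TangentConnection I M}
  {J : TangentEndo I M}
  {F : Type*} [NormedAddCommGroup F] [NormedSpace ℂ F] [FiniteDimensional ℂ F]
  {V : M → Type*} [TopologicalSpace (TotalSpace F V)]
  [∀ x, NormedAddCommGroup (V x)] [∀ x, InnerProductSpace ℂ (V x)]
  [FiberBundle F V] [VectorBundle ℂ F V] [VectorBundle ℝ F V]
  [ContMDiffVectorBundle ∞ F V I]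
  {covE : CovariantDerivative I F V} {x : M} {i : ι}
  {ψ η : LocalSpinor d ι V} {Λ : (M → ℝ) → ℝ} {lam : ℝ}

theorem IsIntegral.add_add_two_mul (hΛ : IsIntegral cov Λ) {f h k : M → ℝ} (hf : Continuous f)
    (hh : Continuous h) (hk : Continuous k) :
    Λ (fun x => f x + h x + 2 * k x) = Λ f + Λ h + 2 * Λ k := by
  rw [hΛ.add _ _ (by fun_prop) (by fun_prop), hΛ.add _ _ hf hh, hΛ.smul _ _ hk]

namespace SpinStructure

/-- The masses of the components of an eigenspinor and of their images under the Dirac operator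
satisfy the relations that come from the eigenvalue equation and the symmetry of the operator. -/
theorem spectralData (hΛ : IsIntegral cov Λ) (hdim : Module.finrank ℝ E = 2 * d)
    (hV : IsSmoothHermitian I F V) (hcov : IsLeviCivita g cov) (hcovE : IsMetricConnection covE)
    (hJ : IsKaehlerStructure g cov J) (hψ : S.IsEigenspinor cov covE lam ψ) :
    SpectralData d (lam ^ 2)
      (fun k => Λ (S.pairing (S.diracFromBelow cov J covE ψ k) (S.diracFromBelow cov J covE ψ k)))
      (fun k => Λ (S.pairing (S.diracFromAbove cov J covE ψ k) (S.diracFromAbove cov J covE ψ k)))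
      (fun k => Λ (S.pairing (S.diracFromBelow cov J covE ψ k) (S.diracFromAbove cov J covE ψ k)))
      (fun k => Λ (S.pairing (S.component J k ψ) (S.component J k ψ))) := by
  have hs := hψ.isSmoothSpinor
  have hA := hs.diracFromBelow hdim hcov hcovE hJ
  have hB := hs.diracFromAbove hdim hcov hcovE hJ
  have hC := hs.component hdim hcov hJ
  have hDC := fun k => (hC k).dirac hdim hcov hcovE
  have hp := fun k => continuous_pairing hV (hA k) (hA k)
  have hm := fun k => continuous_pairing hV (hB k) (hB k)
  have hc := fun k => continuous_pairing hV (hA k) (hB k)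
  have hn := fun k => continuous_pairing hV (hC k) (hC k)
  have hj := fun x => S.isComplexStructure hdim hJ (S.mem_index x)
  have hadd := fun x k => diracFromBelow_add_diracFromAbove hdim hcov hcovE hJ hψ (S.mem_index x) k
  have hnonneg : ∀ (η : LocalSpinor d ι V) x, 0 ≤ S.pairing η η x := fun η x => re_ip_self_nonneg _
  have hA0 : ∀ η : LocalSpinor d ι V, S.pairing (S.diracFromBelow cov J covE ψ 0) η =
      fun _ => 0 := fun η => by
    funext x
    exact congrArg Complex.re (ip_zero_left _)
  have hBd : ∀ η : LocalSpinor d ι V, S.pairing η (S.diracFromAbove cov J covE ψ d) =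
      fun _ => 0 := fun η => by
    funext x
    unfold pairing
    rw [diracFromAbove_eq hdim hcov hcovE hJ hs (S.mem_index x), symbolFromAbove_of_le le_rfl,
      ip_zero_right, Complex.zero_re]
  -- the two sides of the balance equation are the two sides of the symmetry of `D`
  have hbelow : ∀ k, Λ (S.pairing (S.diracFromBelow cov J covE ψ (k + 1))
        (S.diracFromBelow cov J covE ψ (k + 1))) +
      Λ (S.pairing (S.diracFromBelow cov J covE ψ (k + 1))
        (S.diracFromAbove cov J covE ψ (k + 1))) =
      lam * Λ (S.pairing (S.dirac cov covE (S.component J k ψ)) (S.component J (k + 1) ψ)) := by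
    intro k
    rw [← hΛ.add _ _ (hp _) (hc _), ← hΛ.smul _ _ (continuous_pairing hV (hDC k) (hC (k + 1)))]
    congr 1
    funext x
    have h1 : ip (S.diracFromBelow cov J covE ψ (k + 1) (S.index x) x)
        (S.component J (k + 1) ψ (S.index x) x) =
        ip (S.dirac cov covE (S.component J k ψ) (S.index x) x)
          (S.component J (k + 1) ψ (S.index x) x) :=
      ip_degreeProj_left (hj x) _ (hasDegree_component hdim hJ (S.mem_index x) (k + 1) ψ)
    unfold pairing
    rw [← Complex.add_re, ← ip_add_right, hadd, ip_smul_right, Complex.re_ofReal_mul, h1]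
  have habove : ∀ k, Λ (S.pairing (S.diracFromAbove cov J covE ψ k)
        (S.diracFromAbove cov J covE ψ k)) +
      Λ (S.pairing (S.diracFromBelow cov J covE ψ k) (S.diracFromAbove cov J covE ψ k)) =
      lam * Λ (S.pairing (S.component J k ψ) (S.dirac cov covE (S.component J (k + 1) ψ))) := by
    intro k
    rw [← hΛ.add _ _ (hm _) (hc _), ← hΛ.smul _ _ (continuous_pairing hV (hC k) (hDC (k + 1)))]
    congr 1
    funext x
    have h1 : (ip (S.component J k ψ (S.index x) x)
        (S.diracFromAbove cov J covE ψ k (S.index x) x)).re =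
        (ip (S.component J k ψ (S.index x) x)
          (S.dirac cov covE (S.component J (k + 1) ψ) (S.index x) x)).re := by
      rw [re_ip_comm, re_ip_comm (S.component J k ψ (S.index x) x)]
      exact congrArg Complex.re
        (ip_degreeProj_left (hj x) _ (hasDegree_component hdim hJ (S.mem_index x) k ψ))
    unfold pairing
    rw [← h1, ← Complex.re_ofReal_mul, ← Complex.add_re, ← ip_add_left, add_comm
      (S.diracFromAbove cov J covE ψ k (S.index x) x), hadd, ip_smul_left, Complex.star_def,
      Complex.conj_ofReal]
  exact
    { p_nonneg := fun k => hΛ.nonneg (hp k) (hnonneg _)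
      m_nonneg := fun k => hΛ.nonneg (hm k) (hnonneg _)
      n_nonneg := fun k => hΛ.nonneg (hn k) (hnonneg _)
      p_zero := by rw [hA0, hΛ.zero]
      c_zero := by rw [hA0, hΛ.zero]
      m_top := by rw [hBd, hΛ.zero]
      c_top := by rw [hBd, hΛ.zero]
      balance := fun k => by
        rw [hbelow, habove, integral_dirac_symm hΛ hdim hV hcov hcovE (hC k) (hC (k + 1))]
      norm_eq := fun k => by
        rw [← hΛ.smul _ _ (hn k), ← hΛ.add_add_two_mul (hp k) (hm k) (hc k)]
        congr 1
        funext x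
        unfold pairing
        rw [← re_ip_add_self, hadd, re_ip_real_smul]
      n_pos := by
        rw [← hΛ.sum _ hn]
        have h1 : (fun x => ∑ k ∈ Finset.range (d + 1),
            S.pairing (S.component J k ψ) (S.component J k ψ) x) = S.pairing ψ ψ := by
          funext x
          have h2 := re_ip_sum_of_degree (hj x) (Finset.range (d + 1))
            fun r => hasDegree_component hdim hJ (S.mem_index x) r ψ
          have h3 : ∑ r ∈ Finset.range (d + 1), S.component J r ψ (S.index x) x =
              ψ (S.index x) x := sum_act_degreeProj _ _
          rw [h3] at h2
          exact h2.symm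
        rw [h1]
        obtain ⟨i, x, hx, h0⟩ := hψ.ne_zero
        refine hΛ.pos _ (continuous_pairing hV hs hs) (hnonneg ψ) ⟨x, ?_⟩
        rw [pairing_eq hs hs hx]
        exact (re_ip_self_pos h0).ne' }

/-- For a curvature of type `(1, 1)`, the Weitzenböck formula for `ψ_k + ψ_{k+2}` shows that
`D ψ_k` and `D ψ_{k+2}` are orthogonal. -/
theorem integral_mixed_eq_zero (hΛ : IsIntegral cov Λ) (hdim : Module.finrank ℝ E = 2 * d)
    (hV : IsSmoothHermitian I F V) (hcov : IsLeviCivita g cov) (hcovE : IsMetricConnection covE)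
    (hJ : IsKaehlerStructure g cov J) (hψ : S.IsSmoothSpinor F ψ)
    (hone : IsCurvatureOneOne J covE) (k : ℕ) :
    Λ (S.pairing (S.diracFromBelow cov J covE ψ k) (S.diracFromAbove cov J covE ψ k)) = 0 := by
  cases k with
  | zero =>
    have h : S.pairing (S.diracFromBelow cov J covE ψ 0) (S.diracFromAbove cov J covE ψ 0) =
        fun _ => 0 := by
      funext x
      exact congrArg Complex.re (ip_zero_left _)
    rw [h, hΛ.zero]
  | succ k =>
    let z : ℕ → ℂ := fun _ => 1
    have hkk : k ≠ k + 2 := by omega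
    let χ : LocalSpinor d ι V := fun i x => ∑ r ∈ {k, k + 2}, z r • S.component J r ψ i x
    have hC := hψ.component hdim hcov hJ
    have hDC := fun k => (hC k).dirac hdim hcov hcovE
    have hχ : S.IsSmoothSpinor F χ := IsSmoothSpinor.sum hC z
    have hχ0 : ∀ i x, χ i x = S.component J k ψ i x + S.component J (k + 2) ψ i x := fun i x => by
      simp only [χ, z, Finset.sum_pair hkk, one_smul]
    have hgrad : ∀ x, S.gradient cov covE χ (S.index x) x = fun l =>
        S.gradient cov covE (S.component J k ψ) (S.index x) x l +
          S.gradient cov covE (S.component J (k + 2) ψ) (S.index x) x l := fun x => by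
      have hx := S.mem_index x
      rw [gradient_sum hdim hcov hcovE hJ hψ hx, gradient_component hdim hcov hcovE hJ hψ hx,
        gradient_component hdim hcov hcovE hJ hψ hx]
      funext l
      simp only [z, Finset.sum_pair hkk, one_smul]
    have horth : ∀ x {v w : SpinorIdx d → V x}, HasDegree (S.kaehlerCoeff J (S.index x) x) k v →
        HasDegree (S.kaehlerCoeff J (S.index x) x) (k + 2 : ℕ) w → (ip v w).re = 0 :=
      fun x v w hv hw => by
        rw [HasDegree.ip_eq_zero (S.isComplexStructure hdim hJ (S.mem_index x)) hkk hv hw,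
          Complex.zero_re]
    -- all terms of the Weitzenböck formula for `χ = ψ_k + ψ_{k+2}` split orthogonally, except for the
    -- square of the Dirac operator, whose mixed term is the pairing in question
    have h1 : ∀ x, S.gradSq cov covE χ x = S.gradSq cov covE (S.component J k ψ) x +
        S.gradSq cov covE (S.component J (k + 2) ψ) x := fun x => by
      have hx := S.mem_index x
      simp only [gradSq_eq_gradient, hgrad]
      rw [← Finset.sum_add_distrib]
      refine Finset.sum_congr rfl fun l _ => ?_
      rw [re_ip_add_self, add_eq_left, mul_eq_zero]
      refine Or.inr (horth x ?_ ?_)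
      · rw [gradient_component hdim hcov hcovE hJ hψ hx]
        exact hasDegree_covectorComponent (S.isComplexStructure hdim hJ hx) k l
      · rw [gradient_component hdim hcov hcovE hJ hψ hx]
        exact hasDegree_covectorComponent (S.isComplexStructure hdim hJ hx) (k + 2) l
    have h2 : ∀ x, S.curvatureForm cov covE χ x = S.curvatureForm cov covE (S.component J k ψ) x +
        S.curvatureForm cov covE (S.component J (k + 2) ψ) x := fun x => by
      have hx := S.mem_index x
      have d1 := hasDegree_component hdim hJ hx k ψ
      have d2 := hasDegree_component hdim hJ hx (k + 2) ψ
      have e1 := hasDegree_curvatureEndo hdim hJ hcovE hone hx d1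
      have e2 := hasDegree_curvatureEndo hdim hJ hcovE hone hx d2
      have e3 : S.curvatureEndo covE (S.index x) x (χ (S.index x) x) =
          S.curvatureEndo covE (S.index x) x (S.component J k ψ (S.index x) x) +
            S.curvatureEndo covE (S.index x) x (S.component J (k + 2) ψ (S.index x) x) := by
        rw [hχ0]
        exact map_add (cliffordCurvature (S.frameCurvature hcovE (S.index x) x)) _ _
      have e4 : (ip (S.component J (k + 2) ψ (S.index x) x)
          (S.curvatureEndo covE (S.index x) x (S.component J k ψ (S.index x) x))).re = 0 := by
        rw [re_ip_comm]
        exact horth x e1 d2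
      unfold curvatureForm pairing
      rw [e3, hχ0, re_ip_add_self, ip_add_left, ip_add_right, ip_add_right, Complex.add_re,
        Complex.add_re, Complex.add_re, horth x d1 d2, horth x d1 e2, e4]
      ring
    have h3 : ∀ x, S.pairing (S.dirac cov covE χ) (S.dirac cov covE χ) x =
        S.pairing (S.dirac cov covE (S.component J k ψ)) (S.dirac cov covE (S.component J k ψ)) x +
        S.pairing (S.dirac cov covE (S.component J (k + 2) ψ))
          (S.dirac cov covE (S.component J (k + 2) ψ)) x +
        2 * S.pairing (S.diracFromBelow cov J covE ψ (k + 1))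
          (S.diracFromAbove cov J covE ψ (k + 1)) x := fun x => by
      have hx := S.mem_index x
      have e1 : S.dirac cov covE χ (S.index x) x =
          S.dirac cov covE (S.component J k ψ) (S.index x) x +
            S.dirac cov covE (S.component J (k + 2) ψ) (S.index x) x := by
        simp only [dirac_eq_diracSymbol, hgrad, diracSymbol, act_add, Finset.sum_add_distrib]
      unfold pairing
      rw [e1, re_ip_add_self, diracFromBelow_eq hdim hcov hcovE hJ hψ hx,
        diracFromAbove_eq hdim hcov hcovE hJ hψ hx, ← ip_diracSymbol_diracSymbol
          (S.isComplexStructure hdim hJ hx), ← gradient_component hdim hcov hcovE hJ hψ hx,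
        ← gradient_component hdim hcov hcovE hJ hψ hx]
      rfl
    have w0 := integral_weitzenboeck hΛ hdim hV hcov hcovE hχ
    have w1 := integral_weitzenboeck hΛ hdim hV hcov hcovE (hC k)
    have w2 := integral_weitzenboeck hΛ hdim hV hcov hcovE (hC (k + 2))
    have hp := fun k => continuous_pairing hV (hDC k) (hDC k)
    have hc := continuous_pairing hV (hψ.diracFromBelow hdim hcov hcovE hJ (k + 1))
      (hψ.diracFromAbove hdim hcov hcovE hJ (k + 1))
    have hgr := fun k => continuous_gradSq hdim hV hcov hcovE (hC k)
    have hcf := fun k => continuous_curvatureForm hdim hV hcov hcovE (hC k)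
    rw [funext h1, funext h2, funext h3, hΛ.add _ _ (hgr k) (hgr (k + 2)),
      hΛ.add _ _ (hcf k) (hcf (k + 2)),
      hΛ.add_add_two_mul (hp k) (hp (k + 2)) hc] at w0
    linarith

/-- For an eigenspinor of type `(r, r + 1)`, of two components whose degrees differ by two one
vanishes. -/
theorem mixed_eq_zero_of_isOfType (hdim : Module.finrank ℝ E = 2 * d) (hcov : IsLeviCivita g cov)
    (hcovE : IsMetricConnection covE) (hJ : IsKaehlerStructure g cov J)
    (hψ : S.IsSmoothSpinor F ψ) {r : ℕ} (htype : S.IsOfType J r ψ) (k : ℕ) :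
    S.pairing (S.diracFromBelow cov J covE ψ k) (S.diracFromAbove cov J covE ψ k) =
      fun _ => 0 := by
  obtain ⟨φ₀, φ₁, h0, h1, hsum⟩ := htype
  have hzero : ∀ s, s ≠ r → s ≠ r + 1 → ∀ i, ∀ x ∈ S.U i, S.component J s ψ i x = 0 := by
    intro s hs0 hs1 i x hx
    have hj := S.isComplexStructure hdim hJ hx
    have d0 : HasDegree (S.kaehlerCoeff J i x) r (φ₀ i x) := h0 i x hx
    have d1 : HasDegree (S.kaehlerCoeff J i x) (r + 1 : ℕ) (φ₁ i x) := h1 i x hx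
    rw [component, hsum i x hx, act_add, d0.degreeProj_of_ne hj (by exact_mod_cast hs0),
      d1.degreeProj_of_ne hj (by exact_mod_cast hs1), add_zero]
  have hgrad : ∀ s, s ≠ r → s ≠ r + 1 → ∀ i, ∀ x ∈ S.U i,
      covectorComponent (S.kaehlerCoeff J i x) (S.gradient cov covE ψ i x) s = 0 := by
    intro s hs0 hs1 i x hx
    rw [← gradient_component hdim hcov hcovE hJ hψ hx]
    funext l
    have h2 : ∀ᶠ y in 𝓝 x, S.component J s ψ i y = (0 : SpinorIdx d → V y) := by
      filter_upwards [S.eventually_mem hx] with y hy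
      exact hzero s hs0 hs1 i y hy
    exact (S.nabla_congr ((hψ.component hdim hcov hJ s).smoothSpinorNear hx) h2 _).trans
      (S.nabla_zero hcovE _)
  funext x
  have hx := S.mem_index x
  unfold pairing
  rw [diracFromBelow_eq hdim hcov hcovE hJ hψ hx, diracFromAbove_eq hdim hcov hcovE hJ hψ hx]
  cases k with
  | zero => exact congrArg Complex.re (ip_zero_left _)
  | succ k =>
    by_cases hk : k = r ∨ k = r + 1
    · rw [symbolFromAbove, hgrad (k + 1 + 1) (by omega) (by omega) _ x hx, diracSymbol_zero,
        act_zero, ip_zero_right, Complex.zero_re]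
    · rw [symbolFromBelow, hgrad k (by omega) (by omega) _ x hx, diracSymbol_zero,
        act_zero, ip_zero_left, Complex.zero_re]

end SpinStructure

end Eigenspinor

end KaehlerSpin

end

theorem corollary3p2 (d : ℕ)
    {M : Type*} [TopologicalSpace M] [T2Space M] [CompactSpace M]
    [ChartedSpace (EuclideanSpace ℝ (Fin (2 * d))) M] [IsManifold (𝓡 (2 * d)) ∞ M]
    -- the Kähler structure `(g, J)`, with Levi-Civita connection `cov`
    (g : KaehlerSpin.Metric (𝓡 (2 * d)) M)
    (cov : KaehlerSpin.TangentConnection (𝓡 (2 * d)) M)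
    (hcov : KaehlerSpin.IsLeviCivita g cov)
    (J : KaehlerSpin.TangentEndo (𝓡 (2 * d)) M)
    (hJ : KaehlerSpin.IsKaehlerStructure g cov J)
    -- the spin structure
    {ι : Type*} (S : KaehlerSpin.SpinStructure d g ι)
    -- the Hermitian vector bundle `V` with fibre `F`, and its metric connection `covE`
    {F : Type*} [NormedAddCommGroup F] [NormedSpace ℂ F] [FiniteDimensional ℂ F]
    {V : M → Type*} [TopologicalSpace (TotalSpace F V)]
    [∀ x, NormedAddCommGroup (V x)] [∀ x, InnerProductSpace ℂ (V x)]
    [FiberBundle F V] [VectorBundle ℂ F V] [VectorBundle ℝ F V]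
    [ContMDiffVectorBundle ∞ F V (𝓡 (2 * d))]
    (hV : KaehlerSpin.IsSmoothHermitian (𝓡 (2 * d)) F V)
    (covE : CovariantDerivative (𝓡 (2 * d)) F V)
    (hcovE : KaehlerSpin.IsMetricConnection covE)
    -- the infimum of the scalar curvature and the smallest eigenvalue of the curvature endomorphism
    (scal₀ κ₁ : ℝ)
    (hscal : IsGLB (KaehlerSpin.scalarCurvatureValues d g cov) scal₀)
    (hκ : IsGLB (S.curvatureEigenvalues covE) κ₁)
    -- an eigenvalue of the twisted Dirac operator
    (lam : ℝ) (hlam : ∃ ψ, S.IsEigenspinor cov covE lam ψ) :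
    (Odd d → lam ^ 2 ≥ (d + 1) / (4 * d) * (scal₀ + κ₁)) ∧
    (Even d →
      (d ≤ 2 ∨ KaehlerSpin.IsCurvatureOneOne J covE ∨
        ∃ r ψ, S.IsEigenspinor cov covE lam ψ ∧ S.IsOfType J r ψ) →
      lam ^ 2 ≥ d / (4 * (d - 1)) * (scal₀ + κ₁)) := by
  have hdim : Module.finrank ℝ (EuclideanSpace ℝ (Fin (2 * d))) = 2 * d := by simp
  obtain ⟨Λ, hΛ⟩ := KaehlerSpin.exists_isIntegral MeasureTheory.volume hcov
    fun Z hZ => S.continuous_divergence hdim hcov hZ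
  constructor
  · intro hd
    obtain ⟨ψ, hψ⟩ := hlam
    exact (KaehlerSpin.SpinStructure.spectralData hΛ hdim hV hcov hcovE hJ hψ).bound_odd hd.pos
      (KaehlerSpin.SpinStructure.integral_estimate hΛ hdim hV hcov hcovE hJ hψ.isSmoothSpinor
        hscal hκ)
  · intro hd hcase
    -- in complex dimension `0` the constant is `0`
    rcases Nat.eq_zero_or_pos d with h0 | hpos
    · subst h0
      simpa using sq_nonneg lam
    have h2 : 2 ≤ d := by
      obtain ⟨k, hk⟩ := hd
      omega
    -- an eigenspinor for which the mixed terms vanish gives the estimate in every even dimension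
    have key : ∀ ψ, S.IsEigenspinor cov covE lam ψ →
        (∀ k, Λ (S.pairing (S.diracFromBelow cov J covE ψ k)
          (S.diracFromAbove cov J covE ψ k)) = 0) →
        lam ^ 2 ≥ d / (4 * (d - 1)) * (scal₀ + κ₁) := fun ψ hψ hmixed =>
      (KaehlerSpin.SpinStructure.spectralData hΛ hdim hV hcov hcovE hJ hψ).bound_even h2 hd
        (sq_nonneg lam) hmixed (KaehlerSpin.SpinStructure.integral_estimate hΛ hdim hV hcov hcovE
          hJ hψ.isSmoothSpinor hscal hκ)
    rcases hcase with hle | hone | ⟨r, ψ, hψ, htype⟩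
    · obtain rfl : d = 2 := le_antisymm hle h2
      obtain ⟨ψ, hψ⟩ := hlam
      exact (KaehlerSpin.SpinStructure.spectralData hΛ hdim hV hcov hcovE hJ hψ).bound_two
        (sq_nonneg lam) (KaehlerSpin.SpinStructure.integral_estimate hΛ hdim hV hcov hcovE
          hJ hψ.isSmoothSpinor hscal hκ)
    · obtain ⟨ψ, hψ⟩ := hlam
      exact key ψ hψ (KaehlerSpin.SpinStructure.integral_mixed_eq_zero hΛ hdim hV hcov hcovE hJ
        hψ.isSmoothSpinor hone)
    · refine key ψ hψ fun k => ?_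
      rw [KaehlerSpin.SpinStructure.mixed_eq_zero_of_isOfType hdim hcov hcovE hJ
        hψ.isSmoothSpinor htype, hΛ.zero]
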